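/- Let $M$ be a smooth real manifold with a symplectic form $\omega$, and let $\alpha$ be the corresponding Poisson structure, with components in local coordinates given by $\alpha^{ij}\omega_{jk}=\delta^i_k$. Let $\varepsilon,\varepsilon_1,\dots,\varepsilon_g$ be formal variables of degrees $0,d_1,\dots,d_g$ with all $d_i\le 0$, let $\mathbb C[[\varepsilon,\varepsilon_1,\dots,\varepsilon_g]]$ be the completed free graded commutative algebra on them (so $\varepsilon_i\varepsilon_j=(-1)^{d_id_j}\varepsilon_j\varepsilon_i$) and $\mathfrak m$ its maximal ideal. Let $\Omega^q(M)$ be the space of smooth complex-valued $q$-forms, placed in degree $q$, and consider the graded vector spaces (completed degree by degree) $$\mathcal L_\Omega=\bigoplus_{q\ge 0}\varepsilon^{-q}\,\mathbf s^{-1}\mathfrak m\,\Omega^q(M)[[\varepsilon,\varepsilon_1,\dots,\varepsilon_g]],\qquad \tilde{\mathcal L}_\Omega=\bigoplus_{q\ge 0}\varepsilon^{1-q}\,\mathbf s^{-1}\mathfrak m\,\Omega^q(M)[[\varepsilon,\varepsilon_1,\dots,\varepsilon_g]],$$ where $\mathbf s^{-1}$ lowers the degree by one. Let $d$ be the de Rham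 differential and, in local coordinates, $$[\mathbf s^{-1}\eta_1,\mathbf s^{-1}\eta_2]_\omega=\mathbf s^{-1}\varepsilon\Big(dx^k\,\partial_{x^k}\alpha^{ij}\,\frac{\partial\eta_1}{\partial dx^i}\frac{\partial\eta_2}{\partial dx^j}-(-1)^{|\eta_1|}\alpha^{ij}\frac{\partial\eta_1}{\partial dx^i}\,\partial_{x^j}\eta_2+\alpha^{ij}(\partial_{x^i}\eta_1)\frac{\partial\eta_2}{\partial dx^j}\Big),$$ where $\partial/\partial dx^i$ is the contraction with $\partial_{x^i}$. These operations are independent of the coordinates, and $(\tilde{\mathcal L}_\Omega,-d,[\,,]_\omega)$ is a dg Lie algebra. For a graded vector space $L$ let $\underline S(\mathbf s^{-1}L)=\bigoplus_{n\ge 1}S^n(\mathbf s^{-1}L)$ be the cofree cocommutative coalgebra without counit and $p$ its projection to $\mathbf s^{-1}L$. An $L_\infty$-morphism of dg Lie algebras is a homomorphism of the graded coalgebras $\underline S(\mathbf s^{-1}L)$ which commutes with the Chevalley–Eilenberg coderivations $Q$, where $p\,Q(\mathbf s^{-1}v)=\mathbf s^{-1}\partial v$, $p\,Q(\mathbf s^{-1}v_1\,\mathbf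 s^{-1}v_2)=(-1)^{|v_1|-1}\mathbf s^{-1}[v_1,v_2]$ and $p\,Q=0$ on $S^n$ for $n\ge 3$. It is a quasi-isomorphism if its linear term induces an isomorphism on cohomology, and it is strictly invertible if it has a two-sided inverse, as a map of coalgebras, which is an $L_\infty$ quasi-isomorphism too. Let $\Pi$ be the coderivation of degree $0$ of $\underline S(\mathbf s^{-1}\tilde{\mathcal L}_\Omega)$ determined by $$p\,\Pi(\mathbf s^{-2}\eta_1\,\mathbf s^{-2}\eta_2)=(-1)^{|\eta_1|}\,\mathbf s^{-2}\,\varepsilon\,\alpha^{ij}\,\frac{\partial\eta_1}{\partial dx^i}\,\frac{\partial\eta_2}{\partial dx^j},\qquad p\,\Pi=0\ \text{ on } S^n \text{ for } n\ne 2.$$ Then this $\Pi$ exists and is unique, the sum $$\exp(\Pi)=1+\sum_{m\ge 1}\frac1{m!}\Pi^m$$ is finite on every vector, and $\exp(\Pi)$ is a strictly invertible $L_\infty$ quasi-isomorphism $$(\tilde{\mathcal L}_\Omega,-d,0)\rightsquigarrow(\tilde{\mathcal L}_\Omega,-d,[\,,]_\omega).$$ It and its inverse are compatible with the filtration $G_k=\bigoplus_q\varepsilon^{1-q}\mathbf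 s^{-1}\mathfrak m^k\Omega^q(M)[[\varepsilon,\varepsilon_1,\dots,\varepsilon_g]]$ of $\tilde{\mathcal L}_\Omega$ ($k\ge 1$): their $n$-th components map $G_{k_1}\times\dots\times G_{k_n}$ to $G_{k_1+\dots+k_n}$. Moreover, let $L=\tilde{\mathcal L}_\Omega\,\hat\otimes\,\mathbb C[t]\ \oplus\ \mathcal L_\Omega\,\hat\otimes\,\mathbb C[t]\,dt$, with the graded-linear extensions of $d$, of $[\,,]_\omega$ and of $\Pi$ over $\mathbb C[t]\oplus\mathbb C[t]\,dt$ and with the de Rham differential $d_t=dt\,\partial_t$, i.e. $d_t(v\otimes a)=(-1)^{|v|}v\otimes d_ta$. Then $(L,-d+d_t,[\,,]_\omega)$ is a dg Lie algebra, and $\exp(\Pi)$ on $\underline S(\mathbf s^{-1}L)$ is a strictly invertible $L_\infty$ quasi-isomorphism $$(L,-d+d_t,0)\rightsquigarrow(L,-d+d_t,[\,,]_\omega)$$ which extends the previous one. It and its inverse are compatible in the same sense with the filtration of $L$ by the subspaces $G_k\,\hat\otimes\,\mathbb C[t]\oplus\big(\bigoplus_q\varepsilon^{-q}\mathbf s^{-1}\mathfrak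 m^k\Omega^q(M)[[\varepsilon,\varepsilon_1,\dots,\varepsilon_g]]\big)\hat\otimes\,\mathbb C[t]\,dt$. -/

import Mathlib

open scoped Manifold TensorProduct DirectSum

namespace ShT

noncomputable section

/-! ## The coalgebra cogenerated by a desuspended graded vector space

A graded vector space is a family `L : ℤ → Type` of complex vector spaces. -/

section Coalgebra

universe u v

/-- The total space of a graded vector space. -/
abbrev Tot (L : ℤ → Type u) [∀ n, AddCommGroup (L n)] [∀ n, Module ℂ (L n)] : Type u :=
  ⨁ n, L n

variable (L : ℤ → Type u) [∀ n, AddCommGroup (L n)] [∀ n, Module ℂ (L n)]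
variable (L' : ℤ → Type v) [∀ n, AddCommGroup (L' n)] [∀ n, Module ℂ (L' n)]

/-- A vector of degree `n`, seen in the total space. -/
abbrev hom (n : ℤ) : L n →ₗ[ℂ] Tot L := DirectSum.lof ℂ ℤ L n

/-- Graded commutativity of the generators `s⁻¹ v`, where `s⁻¹ v` has degree `i - 1`
when `v ∈ L i`. -/
inductive SymRel : TensorAlgebra ℂ (Tot L) → TensorAlgebra ℂ (Tot L) → Prop
  | comm (i j : ℤ) (a : L i) (b : L j) :
      SymRel (TensorAlgebra.ι ℂ (hom L i a) * TensorAlgebra.ι ℂ (hom L j b))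
        (((-1 : ℂ) ^ ((i - 1) * (j - 1))) •
          (TensorAlgebra.ι ℂ (hom L j b) * TensorAlgebra.ι ℂ (hom L i a)))

/-- The graded symmetric algebra `S(s⁻¹ L)`: the sum over `n` of the coinvariants of
`(s⁻¹ L)^{⊗ n}` under the symmetric group acting with Koszul signs. -/
abbrev GSym : Type u := RingQuot (SymRel L)

/-- The generator `s⁻¹ v`. -/
def gen : Tot L →ₗ[ℂ] GSym L :=
  (RingQuot.mkAlgHom ℂ (SymRel L)).toLinearMap ∘ₗ TensorAlgebra.ι ℂ

section Lift

variable {L}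

lemma gen_comm (i j : ℤ) (a : L i) (b : L j) :
    gen L (hom L i a) * gen L (hom L j b) =
      ((-1 : ℂ) ^ ((i - 1) * (j - 1))) • (gen L (hom L j b) * gen L (hom L i a)) := by
  have h := RingQuot.mkAlgHom_rel ℂ (SymRel.comm (L := L) i j a b)
  rw [map_mul, map_smul, map_mul] at h
  exact h

/-- The universal property of `S(s⁻¹ L)`. -/
def symLift {A : Type*} [Semiring A] [Algebra ℂ A] (f : Tot L →ₗ[ℂ] A)
    (hf : ∀ (i j : ℤ) (a : L i) (b : L j), f (hom L i a) * f (hom L j b) =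
      ((-1 : ℂ) ^ ((i - 1) * (j - 1))) • (f (hom L j b) * f (hom L i a))) :
    GSym L →ₐ[ℂ] A :=
  RingQuot.liftAlgHom ℂ ⟨TensorAlgebra.lift ℂ f, by
    rintro _ _ ⟨i, j, a, b⟩
    simpa only [map_mul, map_smul, TensorAlgebra.lift_ι_apply] using hf i j a b⟩

lemma symLift_gen {A : Type*} [Semiring A] [Algebra ℂ A] (f : Tot L →ₗ[ℂ] A)
    (hf : ∀ (i j : ℤ) (a : L i) (b : L j), f (hom L i a) * f (hom L j b) =
      ((-1 : ℂ) ^ ((i - 1) * (j - 1))) • (f (hom L j b) * f (hom L i a))) (x : Tot L) :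
    symLift f hf (gen L x) = f x := by
  simp [symLift, gen, RingQuot.liftAlgHom_mkAlgHom_apply]

end Lift

/-- The sign operator `s⁻¹ v ↦ (-1)^{|s⁻¹ v|} s⁻¹ v` on generators. -/
def parityGen : Tot L →ₗ[ℂ] GSym L :=
  DirectSum.toModule ℂ ℤ (GSym L) fun n => ((-1 : ℂ) ^ (n - 1)) • (gen L ∘ₗ hom L n)

lemma parityGen_hom (n : ℤ) (a : L n) :
    parityGen L (hom L n a) = ((-1 : ℂ) ^ (n - 1)) • gen L (hom L n a) := by
  simp [parityGen, DirectSum.toModule_lof]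

/-- The sign operator `x ↦ (-1)^{|x|} x` of `S(s⁻¹ L)`. -/
def parity : GSym L →ₐ[ℂ] GSym L :=
  symLift (parityGen L) (by
    intro i j a b
    simp only [parityGen_hom, smul_mul_smul_comm, gen_comm i j a b, smul_smul]
    congr 1
    ring)

lemma parity_gen (n : ℤ) (a : L n) :
    parity L (gen L (hom L n a)) = ((-1 : ℂ) ^ (n - 1)) • gen L (hom L n a) := by
  rw [parity, symLift_gen, parityGen_hom]

/-- The operator `x ↦ (-1)^{r |x|} x`: the Koszul sign for moving an operation of degree `r`
across `x`. -/
def koszul (r : ℤ) : GSym L →ₗ[ℂ] GSym L :=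
  if Even r then LinearMap.id else (parity L).toLinearMap

/-- The counit of `S(s⁻¹ L)`. -/
def counit : GSym L →ₐ[ℂ] ℂ := symLift 0 (by intros; simp)

/-- Left multiplication by `s⁻¹ v ⊗ 1 + 1 ⊗ s⁻¹ v`, for `v` of degree `n`, in the graded tensor
square of `S(s⁻¹ L)`:
`x ⊗ y ↦ (s⁻¹ v) x ⊗ y + (-1)^{(n - 1) |x|} x ⊗ (s⁻¹ v) y`. -/
def coprodHom (n : ℤ) : L n →ₗ[ℂ] Module.End ℂ (GSym L ⊗[ℂ] GSym L) where
  toFun a := TensorProduct.map (LinearMap.mulLeft ℂ (gen L (hom L n a))) LinearMap.id +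
    TensorProduct.map (koszul L (n - 1)) (LinearMap.mulLeft ℂ (gen L (hom L n a)))
  map_add' a b := by
    ext x y
    simp [add_mul, TensorProduct.add_tmul, TensorProduct.tmul_add]
    abel
  map_smul' c a := by
    ext x y
    simp [TensorProduct.smul_tmul']

/-- Left multiplication by `s⁻¹ v ⊗ 1 + 1 ⊗ s⁻¹ v`, for every `v`. -/
def coprodGen : Tot L →ₗ[ℂ] Module.End ℂ (GSym L ⊗[ℂ] GSym L) :=
  DirectSum.toModule ℂ ℤ _ (coprodHom L)

lemma coprodGen_hom (n : ℤ) (a : L n) (x y : GSym L) :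
    coprodGen L (hom L n a) (x ⊗ₜ y) =
      (gen L (hom L n a) * x) ⊗ₜ y + koszul L (n - 1) x ⊗ₜ (gen L (hom L n a) * y) := by
  simp [coprodGen, DirectSum.toModule_lof, coprodHom]

lemma koszul_mul (r n : ℤ) (a : L n) (x : GSym L) :
    koszul L r (gen L (hom L n a) * x) =
      ((-1 : ℂ) ^ (r * (n - 1))) • (gen L (hom L n a) * koszul L r x) := by
  unfold koszul
  split_ifs with h
  · simp [h.mul_right (n - 1), Even.neg_one_zpow]
  · have h' : Odd r := Int.not_even_iff_odd.mp h
    simp only [AlgHom.toLinearMap_apply, map_mul, parity_gen, smul_mul_assoc, zpow_mul,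
      h'.neg_one_zpow]

lemma koszul_comm (r t : ℤ) (x : GSym L) :
    koszul L r (koszul L t x) = koszul L t (koszul L r x) := by
  unfold koszul
  split_ifs <;> rfl

lemma coprodGen_comm (i j : ℤ) (a : L i) (b : L j) :
    coprodGen L (hom L i a) * coprodGen L (hom L j b) =
      ((-1 : ℂ) ^ ((i - 1) * (j - 1))) •
        (coprodGen L (hom L j b) * coprodGen L (hom L i a)) := by
  have hs : ((-1 : ℂ) ^ ((i - 1) * (j - 1))) * ((-1 : ℂ) ^ ((j - 1) * (i - 1))) = 1 := by
    rw [mul_comm (j - 1), ← mul_zpow]; simp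
  have key : ∀ x y : GSym L,
      (coprodGen L (hom L i a) * coprodGen L (hom L j b)) (x ⊗ₜ[ℂ] y) =
        (((-1 : ℂ) ^ ((i - 1) * (j - 1))) •
          (coprodGen L (hom L j b) * coprodGen L (hom L i a))) (x ⊗ₜ[ℂ] y) := by
    intro x y
    simp only [Module.End.mul_apply, LinearMap.smul_apply, coprodGen_hom, map_add, koszul_mul,
      ← mul_assoc, gen_comm i j a b, koszul_comm L (i - 1) (j - 1), smul_add,
      smul_mul_assoc, ← TensorProduct.smul_tmul', TensorProduct.tmul_smul, smul_smul, hs,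
      one_smul]
    abel
  exact TensorProduct.ext' key

/-- The full comultiplication of `S(s⁻¹ L)`, as an algebra map: `Δ(x) = coprodAlg x (1 ⊗ 1)`. -/
def coprodAlg : GSym L →ₐ[ℂ] Module.End ℂ (GSym L ⊗[ℂ] GSym L) :=
  symLift (coprodGen L) (coprodGen_comm L)

/-- The full comultiplication `Δ` of `S(s⁻¹ L)`: the multiplicative map (for the graded tensor
product) with `Δ(s⁻¹ v) = s⁻¹ v ⊗ 1 + 1 ⊗ s⁻¹ v`. -/
def coprod : GSym L →ₗ[ℂ] GSym L ⊗[ℂ] GSym L :=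
  LinearMap.applyₗ (1 ⊗ₜ[ℂ] 1) ∘ₗ (coprodAlg L).toLinearMap

/-- The truncated symmetric algebra `S⁺(s⁻¹ L)`, the sum of the `S^n(s⁻¹ L)` with `n ≥ 1`:
the kernel of the counit. -/
abbrev SBar : Type u := LinearMap.ker (counit L).toLinearMap

/-- The projection of `S(s⁻¹ L)` onto `S⁺(s⁻¹ L)`. -/
def toBar : GSym L →ₗ[ℂ] SBar L :=
  (LinearMap.id - (Algebra.linearMap ℂ (GSym L)) ∘ₗ (counit L).toLinearMap).codRestrict _
    (by intro x; simp)

/-- The comultiplication of `S⁺(s⁻¹ L)`: the sum, over the `(p, n - p)`-shuffles with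
`1 ≤ p ≤ n - 1`, that is `Δ` without its terms in `1 ⊗ S` and `S ⊗ 1`. -/
def coprodBar : SBar L →ₗ[ℂ] SBar L ⊗[ℂ] SBar L :=
  TensorProduct.map (toBar L) (toBar L) ∘ₗ coprod L ∘ₗ Submodule.subtype _

/-- The sign operator `x ↦ (-1)^{r |x|} x` of `S⁺(s⁻¹ L)`. -/
def koszulBar (r : ℤ) : SBar L →ₗ[ℂ] SBar L :=
  toBar L ∘ₗ koszul L r ∘ₗ Submodule.subtype _

/-- The canonical projection `p : S⁺(s⁻¹ L) → s⁻¹ L`, where `s⁻¹ v` is written as `v`. -/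
def corestr : SBar L →ₗ[ℂ] Tot L := by
  letI : Module ℂᵐᵒᵖ (Tot L) := Module.compHom _ ((RingHom.id ℂ).fromOpposite mul_comm)
  haveI : IsCentralScalar ℂ (Tot L) := ⟨fun r m => rfl⟩
  exact (TrivSqZeroExt.sndHom ℂ (Tot L)) ∘ₗ
    (symLift (TrivSqZeroExt.inrHom ℂ (Tot L)) (by
      intro i j a b
      simp [TrivSqZeroExt.inr_mul_inr])).toLinearMap ∘ₗ Submodule.subtype _

variable {L} in
/-- The monomial `s⁻¹ v₁ ⋯ s⁻¹ v_n` of `S⁺(s⁻¹ L)`, for a non-empty list `v₁, …, v_n`. -/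
def mono (l : List (Tot L)) : SBar L := toBar L ((l.map (gen L)).prod)

/-- The subspace of degree `n` of `S⁺(s⁻¹ L)`. -/
def degPart (n : ℤ) : Submodule ℂ (SBar L) :=
  Submodule.span ℂ {x | ∃ l : List (Σ i, L i), l ≠ [] ∧ (l.map fun a => a.1 - 1).sum = n ∧
    x = mono (l.map fun a => hom L a.1 a.2)}

variable {L L'}

/-- The linear map `f` has degree `r`. -/
def HasDegree (r : ℤ) (f : SBar L →ₗ[ℂ] SBar L') : Prop :=
  ∀ n, ∀ x ∈ degPart L n, f x ∈ degPart L' (n + r)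

/-- `D` is a coderivation of degree `r`: `Δ D = (D ⊗ 1 + 1 ⊗ D) Δ` with Koszul signs. -/
structure IsCoderivation (r : ℤ) (D : SBar L →ₗ[ℂ] SBar L) : Prop where
  degree : HasDegree r D
  coleibniz : coprodBar L ∘ₗ D =
    (TensorProduct.map D LinearMap.id + TensorProduct.map (koszulBar L r) D) ∘ₗ coprodBar L

/-- `F` is a homomorphism of graded coalgebras: `Δ F = (F ⊗ F) Δ`. -/
structure IsCoalgHom (F : SBar L →ₗ[ℂ] SBar L') : Prop where
  degree : HasDegree 0 F
  comul : coprodBar L' ∘ₗ F = TensorProduct.map F F ∘ₗ coprodBar L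

/-- `F = exp(P) = 1 + ∑_{m ≥ 1} P^m / m!`, where the sum is finite on every vector. -/
def IsExp (P F : SBar L →ₗ[ℂ] SBar L) : Prop :=
  ∀ x, ∃ N : ℕ, ∀ n ≥ N, (P ^ n) x = 0 ∧
    F x = ∑ i ∈ Finset.range n, ((i.factorial : ℂ)⁻¹) • (P ^ i) x

end Coalgebra

/-! ## Differential graded Lie algebras and `L∞`-morphisms -/

section Linfty

universe u v

/-- A structure of differential graded Lie algebra on the graded vector space `L`. -/
structure DGLie (L : ℤ → Type u) [∀ n, AddCommGroup (L n)] [∀ n, Module ℂ (L n)] where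
  diff : Tot L →ₗ[ℂ] Tot L
  bracket : Tot L →ₗ[ℂ] Tot L →ₗ[ℂ] Tot L
  diff_degree : ∀ i (a : L i), diff (hom L i a) ∈ LinearMap.range (hom L (i + 1))
  bracket_degree : ∀ i j (a : L i) (b : L j),
    bracket (hom L i a) (hom L j b) ∈ LinearMap.range (hom L (i + j))
  diff_diff : ∀ x, diff (diff x) = 0
  antisymm : ∀ i j (a : L i) (b : L j),
    bracket (hom L i a) (hom L j b) = -((-1 : ℂ) ^ (i * j)) • bracket (hom L j b) (hom L i a)
  leibniz : ∀ i (a : L i) (y : Tot L),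
    diff (bracket (hom L i a) y) =
      bracket (diff (hom L i a)) y + ((-1 : ℂ) ^ i) • bracket (hom L i a) (diff y)
  jacobi : ∀ i j (a : L i) (b : L j) (z : Tot L),
    bracket (hom L i a) (bracket (hom L j b) z) =
      bracket (bracket (hom L i a) (hom L j b)) z +
        ((-1 : ℂ) ^ (i * j)) • bracket (hom L j b) (bracket (hom L i a) z)

variable {L : ℤ → Type u} [∀ n, AddCommGroup (L n)] [∀ n, Module ℂ (L n)]
variable {L' : ℤ → Type v} [∀ n, AddCommGroup (L' n)] [∀ n, Module ℂ (L' n)]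

/-- The same complex with the zero bracket. -/
def DGLie.abelian (A : DGLie L) : DGLie L where
  diff := A.diff
  bracket := 0
  diff_degree := A.diff_degree
  bracket_degree _ _ _ _ := by simp
  diff_diff := A.diff_diff
  antisymm _ _ _ _ := by simp
  leibniz _ _ _ := by simp
  jacobi _ _ _ _ _ := by simp

/-- `Q` is the Chevalley–Eilenberg coderivation of the differential graded Lie algebra `A`. -/
structure IsCE (A : DGLie L) (Q : SBar L →ₗ[ℂ] SBar L) : Prop where
  coder : IsCoderivation 1 Q
  linear : ∀ x, corestr L (Q (mono [x])) = A.diff x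
  quadratic : ∀ i (a : L i) (y : Tot L),
    corestr L (Q (mono [hom L i a, y])) = ((-1 : ℂ) ^ (i - 1)) • A.bracket (hom L i a) y
  higher : ∀ l : List (Tot L), 3 ≤ l.length → corestr L (Q (mono l)) = 0

/-- `F` is an `L∞`-morphism from `A` to `B`: a homomorphism of the differential graded
coalgebras that the Chevalley–Eilenberg construction attaches to `A` and `B`. -/
structure IsLinftyMorphism (A : DGLie L) (B : DGLie L') (F : SBar L →ₗ[ℂ] SBar L') : Prop where
  hom : IsCoalgHom F
  chain : ∃ Q Q', IsCE A Q ∧ IsCE B Q' ∧ Q ∘ₗ Q = 0 ∧ Q' ∘ₗ Q' = 0 ∧ F ∘ₗ Q = Q' ∘ₗ F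

/-- The linear term `F₁` of `F`. -/
def linearTerm (F : SBar L →ₗ[ℂ] SBar L') (x : Tot L) : Tot L' := corestr L' (F (mono [x]))

/-- `F` is compatible with the filtrations `G` and `G'`: the component `F_n` maps
`G_{k₁} × ⋯ × G_{k_n}` to `G'_{k₁ + ⋯ + k_n}`. -/
def IsFiltered (G : ℕ → ∀ n, Submodule ℂ (L n)) (G' : ℕ → ∀ n, Submodule ℂ (L' n))
    (F : SBar L →ₗ[ℂ] SBar L') : Prop :=
  ∀ l : List (ℕ × Tot L), l ≠ [] → (∀ a ∈ l, ∀ n, a.2 n ∈ G a.1 n) →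
    ∀ n, corestr L' (F (mono (l.map Prod.snd))) n ∈ G' (l.map Prod.fst).sum n

/-- `F` is a filtered `L∞` quasi-isomorphism: an `L∞`-morphism compatible with the filtrations
whose linear term induces an isomorphism on cohomology. -/
structure IsLinftyQuasiIso (G : ℕ → ∀ n, Submodule ℂ (L n)) (G' : ℕ → ∀ n, Submodule ℂ (L' n))
    (A : DGLie L) (B : DGLie L') (F : SBar L →ₗ[ℂ] SBar L') : Prop where
  morphism : IsLinftyMorphism A B F
  filtered : IsFiltered G G' F
  chain : ∀ x, linearTerm F (A.diff x) = B.diff (linearTerm F x)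
  inj : ∀ x, A.diff x = 0 → (∃ z, linearTerm F x = B.diff z) → ∃ z, x = A.diff z
  surj : ∀ y, B.diff y = 0 → ∃ x z, A.diff x = 0 ∧ y = linearTerm F x + B.diff z

/-- `F` is a strictly invertible `L∞` quasi-isomorphism: it has a two-sided inverse which is an
`L∞` quasi-isomorphism too. -/
def IsStrictlyInvertible (G : ℕ → ∀ n, Submodule ℂ (L n)) (G' : ℕ → ∀ n, Submodule ℂ (L' n))
    (A : DGLie L) (B : DGLie L') (F : SBar L →ₗ[ℂ] SBar L') : Prop :=
  IsLinftyQuasiIso G G' A B F ∧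
    ∃ F' : SBar L' →ₗ[ℂ] SBar L, IsLinftyQuasiIso G' G B A F' ∧
      F' ∘ₗ F = LinearMap.id ∧ F ∘ₗ F' = LinearMap.id

end Linfty

/-! ## Differential forms

The model space is `ℝ^m`. As for Mathlib's `TangentSpace`, the tangent space at `x` is identified
with `ℝ^m` by the chart `chartAt x`, so that a field of complex exterior forms on `M` is a function
`M → ℂ[dx¹, …, dx^m]`, where the `dxⁱ` anticommute. -/

section Geometry

/-- The model space `ℝ^m`. -/
abbrev Eu (m : ℕ) : Type := EuclideanSpace ℝ (Fin m)

/-- The algebra `ℂ[dx¹, …, dx^m]`. -/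
abbrev Lam (m : ℕ) : Type := ExteriorAlgebra ℂ (Fin m → ℂ)

variable {m : ℕ}

/-- The `i`-th basis vector of `ℝ^m`. -/
abbrev vec (i : Fin m) : Eu m := EuclideanSpace.single i 1

/-- The generator `dxⁱ`. -/
def dx (i : Fin m) : Lam m := ExteriorAlgebra.ι ℂ (Pi.single i 1)

/-- The basis of `ℂ[dx¹, …, dx^m]` which consists of the ordered monomials in the `dxⁱ`. -/
def lamBasis (m : ℕ) : Module.Basis (Finset (Fin m)) ℂ (Lam m) :=
  (Pi.basisFun ℂ (Fin m)).ExteriorAlgebra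

/-- The coefficient of the monomial indexed by `S`; this monomial has degree `S.card`. -/
abbrev coef (S : Finset (Fin m)) : Lam m →ₗ[ℂ] ℂ := (lamBasis m).coord S

/-- The left partial derivative `∂ / ∂dxⁱ`, that is the contraction with the `i`-th coordinate
vector field. -/
def contr (i : Fin m) : Lam m →ₗ[ℂ] Lam m :=
  CliffordAlgebra.contractLeft (LinearMap.proj i)

/-- The pullback of exterior forms by the linear map `J`. -/
def pullLam (J : Eu m →L[ℝ] Eu m) : Lam m →ₐ[ℂ] Lam m :=
  ExteriorAlgebra.map (Matrix.toLin' (Matrix.of fun j i => ((J (vec j) i : ℝ) : ℂ)))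

/-- The partial derivative `∂_{xⁱ}` of the coefficients of a form on (a part of) `ℝ^m`. -/
def pd (i : Fin m) (f : Eu m → Lam m) (y : Eu m) : Lam m :=
  ∑ S, (fderiv ℝ (fun z => coef S (f z)) y (vec i)) • lamBasis m S

variable {M : Type*} [TopologicalSpace M] [ChartedSpace (EuclideanSpace ℝ (Fin m)) M]

/-- The derivative, at the point with coordinates `y` in the chart at `x₀`, of the change of
coordinates from the chart at `x₀` to the chart that trivializes the tangent space at this
point. -/
def jac (x₀ : M) (y : Eu m) : Eu m →L[ℝ] Eu m :=
  fderiv ℝ (chartAt (Eu m) ((chartAt (Eu m) x₀).symm y) ∘ (chartAt (Eu m) x₀).symm) y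

/-- The expression of a field of exterior forms in the coordinates of the chart at `x₀`. -/
def loc (x₀ : M) (η : M → Lam m) (y : Eu m) : Lam m :=
  pullLam (jac x₀ y) (η ((chartAt (Eu m) x₀).symm y))

/-- A field of exterior forms is smooth if its components in local coordinates are. -/
def IsSmoothForm (η : M → Lam m) : Prop :=
  ∀ (x₀ : M) (S : Finset (Fin m)),
    ContDiffOn ℝ ((⊤ : ℕ∞) : WithTop ℕ∞) (fun y => coef S (loc x₀ η y)) (chartAt (Eu m) x₀).target

/-- The partial derivative `∂_{xⁱ} η` at `x`, in the coordinates of the chart at `x`. -/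
def pdAt (x : M) (i : Fin m) (η : M → Lam m) : Lam m := pd i (loc x η) (chartAt (Eu m) x x)

/-- The expression of a field of real exterior two-forms in the coordinates of the chart at
`x₀`. -/
def loc₂ (x₀ : M) (ω : M → Eu m [⋀^Fin 2]→L[ℝ] ℝ) (y : Eu m) : Eu m [⋀^Fin 2]→L[ℝ] ℝ :=
  (ω ((chartAt (Eu m) x₀).symm y)).compContinuousLinearMap (jac x₀ y)

variable (m M) in
/-- A symplectic form on `M`: a smooth, closed, non-degenerate two-form. -/
structure SymplecticForm where
  form : M → Eu m [⋀^Fin 2]→L[ℝ] ℝ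
  smooth : ∀ x₀ : M, ContDiffOn ℝ ((⊤ : ℕ∞) : WithTop ℕ∞) (loc₂ x₀ form) (chartAt (Eu m) x₀).target
  closed : ∀ x : M, extDeriv (loc₂ x form) (chartAt (Eu m) x x) = 0
  nondegenerate : ∀ (x : M) (v : Eu m), (∀ w, form x ![v, w] = 0) → v = 0

/-- The components `α^{ij}` of the Poisson structure in the coordinates of the chart at `x₀`:
`α^{ij} ω_{jk} = δ^i_k`, where `ω_{jk}` are the components of the symplectic form. -/
def SymplecticForm.poisson (ω : SymplecticForm m M) (x₀ : M) (y : Eu m) :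
    Matrix (Fin m) (Fin m) ℝ :=
  (Matrix.of fun i j => loc₂ x₀ ω.form y ![vec i, vec j])⁻¹

/-- The component `α^{ij}(x)` in the coordinates of the chart at `x`. -/
def SymplecticForm.poissonAt (ω : SymplecticForm m M) (x : M) (i j : Fin m) : ℝ :=
  ω.poisson x (chartAt (Eu m) x x) i j

/-- The partial derivative `∂_{x^k} α^{ij}(x)` in the coordinates of the chart at `x`. -/
def SymplecticForm.dpoissonAt (ω : SymplecticForm m M) (x : M) (k i j : Fin m) : ℝ :=
  fderiv ℝ (fun y => ω.poisson x y i j) (chartAt (Eu m) x x) (vec k)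

end Geometry

/-! ## Formal series in the deformation parameters

The parameters are `ε` of degree `0`, `ε₁, …, ε_g` of degrees `d₁, …, d_g`, the coordinate `t` of
the `1`-simplex, of degree `0`, and `dt`, of degree `1`. -/

section Series

/-- The monomial `ε^e ε₁^{k₁} ⋯ ε_g^{k_g} t^n dt^s`. -/
@[ext]
structure Mon (g : ℕ) where
  e : ℤ
  k : Fin g → ℕ
  n : ℕ
  s : ℕ

variable {g m : ℕ}

instance : Add (Mon g) := ⟨fun a b => ⟨a.e + b.e, a.k + b.k, a.n + b.n, a.s + b.s⟩⟩

/-- The degree of a monomial. -/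
def Mon.deg (d : Fin g → ℤ) (κ : Mon g) : ℤ := ∑ i, d i * κ.k i + κ.s

/-- The monomials that do not vanish: parameters of odd degree square to zero. -/
def Mon.Adm (d : Fin g → ℤ) (κ : Mon g) : Prop := (∀ i, Odd (d i) → κ.k i ≤ 1) ∧ κ.s ≤ 1

/-- The Koszul sign that arises from reordering the product of two monomials. -/
def Mon.sign (d : Fin g → ℤ) (κ μ : Mon g) : ℂ :=
  (-1) ^ ((∑ i, ∑ j ∈ Finset.univ.filter (· < i), (d i * κ.k i) * (d j * μ.k j)) +
    κ.s * ∑ j, d j * μ.k j : ℤ)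

/-- Series in the parameters with coefficients on the left in `ℂ[dx¹, …, dx^m]`. -/
abbrev PtSer (g m : ℕ) : Type := Mon g → Lam m

/-- The sign operator `a ↦ (-1)^{r |a|} a` of `ℂ[dx¹, …, dx^m]`. -/
def twist (r : ℤ) : Lam m →ₗ[ℂ] Lam m :=
  if Even r then LinearMap.id else (CliffordAlgebra.involute).toLinearMap

open Classical in
/-- The graded commutative product of two series:
`(a κ) (b μ) = (-1)^{|κ| |b|} (a b) (κ μ)`, for `a, b` in `ℂ[dx¹, …, dx^m]` and monomials `κ, μ`
in the parameters. -/
def serMul (d : Fin g → ℤ) (a b : PtSer g m) : PtSer g m := fun κ =>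
  if κ.Adm d then
    ∑ᶠ p : {p : Mon g × Mon g // p.1 + p.2 = κ},
      (Mon.sign d p.1.1 p.1.2) • (a p.1.1 * twist (p.1.1.deg d) (b p.1.2))
  else 0

/-- The operator `a ↦ (-1)^{|a|} a`, where `|a|` is the total degree. -/
def serSgn (d : Fin g → ℤ) (a : PtSer g m) : PtSer g m := fun κ =>
  ((-1 : ℂ) ^ (κ.deg d)) • CliffordAlgebra.involute (a κ)

/-- Multiplication by `ε`. -/
def epsMul (a : PtSer g m) : PtSer g m := fun κ => a { κ with e := κ.e - 1 }

/-- The operator `∂ / ∂dxⁱ` on series. -/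
def serContr (i : Fin m) (a : PtSer g m) : PtSer g m := fun κ => contr i (a κ)

/-- Left multiplication by `dxⁱ` on series. -/
def serDx (i : Fin m) (a : PtSer g m) : PtSer g m := fun κ => dx i * a κ

variable {M : Type*} [TopologicalSpace M] [ChartedSpace (EuclideanSpace ℝ (Fin m)) M]

/-- Series in the parameters whose coefficients are fields of exterior forms on `M`. -/
abbrev Ser (g m : ℕ) (M : Type*) : Type _ := Mon g → M → Lam m

/-- The value at `x` of a series. -/
def Ser.value (η : Ser g m M) (x : M) : PtSer g m := fun κ => η κ x

/-- The value at `x` of the partial derivative `∂_{xⁱ} η`, in the coordinates of the chart at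
`x`. -/
def Ser.pdAt (i : Fin m) (η : Ser g m M) (x : M) : PtSer g m := fun κ => ShT.pdAt x i (η κ)

/-- The de Rham differential `d = ∑ dxⁱ ∂_{xⁱ}`. -/
def deRham (η : Ser g m M) : Ser g m M := fun κ x => (∑ i, serDx i (η.pdAt i x)) κ

/-- The de Rham differential `d_t = dt ∂_t` of the `1`-simplex, acting on the tensor product of the
desuspended forms with `ℂ[t] ⊕ ℂ[t] dt`:
`s⁻¹ η t^n ↦ (-1)^{|η| - 1} n s⁻¹ η t^{n - 1} dt`. -/
def simplexD (d : Fin g → ℤ) (η : Ser g m M) : Ser g m M := fun κ x =>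
  if κ.s = 1 then
    -(((κ.n : ℂ) + 1) • serSgn d (η.value x) { κ with n := κ.n + 1, s := 0 })
  else 0

/-- The bracket `[s⁻¹ η, s⁻¹ ξ]_ω`, which in local coordinates is
`s⁻¹ ε ( dx^k ∂_{x^k} α^{ij} ∂η/∂dxⁱ ∂ξ/∂dx^j
  - (-1)^{|η|} α^{ij} ∂η/∂dxⁱ ∂_{x^j} ξ + α^{ij} ∂_{xⁱ} η ∂ξ/∂dx^j )`. -/
def formBracket (ω : SymplecticForm m M) (d : Fin g → ℤ) (η ξ : Ser g m M) : Ser g m M :=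
  fun κ x => epsMul (∑ i, ∑ j,
    ((∑ k, (ω.dpoissonAt x k i j) •
        serDx k (serMul d (serContr i (η.value x)) (serContr j (ξ.value x))))
      - (ω.poissonAt x i j) • serMul d (serContr i (serSgn d (η.value x))) (ξ.pdAt j x)
      + (ω.poissonAt x i j) • serMul d (η.pdAt i x) (serContr j (ξ.value x)))) κ

/-- The operation `(-1)^{|η|} ε α^{ij} ∂η/∂dxⁱ ∂ξ/∂dx^j`. -/
def poissonContr (ω : SymplecticForm m M) (d : Fin g → ℤ) (η ξ : Ser g m M) : Ser g m M :=
  fun κ x => epsMul (∑ i, ∑ j,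
    (ω.poissonAt x i j) •
      serMul d (serContr i (serSgn d (η.value x))) (serContr j (ξ.value x))) κ

lemma loc_add (x₀ : M) (η ξ : M → Lam m) (y : Eu m) :
    loc x₀ (η + ξ) y = loc x₀ η y + loc x₀ ξ y := by
  simp [loc]

lemma loc_smul (x₀ : M) (c : ℂ) (η : M → Lam m) (y : Eu m) :
    loc x₀ (c • η) y = c • loc x₀ η y := by
  simp [loc]

variable (M) in
/-- The series with smooth coefficients, polynomial in `t` for every monomial in the other
parameters, which only involve the products of a monomial `κ` in the parameters and a `q`-form
for which `R κ q` holds. -/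
def seriesSub (R : Mon g → ℕ → Prop) : Submodule ℂ (Ser g m M) where
  carrier := {η | (∀ κ, IsSmoothForm (η κ)) ∧
    (∀ κ x (S : Finset (Fin m)), ¬ R κ S.card → coef S (η κ x) = 0) ∧
    ∀ κ : Mon g, ∃ N : ℕ, ∀ n ≥ N, η { κ with n := n } = 0}
  zero_mem' := by
    refine ⟨fun κ x₀ S => ?_, fun κ x S _ => ?_, fun κ => ⟨0, fun n _ => rfl⟩⟩
    · simp [loc, contDiffOn_const]
    · simp
  add_mem' := by
    rintro η ξ ⟨h1, h2, h3⟩ ⟨h1', h2', h3'⟩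
    refine ⟨fun κ x₀ S => ?_, fun κ x S hS => ?_, fun κ => ?_⟩
    · simpa only [Pi.add_apply, loc_add, map_add] using (h1 κ x₀ S).add (h1' κ x₀ S)
    · simp only [Pi.add_apply, map_add, h2 κ x S hS, h2' κ x S hS, add_zero]
    · obtain ⟨N, hN⟩ := h3 κ
      obtain ⟨N', hN'⟩ := h3' κ
      exact ⟨max N N', fun n hn => by
        simp [hN n (le_trans (le_max_left _ _) hn), hN' n (le_trans (le_max_right _ _) hn)]⟩
  smul_mem' := by
    rintro c η ⟨h1, h2, h3⟩
    refine ⟨fun κ x₀ S => ?_, fun κ x S hS => ?_, fun κ => ?_⟩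
    · simpa only [Pi.smul_apply, loc_smul, map_smul] using (h1 κ x₀ S).const_smul c
    · simp only [Pi.smul_apply, map_smul, h2 κ x S hS, smul_zero]
    · obtain ⟨N, hN⟩ := h3 κ
      exact ⟨N, fun n hn => by simp [hN n hn]⟩

lemma seriesSub_mono {R R' : Mon g → ℕ → Prop} (h : ∀ κ q, R κ q → R' κ q) :
    seriesSub (m := m) M R ≤ seriesSub M R' :=
  fun _ hη => ⟨hη.1, fun κ x S hS => hη.2.1 κ x S fun h' => hS (h _ _ h'), hη.2.2⟩

/-- The products of a `q`-form and a monomial `κ` that occur in `ε^{1-q} 𝔪^k Ω^q[[ε, ε₁, …, ε_g]]`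
and give a vector of degree `n` after desuspension. -/
def TildeRule (d : Fin g → ℤ) (k : ℕ) (n : ℤ) (κ : Mon g) (q : ℕ) : Prop :=
  κ.n = 0 ∧ κ.s = 0 ∧ κ.Adm d ∧ 0 ≤ κ.e + q - 1 ∧ (k : ℤ) ≤ κ.e + q - 1 + ∑ i, (κ.k i : ℤ) ∧
    q + κ.deg d - 1 = n

/-- The products of a `q`-form and a monomial `κ` that occur in
`ε^{1-q} 𝔪^k Ω^q[[ε, ε₁, …, ε_g]] ⊗ ℂ[t]` (if `dt` does not occur) or in
`ε^{-q} 𝔪^k Ω^q[[ε, ε₁, …, ε_g]] ⊗ ℂ[t] dt` (if `dt` occurs) and give a vector of degree `n`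
after desuspension. -/
def SimplexRule (d : Fin g → ℤ) (k : ℕ) (n : ℤ) (κ : Mon g) (q : ℕ) : Prop :=
  κ.Adm d ∧
    (κ.s = 0 → 0 ≤ κ.e + q - 1 ∧ (k : ℤ) ≤ κ.e + q - 1 + ∑ i, (κ.k i : ℤ)) ∧
    (κ.s = 1 → 0 ≤ κ.e + q ∧ (k : ℤ) ≤ κ.e + q + ∑ i, (κ.k i : ℤ)) ∧
    q + κ.deg d - 1 = n

variable (m M)

/-- The graded vector space `⨁_q ε^{1-q} s⁻¹ 𝔪 Ω^q(M)[[ε, ε₁, …, ε_g]]`; a vector `s⁻¹ η` of it is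
written as `η`, and lies in degree `|η| - 1`. -/
abbrev tildeSub (d : Fin g → ℤ) (n : ℤ) : Submodule ℂ (Ser g m M) :=
  seriesSub M (TildeRule d 1 n)

/-- The graded vector space `tildeSub`, as a family of types. -/
abbrev TildeForms (d : Fin g → ℤ) (n : ℤ) : Type _ := tildeSub m M d n

/-- The filtration of `TildeForms` by the subspaces
`⨁_q ε^{1-q} s⁻¹ 𝔪^k Ω^q(M)[[ε, ε₁, …, ε_g]]`, for `k ≥ 1`. -/
def tildeFilt (d : Fin g → ℤ) (k : ℕ) (n : ℤ) : Submodule ℂ (TildeForms m M d n) :=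
  (seriesSub M (TildeRule d k n)).comap (Submodule.subtype _)

/-- The graded vector space `L̃ ⊗̂ ℂ[t] ⊕ L ⊗̂ ℂ[t] dt`, where
`L̃ = ⨁_q ε^{1-q} s⁻¹ 𝔪 Ω^q(M)[[ε, ε₁, …, ε_g]]` and `L = ⨁_q ε^{-q} s⁻¹ 𝔪 Ω^q(M)[[ε, ε₁, …, ε_g]]`. -/
abbrev simplexSub (d : Fin g → ℤ) (n : ℤ) : Submodule ℂ (Ser g m M) :=
  seriesSub M (SimplexRule d 1 n)

/-- The graded vector space `simplexSub`, as a family of types. -/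
abbrev SimplexForms (d : Fin g → ℤ) (n : ℤ) : Type _ := simplexSub m M d n

/-- The filtration of `SimplexForms` that is given by the powers `𝔪^k` for `k ≥ 1`, as for
`TildeForms`. -/
def simplexFilt (d : Fin g → ℤ) (k : ℕ) (n : ℤ) : Submodule ℂ (SimplexForms m M d n) :=
  (seriesSub M (SimplexRule d k n)).comap (Submodule.subtype _)

lemma tilde_le_simplex (d : Fin g → ℤ) (n : ℤ) :
    tildeSub m M d n ≤ simplexSub m M d n :=
  seriesSub_mono fun κ q h =>
    ⟨h.2.2.1, fun _ => ⟨h.2.2.2.1, h.2.2.2.2.1⟩, fun h' => by simp [h.2.1] at h', h.2.2.2.2.2⟩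

/-- The inclusion of `TildeForms` into `SimplexForms` (the vectors in which `t` and `dt` do not
occur). -/
def inclSimplex (d : Fin g → ℤ) : Tot (TildeForms m M d) →ₗ[ℂ] Tot (SimplexForms m M d) :=
  DirectSum.lmap fun n => Submodule.inclusion (tilde_le_simplex m M d n)

variable {m M}

/-- The series underlying a vector of a graded space of series. -/
def toSer (V : ℤ → Submodule ℂ (Ser g m M)) : Tot (fun n => V n) →ₗ[ℂ] Ser g m M :=
  DirectSum.coeLinearMap V

/-- `P` is the coderivation `Π` of degree zero with
`p Π (s⁻² η s⁻² ξ) = (-1)^{|η|} s⁻² ε α^{ij} ∂η/∂dxⁱ ∂ξ/∂dx^j`,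
and `p Π = 0` on `S^n` for `n ≠ 2`. -/
structure IsPi (ω : SymplecticForm m M) (d : Fin g → ℤ) (V : ℤ → Submodule ℂ (Ser g m M))
    (P : SBar (fun n => V n) →ₗ[ℂ] SBar (fun n => V n)) : Prop where
  coder : IsCoderivation 0 P
  quadratic : ∀ x y, toSer V (corestr _ (P (mono [x, y]))) =
    poissonContr ω d (toSer V x) (toSer V y)
  other : ∀ l : List (Tot fun n => V n), l.length ≠ 2 → corestr _ (P (mono l)) = 0

end Series
end
end ShT

open ShT

/-!
The shifted contraction `B(η, ξ) = (-1)^{|η|} ε α^{ij} ∂η/∂dxⁱ ∂ξ/∂dx^j` with the Poisson structure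
is a graded symmetric operation of degree zero on `s⁻¹ L`, so that it is the corestriction of a
unique coderivation `Π` of the symmetric coalgebra (`exists_secondOrder`,
`IsCoderivation.ext_mono`). It lowers the length of monomials by one, hence is locally nilpotent,
and `exp(Π)` is a coalgebra automorphism with inverse `exp(-Π)`.

Let `Q₀` be the coderivation given by the differential `D`. The commutator `Q₂ = [Π, Q₀]` is the
coderivation whose corestriction is the failure of `D` to be a derivation of `B` (`defect`). The
simplex part of `D` is a derivation of `B` (`SerRing.simp₁_pbr`), and the failure of `-d` is, up to
the sign of the desuspension, the bracket of forms (`SerRing.dx_pbrDeriv`): this is the Koszul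
formula for the Koszul–Brylinski bracket. If moreover `[Π, Q₂] = 0`, then
`exp(Π) Q₀ exp(-Π) = Q₀ + Q₂` (`lexp_conj`), which is the statement that `exp(Π)` is an
`L∞`-isomorphism onto the Lie algebra with the bracket; the Jacobi identity and the Leibniz rule of
that Lie algebra follow from `[Π, Q₂] = 0` as well (`TwistData.bracket_bracket`,
`TwistData.diff_bracket`), as does the assertion in general (`TwistData.isStrictlyInvertible`). The
linear part of `exp(Π)` is the identity, and its components respect any filtration that `B` respects.

A coderivation vanishes if its corestriction does (`IsCoderivation.eq_zero`): the comultiplication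
followed by the multiplication multiplies the monomials of length `n` by `2 ^ n`, so that a
primitive element has length one. Hence `[Π, Q₂] = 0` is an identity between three vectors, and by
symmetry the vanishing of a cyclic sum (`TwistData.of_cyclic`). It involves no second derivatives,
so it is checked point by point (`SerRing.cubic_sum`), in the graded commutative ring `SerRing` of
series with values in the exterior algebra of the cotangent space. There it is a
consequence of the antisymmetry of `α` and of its Jacobi identity
`∑ α^{li} ∂_l α^{jk} + cyclic = 0`, which is the closedness of the symplectic form
(`SymplecticForm.poisson_jacobi`).

The coefficients of the series are fields of exterior forms on the manifold, given at every point in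
the preferred chart of that point. That the de Rham differential and the contraction preserve
smoothness, and that `d² = 0`, requires that their expressions do not depend on the chart
(`dFlat_pullLam`, `SymplecticForm.loc_poissonForm`). Both graded spaces of the theorem are instances
of a family of spaces described by the pairs of a monomial and a form degree that occur (`IsRule`),
so that `IsRule.twistData` and its consequences apply to both.
-/

namespace ShT

noncomputable section

/-! ### The graded symmetric algebra: induction, length and corestriction -/

section CoalgebraBasics

universe u v w

variable {L : ℤ → Type u} [∀ n, AddCommGroup (L n)] [∀ n, Module ℂ (L n)]

lemma GSym.submodule_eq_top {N : Submodule ℂ (GSym L)} (h1 : 1 ∈ N)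
    (hm : ∀ i (a : L i), ∀ x ∈ N, gen L (hom L i a) * x ∈ N) : N = ⊤ := by
  have hv : ∀ (v : Tot L), ∀ x ∈ N, gen L v * x ∈ N := by
    intro v x hx
    induction v using DirectSum.induction_on with
    | zero => simp
    | of i a => exact hm i a x hx
    | add v w hv hw => rw [map_add, add_mul]; exact N.add_mem hv hw
  have key : ∀ t : TensorAlgebra ℂ (Tot L), ∀ x ∈ N,
      RingQuot.mkAlgHom ℂ (SymRel L) t * x ∈ N := by
    intro t
    induction t using TensorAlgebra.induction with
    | algebraMap r =>
      intro x hx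
      rw [AlgHom.commutes, ← Algebra.smul_def]
      exact N.smul_mem _ hx
    | ι v => exact hv v
    | mul a b ha hb =>
      intro x hx
      rw [map_mul, mul_assoc]
      exact ha _ (hb _ hx)
    | add a b ha hb =>
      intro x hx
      rw [map_add, add_mul]
      exact N.add_mem (ha _ hx) (hb _ hx)
  rw [eq_top_iff]
  rintro x -
  obtain ⟨t, rfl⟩ := RingQuot.mkAlgHom_surjective ℂ (SymRel L) x
  simpa using key t 1 h1

lemma GSym.linearMap_ext {W : Type*} [AddCommMonoid W] [Module ℂ W] {f f' : GSym L →ₗ[ℂ] W}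
    (h1 : f 1 = f' 1)
    (hm : ∀ i (a : L i) x, f x = f' x →
      f (gen L (hom L i a) * x) = f' (gen L (hom L i a) * x)) : f = f' := by
  have : LinearMap.eqLocus f f' = ⊤ := GSym.submodule_eq_top h1 hm
  exact LinearMap.eqLocus_eq_top.mp this

lemma koszul_one (r : ℤ) : koszul L r 1 = 1 := by
  unfold koszul; split_ifs <;> simp

lemma koszul_gen (r n : ℤ) (a : L n) :
    koszul L r (gen L (hom L n a)) = ((-1 : ℂ) ^ (r * (n - 1))) • gen L (hom L n a) := by
  simpa [koszul_one] using koszul_mul L r n a 1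

lemma koszul_koszul (r t : ℤ) (x : GSym L) :
    koszul L r (koszul L t x) = koszul L (r + t) x := by
  have : koszul L r ∘ₗ koszul L t = koszul L (r + t) := by
    apply GSym.linearMap_ext
    · simp [koszul_one]
    · intro i a x hx
      simp only [LinearMap.comp_apply] at hx ⊢
      rw [koszul_mul, map_smul, koszul_mul, koszul_mul, hx, smul_smul, add_mul,
        zpow_add₀ (by simp), mul_comm]
  exact LinearMap.congr_fun this x

lemma koszul_zero (x : GSym L) : koszul L 0 x = x := by simp [koszul]

lemma neg_one_zpow_mul_self (n : ℤ) : ((-1 : ℂ) ^ n) * (-1) ^ n = 1 := by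
  rw [← mul_zpow]; simp

lemma counit_gen (v : Tot L) : counit L (gen L v) = 0 := by
  rw [counit, symLift_gen]; rfl

lemma counit_koszul (r : ℤ) (x : GSym L) : counit L (koszul L r x) = counit L x := by
  have : (counit L).toLinearMap ∘ₗ koszul L r = (counit L).toLinearMap := by
    apply GSym.linearMap_ext
    · simp [koszul_one]
    · intro i a x hx
      simp [koszul_mul, counit_gen]
  exact LinearMap.congr_fun this x

variable (L) in
/-- The extension by zero of `corestr` to the whole symmetric algebra. -/
def cor : GSym L →ₗ[ℂ] Tot L := by
  letI : Module ℂᵐᵒᵖ (Tot L) := Module.compHom _ ((RingHom.id ℂ).fromOpposite mul_comm)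
  haveI : IsCentralScalar ℂ (Tot L) := ⟨fun r m => rfl⟩
  exact (TrivSqZeroExt.sndHom ℂ (Tot L)) ∘ₗ
    (symLift (TrivSqZeroExt.inrHom ℂ (Tot L)) (by
      intro i j a b
      simp [TrivSqZeroExt.inr_mul_inr])).toLinearMap

lemma corestr_eq_cor (x : SBar L) : corestr L x = cor L x.1 := rfl

lemma cor_one : cor L 1 = 0 := by
  let _ : Module ℂᵐᵒᵖ (Tot L) := Module.compHom _ ((RingHom.id ℂ).fromOpposite mul_comm)
  have _ : IsCentralScalar ℂ (Tot L) := ⟨fun r m => rfl⟩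
  change TrivSqZeroExt.snd (symLift (L := L) (TrivSqZeroExt.inrHom ℂ (Tot L)) _ 1) = 0
  rw [map_one, TrivSqZeroExt.snd_one]

lemma cor_gen_mul (v : Tot L) (x : GSym L) : cor L (gen L v * x) = counit L x • v := by
  let _ : Module ℂᵐᵒᵖ (Tot L) := Module.compHom _ ((RingHom.id ℂ).fromOpposite mul_comm)
  have _ : IsCentralScalar ℂ (Tot L) := ⟨fun r m => rfl⟩
  have hh : ∀ (i j : ℤ) (a : L i) (b : L j),
      TrivSqZeroExt.inrHom ℂ (Tot L) (hom L i a) * TrivSqZeroExt.inrHom ℂ (Tot L) (hom L j b) =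
      ((-1 : ℂ) ^ ((i - 1) * (j - 1))) • (TrivSqZeroExt.inrHom ℂ (Tot L) (hom L j b) *
        TrivSqZeroExt.inrHom ℂ (Tot L) (hom L i a)) := by
    intro i j a b
    simp [TrivSqZeroExt.inr_mul_inr]
  have hf : (TrivSqZeroExt.fstHom ℂ ℂ (Tot L)).toLinearMap ∘ₗ
      (symLift (TrivSqZeroExt.inrHom ℂ (Tot L)) hh).toLinearMap = (counit L).toLinearMap := by
    apply GSym.linearMap_ext
    · simp
    · intro i a x hx
      simp [symLift_gen, counit_gen]
  have hf' : (symLift (TrivSqZeroExt.inrHom ℂ (Tot L)) hh x).fst = counit L x :=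
    LinearMap.congr_fun hf x
  change (symLift (TrivSqZeroExt.inrHom ℂ (Tot L)) hh (gen L v * x)).snd = _
  rw [map_mul, symLift_gen, TrivSqZeroExt.snd_mul]
  simp [hf']

lemma cor_gen (v : Tot L) : cor L (gen L v) = v := by
  simpa using cor_gen_mul v 1

lemma toBar_val (x : GSym L) : (toBar L x).1 = x - algebraMap ℂ _ (counit L x) := rfl

lemma toBar_one : toBar L 1 = 0 := by
  ext; simp [toBar_val]

lemma toBar_of_counit_eq_zero {x : GSym L} (hx : counit L x = 0) : (toBar L x).1 = x := by
  simp [toBar_val, hx]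

lemma toBar_coe (x : SBar L) : toBar L x.1 = x := by
  ext
  rw [toBar_val, show counit L x.1 = 0 from x.2]
  simp

lemma counit_gen_mul (v : Tot L) (x : GSym L) : counit L (gen L v * x) = 0 := by
  simp [counit_gen]

lemma mono_val_cons (v : Tot L) (l : List (Tot L)) :
    (mono (v :: l)).1 = gen L v * (l.map (gen L)).prod := by
  rw [mono, toBar_of_counit_eq_zero] <;> simp [counit_gen]

/-! Monomials in generators taken from prescribed subspaces. -/

/-- The products of generators `s⁻¹ a` with `a ∈ U k n`, where `k` is a weight and `n` the degree
of `a`, indexed by the sum of the weights. -/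
inductive IsWeightedProd (U : ℤ → ∀ n, Submodule ℂ (L n)) : ℤ → GSym L → Prop
  | one : IsWeightedProd U 0 1
  | cons {k n : ℤ} {a : L n} {N : ℤ} {x : GSym L} (ha : a ∈ U k n) (hx : IsWeightedProd U N x) :
      IsWeightedProd U (k + N) (gen L (hom L n a) * x)

/-- The subspace of `S(s⁻¹ L)` of total weight `N`, where the vectors of `U k n` have weight `k`. -/
def weightSub (U : ℤ → ∀ n, Submodule ℂ (L n)) (N : ℤ) : Submodule ℂ (GSym L) :=
  Submodule.span ℂ {x | IsWeightedProd U N x}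

lemma one_mem_weightSub (U : ℤ → ∀ n, Submodule ℂ (L n)) : 1 ∈ weightSub U 0 :=
  Submodule.subset_span IsWeightedProd.one

lemma gen_hom_mul_mem_weightSub {U : ℤ → ∀ n, Submodule ℂ (L n)} {k n N M : ℤ} {a : L n}
    (ha : a ∈ U k n) {x : GSym L} (hx : x ∈ weightSub U N) (hM : k + N = M) :
    gen L (hom L n a) * x ∈ weightSub U M := by
  subst hM
  refine Submodule.span_induction (p := fun x _ => gen L (hom L n a) * x ∈ weightSub U (k + N))
    ?_ ?_ ?_ ?_ hx
  · intro y hy; exact Submodule.subset_span (IsWeightedProd.cons ha hy)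
  · simp
  · intro y z _ _ hy hz; rw [mul_add]; exact Submodule.add_mem _ hy hz
  · intro c y _ hy; rw [mul_smul_comm]; exact Submodule.smul_mem _ _ hy

lemma gen_mul_mem_weightSub {U : ℤ → ∀ n, Submodule ℂ (L n)} {k N M : ℤ} {v : Tot L}
    (hv : ∀ n, v n ∈ U k n) {x : GSym L} (hx : x ∈ weightSub U N) (hM : k + N = M) :
    gen L v * x ∈ weightSub U M := by
  classical
  rw [← DirectSum.sum_support_of v, map_sum, Finset.sum_mul]
  exact Submodule.sum_mem _ fun n _ => gen_hom_mul_mem_weightSub (hv n) hx hM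

lemma koszul_mem_weightSub {U : ℤ → ∀ n, Submodule ℂ (L n)} (r : ℤ) {N : ℤ} {x : GSym L}
    (hx : x ∈ weightSub U N) : koszul L r x ∈ weightSub U N := by
  refine Submodule.span_induction (p := fun x _ => koszul L r x ∈ weightSub U N) ?_ ?_ ?_ ?_ hx
  · intro y hy
    change IsWeightedProd U N y at hy
    clear hx
    induction hy with
    | one => rw [koszul_one]; exact one_mem_weightSub U
    | cons ha _ ih =>
      rw [koszul_mul]
      exact Submodule.smul_mem _ _ (gen_hom_mul_mem_weightSub ha ih rfl)
  · simp
  · intro y z _ _ hy hz; rw [map_add]; exact Submodule.add_mem _ hy hz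
  · intro c y _ hy; rw [map_smul]; exact Submodule.smul_mem _ _ hy

variable (L) in
/-- The weights for which every generator has weight one: the weight of a monomial is its number
of factors. -/
def lenWeight (k n : ℤ) : Submodule ℂ (L n) := if k = 1 then ⊤ else ⊥

variable (L) in
/-- The weights given by the degree of `s⁻¹ a`. -/
def degWeight (k n : ℤ) : Submodule ℂ (L n) := if k = n - 1 then ⊤ else ⊥

lemma mem_lenWeight_one {n : ℤ} (a : L n) : a ∈ lenWeight L 1 n := by simp [lenWeight]

lemma mem_degWeight {n : ℤ} (a : L n) : a ∈ degWeight L (n - 1) n := by simp [degWeight]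

lemma lenWeight_eq_zero {k n : ℤ} {a : L n} (h : a ∈ lenWeight L k n) (hk : k ≠ 1) : a = 0 := by
  simpa [lenWeight, hk] using h

lemma degWeight_eq_zero {k n : ℤ} {a : L n} (h : a ∈ degWeight L k n) (hk : k ≠ n - 1) :
    a = 0 := by
  simpa [degWeight, hk] using h

lemma isWeightedProd_len {N : ℤ} {x : GSym L} (h : IsWeightedProd (lenWeight L) N x) :
    x = 0 ∨ (N = 0 ∧ x = 1) ∨
      (0 < N ∧ ∃ v y, y ∈ weightSub (lenWeight L) (N - 1) ∧ x = gen L v * y) := by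
  induction h with
  | one => exact Or.inr (Or.inl ⟨rfl, rfl⟩)
  | @cons k n a N x ha hx ih =>
    by_cases hk : k = 1
    · subst hk
      rcases ih with rfl | h
      · left; simp
      · right; right
        refine ⟨by rcases h with h | h <;> omega, _, x, ?_, rfl⟩
        rw [add_sub_cancel_left]
        exact Submodule.subset_span hx
    · left; simp [lenWeight_eq_zero ha hk]

lemma weightSub_len_neg {N : ℤ} (hN : N < 0) {x : GSym L}
    (hx : x ∈ weightSub (lenWeight L) N) : x = 0 := by
  have : weightSub (lenWeight L) N ≤ ⊥ := by
    rw [weightSub, Submodule.span_le]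
    intro y hy
    rcases isWeightedProd_len hy with h | h | h
    · simpa using h
    · omega
    · omega
  exact this hx

lemma weightSub_len_zero {x : GSym L} (hx : x ∈ weightSub (lenWeight L) 0) :
    ∃ c : ℂ, x = algebraMap ℂ _ c := by
  have : weightSub (lenWeight L) 0 ≤ LinearMap.range (Algebra.linearMap ℂ (GSym L)) := by
    rw [weightSub, Submodule.span_le]
    intro y hy
    rcases isWeightedProd_len hy with h | h | h
    · exact ⟨0, by simp [h]⟩
    · exact ⟨1, by simp [h.2]⟩
    · omega
  obtain ⟨c, hc⟩ := this hx
  exact ⟨c, hc.symm⟩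

lemma counit_weightSub_len {N : ℤ} (hN : N ≠ 0) {x : GSym L}
    (hx : x ∈ weightSub (lenWeight L) N) : counit L x = 0 := by
  have : weightSub (lenWeight L) N ≤ LinearMap.ker (counit L).toLinearMap := by
    rw [weightSub, Submodule.span_le]
    intro y hy
    rcases isWeightedProd_len hy with rfl | h | ⟨_, v, y, _, rfl⟩
    · simp
    · omega
    · simp [counit_gen]
  exact this hx

lemma cor_weightSub_len {N : ℤ} (hN : N ≠ 1) {x : GSym L}
    (hx : x ∈ weightSub (lenWeight L) N) : cor L x = 0 := by
  have : weightSub (lenWeight L) N ≤ LinearMap.ker (cor L) := by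
    rw [weightSub, Submodule.span_le]
    intro y hy
    rcases isWeightedProd_len hy with rfl | ⟨_, rfl⟩ | ⟨_, v, y, hy', rfl⟩
    · simp
    · simp [cor_one]
    · simp [cor_gen_mul, counit_weightSub_len (show N - 1 ≠ 0 by omega) hy']
  exact this hx

lemma prod_gen_mem_weightSub_len (l : List (Tot L)) :
    (l.map (gen L)).prod ∈ weightSub (lenWeight L) l.length := by
  induction l with
  | nil => exact one_mem_weightSub _
  | cons v l ih =>
    rw [List.map_cons, List.prod_cons]
    refine gen_mul_mem_weightSub (k := 1) (fun n => mem_lenWeight_one _) ih ?_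
    simp [add_comm]

lemma mono_val_mem_weightSub_len {l : List (Tot L)} (hl : l ≠ []) :
    (mono l).1 ∈ weightSub (lenWeight L) l.length := by
  obtain ⟨v, l, rfl⟩ := List.exists_cons_of_ne_nil hl
  rw [mono_val_cons]
  simpa using prod_gen_mem_weightSub_len (v :: l)

/-- Every element of the symmetric algebra is a sum of elements of given lengths. -/
lemma GSym.len_induction {N : Submodule ℂ (GSym L)}
    (h : ∀ n : ℕ, weightSub (lenWeight L) n ≤ N) : N = ⊤ := by
  have : (⨆ n : ℕ, weightSub (lenWeight L) (n : ℤ)) = ⊤ := by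
    apply GSym.submodule_eq_top
    · exact Submodule.mem_iSup_of_mem 0 (one_mem_weightSub _)
    · intro i a x hx
      refine Submodule.iSup_induction _
        (motive := fun x => gen L (hom L i a) * x ∈ ⨆ n : ℕ, weightSub (lenWeight L) (n : ℤ))
        hx ?_ ?_ ?_
      · intro n x hx
        refine Submodule.mem_iSup_of_mem (n + 1)
          (gen_hom_mul_mem_weightSub (mem_lenWeight_one a) hx ?_)
        push_cast; ring
      · simp
      · intro x y hx hy; rw [mul_add]; exact Submodule.add_mem _ hx hy
  rw [eq_top_iff, ← this]
  exact iSup_le h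

/-! ### Primitive elements and uniqueness of coderivations -/

lemma coprod_one : coprod L 1 = 1 ⊗ₜ 1 := by simp [coprod]

lemma coprod_gen_mul (v : Tot L) (x : GSym L) :
    coprod L (gen L v * x) = coprodGen L v (coprod L x) := by
  simp [coprod, coprodAlg, symLift_gen]

lemma mulLift_coprodGen (i : ℤ) (a : L i) (t : GSym L ⊗[ℂ] GSym L) :
    LinearMap.mul' ℂ (GSym L) (coprodGen L (hom L i a) t) =
      (2 : ℂ) • (gen L (hom L i a) * LinearMap.mul' ℂ (GSym L) t) := by
  have hcomm : ∀ x : GSym L, koszul L (i - 1) x * gen L (hom L i a) =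
      gen L (hom L i a) * x := by
    intro x
    have : (LinearMap.mulRight ℂ (gen L (hom L i a))) ∘ₗ koszul L (i - 1) =
        LinearMap.mulLeft ℂ (gen L (hom L i a)) := by
      apply GSym.linearMap_ext
      · simp [koszul_one]
      · intro j b x hx
        simp only [LinearMap.comp_apply, LinearMap.mulRight_apply, LinearMap.mulLeft_apply]
          at hx ⊢
        rw [koszul_mul, smul_mul_assoc, mul_assoc, hx, ← mul_assoc, ← mul_assoc,
          gen_comm i j a b, smul_mul_assoc]
    exact LinearMap.congr_fun this x
  induction t using TensorProduct.induction_on with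
  | zero => simp
  | tmul x y =>
    rw [coprodGen_hom, map_add, LinearMap.mul'_apply, LinearMap.mul'_apply, LinearMap.mul'_apply,
      ← mul_assoc (koszul L (i - 1) x), hcomm, two_smul, mul_assoc]
  | add x y hx hy => simp only [map_add, hx, hy, mul_add, smul_add]

variable (L) in
/-- The scaling automorphism `s⁻¹ v ↦ 2 s⁻¹ v`. -/
def doubling : GSym L →ₐ[ℂ] GSym L :=
  symLift ((2 : ℂ) • gen L) (by
    intro i j a b
    simp only [LinearMap.smul_apply, smul_mul_smul_comm, gen_comm i j a b, smul_smul]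
    congr 1; ring)

lemma doubling_gen (v : Tot L) : doubling L (gen L v) = (2 : ℂ) • gen L v := by
  rw [doubling, symLift_gen]; rfl

lemma mul_coprod (x : GSym L) : LinearMap.mul' ℂ (GSym L) (coprod L x) = doubling L x := by
  have : LinearMap.mul' ℂ (GSym L) ∘ₗ coprod L = (doubling L).toLinearMap := by
    apply GSym.linearMap_ext
    · simp [coprod_one]
    · intro i a x hx
      simp only [LinearMap.comp_apply, AlgHom.toLinearMap_apply] at hx ⊢
      rw [coprod_gen_mul, mulLift_coprodGen, hx, map_mul, doubling_gen, smul_mul_assoc]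
  exact LinearMap.congr_fun this x

variable (L) in
/-- The projection of `S(s⁻¹ L)` onto the constants. -/
abbrev constPart : GSym L →ₗ[ℂ] GSym L :=
  Algebra.linearMap ℂ (GSym L) ∘ₗ (counit L).toLinearMap

lemma mul_id_counit_coprod (x : GSym L) :
    LinearMap.mul' ℂ (GSym L) (TensorProduct.map LinearMap.id (constPart L) (coprod L x)) = x := by
  have : LinearMap.mul' ℂ (GSym L) ∘ₗ TensorProduct.map LinearMap.id (constPart L) ∘ₗ coprod L =
      LinearMap.id := by
    apply GSym.linearMap_ext
    · simp [coprod_one]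
    · intro i a x hx
      simp only [LinearMap.comp_apply, LinearMap.id_apply] at hx ⊢
      rw [coprod_gen_mul]
      conv_rhs => rw [← hx]
      generalize coprod L x = t
      induction t using TensorProduct.induction_on with
      | zero => simp
      | tmul x y => rw [coprodGen_hom]; simp [counit_gen, mul_assoc]
      | add x y hx hy => simp only [map_add, hx, hy, mul_add]
  exact LinearMap.congr_fun this x

lemma mul_counit_id_coprod (x : GSym L) :
    LinearMap.mul' ℂ (GSym L) (TensorProduct.map (constPart L) LinearMap.id (coprod L x)) = x := by
  have : LinearMap.mul' ℂ (GSym L) ∘ₗ TensorProduct.map (constPart L) LinearMap.id ∘ₗ coprod L =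
      LinearMap.id := by
    apply GSym.linearMap_ext
    · simp [coprod_one]
    · intro i a x hx
      simp only [LinearMap.comp_apply, LinearMap.id_apply] at hx ⊢
      rw [coprod_gen_mul]
      conv_rhs => rw [← hx]
      generalize coprod L x = t
      induction t using TensorProduct.induction_on with
      | zero => simp
      | tmul x y =>
        rw [coprodGen_hom]
        simp [counit_gen, counit_koszul, ← Algebra.smul_def]
      | add x y hx hy => simp only [map_add, hx, hy, mul_add]
  exact LinearMap.congr_fun this x

lemma mul_counit_counit_coprod (x : GSym L) :
    LinearMap.mul' ℂ (GSym L) (TensorProduct.map (constPart L) (constPart L) (coprod L x)) =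
      constPart L x := by
  have : LinearMap.mul' ℂ (GSym L) ∘ₗ TensorProduct.map (constPart L) (constPart L) ∘ₗ coprod L =
      constPart L := by
    apply GSym.linearMap_ext
    · simp [coprod_one]
    · intro i a x hx
      simp only [LinearMap.comp_apply] at hx ⊢
      rw [coprod_gen_mul]
      rw [AlgHom.toLinearMap_apply, counit_gen_mul, map_zero]
      generalize coprod L x = t
      induction t using TensorProduct.induction_on with
      | zero => simp
      | tmul x y =>
        rw [coprodGen_hom]
        simp [counit_gen]
      | add x y hx hy => simp only [map_add, hx, hy, add_zero]
  exact LinearMap.congr_fun this x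

/-- On a primitive element, the comultiplication followed by the multiplication is `2`; this
distinguishes the elements of length one, since it is `2 ^ n` on the elements of length `n`. -/
lemma doubling_of_coprodBar_eq_zero {y : SBar L} (hy : coprodBar L y = 0) :
    doubling L y.1 = (2 : ℂ) • y.1 := by
  have hsub : ∀ x : GSym L, (Submodule.subtype _ ∘ₗ toBar L : GSym L →ₗ[ℂ] GSym L) x =
      (LinearMap.id - constPart L : GSym L →ₗ[ℂ] GSym L) x := fun x => rfl
  have h0 : TensorProduct.map (LinearMap.id - constPart L) (LinearMap.id - constPart L)
      (coprod L y.1) = 0 := by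
    rw [← LinearMap.ext hsub, TensorProduct.map_comp, LinearMap.comp_apply]
    rw [show TensorProduct.map (toBar L) (toBar L) (coprod L y.1) = 0 from hy, map_zero]
  have hc : constPart L y.1 = 0 := by simp [show counit L y.1 = 0 from y.2]
  rw [← mul_coprod]
  have h1 := congrArg (LinearMap.mul' ℂ (GSym L)) h0
  have hexp : ∀ t : GSym L ⊗[ℂ] GSym L,
      TensorProduct.map (LinearMap.id - constPart L) (LinearMap.id - constPart L) t =
        t - TensorProduct.map LinearMap.id (constPart L) t -
          TensorProduct.map (constPart L) LinearMap.id t +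
          TensorProduct.map (constPart L) (constPart L) t := by
    intro t
    induction t using TensorProduct.induction_on with
    | zero => simp
    | tmul x y =>
      simp only [TensorProduct.map_tmul, LinearMap.sub_apply, LinearMap.id_apply,
        TensorProduct.sub_tmul, TensorProduct.tmul_sub]
      abel
    | add x y hx hy => simp only [map_add, hx, hy]; abel
  rw [hexp, map_add, map_sub, map_sub, mul_id_counit_coprod, mul_counit_id_coprod,
    mul_counit_counit_coprod, hc, map_zero] at h1
  rw [two_smul, ← sub_eq_zero, ← sub_sub]
  simpa using h1

lemma doubling_weightSub_len {n : ℕ} {x : GSym L} (hx : x ∈ weightSub (lenWeight L) n) :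
    doubling L x = (2 : ℂ) ^ n • x := by
  induction n generalizing x with
  | zero =>
    obtain ⟨c, rfl⟩ := weightSub_len_zero hx
    simp
  | succ n ih =>
    have : weightSub (lenWeight L) ((n + 1 : ℕ) : ℤ) ≤
        LinearMap.eqLocus (doubling L).toLinearMap ((2 : ℂ) ^ (n + 1) • LinearMap.id) := by
      rw [weightSub, Submodule.span_le]
      intro y hy
      rcases isWeightedProd_len hy with rfl | h | ⟨_, v, y, hy', rfl⟩
      · simp
      · omega
      · have := ih (x := y) (by simpa using hy')
        simp [this, doubling_gen, pow_succ, smul_smul, mul_comm]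
    exact this hx

/-- A primitive element without linear part vanishes. -/
lemma eq_zero_of_coprodBar_eq_zero {y : SBar L} (hy : coprodBar L y = 0)
    (hc : corestr L y = 0) : y = 0 := by
  have h2 := doubling_of_coprodBar_eq_zero hy
  have htop : (⨆ n : ℕ, weightSub (lenWeight L) (n : ℤ)) = ⊤ :=
    GSym.len_induction fun n => le_iSup (fun n : ℕ => weightSub (lenWeight L) (n : ℤ)) n
  obtain ⟨f, hf, hsum⟩ := (Submodule.mem_iSup_iff_exists_finsupp _ y.1).1
    (htop ▸ Submodule.mem_top : y.1 ∈ ⨆ n : ℕ, weightSub (lenWeight L) (n : ℤ))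
  -- the components lie in eigenspaces of the doubling map for different eigenvalues
  have hind := Module.End.eigenspaces_iSupIndep (doubling L).toLinearMap
  have hinj : Function.Injective fun n : ℕ => (2 : ℂ) ^ n := by
    intro a b hab
    have : (2 : ℝ) ^ a = 2 ^ b := by
      have := congrArg norm hab
      simpa using this
    exact pow_right_injective₀ (by norm_num) (by norm_num) this
  have hind' := (hind.comp hinj)
  have hmem : ∀ n, f n ∈ (Module.End.eigenspace (doubling L).toLinearMap ((2 : ℂ) ^ n)) := by
    intro n
    rw [Module.End.mem_eigenspace_iff]
    exact doubling_weightSub_len (hf n)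
  have hy1 : y.1 ∈ Module.End.eigenspace (doubling L).toLinearMap ((2 : ℂ) ^ 1) := by
    rw [Module.End.mem_eigenspace_iff, pow_one]; exact h2
  have hzero : ∀ n, n ≠ 1 → f n = 0 := by
    classical
    let G : ℕ →₀ GSym L := f - Finsupp.single 1 y.1
    have hG : ∀ n, G n ∈ Module.End.eigenspace (doubling L).toLinearMap ((2 : ℂ) ^ n) := by
      intro n
      refine Submodule.sub_mem _ (hmem n) ?_
      by_cases h : 1 = n
      · subst h; simpa using hy1
      · simp [h]
    have hGs : ∑ n ∈ G.support, G n = 0 := by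
      have : G.sum (fun _ x => x) = 0 := by
        simp only [G]
        rw [Finsupp.sum_sub_index (by simp), hsum, Finsupp.sum_single_index rfl, sub_self]
      exact this
    intro n hn
    have hGn : G n = 0 := by
      by_cases hs : n ∈ G.support
      · exact (iSupIndep_iff_finsetSum_eq_zero_imp_eq_zero _).1 hind' G.support G
          (fun i _ => hG i) hGs n hs
      · simpa using hs
    simpa [G, Finsupp.single_apply, Ne.symm hn] using hGn
  have hy' : y.1 ∈ weightSub (lenWeight L) (1 : ℕ) := by
    have : y.1 = f 1 := by
      rw [← hsum, Finsupp.sum, Finset.sum_eq_single 1]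
      · intro n _ hn; exact hzero n hn
      · simp
    rw [this]; exact hf 1
  have hgen : weightSub (lenWeight L) ((1 : ℕ) : ℤ) ≤
      LinearMap.eqLocus (gen L ∘ₗ cor L) LinearMap.id := by
    rw [weightSub, Submodule.span_le]
    intro z hz
    rcases isWeightedProd_len hz with rfl | h | ⟨_, v, z, hz', rfl⟩
    · simp
    · simp at h
    · obtain ⟨c, rfl⟩ := weightSub_len_zero (L := L) (x := z) (by simpa using hz')
      simp [cor_gen, Algebra.algebraMap_eq_smul_one]
  have := hgen hy'
  ext
  have h3 : gen L (cor L y.1) = y.1 := this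
  rw [← h3, ← corestr_eq_cor, hc, map_zero]; rfl

/-- The span of the tensors of two non-empty monomials shorter than `n`. -/
def shortTensors (n : ℕ) : Submodule ℂ (GSym L ⊗[ℂ] GSym L) :=
  Submodule.span ℂ {t | ∃ (a b : ℕ) (x y : GSym L), a + b = n ∧ x ∈ weightSub (lenWeight L) a ∧
    y ∈ weightSub (lenWeight L) b ∧ t = x ⊗ₜ y}

lemma coprod_mem_shortTensors {n : ℕ} {x : GSym L} (hx : x ∈ weightSub (lenWeight L) n) :
    coprod L x ∈ shortTensors (L := L) n := by
  induction n generalizing x with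
  | zero =>
    obtain ⟨c, rfl⟩ := weightSub_len_zero hx
    rw [Algebra.algebraMap_eq_smul_one, map_smul, coprod_one]
    exact Submodule.smul_mem _ _ (Submodule.subset_span
      ⟨0, 0, 1, 1, rfl, one_mem_weightSub _, one_mem_weightSub _, rfl⟩)
  | succ n ih =>
    have hstep : ∀ i (a : L i), ∀ t ∈ shortTensors (L := L) n,
        coprodGen L (hom L i a) t ∈ shortTensors (L := L) (n + 1) := by
      intro i a t ht
      refine Submodule.span_induction
        (p := fun t _ => coprodGen L (hom L i a) t ∈ shortTensors (n + 1)) ?_ ?_ ?_ ?_ ht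
      · rintro _ ⟨p, q, x, y, hpq, hx, hy, rfl⟩
        rw [coprodGen_hom]
        refine Submodule.add_mem _
          (Submodule.subset_span ⟨p + 1, q, _, _, by omega,
            gen_hom_mul_mem_weightSub (mem_lenWeight_one a) hx (by push_cast; ring), hy, rfl⟩)
          (Submodule.subset_span ⟨p, q + 1, _, _, by omega, koszul_mem_weightSub _ hx,
            gen_hom_mul_mem_weightSub (mem_lenWeight_one a) hy (by push_cast; ring), rfl⟩)
      · simp
      · intro s t _ _ hs ht; rw [map_add]; exact Submodule.add_mem _ hs ht
      · intro c t _ ht; rw [map_smul]; exact Submodule.smul_mem _ _ ht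
    have : weightSub (lenWeight L) ((n + 1 : ℕ) : ℤ) ≤
        (shortTensors (L := L) (n + 1)).comap (coprod L) := by
      rw [weightSub, Submodule.span_le]
      intro y hy
      rcases isWeightedProd_len hy with rfl | h | ⟨_, v, y, hy', rfl⟩
      · simp
      · omega
      · change coprod L _ ∈ shortTensors (L := L) (n + 1)
        have hy'' := ih (x := y) (by simpa using hy')
        rw [coprod_gen_mul]
        clear hy
        induction v using DirectSum.induction_on with
        | zero => simp
        | of i a => exact hstep i a _ hy''
        | add v w hv hw =>
          rw [map_add]
          exact Submodule.add_mem _ hv hw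
    exact this hx

lemma toBar_algebraMap (c : ℂ) : toBar L (algebraMap ℂ _ c) = 0 := by
  rw [Algebra.algebraMap_eq_smul_one, map_smul, toBar_one, smul_zero]

/-- A coderivation is determined by its corestriction. -/
theorem IsCoderivation.eq_zero {r : ℤ} {D : SBar L →ₗ[ℂ] SBar L} (hD : IsCoderivation r D)
    (h : ∀ x, corestr L (D x) = 0) : D = 0 := by
  have key : ∀ n : ℕ, ∀ x ∈ weightSub (lenWeight L) (n : ℤ), D (toBar L x) = 0 := by
    intro n
    induction n using Nat.strong_induction_on with
    | _ n ih =>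
      intro x hx
      refine eq_zero_of_coprodBar_eq_zero ?_ (h _)
      have hval : coprodBar L (toBar L x) =
          TensorProduct.map (toBar L) (toBar L) (coprod L x) := by
        by_cases hn : n = 0
        · subst hn
          obtain ⟨c, rfl⟩ := weightSub_len_zero hx
          rw [toBar_algebraMap, map_zero, Algebra.algebraMap_eq_smul_one, map_smul, coprod_one,
            map_smul, TensorProduct.map_tmul, toBar_one, TensorProduct.zero_tmul, smul_zero]
        · rw [coprodBar, LinearMap.comp_apply, LinearMap.comp_apply, Submodule.subtype_apply,
            toBar_of_counit_eq_zero (counit_weightSub_len (by exact_mod_cast hn) hx)]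
      have hco := LinearMap.congr_fun hD.coleibniz (toBar L x)
      rw [LinearMap.comp_apply, LinearMap.comp_apply, hval] at hco
      rw [hco]
      have hle : shortTensors (L := L) n ≤ LinearMap.ker
          ((TensorProduct.map D LinearMap.id + TensorProduct.map (koszulBar L r) D) ∘ₗ
            TensorProduct.map (toBar L) (toBar L)) := by
        rw [shortTensors, Submodule.span_le]
        rintro _ ⟨a, b, y, z, hab, hy, hz, rfl⟩
        change _ = _
        rw [LinearMap.comp_apply, TensorProduct.map_tmul]
        by_cases ha : a = 0
        · subst ha
          obtain ⟨c, rfl⟩ := weightSub_len_zero hy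
          rw [toBar_algebraMap, TensorProduct.zero_tmul, map_zero]
        by_cases hb : b = 0
        · subst hb
          obtain ⟨c, rfl⟩ := weightSub_len_zero hz
          rw [toBar_algebraMap, TensorProduct.tmul_zero, map_zero]
        rw [LinearMap.add_apply, TensorProduct.map_tmul, TensorProduct.map_tmul,
          ih a (by omega) y hy, ih b (by omega) z hz, TensorProduct.zero_tmul,
          TensorProduct.tmul_zero, add_zero]
      exact hle (coprod_mem_shortTensors hx)
  have htop : LinearMap.ker (D ∘ₗ toBar L) = ⊤ := GSym.len_induction fun n x hx => key n x hx
  ext1 x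
  have : x.1 ∈ LinearMap.ker (D ∘ₗ toBar L) := htop ▸ Submodule.mem_top
  simpa [toBar_coe] using this

end CoalgebraBasics

/-! ### Operators on the symmetric algebra that are defined by recursion -/

section Recursion

universe u

variable {L : ℤ → Type u} [∀ n, AddCommGroup (L n)] [∀ n, Module ℂ (L n)]

lemma koszul_gen_gen_comm (r i j : ℤ) (a : L i) (b : L j) (x : GSym L) :
    koszul L r (gen L (hom L i a)) * (koszul L r (gen L (hom L j b)) * x) =
      ((-1 : ℂ) ^ ((i - 1) * (j - 1))) •
        (koszul L r (gen L (hom L j b)) * (koszul L r (gen L (hom L i a)) * x)) := by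
  simp only [koszul_gen, smul_mul_assoc, mul_smul_comm, smul_smul]
  rw [← mul_assoc, ← mul_assoc, gen_comm i j a b, smul_mul_assoc, smul_smul,
    mul_assoc (gen L (hom L j b))]
  congr 1; ring

/-- The operators `(x, y) ↦ (s⁻¹ v x, (-1)^{r |s⁻¹ v|} s⁻¹ v y + T_v x)`. -/
def recOp (r : ℤ) (T : Tot L →ₗ[ℂ] Module.End ℂ (GSym L)) :
    Tot L →ₗ[ℂ] Module.End ℂ (GSym L × GSym L) where
  toFun v := LinearMap.prod (LinearMap.mulLeft ℂ (gen L v) ∘ₗ LinearMap.fst ℂ _ _)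
    (LinearMap.mulLeft ℂ (koszul L r (gen L v)) ∘ₗ LinearMap.snd ℂ _ _ +
      T v ∘ₗ LinearMap.fst ℂ _ _)
  map_add' v w := by
    ext x <;> simp [add_mul]
  map_smul' c v := by
    ext x <;> simp

lemma recOp_apply (r : ℤ) (T : Tot L →ₗ[ℂ] Module.End ℂ (GSym L)) (v : Tot L)
    (p : GSym L × GSym L) :
    recOp r T v p = (gen L v * p.1, koszul L r (gen L v) * p.2 + T v p.1) := rfl

/-- The compatibility of the operators `T_v` with the graded commutativity of the generators that
makes the recursion `O (s⁻¹ v x) = (-1)^{r |s⁻¹ v|} s⁻¹ v O x + T_v x` consistent. -/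
def RecCompat (r : ℤ) (T : Tot L →ₗ[ℂ] Module.End ℂ (GSym L)) : Prop :=
  ∀ (i j : ℤ) (a : L i) (b : L j) (x : GSym L),
    koszul L r (gen L (hom L i a)) * T (hom L j b) x + T (hom L i a) (gen L (hom L j b) * x) =
      ((-1 : ℂ) ^ ((i - 1) * (j - 1))) •
        (koszul L r (gen L (hom L j b)) * T (hom L i a) x +
          T (hom L j b) (gen L (hom L i a) * x))

/-- The recursion `O (s⁻¹ v x) = (-1)^{r |s⁻¹ v|} s⁻¹ v O x + T_v x` is consistent: the operators
`recOp` satisfy the relations of the symmetric algebra, which therefore acts on pairs. -/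
lemma exists_rec {r : ℤ} {T : Tot L →ₗ[ℂ] Module.End ℂ (GSym L)} (hT : RecCompat r T) :
    ∃ O : GSym L →ₗ[ℂ] GSym L, O 1 = 0 ∧
      ∀ v x, O (gen L v * x) = koszul L r (gen L v) * O x + T v x := by
  have hcomm : ∀ (i j : ℤ) (a : L i) (b : L j),
      recOp r T (hom L i a) * recOp r T (hom L j b) =
        ((-1 : ℂ) ^ ((i - 1) * (j - 1))) •
          (recOp r T (hom L j b) * recOp r T (hom L i a)) := by
    intro i j a b
    refine LinearMap.ext fun p => ?_
    have h := hT i j a b p.1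
    simp only [Module.End.mul_apply, LinearMap.smul_apply, recOp_apply, Prod.smul_mk]
    refine Prod.ext ?_ ?_
    · simp only [← mul_assoc, gen_comm i j a b, smul_mul_assoc]
    · simp only [mul_add]
      rw [add_assoc, add_assoc, h, koszul_gen_gen_comm r i j a b, smul_add, smul_add, smul_add]
  let Φ : GSym L →ₐ[ℂ] Module.End ℂ (GSym L × GSym L) := symLift (recOp r T) hcomm
  have hfst : ∀ x, (Φ x (1, 0)).1 = x := by
    intro x
    have : LinearMap.fst ℂ _ _ ∘ₗ LinearMap.applyₗ ((1 : GSym L), (0 : GSym L)) ∘ₗ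
        Φ.toLinearMap = LinearMap.id := by
      apply GSym.linearMap_ext
      · simp
      · intro i a x hx
        simp only [LinearMap.comp_apply, AlgHom.toLinearMap_apply, LinearMap.applyₗ_apply_apply,
          LinearMap.fst_apply, LinearMap.id_apply, map_mul, Module.End.mul_apply] at hx ⊢
        rw [show Φ (gen L (hom L i a)) = recOp r T (hom L i a) from symLift_gen _ _ _,
          recOp_apply, hx]
    exact LinearMap.congr_fun this x
  refine ⟨LinearMap.snd ℂ _ _ ∘ₗ LinearMap.applyₗ ((1 : GSym L), (0 : GSym L)) ∘ₗ
        Φ.toLinearMap, by simp, fun v x => ?_⟩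
  simp only [LinearMap.comp_apply, AlgHom.toLinearMap_apply, LinearMap.applyₗ_apply_apply,
    LinearMap.snd_apply, map_mul, Module.End.mul_apply]
  rw [show Φ (gen L v) = recOp r T v from symLift_gen _ _ _, recOp_apply, hfst]

/-- The operator defined by `O 1 = 0` and
`O (s⁻¹ v x) = (-1)^{r |s⁻¹ v|} s⁻¹ v O x + T_v x`. -/
structure IsRec (r : ℤ) (T : Tot L →ₗ[ℂ] Module.End ℂ (GSym L)) (O : GSym L →ₗ[ℂ] GSym L) :
    Prop where
  one : O 1 = 0
  gen_mul : ∀ v x, O (gen L v * x) = koszul L r (gen L v) * O x + T v x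

/-- The operator `O` is odd or even, according to the parity of `r`. -/
def HasParity (r : ℤ) (O : GSym L →ₗ[ℂ] GSym L) : Prop :=
  ∀ t x, koszul L t (O x) = ((-1 : ℂ) ^ (t * r)) • O (koszul L t x)

lemma IsRec.hasParity {r : ℤ} {T : Tot L →ₗ[ℂ] Module.End ℂ (GSym L)} {O : GSym L →ₗ[ℂ] GSym L}
    (hO : IsRec r T O) (hT : ∀ i (a : L i), HasParity (r + (i - 1)) (T (hom L i a))) :
    HasParity r O := by
  intro t x
  have : koszul L t ∘ₗ O = ((-1 : ℂ) ^ (t * r)) • (O ∘ₗ koszul L t) := by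
    apply GSym.linearMap_ext
    · simp [hO.one, koszul_one]
    · intro i a x hx
      simp only [LinearMap.comp_apply, LinearMap.smul_apply] at hx ⊢
      rw [hO.gen_mul, map_add, hT i a t, koszul_gen, smul_mul_assoc, map_smul, koszul_mul, hx,
        koszul_mul, map_smul, hO.gen_mul, koszul_gen]
      simp only [smul_add, smul_smul, smul_mul_assoc, mul_smul_comm, mul_add,
        zpow_add₀ (show (-1 : ℂ) ≠ 0 by simp)]
      congr 2; ring
  exact LinearMap.congr_fun this x

lemma IsRec.counit {r : ℤ} {T : Tot L →ₗ[ℂ] Module.End ℂ (GSym L)} {O : GSym L →ₗ[ℂ] GSym L}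
    (hO : IsRec r T O) (hT : ∀ i (a : L i) x, counit L (T (hom L i a) x) = 0) (x : GSym L) :
    counit L (O x) = 0 := by
  have : (ShT.counit L).toLinearMap ∘ₗ O = 0 := by
    apply GSym.linearMap_ext
    · simp [hO.one]
    · intro i a x hx
      simp [hO.gen_mul, hT, koszul_gen, counit_gen]
  exact LinearMap.congr_fun this x

/-- The coderivation property on the full symmetric algebra:
`Δ O = (O ⊗ 1 + (-1)^{r |·|} ⊗ O) Δ`. -/
def CoLeibniz (r : ℤ) (O : GSym L →ₗ[ℂ] GSym L) : Prop :=
  ∀ x, coprod L (O x) =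
    TensorProduct.map O LinearMap.id (coprod L x) + TensorProduct.map (koszul L r) O (coprod L x)

/-- The coderivation property passes from the operators `T_v` to the operator they define. -/
lemma IsRec.coLeibniz {r : ℤ} {T : Tot L →ₗ[ℂ] Module.End ℂ (GSym L)} {O : GSym L →ₗ[ℂ] GSym L}
    (hO : IsRec r T O) (hT : ∀ i (a : L i), HasParity (r + (i - 1)) (T (hom L i a)))
    (hT' : ∀ i (a : L i), CoLeibniz (r + (i - 1)) (T (hom L i a))) : CoLeibniz r O := by
  have hpar := hO.hasParity hT
  intro x
  have : coprod L ∘ₗ O =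
      (TensorProduct.map O LinearMap.id + TensorProduct.map (koszul L r) O) ∘ₗ coprod L := by
    apply GSym.linearMap_ext
    · simp [hO.one, coprod_one]
    · intro i a x hx
      simp only [LinearMap.comp_apply, LinearMap.add_apply] at hx ⊢
      rw [hO.gen_mul, map_add, hT' i a, koszul_gen, smul_mul_assoc, map_smul, coprod_gen_mul, hx,
        coprod_gen_mul]
      generalize coprod L x = t
      induction t using TensorProduct.induction_on with
      | zero => simp
      | add x y hx hy =>
        have := congrArg₂ (· + ·) hx hy
        simp only [map_add, smul_add] at this ⊢
        convert this using 1 <;> abel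
      | tmul y z =>
        simp only [TensorProduct.map_tmul, LinearMap.id_apply, map_add,
          coprodGen_hom, hO.gen_mul, koszul_gen, koszul_mul, smul_mul_assoc, koszul_koszul,
          hpar (i - 1) y, smul_add, TensorProduct.add_tmul, TensorProduct.tmul_add,
          TensorProduct.tmul_smul, ← TensorProduct.smul_tmul', smul_smul]
        rw [mul_comm (i - 1) r, neg_one_zpow_mul_self, one_smul, add_comm (i - 1) r]
        abel
  exact LinearMap.congr_fun this x

/-- If every `T_v` shifts the weight by the weight of `v` plus `c`, then `O` shifts it by `c`. -/
lemma IsRec.mem_weightSub {r c : ℤ} {T : Tot L →ₗ[ℂ] Module.End ℂ (GSym L)}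
    {O : GSym L →ₗ[ℂ] GSym L} (hO : IsRec r T O) {U : ℤ → ∀ n, Submodule ℂ (L n)}
    (hT : ∀ k n (a : L n), a ∈ U k n → ∀ N, ∀ x ∈ weightSub U N,
      T (hom L n a) x ∈ weightSub U (k + N + c)) :
    ∀ N, ∀ x ∈ weightSub U N, O x ∈ weightSub U (N + c) := by
  intro N x hx
  have : weightSub U N ≤ (weightSub U (N + c)).comap O := by
    rw [weightSub, Submodule.span_le]
    intro y hy
    change IsWeightedProd U N y at hy
    change O y ∈ weightSub U (N + c)
    clear hx
    induction hy with
    | one => rw [hO.one]; exact Submodule.zero_mem _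
    | @cons k n a N x ha hx ih =>
      rw [hO.gen_mul, koszul_gen, smul_mul_assoc]
      refine Submodule.add_mem _ (Submodule.smul_mem _ _ (gen_hom_mul_mem_weightSub ha ih
        (by ring))) (hT k n a ha N x (Submodule.subset_span hx))
  exact this hx

/-! ### Derivations and second-order operators -/

/-- The map `f` of graded vector spaces has degree `r`. -/
def HomDegree (r : ℤ) (f : Tot L →ₗ[ℂ] Tot L) : Prop :=
  ∀ i (a : L i), f (hom L i a) ∈ LinearMap.range (hom L (i + r))

variable (L) in
/-- Left multiplication by the generators `s⁻¹ f(v)`. -/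
def leftGen (f : Tot L →ₗ[ℂ] Tot L) : Tot L →ₗ[ℂ] Module.End ℂ (GSym L) :=
  LinearMap.mul ℂ (GSym L) ∘ₗ gen L ∘ₗ f

lemma leftGen_apply (f : Tot L →ₗ[ℂ] Tot L) (v : Tot L) (x : GSym L) :
    leftGen L f v x = gen L (f v) * x := rfl

lemma leftGen_recCompat {r : ℤ} {f : Tot L →ₗ[ℂ] Tot L} (hf : HomDegree r f) :
    RecCompat r (leftGen L f) := by
  intro i j a b x
  obtain ⟨a', ha⟩ := hf i a
  obtain ⟨b', hb⟩ := hf j b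
  simp only [leftGen_apply, ← ha, ← hb, koszul_gen, ← mul_assoc, smul_mul_assoc,
    gen_comm (i + r) j a' b, gen_comm i (j + r) a b', smul_add, smul_smul]
  rw [add_comm]
  have h1 := neg_one_zpow_mul_self (r * (i - 1))
  congr 3
  · rw [show (i + r - 1) * (j - 1) = (i - 1) * (j - 1) + r * (j - 1) by ring,
      zpow_add₀ (by simp)]
  · rw [show (i - 1) * (j + r - 1) = (i - 1) * (j - 1) + r * (i - 1) by ring,
      zpow_add₀ (by simp), mul_comm, mul_assoc, h1, mul_one]

lemma leftGen_hasParity {r : ℤ} {f : Tot L →ₗ[ℂ] Tot L} (hf : HomDegree r f) (i : ℤ) (a : L i) :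
    HasParity (r + (i - 1)) (leftGen L f (hom L i a)) := by
  intro t x
  obtain ⟨a', ha⟩ := hf i a
  simp only [leftGen_apply, ← ha, koszul_mul]
  congr 2; ring

lemma leftGen_coLeibniz {r : ℤ} {f : Tot L →ₗ[ℂ] Tot L} (hf : HomDegree r f) (i : ℤ) (a : L i) :
    CoLeibniz (r + (i - 1)) (leftGen L f (hom L i a)) := by
  intro x
  obtain ⟨a', ha⟩ := hf i a
  simp only [leftGen_apply, ← ha, coprod_gen_mul]
  generalize coprod L x = t
  induction t using TensorProduct.induction_on with
  | zero => simp
  | add x y hx hy => simp only [map_add, hx, hy]; abel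
  | tmul y z =>
    rw [coprodGen_hom, TensorProduct.map_tmul, TensorProduct.map_tmul]
    simp only [leftGen_apply, ← ha, LinearMap.id_apply]
    rw [show i + r - 1 = r + (i - 1) by ring]

lemma exists_deriv {r : ℤ} {f : Tot L →ₗ[ℂ] Tot L} (hf : HomDegree r f) :
    ∃ O, IsRec r (leftGen L f) O :=
  (exists_rec (leftGen_recCompat hf)).imp fun _ h => ⟨h.1, h.2⟩

/-- A bilinear operation `B` on a graded vector space that is, in terms of the desuspended
vectors, of degree `r` and graded symmetric. -/
structure IsSymmBilin (r : ℤ) (B : Tot L →ₗ[ℂ] Tot L →ₗ[ℂ] Tot L) : Prop where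
  degree : ∀ i j (a : L i) (b : L j),
    B (hom L i a) (hom L j b) ∈ LinearMap.range (hom L (i + j - 1 + r))
  symm : ∀ i j (a : L i) (b : L j),
    B (hom L i a) (hom L j b) = ((-1 : ℂ) ^ ((i - 1) * (j - 1))) • B (hom L j b) (hom L i a)

lemma IsSymmBilin.homDegree {r : ℤ} {B : Tot L →ₗ[ℂ] Tot L →ₗ[ℂ] Tot L} (hB : IsSymmBilin r B)
    (i : ℤ) (a : L i) : HomDegree (r + (i - 1)) (B (hom L i a)) := by
  intro j b
  have := hB.degree i j a b
  rwa [show i + j - 1 + r = j + (r + (i - 1)) by ring] at this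

/-- The family of the derivations of `S(s⁻¹ L)` with `s⁻¹ w ↦ s⁻¹ B(v, w)`. -/
structure IsDerivFamily (r : ℤ) (B : Tot L →ₗ[ℂ] Tot L →ₗ[ℂ] Tot L)
    (T : Tot L →ₗ[ℂ] Module.End ℂ (GSym L)) : Prop where
  isRec : ∀ i (a : L i), IsRec (r + (i - 1)) (leftGen L (B (hom L i a))) (T (hom L i a))

lemma IsRec.ext {r : ℤ} {T : Tot L →ₗ[ℂ] Module.End ℂ (GSym L)} {O O' : GSym L →ₗ[ℂ] GSym L}
    (h : IsRec r T O) (h' : IsRec r T O') : O = O' := by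
  apply GSym.linearMap_ext
  · rw [h.one, h'.one]
  · intro i a x hx
    rw [h.gen_mul, h'.gen_mul, hx]

lemma exists_derivFamily {r : ℤ} {B : Tot L →ₗ[ℂ] Tot L →ₗ[ℂ] Tot L} (hB : IsSymmBilin r B) :
    ∃ T, IsDerivFamily r B T := by
  choose D hD using fun i (a : L i) => exists_deriv (hB.homDegree i a)
  let E : ∀ i, L i →ₗ[ℂ] Module.End ℂ (GSym L) := fun i =>
    { toFun := D i
      map_add' := fun a b => by
        refine IsRec.ext (hD i (a + b)) ⟨?_, fun v x => ?_⟩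
        · simp [(hD i a).one, (hD i b).one]
        · simp only [LinearMap.add_apply, (hD i a).gen_mul, (hD i b).gen_mul, leftGen_apply,
            map_add, mul_add, add_mul]
          abel
      map_smul' := fun c a => by
        refine IsRec.ext (hD i (c • a)) ⟨?_, fun v x => ?_⟩
        · simp [(hD i a).one]
        · simp only [LinearMap.smul_apply, (hD i a).gen_mul, leftGen_apply, map_smul,
            mul_smul_comm, smul_mul_assoc, smul_add, RingHom.id_apply] }
  refine ⟨DirectSum.toModule ℂ ℤ _ E, ⟨fun i a => ?_⟩⟩
  rw [DirectSum.toModule_lof]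
  exact hD i a

lemma IsDerivFamily.recCompat {r : ℤ} {B : Tot L →ₗ[ℂ] Tot L →ₗ[ℂ] Tot L}
    {T : Tot L →ₗ[ℂ] Module.End ℂ (GSym L)} (hB : IsSymmBilin r B) (hT : IsDerivFamily r B T) :
    RecCompat r T := by
  intro i j a b x
  rw [(hT.isRec i a).gen_mul, (hT.isRec j b).gen_mul, leftGen_apply, leftGen_apply,
    hB.symm i j a b]
  simp only [koszul_gen, smul_add, smul_smul, smul_mul_assoc, map_smul]
  have h1 := neg_one_zpow_mul_self ((i - 1) * (j - 1))
  have e1 : ((-1 : ℂ) ^ ((r + (i - 1)) * (j - 1))) =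
      (-1) ^ ((i - 1) * (j - 1)) * (-1) ^ (r * (j - 1)) := by
    rw [← zpow_add₀ (by simp)]; congr 1; ring
  have e2 : (-1 : ℂ) ^ ((i - 1) * (j - 1)) * (-1) ^ ((r + (j - 1)) * (i - 1)) =
      (-1) ^ (r * (i - 1)) := by
    rw [show (r + (j - 1)) * (i - 1) = (i - 1) * (j - 1) + r * (i - 1) by ring,
      zpow_add₀ (by simp), ← mul_assoc, h1, one_mul]
  rw [e1, e2]
  abel

lemma IsDerivFamily.hasParity {r : ℤ} {B : Tot L →ₗ[ℂ] Tot L →ₗ[ℂ] Tot L}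
    {T : Tot L →ₗ[ℂ] Module.End ℂ (GSym L)} (hB : IsSymmBilin r B) (hT : IsDerivFamily r B T)
    (i : ℤ) (a : L i) : HasParity (r + (i - 1)) (T (hom L i a)) :=
  (hT.isRec i a).hasParity fun j b => leftGen_hasParity (hB.homDegree i a) j b

lemma IsDerivFamily.coLeibniz {r : ℤ} {B : Tot L →ₗ[ℂ] Tot L →ₗ[ℂ] Tot L}
    {T : Tot L →ₗ[ℂ] Module.End ℂ (GSym L)} (hB : IsSymmBilin r B) (hT : IsDerivFamily r B T)
    (i : ℤ) (a : L i) : CoLeibniz (r + (i - 1)) (T (hom L i a)) :=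
  (hT.isRec i a).coLeibniz (fun j b => leftGen_hasParity (hB.homDegree i a) j b)
    fun j b => leftGen_coLeibniz (hB.homDegree i a) j b

/-- The extension of a coderivation to the full symmetric algebra. -/
structure IsFullCoder (r : ℤ) (O : GSym L →ₗ[ℂ] GSym L) : Prop where
  one : O 1 = 0
  counit : ∀ x, counit L (O x) = 0
  coLeibniz : CoLeibniz r O
  parity : HasParity r O
  degree : ∀ N, ∀ x ∈ weightSub (degWeight L) N, O x ∈ weightSub (degWeight L) (N + r)

lemma gen_range_mul_mem_degWeight {n N M : ℤ} {v : Tot L} (hv : v ∈ LinearMap.range (hom L n))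
    {x : GSym L} (hx : x ∈ weightSub (degWeight L) N) (hM : n - 1 + N = M) :
    gen L v * x ∈ weightSub (degWeight L) M := by
  obtain ⟨a, rfl⟩ := hv
  exact gen_hom_mul_mem_weightSub (mem_degWeight a) hx hM

lemma leftGen_degree {r : ℤ} {f : Tot L →ₗ[ℂ] Tot L} (hf : HomDegree r f) (k n : ℤ) (a : L n)
    (ha : a ∈ degWeight L k n) (N : ℤ) (x : GSym L) (hx : x ∈ weightSub (degWeight L) N) :
    leftGen L f (hom L n a) x ∈ weightSub (degWeight L) (k + N + r) := by
  by_cases hk : k = n - 1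
  · subst hk
    exact gen_range_mul_mem_degWeight (hf n a) hx (by ring)
  · simp [degWeight_eq_zero ha hk]

lemma IsRec.isFullCoder_of_leftGen {r : ℤ} {f : Tot L →ₗ[ℂ] Tot L} {O : GSym L →ₗ[ℂ] GSym L}
    (hf : HomDegree r f) (hO : IsRec r (leftGen L f) O) : IsFullCoder r O where
  one := hO.one
  counit := hO.counit fun i a x => by simp [leftGen_apply, counit_gen]
  coLeibniz := hO.coLeibniz (fun i a => leftGen_hasParity hf i a)
    fun i a => leftGen_coLeibniz hf i a
  parity := hO.hasParity fun i a => leftGen_hasParity hf i a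
  degree := hO.mem_weightSub (leftGen_degree hf)

/-- The operator `O` on the symmetric algebra is the coderivation whose corestriction is
`s⁻¹ v s⁻¹ w ↦ s⁻¹ B(v, w)`; it is a differential operator of order two. -/
def IsSecondOrder (r : ℤ) (B : Tot L →ₗ[ℂ] Tot L →ₗ[ℂ] Tot L) (O : GSym L →ₗ[ℂ] GSym L) : Prop :=
  ∃ T, IsDerivFamily r B T ∧ IsRec r T O

/-- The coderivation with quadratic corestriction `B` exists: apply the recursion to the derivations
that extend `B(v, ·)`. -/
lemma exists_secondOrder {r : ℤ} {B : Tot L →ₗ[ℂ] Tot L →ₗ[ℂ] Tot L} (hB : IsSymmBilin r B) :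
    ∃ O, IsSecondOrder r B O := by
  obtain ⟨T, hT⟩ := exists_derivFamily hB
  obtain ⟨O, h1, h2⟩ := exists_rec (hT.recCompat hB)
  exact ⟨O, T, hT, h1, h2⟩

lemma IsSecondOrder.isFullCoder {r : ℤ} {B : Tot L →ₗ[ℂ] Tot L →ₗ[ℂ] Tot L}
    {O : GSym L →ₗ[ℂ] GSym L} (hB : IsSymmBilin r B) (hO : IsSecondOrder r B O) :
    IsFullCoder r O := by
  obtain ⟨T, hT, hO⟩ := hO
  refine ⟨hO.one, hO.counit fun i a x => ?_,
    hO.coLeibniz (fun i a => hT.hasParity hB i a) fun i a => hT.coLeibniz hB i a,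
    hO.hasParity fun i a => hT.hasParity hB i a,
    hO.mem_weightSub ?_⟩
  · exact ((hT.isRec i a).isFullCoder_of_leftGen (hB.homDegree i a)).counit x
  · intro k n a ha N x hx
    by_cases hk : k = n - 1
    · have := ((hT.isRec n a).isFullCoder_of_leftGen (hB.homDegree n a)).degree N x hx
      rwa [show N + (r + (n - 1)) = k + N + r by rw [hk]; ring] at this
    · simp [degWeight_eq_zero ha hk]

/-- A second-order coderivation preserves a filtration if `B` does. -/
lemma IsSecondOrder.mem_weightSub {r c : ℤ} {B : Tot L →ₗ[ℂ] Tot L →ₗ[ℂ] Tot L}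
    {O : GSym L →ₗ[ℂ] GSym L} (hO : IsSecondOrder r B O) {U : ℤ → ∀ n, Submodule ℂ (L n)}
    (hU : ∀ k l i j (a : L i) (b : L j), a ∈ U k i → b ∈ U l j →
      ∀ n, B (hom L i a) (hom L j b) n ∈ U (k + l + c) n) :
    ∀ N, ∀ x ∈ weightSub U N, O x ∈ weightSub U (N + c) := by
  obtain ⟨T, hT, hO⟩ := hO
  refine hO.mem_weightSub fun k i a ha N x hx => ?_
  have := (hT.isRec i a).mem_weightSub (U := U) (c := k + c) (fun l j b hb N x hx => ?_) N x hx
  · rwa [show N + (k + c) = k + N + c by ring] at this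
  · exact gen_mul_mem_weightSub (hU k l i j a b ha hb) hx (by ring)

lemma IsSecondOrder.len {r : ℤ} {B : Tot L →ₗ[ℂ] Tot L →ₗ[ℂ] Tot L} {O : GSym L →ₗ[ℂ] GSym L}
    (hO : IsSecondOrder r B O) (N : ℤ) (x : GSym L) (hx : x ∈ weightSub (lenWeight L) N) :
    O x ∈ weightSub (lenWeight L) (N - 1) := by
  refine hO.mem_weightSub (c := -1) (fun k l i j a b ha hb n => ?_) N x hx
  by_cases hk : k = 1
  · by_cases hl : l = 1
    · subst hk hl
      exact mem_lenWeight_one _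
    · simp [lenWeight_eq_zero hb hl]
  · simp [lenWeight_eq_zero ha hk]

lemma IsRec.len {r : ℤ} {f : Tot L →ₗ[ℂ] Tot L} {O : GSym L →ₗ[ℂ] GSym L}
    (hO : IsRec r (leftGen L f) O) (N : ℤ) (x : GSym L) (hx : x ∈ weightSub (lenWeight L) N) :
    O x ∈ weightSub (lenWeight L) N := by
  have := hO.mem_weightSub (c := 0) (U := lenWeight L) (fun k n a ha N x hx => ?_) N x hx
  · simpa using this
  · by_cases hk : k = 1
    · subst hk
      exact gen_mul_mem_weightSub (k := 1) (fun n => mem_lenWeight_one _) hx (by ring)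
    · simp [lenWeight_eq_zero ha hk]

/-! Values on short monomials. -/

lemma IsRec.apply_gen {r : ℤ} {f : Tot L →ₗ[ℂ] Tot L} {O : GSym L →ₗ[ℂ] GSym L}
    (hO : IsRec r (leftGen L f) O) (v : Tot L) : O (gen L v) = gen L (f v) := by
  have := hO.gen_mul v 1
  simpa [hO.one, leftGen_apply] using this

lemma IsRec.apply_gen_gen {r : ℤ} {f : Tot L →ₗ[ℂ] Tot L} {O : GSym L →ₗ[ℂ] GSym L}
    (hO : IsRec r (leftGen L f) O) (i : ℤ) (a : L i) (w : Tot L) :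
    O (gen L (hom L i a) * gen L w) = ((-1 : ℂ) ^ (r * (i - 1))) •
      (gen L (hom L i a) * gen L (f w)) + gen L (f (hom L i a)) * gen L w := by
  rw [hO.gen_mul, hO.apply_gen, koszul_gen, leftGen_apply, smul_mul_assoc]

lemma IsSecondOrder.apply_gen {r : ℤ} {B : Tot L →ₗ[ℂ] Tot L →ₗ[ℂ] Tot L}
    {O : GSym L →ₗ[ℂ] GSym L} (hO : IsSecondOrder r B O) (v : Tot L) : O (gen L v) = 0 := by
  obtain ⟨T, hT, hO⟩ := hO
  have h := hO.gen_mul v 1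
  rw [mul_one, hO.one, mul_zero, zero_add] at h
  rw [h]
  induction v using DirectSum.induction_on with
  | zero => simp
  | of i a => exact (hT.isRec i a).one
  | add v w hv hw =>
    have hv' : T v 1 = 0 := hv (by simpa [hO.one] using hO.gen_mul v 1)
    have hw' : T w 1 = 0 := hw (by simpa [hO.one] using hO.gen_mul w 1)
    rw [map_add, LinearMap.add_apply, hv', hw', add_zero]

lemma IsSecondOrder.apply_gen_gen {r : ℤ} {B : Tot L →ₗ[ℂ] Tot L →ₗ[ℂ] Tot L}
    {O : GSym L →ₗ[ℂ] GSym L} (hO : IsSecondOrder r B O) (v w : Tot L) :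
    O (gen L v * gen L w) = gen L (B v w) := by
  have h0 := hO.apply_gen
  obtain ⟨T, hT, hO⟩ := hO
  rw [hO.gen_mul, h0, mul_zero, zero_add]
  induction v using DirectSum.induction_on with
  | zero => simp
  | of i a => exact (hT.isRec i a).apply_gen w
  | add v v' hv hv' => simp [hv, hv']

lemma IsSecondOrder.apply_gen_gen_gen {r : ℤ} {B : Tot L →ₗ[ℂ] Tot L →ₗ[ℂ] Tot L}
    {O : GSym L →ₗ[ℂ] GSym L} (hO : IsSecondOrder r B O) (i j : ℤ) (a : L i) (b : L j)
    (w : Tot L) :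
    O (gen L (hom L i a) * (gen L (hom L j b) * gen L w)) =
      ((-1 : ℂ) ^ (r * (i - 1))) • (gen L (hom L i a) * gen L (B (hom L j b) w)) +
      (((-1 : ℂ) ^ ((r + (i - 1)) * (j - 1))) •
        (gen L (hom L j b) * gen L (B (hom L i a) w)) +
        gen L (B (hom L i a) (hom L j b)) * gen L w) := by
  have h2 := hO.apply_gen_gen
  obtain ⟨T, hT, hO⟩ := hO
  rw [hO.gen_mul, h2, (hT.isRec i a).apply_gen_gen, koszul_gen, smul_mul_assoc]

end Recursion

/-! ### Exponentials of locally nilpotent operators -/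

section LocallyNilpotent

variable {V : Type*} [AddCommMonoid V] [Module ℂ V]

/-- An operator every vector of which is killed by a power of it. -/
def LocNilp (P : V →ₗ[ℂ] V) : Prop := ∀ x, ∃ N : ℕ, ∀ n ≥ N, (P ^ n) x = 0

lemma LocNilp.support_finite {P : V →ₗ[ℂ] V} (h : LocNilp P) (x : V) :
    (Function.support fun i : ℕ => ((i.factorial : ℂ)⁻¹) • (P ^ i) x).Finite := by
  obtain ⟨N, hN⟩ := h x
  refine (Finset.range N).finite_toSet.subset fun i hi => ?_
  by_contra hlt
  exact hi (by simp [hN i (by simpa using hlt)])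

open Classical in
/-- The exponential of a locally nilpotent operator. -/
def lexp (P : V →ₗ[ℂ] V) : V →ₗ[ℂ] V :=
  if h : LocNilp P then
    { toFun := fun x => ∑ᶠ i : ℕ, ((i.factorial : ℂ)⁻¹) • (P ^ i) x
      map_add' := fun x y => by
        rw [← finsum_add_distrib (h.support_finite x) (h.support_finite y)]
        simp
      map_smul' := fun c x => by
        rw [RingHom.id_apply, smul_finsum' c (h.support_finite x)]
        simp [smul_comm c] }
  else 0

lemma lexp_eq_sum {P : V →ₗ[ℂ] V} (h : LocNilp P) {x : V} {N : ℕ} (hN : ∀ n ≥ N, (P ^ n) x = 0) :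
    lexp P x = ∑ i ∈ Finset.range N, ((i.factorial : ℂ)⁻¹) • (P ^ i) x := by
  rw [lexp, dif_pos h]
  refine finsum_eq_sum_of_support_subset _ fun i hi => ?_
  by_contra hlt
  exact hi (by simp [hN i (by simpa using hlt)])

lemma LocNilp.neg {V : Type*} [AddCommGroup V] [Module ℂ V] {P : V →ₗ[ℂ] V}
    (h : LocNilp P) : LocNilp (-P) := by
  intro x
  obtain ⟨N, hN⟩ := h x
  refine ⟨N, fun n hn => ?_⟩
  rw [neg_pow, Module.End.mul_apply, hN n hn, map_zero]

lemma pow_mul_pow_apply_eq_zero {A B : V →ₗ[ℂ] V} (hAB : Commute A B) {x : V} {a b : ℕ}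
    (ha : ∀ n ≥ a, (A ^ n) x = 0) (hb : ∀ n ≥ b, (B ^ n) x = 0) {i j : ℕ} (hij : a ≤ i ∨ b ≤ j) :
    (A ^ i) ((B ^ j) x) = 0 := by
  rcases hij with h | h
  · rw [← Module.End.mul_apply, (hAB.pow_pow i j).eq, Module.End.mul_apply, ha i h, map_zero]
  · rw [hb j h, map_zero]

lemma LocNilp.add {A B : V →ₗ[ℂ] V} (hA : LocNilp A) (hB : LocNilp B) (hAB : Commute A B) :
    LocNilp (A + B) := by
  intro x
  obtain ⟨a, ha⟩ := hA x
  obtain ⟨b, hb⟩ := hB x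
  refine ⟨a + b, fun n hn => ?_⟩
  rw [hAB.add_pow', LinearMap.sum_apply]
  refine Finset.sum_eq_zero fun p hp => ?_
  rw [Finset.HasAntidiagonal.mem_antidiagonal] at hp
  rw [LinearMap.smul_apply, Module.End.mul_apply,
    pow_mul_pow_apply_eq_zero hAB ha hb (by omega), smul_zero]

lemma lexp_add {A B : V →ₗ[ℂ] V} (hA : LocNilp A) (hB : LocNilp B) (hAB : Commute A B) (x : V) :
    lexp (A + B) x = lexp A (lexp B x) := by
  obtain ⟨a, ha⟩ := hA x
  obtain ⟨b, hb⟩ := hB x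
  have hz : ∀ i j, a ≤ i ∨ b ≤ j → (A ^ i) ((B ^ j) x) = 0 := fun i j =>
    pow_mul_pow_apply_eq_zero hAB ha hb
  have hsum : ∀ n ≥ a + b, ((A + B) ^ n) x = 0 := by
    intro n hn
    rw [hAB.add_pow', LinearMap.sum_apply]
    refine Finset.sum_eq_zero fun p hp => ?_
    rw [Finset.HasAntidiagonal.mem_antidiagonal] at hp
    rw [LinearMap.smul_apply, Module.End.mul_apply, hz _ _ (by omega), smul_zero]
  let f : ℕ × ℕ → V := fun p =>
    ((p.1.factorial : ℂ)⁻¹ * (p.2.factorial : ℂ)⁻¹) • (A ^ p.1) ((B ^ p.2) x)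
  have hr : lexp A (lexp B x) =
      ∑ p ∈ Finset.range (a + b) ×ˢ Finset.range (a + b), f p := by
    rw [lexp_eq_sum hB (N := a + b) (fun n hn => hb n (by omega)), map_sum,
      Finset.sum_product_right]
    refine Finset.sum_congr rfl fun j _ => ?_
    rw [map_smul, lexp_eq_sum hA (N := a + b) (fun n hn => hz n j (by omega)), Finset.smul_sum]
    refine Finset.sum_congr rfl fun i _ => ?_
    rw [smul_smul, mul_comm]
  have hl : lexp (A + B) x =
      ∑ n ∈ Finset.range (a + b), ∑ p ∈ Finset.HasAntidiagonal.antidiagonal n, f p := by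
    rw [lexp_eq_sum (hA.add hB hAB) hsum]
    refine Finset.sum_congr rfl fun n _ => ?_
    rw [hAB.add_pow', LinearMap.sum_apply, Finset.smul_sum]
    refine Finset.sum_congr rfl fun p hp => ?_
    rw [Finset.HasAntidiagonal.mem_antidiagonal] at hp
    rw [LinearMap.smul_apply, Module.End.mul_apply, ← Nat.cast_smul_eq_nsmul ℂ, smul_smul]
    have hc : ((n.choose p.1 : ℕ) : ℂ) * (p.1.factorial : ℂ) * (p.2.factorial : ℂ) =
        (n.factorial : ℂ) := by
      have := Nat.choose_mul_factorial_mul_factorial (show p.1 ≤ n by omega)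
      rw [show n - p.1 = p.2 by omega] at this
      exact_mod_cast this
    congr 1
    have h1 : (p.1.factorial : ℂ) ≠ 0 := by exact_mod_cast p.1.factorial_ne_zero
    have h2 : (p.2.factorial : ℂ) ≠ 0 := by exact_mod_cast p.2.factorial_ne_zero
    have h3 : (n.factorial : ℂ) ≠ 0 := by exact_mod_cast n.factorial_ne_zero
    field_simp
    rw [← hc]
  have hfilter : ∑ p ∈ (Finset.range (a + b) ×ˢ Finset.range (a + b)) with p.1 + p.2 < a + b, f p =
      ∑ p ∈ Finset.range (a + b) ×ˢ Finset.range (a + b), f p :=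
    Finset.sum_filter_of_ne fun p _ hp => by
      by_contra hlt
      exact hp (by simp only [f]; rw [hz _ _ (by omega), smul_zero])
  rw [hl, hr, ← hfilter, ← Finset.sum_fiberwise_of_maps_to (t := Finset.range (a + b))
    (g := fun p : ℕ × ℕ => p.1 + p.2) fun p hp => by simpa using (Finset.mem_filter.1 hp).2]
  refine Finset.sum_congr rfl fun n hn => Finset.sum_congr ?_ fun _ _ => rfl
  ext p
  simp only [Finset.HasAntidiagonal.mem_antidiagonal, Finset.mem_filter, Finset.mem_product,
    Finset.mem_range] at hn ⊢
  omega

lemma locNilp_zero : LocNilp (0 : V →ₗ[ℂ] V) := fun x => ⟨1, fun n hn => by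
  rw [zero_pow (by omega), LinearMap.zero_apply]⟩

lemma lexp_of_apply_eq_zero {P : V →ₗ[ℂ] V} (h : LocNilp P) {x : V} (hx : P x = 0) :
    lexp P x = x := by
  rw [lexp_eq_sum h (N := 1)]
  · simp
  · intro n hn
    obtain ⟨k, rfl⟩ := Nat.exists_eq_add_of_le' hn
    rw [pow_succ, Module.End.mul_apply, hx, map_zero]

lemma lexp_neg_lexp {V : Type*} [AddCommGroup V] [Module ℂ V] {P : V →ₗ[ℂ] V}
    (h : LocNilp P) (x : V) : lexp (-P) (lexp P x) = x := by
  rw [← lexp_add h.neg h (Commute.neg_left (Commute.refl P)), neg_add_cancel,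
    lexp_of_apply_eq_zero locNilp_zero (by simp)]

lemma lexp_lexp_neg {V : Type*} [AddCommGroup V] [Module ℂ V] {P : V →ₗ[ℂ] V}
    (h : LocNilp P) (x : V) : lexp P (lexp (-P) x) = x := by
  simpa using lexp_neg_lexp h.neg x

/-- Intertwining relations pass to exponentials. -/
lemma lexp_intertwine {W : Type*} [AddCommMonoid W] [Module ℂ W] {P : V →ₗ[ℂ] V} {R : W →ₗ[ℂ] W}
    (hP : LocNilp P) (hR : LocNilp R) (f : V →ₗ[ℂ] W) (h : ∀ x, f (P x) = R (f x)) (x : V) :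
    f (lexp P x) = lexp R (f x) := by
  have hpow : ∀ n x, f ((P ^ n) x) = (R ^ n) (f x) := by
    intro n
    induction n with
    | zero => simp
    | succ n ih =>
      intro x
      rw [pow_succ, pow_succ, Module.End.mul_apply, Module.End.mul_apply, ih, h]
  obtain ⟨N, hN⟩ := hP x
  rw [lexp_eq_sum hP hN, lexp_eq_sum hR (N := N) fun n hn => by rw [← hpow, hN n hn, map_zero]]
  simp [hpow]

lemma lexp_mem {P : V →ₗ[ℂ] V} (h : LocNilp P) {N : Submodule ℂ V} (hN : ∀ x ∈ N, P x ∈ N) {x : V}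
    (hx : x ∈ N) : lexp P x ∈ N := by
  obtain ⟨n, hn⟩ := h x
  have hpow : ∀ n, (P ^ n) x ∈ N := by
    intro n
    induction n with
    | zero => simpa
    | succ n ih => rw [pow_succ', Module.End.mul_apply]; exact hN _ ih
  rw [lexp_eq_sum h hn]
  exact Submodule.sum_mem _ fun i _ => Submodule.smul_mem _ _ (hpow i)

/-- If `[P, Q₀] = Q₂` commutes with `P`, then `exp(P) Q₀ = (Q₀ + Q₂) exp(P)`. -/
lemma lexp_conj {P Q₀ Q₂ : V →ₗ[ℂ] V} (hP : LocNilp P) (h1 : ∀ x, P (Q₀ x) = Q₀ (P x) + Q₂ x)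
    (h2 : ∀ x, P (Q₂ x) = Q₂ (P x)) (x : V) :
    lexp P (Q₀ x) = Q₀ (lexp P x) + Q₂ (lexp P x) := by
  have hpow2 : ∀ n x, (P ^ n) (Q₂ x) = Q₂ ((P ^ n) x) := by
    intro n
    induction n with
    | zero => simp
    | succ n ih => intro x; rw [pow_succ, Module.End.mul_apply, Module.End.mul_apply, h2, ih]
  have hpow : ∀ (n : ℕ) x, (P ^ (n + 1)) (Q₀ x) =
      Q₀ ((P ^ (n + 1)) x) + ((n : ℂ) + 1) • Q₂ ((P ^ n) x) := by
    intro n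
    induction n with
    | zero => intro x; simp [h1]
    | succ n ih =>
      intro x
      rw [pow_succ' P (n + 1), Module.End.mul_apply, Module.End.mul_apply, ih, map_add, h1,
        map_smul, h2, ← Module.End.mul_apply P (P ^ n) x, ← pow_succ']
      push_cast
      module
  obtain ⟨N, hN⟩ := hP x
  obtain ⟨N', hN'⟩ := hP (Q₀ x)
  have hz : ∀ n ≥ N + N', (P ^ n) x = 0 := fun n hn => hN n (by omega)
  rw [lexp_eq_sum hP (N := N + N' + 1) (fun n hn => hN' n (by omega)), Finset.sum_range_succ']
  conv_rhs => rw [lexp_eq_sum hP hz]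
  have h0 : Q₀ (∑ i ∈ Finset.range (N + N'), ((i.factorial : ℂ)⁻¹) • (P ^ i) x) =
      Q₀ (∑ i ∈ Finset.range (N + N' + 1), ((i.factorial : ℂ)⁻¹) • (P ^ i) x) := by
    rw [Finset.sum_range_succ, hz _ le_rfl, smul_zero, add_zero]
  rw [h0, Finset.sum_range_succ' _ (N + N'), map_add, map_sum, map_sum, add_right_comm,
    ← Finset.sum_add_distrib]
  congr 1
  · refine Finset.sum_congr rfl fun i _ => ?_
    rw [hpow, smul_add, map_smul, map_smul, smul_smul]
    congr 2
    rw [Nat.factorial_succ]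
    have h1 : (i.factorial : ℂ) ≠ 0 := by exact_mod_cast i.factorial_ne_zero
    have h2 : ((i : ℂ) + 1) ≠ 0 := by exact_mod_cast i.succ_ne_zero
    push_cast
    field_simp
  · simp

end LocallyNilpotent

/-! ### From the full symmetric algebra to the truncated one -/

section Bar

universe u v

variable {L : ℤ → Type u} [∀ n, AddCommGroup (L n)] [∀ n, Module ℂ (L n)]

/-- The operator on `S⁺(s⁻¹ L)` that is induced by an operator on `S(s⁻¹ L)`. -/
def barOp (O : GSym L →ₗ[ℂ] GSym L) : SBar L →ₗ[ℂ] SBar L :=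
  toBar L ∘ₗ O ∘ₗ Submodule.subtype _

lemma barOp_val {O : GSym L →ₗ[ℂ] GSym L} {x : SBar L} (h : counit L (O x.1) = 0) :
    (barOp O x).1 = O x.1 :=
  toBar_of_counit_eq_zero h

lemma toBar_apply_toBar {O : GSym L →ₗ[ℂ] GSym L} {c : ℂ} (h1 : O 1 = algebraMap ℂ _ c)
    (x : GSym L) : toBar L (O (toBar L x).1) = toBar L (O x) := by
  rw [toBar_val, map_sub, map_sub, Algebra.algebraMap_eq_smul_one, map_smul, h1, map_smul,
    toBar_algebraMap, smul_zero]
  exact sub_zero (toBar L (O x))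

lemma isWeightedProd_deg {N : ℤ} {x : GSym L} (h : IsWeightedProd (degWeight L) N x) :
    x = 0 ∨ ∃ l : List (Σ i, L i), (l.map fun a => a.1 - 1).sum = N ∧
      x = ((l.map fun a => hom L a.1 a.2).map (gen L)).prod := by
  induction h with
  | one => exact Or.inr ⟨[], rfl, rfl⟩
  | @cons k n a N x ha hx ih =>
    by_cases hk : k = n - 1
    · rcases ih with rfl | ⟨l, rfl, rfl⟩
      · left; simp
      · right
        exact ⟨⟨n, a⟩ :: l, by simp [hk], by simp⟩
    · left; simp [degWeight_eq_zero ha hk]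

lemma toBar_mem_degPart {N : ℤ} {x : GSym L} (hx : x ∈ weightSub (degWeight L) N) :
    toBar L x ∈ degPart L N := by
  have : weightSub (degWeight L) N ≤ (degPart L N).comap (toBar L) := by
    rw [weightSub, Submodule.span_le]
    intro y hy
    change toBar L y ∈ degPart L N
    rcases isWeightedProd_deg hy with rfl | ⟨l, hl, rfl⟩
    · simp
    · by_cases h : l = []
      · subst h
        simp [toBar_one]
      · exact Submodule.subset_span ⟨l, h, hl, rfl⟩
  exact this hx

lemma val_mem_of_mem_degPart {N : ℤ} {x : SBar L} (hx : x ∈ degPart L N) :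
    x.1 ∈ weightSub (degWeight L) N := by
  have : degPart L N ≤ (weightSub (degWeight L) N).comap (Submodule.subtype _) := by
    rw [degPart, Submodule.span_le]
    rintro _ ⟨l, hl, rfl, rfl⟩
    change (mono _).1 ∈ weightSub (degWeight L) _
    obtain ⟨a, l, rfl⟩ := List.exists_cons_of_ne_nil hl
    rw [show (a :: l).map (fun a => hom L a.1 a.2) =
      hom L a.1 a.2 :: l.map (fun a => hom L a.1 a.2) from rfl, mono_val_cons]
    have key : ∀ l : List (Σ i, L i), ((l.map fun a => hom L a.1 a.2).map (gen L)).prod ∈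
        weightSub (degWeight L) (l.map fun a => a.1 - 1).sum := by
      intro l
      induction l with
      | nil => exact one_mem_weightSub _
      | cons a l ih =>
        simp only [List.map_cons, List.prod_cons, List.sum_cons]
        exact gen_hom_mul_mem_weightSub (mem_degWeight a.2) ih rfl
    simpa using key (a :: l)
  exact this hx

lemma hasDegree_barOp {r : ℤ} {O : GSym L →ₗ[ℂ] GSym L}
    (h : ∀ N, ∀ x ∈ weightSub (degWeight L) N, O x ∈ weightSub (degWeight L) (N + r)) :
    HasDegree r (barOp O) := fun n x hx =>
  toBar_mem_degPart (h n x.1 (val_mem_of_mem_degPart hx))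

lemma toBar_comp_eq {O : GSym L →ₗ[ℂ] GSym L} {c : ℂ} (h1 : O 1 = algebraMap ℂ _ c) :
    toBar L ∘ₗ O = barOp O ∘ₗ toBar L :=
  LinearMap.ext fun x => (toBar_apply_toBar h1 x).symm

lemma coprodBar_barOp {O : GSym L →ₗ[ℂ] GSym L} (hc : ∀ x, counit L (O x) = counit L x ∨
    counit L (O x) = 0) (x : SBar L) : coprodBar L (barOp O x) =
      TensorProduct.map (toBar L) (toBar L) (coprod L (O x.1)) := by
  have : counit L (O x.1) = 0 := by
    rcases hc x.1 with h | h
    · rw [h]; exact x.2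
    · exact h
  rw [coprodBar, LinearMap.comp_apply, LinearMap.comp_apply, Submodule.subtype_apply,
    barOp_val this]

lemma koszulBar_eq (r : ℤ) : koszulBar L r = barOp (koszul L r) := rfl

lemma IsFullCoder.isCoderivation {r : ℤ} {O : GSym L →ₗ[ℂ] GSym L} (hO : IsFullCoder r O) :
    IsCoderivation r (barOp O) where
  degree := hasDegree_barOp hO.degree
  coleibniz := by
    ext1 x
    rw [LinearMap.comp_apply, coprodBar_barOp fun x => Or.inr (hO.counit x), hO.coLeibniz,
      LinearMap.comp_apply, coprodBar, LinearMap.comp_apply, LinearMap.comp_apply,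
      Submodule.subtype_apply, koszulBar_eq]
    have h1 : toBar L ∘ₗ O = barOp O ∘ₗ toBar L :=
      toBar_comp_eq (c := 0) (by simpa using hO.one)
    have h2 : toBar L ∘ₗ koszul L r = barOp (koszul L r) ∘ₗ toBar L :=
      toBar_comp_eq (c := 1) (by simp [koszul_one])
    generalize coprod L x.1 = t
    induction t using TensorProduct.induction_on with
    | zero => simp
    | add s t hs ht =>
      simp only [map_add] at hs ht ⊢
      rw [← hs, ← ht]; abel
    | tmul y z =>
      have h1y := LinearMap.congr_fun h1 y
      have h1z := LinearMap.congr_fun h1 z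
      have h2y := LinearMap.congr_fun h2 y
      simp only [LinearMap.comp_apply] at h1y h1z h2y
      simp [h1y, h1z, h2y]

/-- A coderivation of the full symmetric algebra is determined by its corestriction. -/
lemma IsFullCoder.eq_zero {r : ℤ} {O : GSym L →ₗ[ℂ] GSym L} (hO : IsFullCoder r O)
    (h : ∀ x, cor L (O x) = 0) : O = 0 := by
  have h0 := hO.isCoderivation.eq_zero fun x => by
    rw [corestr_eq_cor, barOp_val (hO.counit _), h]
  ext1 x
  have h1 := barOp_val (O := O) (x := toBar L x) (hO.counit _)
  rw [h0, toBar_val, map_sub, Algebra.algebraMap_eq_smul_one, map_smul, hO.one] at h1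
  simpa using h1.symm

/-- The commutator of coderivations, one of them even, is a coderivation. -/
lemma IsFullCoder.comm {r : ℤ} {P Q : GSym L →ₗ[ℂ] GSym L} (hP : IsFullCoder 0 P)
    (hQ : IsFullCoder r Q) : IsFullCoder r (P ∘ₗ Q - Q ∘ₗ P) where
  one := by simp [hP.one, hQ.one]
  counit x := by simp [hP.counit, hQ.counit]
  parity t x := by
    have h1 := hP.parity t (Q x)
    have h2 := hQ.parity t (P x)
    have h3 := hP.parity t x
    have h4 := hQ.parity t x
    simp only [mul_zero, zpow_zero, one_smul] at h1 h3
    simp only [LinearMap.sub_apply, LinearMap.comp_apply, map_sub, h1, h2, h3, h4, map_smul,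
      smul_sub]
  coLeibniz x := by
    simp only [LinearMap.sub_apply, LinearMap.comp_apply, map_sub, hP.coLeibniz (Q x),
      hQ.coLeibniz (P x), hP.coLeibniz x, hQ.coLeibniz x]
    generalize coprod L x = t
    induction t using TensorProduct.induction_on with
    | zero => simp
    | add s t hs ht =>
      have := congrArg₂ (· + ·) hs ht
      simp only [map_add] at this ⊢
      convert this using 1 <;> abel
    | tmul y z =>
      have h3 := hP.parity r y
      simp only [mul_zero, zpow_zero, one_smul] at h3
      simp only [map_add, TensorProduct.map_tmul, LinearMap.id_apply, LinearMap.sub_apply,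
        LinearMap.comp_apply, koszul_zero, h3, TensorProduct.sub_tmul, TensorProduct.tmul_sub]
      abel
  degree N x hx := by
    refine Submodule.sub_mem _ ?_ ?_
    · have := hP.degree _ _ (hQ.degree N x hx)
      simpa using this
    · have := hQ.degree _ _ (hP.degree N x hx)
      simpa using this

lemma IsFullCoder.sub {r : ℤ} {P Q : GSym L →ₗ[ℂ] GSym L} (hP : IsFullCoder r P)
    (hQ : IsFullCoder r Q) : IsFullCoder r (P - Q) where
  one := by simp [hP.one, hQ.one]
  counit x := by simp [hP.counit, hQ.counit]
  parity t x := by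
    simp only [LinearMap.sub_apply, map_sub, hP.parity t x, hQ.parity t x, smul_sub]
  coLeibniz x := by
    simp only [LinearMap.sub_apply, map_sub, hP.coLeibniz x, hQ.coLeibniz x]
    generalize coprod L x = t
    induction t using TensorProduct.induction_on with
    | zero => simp
    | add s t hs ht =>
      have := congrArg₂ (· + ·) hs ht
      simp only [map_add] at this ⊢
      convert this using 1 <;> abel
    | tmul y z =>
      simp only [TensorProduct.map_tmul, LinearMap.id_apply, LinearMap.sub_apply,
        TensorProduct.sub_tmul, TensorProduct.tmul_sub]
      abel
  degree N x hx := Submodule.sub_mem _ (hP.degree N x hx) (hQ.degree N x hx)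

lemma IsFullCoder.zero (r : ℤ) : IsFullCoder r (0 : GSym L →ₗ[ℂ] GSym L) where
  one := rfl
  counit x := by simp
  parity t x := by simp
  coLeibniz x := by simp
  degree N x hx := Submodule.zero_mem _

lemma IsFullCoder.neg {r : ℤ} {P : GSym L →ₗ[ℂ] GSym L} (hP : IsFullCoder r P) :
    IsFullCoder r (-P) := by
  have := (IsFullCoder.zero r).sub hP
  rwa [show 0 - P = -P from LinearMap.ext fun x => zero_sub (P x)] at this

lemma IsFullCoder.add {r : ℤ} {P Q : GSym L →ₗ[ℂ] GSym L} (hP : IsFullCoder r P)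
    (hQ : IsFullCoder r Q) : IsFullCoder r (P + Q) := by
  have := hP.sub hQ.neg
  rwa [show P - -Q = P + Q from LinearMap.ext fun x => sub_neg_eq_add (P x) (Q x)] at this

/-- The square of an odd coderivation is a coderivation. -/
lemma IsFullCoder.square {Q : GSym L →ₗ[ℂ] GSym L} (hQ : IsFullCoder 1 Q) :
    IsFullCoder 2 (Q ∘ₗ Q) where
  one := by simp [hQ.one]
  counit x := by simp [hQ.counit]
  parity t x := by
    simp only [LinearMap.comp_apply, hQ.parity t (Q x), hQ.parity t x, map_smul, smul_smul]
    congr 1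
    rw [mul_one, ← zpow_add₀ (by simp), mul_two]
  coLeibniz x := by
    simp only [LinearMap.comp_apply, hQ.coLeibniz (Q x), hQ.coLeibniz x]
    generalize coprod L x = t
    induction t using TensorProduct.induction_on with
    | zero => simp
    | add s t hs ht =>
      have := congrArg₂ (· + ·) hs ht
      simp only [map_add] at this ⊢
      convert this using 1 <;> abel
    | tmul y z =>
      have h3 := hQ.parity 1 y
      rw [mul_one, zpow_one, neg_one_smul ℂ (Q (koszul L 1 y))] at h3
      simp only [map_add, TensorProduct.map_tmul, LinearMap.id_apply,
        LinearMap.comp_apply, koszul_koszul, h3, TensorProduct.neg_tmul]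
      norm_num
      abel
  degree N x hx := by
    have := hQ.degree _ _ (hQ.degree N x hx)
    rwa [add_assoc] at this

/-! ### Exponentials of coderivations -/

/-- The exponential of an even coderivation is a coalgebra homomorphism: `P ⊗ 1` and `1 ⊗ P`
commute, so that the exponential of their sum is the product of the exponentials. -/
lemma coprod_lexp {P : GSym L →ₗ[ℂ] GSym L} (hP : IsFullCoder 0 P) (hn : LocNilp P) (x : GSym L) :
    coprod L (lexp P x) = TensorProduct.map (lexp P) (lexp P) (coprod L x) := by
  have hpow1 : ∀ n, (TensorProduct.map P (LinearMap.id (M := GSym L))) ^ n =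
      TensorProduct.map (P ^ n) LinearMap.id := fun n => by
    rw [TensorProduct.map_pow, ← Module.End.one_eq_id, one_pow]
  have hpow2 : ∀ n, (TensorProduct.map (LinearMap.id (M := GSym L)) P) ^ n =
      TensorProduct.map LinearMap.id (P ^ n) := fun n => by
    rw [TensorProduct.map_pow, ← Module.End.one_eq_id, one_pow]
  have hn1 : LocNilp (TensorProduct.map P (LinearMap.id (R := ℂ) (M := GSym L))) := by
    intro t
    induction t using TensorProduct.induction_on with
    | zero => exact ⟨0, by simp⟩
    | tmul y z =>
      obtain ⟨N, hN⟩ := hn y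
      exact ⟨N, fun n h => by rw [hpow1, TensorProduct.map_tmul, hN n h, TensorProduct.zero_tmul]⟩
    | add s t hs ht =>
      obtain ⟨N, hN⟩ := hs
      obtain ⟨N', hN'⟩ := ht
      exact ⟨N + N', fun n h => by rw [map_add, hN n (by omega), hN' n (by omega), add_zero]⟩
  have hn2 : LocNilp (TensorProduct.map (LinearMap.id (R := ℂ) (M := GSym L)) P) := by
    intro t
    induction t using TensorProduct.induction_on with
    | zero => exact ⟨0, by simp⟩
    | tmul y z =>
      obtain ⟨N, hN⟩ := hn z
      exact ⟨N, fun n h => by rw [hpow2, TensorProduct.map_tmul, hN n h, TensorProduct.tmul_zero]⟩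
    | add s t hs ht =>
      obtain ⟨N, hN⟩ := hs
      obtain ⟨N', hN'⟩ := ht
      exact ⟨N + N', fun n h => by rw [map_add, hN n (by omega), hN' n (by omega), add_zero]⟩
  have hcomm : Commute (TensorProduct.map P (LinearMap.id (R := ℂ) (M := GSym L)))
      (TensorProduct.map (LinearMap.id (R := ℂ) (M := GSym L)) P) :=
    TensorProduct.ext' fun y z => by simp
  have hk : koszul L 0 = LinearMap.id := LinearMap.ext koszul_zero
  rw [lexp_intertwine hn (hn1.add hn2 hcomm) (coprod L)
    (fun x => by rw [hP.coLeibniz, hk, LinearMap.add_apply]), lexp_add hn1 hn2 hcomm]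
  generalize coprod L x = t
  induction t using TensorProduct.induction_on with
  | zero => simp
  | tmul y z =>
    have e2 : lexp (TensorProduct.map (LinearMap.id (R := ℂ) (M := GSym L)) P) (y ⊗ₜ z) =
        y ⊗ₜ lexp P z :=
      (lexp_intertwine hn hn2 (TensorProduct.mk ℂ (GSym L) (GSym L) y) (fun z => by simp) z).symm
    have e1 : ∀ w, lexp (TensorProduct.map P (LinearMap.id (R := ℂ) (M := GSym L))) (y ⊗ₜ w) =
        lexp P y ⊗ₜ w := fun w =>
      (lexp_intertwine hn hn1 ((TensorProduct.mk ℂ (GSym L) (GSym L)).flip w)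
        (fun z => by simp) y).symm
    rw [e2, e1, TensorProduct.map_tmul]
  | add s t hs ht => simp only [map_add, hs, ht]

lemma counit_lexp {P : GSym L →ₗ[ℂ] GSym L} (hP : IsFullCoder 0 P) (hn : LocNilp P) (x : GSym L) :
    counit L (lexp P x) = counit L x := by
  have := lexp_intertwine hn locNilp_zero (counit L).toLinearMap
    (fun x => by simp [hP.counit]) x
  rw [lexp_of_apply_eq_zero locNilp_zero (by simp)] at this
  exact this

lemma barOp_lexp_val {P : GSym L →ₗ[ℂ] GSym L} (hP : IsFullCoder 0 P) (hn : LocNilp P)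
    (x : SBar L) : (barOp (lexp P) x).1 = lexp P x.1 :=
  barOp_val (by rw [counit_lexp hP hn]; exact x.2)

lemma isCoalgHom_barOp_lexp {P : GSym L →ₗ[ℂ] GSym L} (hP : IsFullCoder 0 P) (hn : LocNilp P) :
    IsCoalgHom (barOp (lexp P)) where
  degree := hasDegree_barOp fun N x hx => by
    rw [add_zero]
    exact lexp_mem hn (fun y hy => by simpa using hP.degree N y hy) hx
  comul := by
    ext1 x
    rw [LinearMap.comp_apply, coprodBar_barOp fun x => Or.inl (counit_lexp hP hn x),
      coprod_lexp hP hn, LinearMap.comp_apply, coprodBar, LinearMap.comp_apply,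
      LinearMap.comp_apply, Submodule.subtype_apply]
    have h1 := toBar_comp_eq (O := lexp P) (c := 1)
      (by rw [lexp_of_apply_eq_zero hn hP.one, map_one])
    generalize coprod L x.1 = t
    induction t using TensorProduct.induction_on with
    | zero => simp
    | add s t hs ht => simp only [map_add, hs, ht]
    | tmul y z =>
      have h1y := LinearMap.congr_fun h1 y
      have h1z := LinearMap.congr_fun h1 z
      simp only [LinearMap.comp_apply] at h1y h1z
      simp [h1y, h1z]

lemma barOp_pow_val {P : GSym L →ₗ[ℂ] GSym L} (hP : ∀ x, counit L (P x) = 0) (n : ℕ) (x : SBar L) :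
    ((barOp P ^ n) x).1 = (P ^ n) x.1 := by
  induction n with
  | zero => rfl
  | succ n ih =>
    rw [pow_succ', pow_succ', Module.End.mul_apply, Module.End.mul_apply, barOp_val (hP _), ih]

lemma isExp_barOp {P : GSym L →ₗ[ℂ] GSym L} (hP : IsFullCoder 0 P) (hn : LocNilp P) :
    IsExp (barOp P) (barOp (lexp P)) := by
  intro x
  obtain ⟨N, hN⟩ := hn x.1
  refine ⟨N, fun n h => ⟨?_, ?_⟩⟩
  · ext1
    rw [barOp_pow_val hP.counit, hN n h]; rfl
  · ext1
    rw [barOp_lexp_val hP hn, lexp_eq_sum hn (N := n) fun k hk => hN k (by omega)]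
    simp [barOp_pow_val hP.counit]

/-! ### Filtrations -/

/-- The weights given by a filtration. -/
def filtWeight (G : ℕ → ∀ n, Submodule ℂ (L n)) (k n : ℤ) : Submodule ℂ (L n) :=
  if 0 ≤ k then G k.toNat n else ⊥

lemma cor_mem_filtWeight {U : ℤ → ∀ n, Submodule ℂ (L n)} {N : ℤ} {x : GSym L}
    (hx : x ∈ weightSub U N) (n : ℤ) : cor L x n ∈ U N n := by
  have hc : ∀ N x, IsWeightedProd U N x → (N = 0 ∧ x = 1) ∨ counit L x = 0 := by
    intro N x h
    cases h with
    | one => exact Or.inl ⟨rfl, rfl⟩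
    | cons ha hx => right; simp [counit_gen]
  have : weightSub U N ≤ (U N n).comap (DirectSum.component ℂ ℤ L n ∘ₗ cor L) := by
    rw [weightSub, Submodule.span_le]
    intro y hy
    change cor L y n ∈ U N n
    cases hy with
    | one => simp [cor_one]
    | @cons k i a N x ha hx' =>
      rw [cor_gen_mul]
      rcases hc N x hx' with ⟨rfl, rfl⟩ | h
      · rw [map_one, one_smul, add_zero]
        by_cases h : n = i
        · subst h
          rw [show hom L n a n = a from DirectSum.lof_apply ℂ n a]
          exact ha
        · rw [show hom L i a n = 0 from DirectSum.of_eq_of_ne i n a h]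
          exact Submodule.zero_mem _
      · simp [h]
  exact this hx

lemma isFiltered_barOp_lexp {G : ℕ → ∀ n, Submodule ℂ (L n)} {P : GSym L →ₗ[ℂ] GSym L}
    (hP : IsFullCoder 0 P) (hn : LocNilp P)
    (hG : ∀ N, ∀ x ∈ weightSub (filtWeight G) N, P x ∈ weightSub (filtWeight G) N) :
    IsFiltered G G (barOp (lexp P)) := by
  intro l hl hmem n
  have hprod : ∀ l : List (ℕ × Tot L), (∀ a ∈ l, ∀ n, a.2 n ∈ G a.1 n) →
      ((l.map Prod.snd).map (gen L)).prod ∈ weightSub (filtWeight G) ((l.map Prod.fst).sum : ℕ) :=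
          by
    intro l hl
    induction l with
    | nil => exact one_mem_weightSub _
    | cons a l ih =>
      simp only [List.map_cons, List.prod_cons, List.sum_cons]
      refine gen_mul_mem_weightSub (k := a.1) (fun n => ?_)
        (ih fun b hb => hl b (List.mem_cons_of_mem _ hb)) (by push_cast; rfl)
      simpa [filtWeight] using hl a List.mem_cons_self n
  have h1 : (mono (l.map Prod.snd)).1 = ((l.map Prod.snd).map (gen L)).prod := by
    obtain ⟨a, l, rfl⟩ := List.exists_cons_of_ne_nil hl
    rw [List.map_cons, mono_val_cons]; simp
  have := cor_mem_filtWeight (lexp_mem hn (hG _) (hprod l hmem)) n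
  rw [corestr_eq_cor, barOp_lexp_val hP hn, h1]
  rwa [filtWeight, if_pos (Int.natCast_nonneg _), Int.toNat_natCast] at this

/-! ### Functoriality -/

variable {L' : ℤ → Type v} [∀ n, AddCommGroup (L' n)] [∀ n, Module ℂ (L' n)]

/-- The algebra map of symmetric algebras induced by a map of degree zero. -/
def symMap (φ : ∀ n, L n →ₗ[ℂ] L' n) : GSym L →ₐ[ℂ] GSym L' :=
  symLift (gen L' ∘ₗ DirectSum.lmap φ) (by
    intro i j a b
    simp only [LinearMap.comp_apply, hom, DirectSum.lmap_lof]
    exact gen_comm i j (φ i a) (φ j b))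

lemma symMap_gen (φ : ∀ n, L n →ₗ[ℂ] L' n) (v : Tot L) :
    symMap φ (gen L v) = gen L' (DirectSum.lmap φ v) := symLift_gen _ _ _

lemma koszul_symMap (φ : ∀ n, L n →ₗ[ℂ] L' n) (r : ℤ) (x : GSym L) :
    koszul L' r (symMap φ x) = symMap φ (koszul L r x) := by
  have : koszul L' r ∘ₗ (symMap φ).toLinearMap = (symMap φ).toLinearMap ∘ₗ koszul L r := by
    apply GSym.linearMap_ext
    · simp [koszul_one]
    · intro i a x hx
      simp only [LinearMap.comp_apply, AlgHom.toLinearMap_apply] at hx ⊢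
      rw [map_mul, koszul_mul, symMap_gen]
      simp only [hom, DirectSum.lmap_lof]
      rw [koszul_mul, hx, map_smul, map_mul, symMap_gen]
      simp [hom]
  exact LinearMap.congr_fun this x

lemma cor_symMap (φ : ∀ n, L n →ₗ[ℂ] L' n) (x : GSym L) :
    cor L' (symMap φ x) = DirectSum.lmap φ (cor L x) := by
  have hc : ∀ x, counit L' (symMap φ x) = counit L x := by
    intro x
    have : (counit L').toLinearMap ∘ₗ (symMap φ).toLinearMap = (counit L).toLinearMap := by
      apply GSym.linearMap_ext
      · simp
      · intro i a x hx
        simp [symMap_gen, counit_gen]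
    exact LinearMap.congr_fun this x
  have : cor L' ∘ₗ (symMap φ).toLinearMap = DirectSum.lmap φ ∘ₗ cor L := by
    apply GSym.linearMap_ext
    · simp [cor_one]
    · intro i a x hx
      simp only [LinearMap.comp_apply, AlgHom.toLinearMap_apply, map_mul, symMap_gen, cor_gen_mul,
        hc, map_smul]
  exact LinearMap.congr_fun this x

lemma IsRec.symMap {r : ℤ} (φ : ∀ n, L n →ₗ[ℂ] L' n) {T : Tot L →ₗ[ℂ] Module.End ℂ (GSym L)}
    {T' : Tot L' →ₗ[ℂ] Module.End ℂ (GSym L')} {O : GSym L →ₗ[ℂ] GSym L}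
    {O' : GSym L' →ₗ[ℂ] GSym L'} (hO : IsRec r T O) (hO' : IsRec r T' O')
    (hT : ∀ i (a : L i) x, T' (hom L' i (φ i a)) (ShT.symMap φ x) = ShT.symMap φ (T (hom L i a) x))
    (x : GSym L) : O' (ShT.symMap φ x) = ShT.symMap φ (O x) := by
  have : O' ∘ₗ (ShT.symMap φ).toLinearMap = (ShT.symMap φ).toLinearMap ∘ₗ O := by
    apply GSym.linearMap_ext
    · simp [hO.one, hO'.one]
    · intro i a x hx
      simp only [LinearMap.comp_apply, AlgHom.toLinearMap_apply] at hx ⊢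
      rw [map_mul, symMap_gen, hO'.gen_mul, hO.gen_mul, hx, map_add, map_mul, ← symMap_gen,
        koszul_symMap, ← hT, hom, DirectSum.lmap_lof]
  exact LinearMap.congr_fun this x

lemma IsSecondOrder.symMap {r : ℤ} (φ : ∀ n, L n →ₗ[ℂ] L' n)
    {B : Tot L →ₗ[ℂ] Tot L →ₗ[ℂ] Tot L} {B' : Tot L' →ₗ[ℂ] Tot L' →ₗ[ℂ] Tot L'}
    {O : GSym L →ₗ[ℂ] GSym L} {O' : GSym L' →ₗ[ℂ] GSym L'}
    (hO : IsSecondOrder r B O) (hO' : IsSecondOrder r B' O')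
    (hB : ∀ x y, B' (DirectSum.lmap φ x) (DirectSum.lmap φ y) = DirectSum.lmap φ (B x y))
    (x : GSym L) : O' (ShT.symMap φ x) = ShT.symMap φ (O x) := by
  obtain ⟨T, hT, hO⟩ := hO
  obtain ⟨T', hT', hO'⟩ := hO'
  refine hO.symMap φ hO' (fun i a x => ?_) x
  refine (hT.isRec i a).symMap φ (hT'.isRec i (φ i a)) (fun j b x => ?_) x
  have := hB (hom L i a) (hom L j b)
  simp only [hom, DirectSum.lmap_lof] at this
  rw [leftGen_apply, leftGen_apply, map_mul, symMap_gen]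
  simp only [hom, this]

end Bar

/-! ### The differential graded Lie algebra with trivialized bracket -/

section Trivialization

lemma neg_one_zpow_congr {a b : ℤ} (k : ℤ) (h : a = b + 2 * k) : ((-1 : ℂ) ^ a) = (-1) ^ b := by
  rw [h, zpow_add₀ (by simp), zpow_mul]; simp

lemma neg_one_zpow_congr_neg {a b : ℤ} (k : ℤ) (h : a = b + 2 * k + 1) :
    ((-1 : ℂ) ^ a) = -(-1) ^ b := by
  rw [h, add_assoc, zpow_add₀ (by simp), zpow_add₀ (by simp), zpow_mul]; simp

universe u v

variable {L : ℤ → Type u} [∀ n, AddCommGroup (L n)] [∀ n, Module ℂ (L n)]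

variable (L) in
/-- The sign operator `v ↦ (-1)^{|s⁻¹ v|} v`. -/
def totSign : Tot L →ₗ[ℂ] Tot L := DirectSum.lmap fun n => ((-1 : ℂ) ^ (n - 1)) • LinearMap.id

lemma totSign_hom (i : ℤ) (a : L i) :
    totSign L (hom L i a) = ((-1 : ℂ) ^ (i - 1)) • hom L i a := by
  rw [totSign, hom, DirectSum.lmap_lof, LinearMap.smul_apply, map_smul, LinearMap.id_apply]

/-- The failure of the differential `D` to be a derivation of the operation `B`. -/
def defect (D : Tot L →ₗ[ℂ] Tot L) (B : Tot L →ₗ[ℂ] Tot L →ₗ[ℂ] Tot L) :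
    Tot L →ₗ[ℂ] Tot L →ₗ[ℂ] Tot L :=
  B ∘ₗ D + (B ∘ₗ totSign L).compl₂ D - B.compr₂ D

lemma defect_hom (D : Tot L →ₗ[ℂ] Tot L) (B : Tot L →ₗ[ℂ] Tot L →ₗ[ℂ] Tot L) (i : ℤ) (a : L i)
    (y : Tot L) : defect D B (hom L i a) y =
      B (D (hom L i a)) y + ((-1 : ℂ) ^ (i - 1)) • B (hom L i a) (D y) - D (B (hom L i a) y) := by
  simp [defect, totSign_hom, LinearMap.compl₂_apply, LinearMap.compr₂_apply]

/-- A differential `D` and a graded symmetric operation `B` of degree zero on `s⁻¹ L` such that the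
coderivation with corestriction `B` commutes with its commutator with the differential. -/
structure TwistData (D : Tot L →ₗ[ℂ] Tot L) (B : Tot L →ₗ[ℂ] Tot L →ₗ[ℂ] Tot L) : Prop where
  diff_degree : HomDegree 1 D
  diff_diff : ∀ x, D (D x) = 0
  symm : IsSymmBilin 0 B
  cubic : ∀ i j l (a : L i) (b : L j) (c : L l),
    defect D B (hom L i a) (B (hom L j b) (hom L l c)) +
      (((-1 : ℂ) ^ ((i - 1) * (j - 1))) •
        defect D B (hom L j b) (B (hom L i a) (hom L l c)) +
      defect D B (B (hom L i a) (hom L j b)) (hom L l c)) =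
    ((-1 : ℂ) ^ (i - 1)) • B (hom L i a) (defect D B (hom L j b) (hom L l c)) +
      (((-1 : ℂ) ^ (i * (j - 1))) •
        B (hom L j b) (defect D B (hom L i a) (hom L l c)) +
      B (defect D B (hom L i a) (hom L j b)) (hom L l c))

lemma mem_range_hom_of_eq {n m : ℤ} (h : n = m) {v : Tot L} (hv : v ∈ LinearMap.range (hom L n)) :
    v ∈ LinearMap.range (hom L m) := h ▸ hv

variable {D : Tot L →ₗ[ℂ] Tot L} {B : Tot L →ₗ[ℂ] Tot L →ₗ[ℂ] Tot L}

lemma IsSymmBilin.mem_range {r : ℤ} (hB : IsSymmBilin r B) {i j n : ℤ} {v w : Tot L}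
    (hv : v ∈ LinearMap.range (hom L i)) (hw : w ∈ LinearMap.range (hom L j))
    (h : i + j - 1 + r = n) : B v w ∈ LinearMap.range (hom L n) := by
  obtain ⟨a, rfl⟩ := hv
  obtain ⟨b, rfl⟩ := hw
  exact mem_range_hom_of_eq h (hB.degree i j a b)

lemma IsSymmBilin.symm_of_mem {r : ℤ} (hB : IsSymmBilin r B) {i j : ℤ} {v w : Tot L}
    (hv : v ∈ LinearMap.range (hom L i)) (hw : w ∈ LinearMap.range (hom L j)) :
    B v w = ((-1 : ℂ) ^ ((i - 1) * (j - 1))) • B w v := by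
  obtain ⟨a, rfl⟩ := hv
  obtain ⟨b, rfl⟩ := hw
  exact hB.symm i j a b

lemma HomDegree.mem_range {f : Tot L →ₗ[ℂ] Tot L} {r : ℤ} (hf : HomDegree r f) {i : ℤ} {v : Tot L}
    (hv : v ∈ LinearMap.range (hom L i)) : f v ∈ LinearMap.range (hom L (i + r)) := by
  obtain ⟨a, rfl⟩ := hv
  exact hf i a

lemma hom_mem_range (i : ℤ) (a : L i) : hom L i a ∈ LinearMap.range (hom L i) := ⟨a, rfl⟩

lemma IsSymmBilin.defect (hB : IsSymmBilin 0 B) (hD : HomDegree 1 D) :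
    IsSymmBilin 1 (ShT.defect D B) where
  degree i j a b := by
    have ha := hom_mem_range i a
    have hb := hom_mem_range j b
    rw [defect_hom]
    refine Submodule.sub_mem _ (Submodule.add_mem _ ?_ (Submodule.smul_mem _ _ ?_)) ?_
    · exact hB.mem_range (hD.mem_range ha) hb (by ring)
    · exact hB.mem_range ha (hD.mem_range hb) (by ring)
    · exact mem_range_hom_of_eq (by ring) (hD.mem_range (hB.mem_range ha hb rfl))
  symm i j a b := by
    have ha := hom_mem_range i a
    have hb := hom_mem_range j b
    rw [defect_hom, defect_hom, hB.symm_of_mem (hD.mem_range ha) hb,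
      hB.symm_of_mem ha (hD.mem_range hb), hB.symm i j a b, map_smul, smul_sub,
      smul_add, smul_smul, smul_smul]
    have e1 : ((-1 : ℂ) ^ ((i + 1 - 1) * (j - 1))) =
        (-1) ^ ((i - 1) * (j - 1)) * (-1) ^ (j - 1) := by
      rw [← zpow_add₀ (by simp)]; congr 1; ring
    have e2 : ((-1 : ℂ) ^ (i - 1)) * (-1) ^ ((i - 1) * (j + 1 - 1)) =
        (-1) ^ ((i - 1) * (j - 1)) := by
      rw [show (i - 1) * (j + 1 - 1) = (i - 1) * (j - 1) + (i - 1) by ring, zpow_add₀ (by simp),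
        mul_left_comm, neg_one_zpow_mul_self, mul_one]
    rw [e1, e2]
    abel

lemma TwistData.isSymmBilin_defect (h : TwistData D B) : IsSymmBilin 1 (defect D B) :=
  h.symm.defect h.diff_degree

lemma exists_gen_of_mem_weightSub_len_one {x : GSym L} (hx : x ∈ weightSub (lenWeight L) 1) :
    ∃ v, x = gen L v := by
  have : weightSub (lenWeight L) 1 ≤ LinearMap.range (gen L) := by
    rw [weightSub, Submodule.span_le]
    intro z hz
    rcases isWeightedProd_len hz with rfl | h | ⟨_, v, z, hz', rfl⟩
    · exact Submodule.zero_mem _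
    · simp at h
    · obtain ⟨c, rfl⟩ := weightSub_len_zero (L := L) (x := z) (by simpa using hz')
      exact ⟨c • v, by simp [Algebra.algebraMap_eq_smul_one]⟩
  obtain ⟨v, hv⟩ := this hx
  exact ⟨v, hv.symm⟩

lemma gen_gen_mem_of_forall {N : Submodule ℂ (GSym L)}
    (h : ∀ i j (a : L i) (b : L j), gen L (hom L i a) * gen L (hom L j b) ∈ N) :
    weightSub (lenWeight L) 2 ≤ N := by
  have h2 : ∀ v w : Tot L, gen L v * gen L w ∈ N := by
    intro v w
    induction v using DirectSum.induction_on with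
    | zero => simp
    | add v v' hv hv' => rw [map_add, add_mul]; exact N.add_mem hv hv'
    | of i a =>
      induction w using DirectSum.induction_on with
      | zero => simp
      | add v v' hv hv' => rw [map_add, mul_add]; exact N.add_mem hv hv'
      | of j b => exact h i j a b
  rw [weightSub, Submodule.span_le]
  intro y hy
  rcases isWeightedProd_len hy with rfl | h | ⟨_, v, y, hy', rfl⟩
  · exact N.zero_mem
  · omega
  · obtain ⟨w, rfl⟩ := exists_gen_of_mem_weightSub_len_one (by simpa using hy')
    exact h2 v w

lemma gen_gen_gen_mem_of_forall {N : Submodule ℂ (GSym L)}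
    (h : ∀ i j l (a : L i) (b : L j) (c : L l),
      gen L (hom L i a) * (gen L (hom L j b) * gen L (hom L l c)) ∈ N) :
    weightSub (lenWeight L) 3 ≤ N := by
  rw [weightSub, Submodule.span_le]
  intro y hy
  rcases isWeightedProd_len hy with rfl | h | ⟨_, v, y, hy', rfl⟩
  · exact N.zero_mem
  · omega
  · clear hy
    change gen L v * y ∈ N
    induction v using DirectSum.induction_on with
    | zero => simp
    | add v v' hv hv' => rw [map_add, add_mul]; exact N.add_mem hv hv'
    | of i a =>
      have := gen_gen_mem_of_forall (N := N.comap (LinearMap.mulLeft ℂ (gen L (hom L i a))))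
        fun j l b c => h i j l a b c
      exact this (by simpa using hy')

/-- To show that an operator has zero corestriction, if it lowers the length by `k`, it suffices to
evaluate it on the elements of length `k + 1`. -/
lemma cor_eq_zero_of_len {O : GSym L →ₗ[ℂ] GSym L} {k : ℤ}
    (hlen : ∀ N, ∀ x ∈ weightSub (lenWeight L) N, O x ∈ weightSub (lenWeight L) (N - k))
    (h : weightSub (lenWeight L) (k + 1) ≤ LinearMap.ker (cor L ∘ₗ O)) (x : GSym L) :
    cor L (O x) = 0 := by
  have : LinearMap.ker (cor L ∘ₗ O) = ⊤ := by
    refine GSym.len_induction fun n x hx => ?_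
    by_cases hn : (n : ℤ) = k + 1
    · rw [hn] at hx; exact h hx
    · exact cor_weightSub_len (by omega) (hlen n x hx)
  have hx : x ∈ LinearMap.ker (cor L ∘ₗ O) := this ▸ Submodule.mem_top
  exact hx

section Operators

variable {P Q₀ Q₂ : GSym L →ₗ[ℂ] GSym L}

/-- `[P, Q₀]` is the coderivation `Q₂` with corestriction `defect D B`, as can be checked on
pairs. -/
lemma TwistData.comm_diff (h : TwistData D B) (hP : IsSecondOrder 0 B P)
    (hQ₀ : IsRec 1 (leftGen L D) Q₀) (hQ₂ : IsSecondOrder 1 (defect D B) Q₂) (x : GSym L) :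
    P (Q₀ x) = Q₀ (P x) + Q₂ x := by
  have hPc := hP.isFullCoder h.symm
  have hc := (hPc.comm (hQ₀.isFullCoder_of_leftGen h.diff_degree)).sub
    (hQ₂.isFullCoder h.isSymmBilin_defect)
  have h0 := hc.eq_zero (cor_eq_zero_of_len (k := 1) (fun N x hx => ?_) ?_)
  · have := LinearMap.congr_fun h0 x
    simp only [LinearMap.sub_apply, LinearMap.comp_apply, LinearMap.zero_apply] at this
    rw [sub_sub, sub_eq_zero] at this
    exact this
  · exact Submodule.sub_mem _ (Submodule.sub_mem _ (hP.len N _ (hQ₀.len N x hx))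
      (hQ₀.len _ _ (hP.len N x hx))) (hQ₂.len N x hx)
  · refine gen_gen_mem_of_forall fun i j a b => ?_
    simp only [LinearMap.mem_ker, LinearMap.comp_apply, LinearMap.sub_apply, hQ₀.apply_gen_gen,
      hP.apply_gen_gen, hQ₀.apply_gen, hQ₂.apply_gen_gen, map_add, map_sub, map_smul, cor_gen,
      defect_hom, one_mul]
    abel

/-- `[P, Q₂] = 0`; on triples, this is the cubic condition. -/
lemma TwistData.comm_bracket (h : TwistData D B) (hP : IsSecondOrder 0 B P)
    (hQ₂ : IsSecondOrder 1 (defect D B) Q₂) (x : GSym L) : P (Q₂ x) = Q₂ (P x) := by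
  have hPc := hP.isFullCoder h.symm
  have hc := hPc.comm (hQ₂.isFullCoder h.isSymmBilin_defect)
  have h0 := hc.eq_zero (cor_eq_zero_of_len (k := 2) (fun N x hx => ?_) ?_)
  · have := LinearMap.congr_fun h0 x
    simp only [LinearMap.sub_apply, LinearMap.comp_apply, LinearMap.zero_apply] at this
    rw [sub_eq_zero] at this
    exact this
  · rw [show N - 2 = N - 1 - 1 by ring]
    exact Submodule.sub_mem _ (hP.len _ _ (hQ₂.len N x hx)) (hQ₂.len _ _ (hP.len N x hx))
  · refine gen_gen_gen_mem_of_forall fun i j l a b c => ?_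
    have hcub := h.cubic i j l a b c
    simp only [LinearMap.mem_ker, LinearMap.comp_apply, LinearMap.sub_apply,
      hP.apply_gen_gen_gen, hQ₂.apply_gen_gen_gen, hP.apply_gen_gen, hQ₂.apply_gen_gen,
      map_add, map_sub, map_smul, cor_gen, one_mul, zero_mul, zpow_zero, one_smul, zero_add,
      add_sub_cancel]
    rw [hcub, sub_self]

lemma TwistData.diff_sq (h : TwistData D B) (hQ₀ : IsRec 1 (leftGen L D) Q₀) (x : GSym L) :
    Q₀ (Q₀ x) = 0 := by
  have h0 := (hQ₀.isFullCoder_of_leftGen h.diff_degree).square.eq_zero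
    (cor_eq_zero_of_len (k := 0) (fun N x hx => ?_) ?_)
  · exact LinearMap.congr_fun h0 x
  · rw [sub_zero]
    exact hQ₀.len _ _ (hQ₀.len N x hx)
  · intro x hx
    obtain ⟨v, rfl⟩ := exists_gen_of_mem_weightSub_len_one hx
    simp [hQ₀.apply_gen, h.diff_diff]

lemma TwistData.diff_bracket (h : TwistData D B) (hP : IsSecondOrder 0 B P)
    (hQ₀ : IsRec 1 (leftGen L D) Q₀) (hQ₂ : IsSecondOrder 1 (defect D B) Q₂) (x : GSym L) :
    Q₀ (Q₂ x) + Q₂ (Q₀ x) = 0 := by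
  have h1 := h.comm_diff hP hQ₀ hQ₂ (Q₀ x)
  have h2 := congrArg Q₀ (h.comm_diff hP hQ₀ hQ₂ x)
  rw [h.diff_sq hQ₀, map_zero] at h1
  rw [map_add, h.diff_sq hQ₀, zero_add] at h2
  rw [← h2, ← h1]

/-- `Q₂² = 0`, since `2 Q₂² = [Q₂, [P, Q₀]]` is `[P, [Q₂, Q₀]] = 0` up to sign. This is the Jacobi
identity of the bracket. -/
lemma TwistData.bracket_bracket (h : TwistData D B) (hP : IsSecondOrder 0 B P)
    (hQ₀ : IsRec 1 (leftGen L D) Q₀) (hQ₂ : IsSecondOrder 1 (defect D B) Q₂) (x : GSym L) :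
    Q₂ (Q₂ x) = 0 := by
  have hc := fun x => h.comm_diff hP hQ₀ hQ₂ x
  have h1 : Q₂ (Q₂ x) = Q₂ (P (Q₀ x)) - Q₂ (Q₀ (P x)) := by rw [hc x, map_add]; abel
  have h2 : Q₂ (Q₂ x) = P (Q₀ (Q₂ x)) - Q₀ (P (Q₂ x)) := by rw [hc (Q₂ x)]; abel
  have h3 : P (Q₀ (Q₂ x)) + Q₂ (P (Q₀ x)) = 0 := by
    rw [← h.comm_bracket hP hQ₂, ← map_add, h.diff_bracket hP hQ₀ hQ₂, map_zero]
  have h4 : Q₂ (Q₀ (P x)) + Q₀ (P (Q₂ x)) = 0 := by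
    rw [h.comm_bracket hP hQ₂, add_comm, h.diff_bracket hP hQ₀ hQ₂]
  have h5 : (2 : ℂ) • Q₂ (Q₂ x) = 0 := by
    rw [two_smul]
    nth_rewrite 1 [h1]
    rw [h2]
    have : Q₂ (P (Q₀ x)) - Q₂ (Q₀ (P x)) + (P (Q₀ (Q₂ x)) - Q₀ (P (Q₂ x))) =
      (P (Q₀ (Q₂ x)) + Q₂ (P (Q₀ x))) - (Q₂ (Q₀ (P x)) + Q₀ (P (Q₂ x))) := by abel
    rw [this, h3, h4, sub_self]
  simpa using h5

end Operators

/-- The bracket `[v, w] = (-1)^{|s⁻¹ v|} (B(Dv, w) + (-1)^{|s⁻¹ v|} B(v, Dw) - D B(v, w))`. -/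
def twistBracket (D : Tot L →ₗ[ℂ] Tot L) (B : Tot L →ₗ[ℂ] Tot L →ₗ[ℂ] Tot L) :
    Tot L →ₗ[ℂ] Tot L →ₗ[ℂ] Tot L := defect D B ∘ₗ totSign L

lemma twistBracket_hom (i : ℤ) (a : L i) (y : Tot L) :
    twistBracket D B (hom L i a) y = ((-1 : ℂ) ^ (i - 1)) • defect D B (hom L i a) y := by
  rw [twistBracket, LinearMap.comp_apply, totSign_hom, map_smul, LinearMap.smul_apply]

lemma twistBracket_of_mem {i : ℤ} {v : Tot L} (hv : v ∈ LinearMap.range (hom L i)) (y : Tot L) :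
    twistBracket D B v y = ((-1 : ℂ) ^ (i - 1)) • defect D B v y := by
  obtain ⟨a, rfl⟩ := hv
  exact twistBracket_hom i a y

/-- The Lie algebra structure that corresponds to the coderivation `Q₀ + [P, Q₀]`. -/
def TwistData.dgLie (h : TwistData D B) : DGLie L where
  diff := D
  bracket := twistBracket D B
  diff_degree := h.diff_degree
  bracket_degree i j a b := by
    rw [twistBracket_hom]
    exact Submodule.smul_mem _ _ (h.isSymmBilin_defect.mem_range (hom_mem_range i a)
      (hom_mem_range j b) (by ring))
  diff_diff := h.diff_diff
  antisymm i j a b := by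
    rw [twistBracket_hom, twistBracket_hom, h.isSymmBilin_defect.symm i j a b, smul_smul, smul_smul]
    congr 1
    rw [neg_mul, ← zpow_add₀ (by simp), ← zpow_add₀ (by simp)]
    exact neg_one_zpow_congr_neg (-j) (by ring)
  leibniz i a y := by
    obtain ⟨P, hP⟩ := exists_secondOrder h.symm
    obtain ⟨Q₀, hQ₀⟩ := exists_deriv h.diff_degree
    obtain ⟨Q₂, hQ₂⟩ := exists_secondOrder h.isSymmBilin_defect
    have h1 := congrArg (cor L) (h.diff_bracket hP hQ₀ hQ₂ (gen L (hom L i a) * gen L y))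
    simp only [hQ₂.apply_gen_gen, hQ₀.apply_gen, hQ₀.apply_gen_gen, map_add, map_smul, cor_gen,
      map_zero, one_mul] at h1
    rw [twistBracket_hom, twistBracket_hom, twistBracket_of_mem (h.diff_degree i a), map_smul,
      smul_smul, eq_neg_of_add_eq_zero_left h1, smul_neg, smul_add, smul_smul,
      neg_one_zpow_mul_self, ← zpow_add₀ (by simp),
      neg_one_zpow_congr_neg (a := i + (i - 1)) (b := 0) (i - 1) (by ring),
      neg_one_zpow_congr_neg (a := i + 1 - 1) (b := i - 1) 0 (by ring)]
    simp only [zpow_zero, neg_smul, one_smul]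
    abel
  jacobi i j a b z := by
    obtain ⟨P, hP⟩ := exists_secondOrder h.symm
    obtain ⟨Q₀, hQ₀⟩ := exists_deriv h.diff_degree
    obtain ⟨Q₂, hQ₂⟩ := exists_secondOrder h.isSymmBilin_defect
    have h1 := congrArg (cor L) (h.bracket_bracket hP hQ₀ hQ₂
      (gen L (hom L i a) * (gen L (hom L j b) * gen L z)))
    simp only [hQ₂.apply_gen_gen_gen, hQ₂.apply_gen_gen, map_add, map_smul, cor_gen, map_zero,
      one_mul] at h1
    have h2 : twistBracket D B (hom L i a) (hom L j b) ∈ LinearMap.range (hom L (i + j)) := by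
      rw [twistBracket_hom]
      exact Submodule.smul_mem _ _ (h.isSymmBilin_defect.mem_range (hom_mem_range i a)
        (hom_mem_range j b) (by ring))
    rw [twistBracket_of_mem h2]
    simp only [twistBracket_hom, map_smul, LinearMap.smul_apply, smul_smul]
    have h3 := eq_neg_of_add_eq_zero_left h1
    have h4 := congrArg (fun v => ((-1 : ℂ) ^ (j - 1)) • v) h3
    simp only [smul_neg, smul_add, smul_smul] at h4
    rw [h4, ← zpow_add₀ (by simp), ← zpow_add₀ (by simp), ← zpow_add₀ (by simp),
      ← zpow_add₀ (by simp), neg_one_zpow_congr_neg (a := i + j - 1 + (i - 1)) (b := j - 1) (i - 1)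
        (by ring),
      neg_one_zpow_congr_neg (a := i * j + (i - 1 + (j - 1)))
        (b := j - 1 + (1 + (i - 1)) * (j - 1)) (i - 1) (by ring)]
    simp only [neg_smul]
    abel

lemma TwistData.dgLie_diff (h : TwistData D B) : h.dgLie.diff = D := rfl

lemma TwistData.dgLie_bracket (h : TwistData D B) : h.dgLie.bracket = twistBracket D B := rfl

lemma IsSecondOrder.locNilp {r : ℤ} {P : GSym L →ₗ[ℂ] GSym L} (hP : IsSecondOrder r B P) :
    LocNilp P := by
  have hpow : ∀ (n : ℕ) (N : ℤ), ∀ x ∈ weightSub (lenWeight L) N,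
      (P ^ n) x ∈ weightSub (lenWeight L) (N - n) := by
    intro n
    induction n with
    | zero => intro N x hx; simpa using hx
    | succ n ih =>
      intro N x hx
      rw [pow_succ, Module.End.mul_apply]
      have := ih _ _ (hP.len N x hx)
      rwa [show N - 1 - (n : ℤ) = N - ((n + 1 : ℕ) : ℤ) by push_cast; ring] at this
  let K : Submodule ℂ (GSym L) :=
    { carrier := {x | ∃ N : ℕ, ∀ n ≥ N, (P ^ n) x = 0}
      zero_mem' := ⟨0, by simp⟩
      add_mem' := by
        rintro x y ⟨N, hN⟩ ⟨N', hN'⟩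
        exact ⟨N + N', fun n hn => by rw [map_add, hN n (by omega), hN' n (by omega), add_zero]⟩
      smul_mem' := by
        rintro c x ⟨N, hN⟩
        exact ⟨N, fun n hn => by rw [map_smul, hN n hn, smul_zero]⟩ }
  have hK : K = ⊤ := GSym.len_induction fun n x hx =>
    ⟨n + 1, fun k hk => weightSub_len_neg (by omega) (hpow k n x hx)⟩
  intro x
  have : x ∈ K := hK ▸ Submodule.mem_top
  exact this

lemma corestr_barOp_mono_of_length_ne {O : GSym L →ₗ[ℂ] GSym L} (hc : ∀ x, counit L (O x) = 0)
    {k : ℤ} (hlen : ∀ N, ∀ x ∈ weightSub (lenWeight L) N, O x ∈ weightSub (lenWeight L) (N - k))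
    {l : List (Tot L)} (hl : (l.length : ℤ) ≠ k + 1) : corestr L (barOp O (mono l)) = 0 := by
  by_cases h : l = []
  · subst h
    rw [show mono ([] : List (Tot L)) = 0 from toBar_one, map_zero, map_zero]
  · rw [corestr_eq_cor, barOp_val (hc _)]
    exact cor_weightSub_len (by omega) (hlen _ _ (mono_val_mem_weightSub_len h))

lemma corestr_barOp_pair {O : GSym L →ₗ[ℂ] GSym L} (hc : ∀ x, counit L (O x) = 0) (v w : Tot L) :
    corestr L (barOp O (mono [v, w])) = cor L (O (gen L v * gen L w)) := by
  rw [corestr_eq_cor, barOp_val (hc _), mono_val_cons]; simp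

lemma corestr_barOp_singleton {O : GSym L →ₗ[ℂ] GSym L} (hc : ∀ x, counit L (O x) = 0)
    (v : Tot L) : corestr L (barOp O (mono [v])) = cor L (O (gen L v)) := by
  rw [corestr_eq_cor, barOp_val (hc _), mono_val_cons]; simp

section Main

variable {P Q₀ Q₂ : GSym L →ₗ[ℂ] GSym L}

lemma TwistData.isCE (h : TwistData D B) (hQ₀ : IsRec 1 (leftGen L D) Q₀)
    (hQ₂ : IsSecondOrder 1 (defect D B) Q₂) : IsCE h.dgLie (barOp (Q₀ + Q₂)) := by
  have h0 := hQ₀.isFullCoder_of_leftGen h.diff_degree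
  have h2 := hQ₂.isFullCoder h.isSymmBilin_defect
  have hc := h0.add h2
  have hsum : ∀ x, barOp (Q₀ + Q₂) x = barOp Q₀ x + barOp Q₂ x := fun x => by
    simp [barOp]
  refine ⟨hc.isCoderivation, fun x => ?_, fun i a y => ?_, fun l hl => ?_⟩
  · rw [corestr_barOp_singleton hc.counit, LinearMap.add_apply, hQ₀.apply_gen, hQ₂.apply_gen,
      add_zero, cor_gen, h.dgLie_diff]
  · rw [hsum, map_add, corestr_barOp_mono_of_length_ne h0.counit (k := 0)
      (by simpa using hQ₀.len) (by simp), zero_add, corestr_barOp_pair h2.counit,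
      hQ₂.apply_gen_gen, cor_gen, h.dgLie_bracket, twistBracket_hom, smul_smul,
      neg_one_zpow_mul_self, one_smul]
  · rw [hsum, map_add, corestr_barOp_mono_of_length_ne h0.counit (k := 0)
      (by simpa using hQ₀.len) (by omega), zero_add,
      corestr_barOp_mono_of_length_ne h2.counit (k := 1) hQ₂.len (by omega)]

lemma TwistData.isCE_abelian (h : TwistData D B) (hQ₀ : IsRec 1 (leftGen L D) Q₀) :
    IsCE h.dgLie.abelian (barOp Q₀) := by
  have h0 := hQ₀.isFullCoder_of_leftGen h.diff_degree
  refine ⟨h0.isCoderivation, fun x => ?_, fun i a y => ?_, fun l hl => ?_⟩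
  · rw [corestr_barOp_singleton h0.counit, hQ₀.apply_gen, cor_gen]; rfl
  · rw [corestr_barOp_mono_of_length_ne h0.counit (k := 0) (by simpa using hQ₀.len) (by simp)]
    simp [DGLie.abelian]
  · rw [corestr_barOp_mono_of_length_ne h0.counit (k := 0) (by simpa using hQ₀.len) (by omega)]

lemma linearTerm_barOp_lexp {P : GSym L →ₗ[ℂ] GSym L} (hP : IsFullCoder 0 P) (hn : LocNilp P)
    (hgen : ∀ v, P (gen L v) = 0) (x : Tot L) : linearTerm (barOp (lexp P)) x = x := by
  rw [linearTerm, corestr_eq_cor, barOp_lexp_val hP hn, mono_val_cons]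
  simp only [List.map_nil, List.prod_nil, mul_one]
  rw [lexp_of_apply_eq_zero hn (hgen x), cor_gen]

/-- `exp(P)` conjugates the coderivation `Q₀` of the trivial bracket into the coderivation
`Q₀ + Q₂` of the bracket, and `exp(-P)` is its inverse. -/
lemma TwistData.isStrictlyInvertible (h : TwistData D B) (hP : IsSecondOrder 0 B P)
    {G : ℕ → ∀ n, Submodule ℂ (L n)}
    (hG : ∀ k l i j (a : L i) (b : L j), a ∈ G k i → b ∈ G l j →
      ∀ n, B (hom L i a) (hom L j b) n ∈ G (k + l) n) :
    IsStrictlyInvertible G G h.dgLie.abelian h.dgLie (barOp (lexp P)) := by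
  obtain ⟨Q₀, hQ₀⟩ := exists_deriv h.diff_degree
  obtain ⟨Q₂, hQ₂⟩ := exists_secondOrder h.isSymmBilin_defect
  have hPc := hP.isFullCoder h.symm
  have hn := hP.locNilp
  have h0 := hQ₀.isFullCoder_of_leftGen h.diff_degree
  have h2 := hQ₂.isFullCoder h.isSymmBilin_defect
  have hce := h.isCE hQ₀ hQ₂
  have hce₀ := h.isCE_abelian hQ₀
  have hsq₀ : barOp Q₀ ∘ₗ barOp Q₀ = 0 := by
    ext1 x
    ext1
    rw [LinearMap.comp_apply, barOp_val (h0.counit _), barOp_val (h0.counit _), h.diff_sq hQ₀]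
    rfl
  have hsq : barOp (Q₀ + Q₂) ∘ₗ barOp (Q₀ + Q₂) = 0 := by
    ext1 x
    ext1
    have := h.diff_bracket hP hQ₀ hQ₂ x.1
    rw [LinearMap.comp_apply, barOp_val ((h0.add h2).counit _), barOp_val ((h0.add h2).counit _)]
    simp only [LinearMap.add_apply, map_add]
    rw [h.diff_sq hQ₀, h.bracket_bracket hP hQ₀ hQ₂, add_zero, zero_add, add_comm, this]
    rfl
  have hF : ∀ x, lexp P (Q₀ x) = (Q₀ + Q₂) (lexp P x) := fun x => by
    rw [lexp_conj hn (h.comm_diff hP hQ₀ hQ₂) (h.comm_bracket hP hQ₂), LinearMap.add_apply]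
  have hinv1 : barOp (lexp (-P)) ∘ₗ barOp (lexp P) = LinearMap.id := by
    ext1 x
    ext1
    rw [LinearMap.comp_apply, barOp_lexp_val hPc.neg hn.neg, barOp_lexp_val hPc hn,
      lexp_neg_lexp hn]
    rfl
  have hinv2 : barOp (lexp P) ∘ₗ barOp (lexp (-P)) = LinearMap.id := by
    ext1 x
    ext1
    rw [LinearMap.comp_apply, barOp_lexp_val hPc hn, barOp_lexp_val hPc.neg hn.neg,
      lexp_lexp_neg hn]
    rfl
  have hchain : barOp (lexp P) ∘ₗ barOp Q₀ = barOp (Q₀ + Q₂) ∘ₗ barOp (lexp P) := by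
    ext1 x
    ext1
    rw [LinearMap.comp_apply, LinearMap.comp_apply, barOp_lexp_val hPc hn,
      barOp_val (h0.counit _), barOp_val ((h0.add h2).counit _), barOp_lexp_val hPc hn, hF]
  have hfilt : ∀ N, ∀ x ∈ weightSub (filtWeight G) N, P x ∈ weightSub (filtWeight G) N := by
    intro N x hx
    have := hP.mem_weightSub (U := filtWeight G) (c := 0) (fun k l i j a b ha hb n => ?_) N x hx
    · simpa using this
    · simp only [filtWeight, add_zero] at ha hb ⊢
      by_cases hk : 0 ≤ k
      · by_cases hl : 0 ≤ l
        · rw [if_pos hk] at ha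
          rw [if_pos hl] at hb
          rw [if_pos (add_nonneg hk hl), Int.toNat_add hk hl]
          exact hG _ _ i j a b ha hb n
        · rw [if_neg hl, Submodule.mem_bot] at hb
          simp [hb]
      · rw [if_neg hk, Submodule.mem_bot] at ha
        simp [ha]
  have hlin := linearTerm_barOp_lexp hPc hn hP.apply_gen
  have hlin' := linearTerm_barOp_lexp hPc.neg hn.neg fun v => by
    rw [LinearMap.neg_apply, hP.apply_gen, neg_zero]
  refine ⟨⟨⟨isCoalgHom_barOp_lexp hPc hn, _, _, hce₀, hce, hsq₀, hsq, hchain⟩,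
    isFiltered_barOp_lexp hPc hn hfilt, fun x => ?_, fun x _ hx => ?_, fun y hy => ?_⟩,
    barOp (lexp (-P)),
    ⟨⟨isCoalgHom_barOp_lexp hPc.neg hn.neg, _, _, hce, hce₀, hsq, hsq₀, ?_⟩,
      isFiltered_barOp_lexp hPc.neg hn.neg fun N x hx => Submodule.neg_mem _ (hfilt N x hx),
      fun x => ?_, fun x _ hx => ?_, fun y hy => ?_⟩, hinv1, hinv2⟩
  · rw [hlin, hlin]; rfl
  · obtain ⟨z, hz⟩ := hx
    exact ⟨z, by rw [hlin] at hz; exact hz⟩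
  · exact ⟨y, 0, hy, by rw [hlin, map_zero, add_zero]⟩
  · calc barOp (lexp (-P)) ∘ₗ barOp (Q₀ + Q₂)
        = barOp (lexp (-P)) ∘ₗ (barOp (Q₀ + Q₂) ∘ₗ barOp (lexp P)) ∘ₗ barOp (lexp (-P)) := by
          rw [LinearMap.comp_assoc, hinv2, LinearMap.comp_id]
      _ = barOp Q₀ ∘ₗ barOp (lexp (-P)) := by
          rw [← hchain, LinearMap.comp_assoc, ← LinearMap.comp_assoc, hinv1, LinearMap.id_comp]
  · rw [hlin', hlin']; rfl
  · obtain ⟨z, hz⟩ := hx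
    exact ⟨z, by rw [hlin'] at hz; exact hz⟩
  · exact ⟨y, 0, hy, by rw [hlin', map_zero, add_zero]⟩

end Main

end Trivialization

/-! ### The algebra of exterior forms at a point -/

section Lam

variable {m : ℕ}

lemma Lam.induction {p : Lam m → Prop} (h1 : ∀ r : ℂ, p (algebraMap ℂ _ r))
    (hadd : ∀ x y, p x → p y → p (x + y))
    (hmul : ∀ (v : Fin m → ℂ) x, p x → p (ExteriorAlgebra.ι ℂ v * x)) (x : Lam m) : p x :=
  CliffordAlgebra.left_induction (Q := (0 : QuadraticForm ℂ (Fin m → ℂ))) h1 hadd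
    (fun x v hx => hmul v x hx) x

lemma contr_ι_mul (i : Fin m) (v : Fin m → ℂ) (x : Lam m) :
    contr i (ExteriorAlgebra.ι ℂ v * x) = v i • x - ExteriorAlgebra.ι ℂ v * contr i x :=
  CliffordAlgebra.contractLeft_ι_mul (Q := (0 : QuadraticForm ℂ (Fin m → ℂ))) (LinearMap.proj i) v x

lemma contr_algebraMap (i : Fin m) (r : ℂ) : contr i (algebraMap ℂ (Lam m) r) = 0 :=
  CliffordAlgebra.contractLeft_algebraMap (Q := (0 : QuadraticForm ℂ (Fin m → ℂ)))
    (LinearMap.proj i) r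

lemma contr_dx_mul (i j : Fin m) (x : Lam m) :
    contr i (dx j * x) = (if i = j then x else 0) - dx j * contr i x := by
  rw [dx, contr_ι_mul, Pi.single_apply]
  simp

lemma contr_contr (i j : Fin m) (x : Lam m) : contr i (contr j x) = -contr j (contr i x) :=
  CliffordAlgebra.contractLeft_comm (Q := (0 : QuadraticForm ℂ (Fin m → ℂ)))
    (LinearMap.proj i) (LinearMap.proj j) x

/-- The sign automorphism of the exterior algebra. -/
abbrev inv : Lam m →ₐ[ℂ] Lam m := CliffordAlgebra.involute

lemma inv_ι (v : Fin m → ℂ) : inv (ExteriorAlgebra.ι ℂ v : Lam m) = -ExteriorAlgebra.ι ℂ v :=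
  CliffordAlgebra.involute_ι v

lemma inv_inv (x : Lam m) : inv (inv x) = x := CliffordAlgebra.involute_involute x

lemma contr_inv (i : Fin m) (x : Lam m) : contr i (inv x) = -inv (contr i x) := by
  induction x using Lam.induction with
  | h1 r => simp [contr_algebraMap]
  | hadd x y hx hy => simp only [map_add, hx, hy, neg_add]
  | hmul v x hx =>
    rw [map_mul, inv_ι, neg_mul, map_neg, contr_ι_mul, contr_ι_mul, map_sub, map_mul, inv_ι, hx,
      map_smul]
    simp

lemma contr_mul (i : Fin m) (x y : Lam m) :
    contr i (x * y) = contr i x * y + inv x * contr i y := by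
  induction x using Lam.induction with
  | h1 r => simp [contr_algebraMap, ← Algebra.smul_def]
  | hadd x y hx hy => simp only [map_add, add_mul, hx, hy]; abel
  | hmul v x hx =>
    rw [mul_assoc, contr_ι_mul, hx, contr_ι_mul, map_mul, inv_ι]
    simp only [mul_add, sub_mul, smul_mul_assoc, mul_assoc, neg_mul]
    abel

lemma inv_comp_dx (j : Fin m) : inv (dx j : Lam m) = -dx j := inv_ι _

lemma ι_mul_comm (v : Fin m → ℂ) (y : Lam m) :
    y * ExteriorAlgebra.ι ℂ v = ExteriorAlgebra.ι ℂ v * inv y := by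
  induction y using Lam.induction with
  | h1 r => simp [Algebra.commutes]
  | hadd x y hx hy => simp only [map_add, add_mul, mul_add, hx, hy]
  | hmul w x hx =>
    have h := ExteriorAlgebra.ι_add_mul_swap (R := ℂ) w v
    rw [mul_assoc, hx, map_mul, inv_ι, ← mul_assoc, ← mul_assoc, eq_neg_of_add_eq_zero_left h]
    simp

lemma dx_mul_comm (i : Fin m) (y : Lam m) : y * dx i = dx i * inv y := ι_mul_comm _ y

/-- Graded commutativity of the exterior algebra, without choosing homogeneous elements. -/
lemma mul_eq_even_add_odd (x y : Lam m) :
    (2 : ℂ) • (x * y) = y * (x + inv x) + inv y * (x - inv x) := by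
  induction x using Lam.induction generalizing y with
  | h1 r =>
    rw [AlgHom.commutes, sub_self, mul_zero, add_zero, ← two_smul ℂ, mul_smul_comm,
      Algebra.commutes]
  | hadd x y hx hy =>
    rw [add_mul, smul_add, hx, hy]
    simp only [map_add, mul_add, mul_sub]
    abel
  | hmul v x hx =>
    have h1 := ι_mul_comm v (inv y)
    have h2 := ι_mul_comm v y
    rw [inv_inv] at h1
    rw [mul_assoc, ← mul_smul_comm, hx, map_mul, inv_ι]
    simp only [mul_add, mul_sub, neg_mul, ← mul_assoc, mul_neg, h1, h2]
    abel

lemma mul_comm_of_inv_eq {x y : Lam m} {p q : ℤ} (hx : inv x = ((-1 : ℂ) ^ p) • x)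
    (hy : inv y = ((-1 : ℂ) ^ q) • y) : x * y = ((-1 : ℂ) ^ (p * q)) • (y * x) := by
  have h := mul_eq_even_add_odd x y
  rw [hx, hy] at h
  have h2 : (2 : ℂ) ≠ 0 := two_ne_zero
  apply smul_right_injective _ h2
  dsimp only
  rw [h]
  rcases Int.even_or_odd p with hp | hp
  · rw [hp.neg_one_zpow, (hp.mul_right q).neg_one_zpow]
    simp [two_smul, mul_add]
  · rw [hp.neg_one_zpow, zpow_mul, hp.neg_one_zpow]
    simp [two_smul, mul_add]

lemma twist_apply (r : ℤ) (x : Lam m) : twist r x = if Even r then x else inv x := by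
  unfold twist
  split_ifs <;> rfl

lemma twist_mul (r : ℤ) (x y : Lam m) : twist r (x * y) = twist r x * twist r y := by
  simp only [twist_apply]; split_ifs <;> simp

lemma twist_inv (r : ℤ) (x : Lam m) : twist r (inv x) = inv (twist r x) := by
  simp only [twist_apply]; split_ifs <;> simp

lemma twist_twist (r t : ℤ) (x : Lam m) : twist r (twist t x) = twist (r + t) x := by
  simp only [twist_apply, Int.even_add]
  by_cases hr : Even r <;> by_cases ht : Even t <;> simp [hr, ht]

lemma twist_dx (r : ℤ) (i : Fin m) : twist r (dx i : Lam m) = ((-1 : ℂ) ^ r) • dx i := by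
  rw [twist_apply]
  split_ifs with h
  · rw [h.neg_one_zpow, one_smul]
  · rw [(Int.not_even_iff_odd.1 h).neg_one_zpow, inv_comp_dx]; simp

lemma contr_twist (i : Fin m) (r : ℤ) (x : Lam m) :
    contr i (twist r x) = ((-1 : ℂ) ^ r) • twist r (contr i x) := by
  rw [twist_apply, twist_apply]
  split_ifs with h
  · rw [h.neg_one_zpow, one_smul]
  · rw [(Int.not_even_iff_odd.1 h).neg_one_zpow, contr_inv]; simp

lemma twist_of_inv_eq {x : Lam m} {p : ℤ} (hx : inv x = ((-1 : ℂ) ^ p) • x) (r : ℤ) :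
    twist r x = ((-1 : ℂ) ^ (r * p)) • x := by
  rw [twist_apply]
  split_ifs with h
  · rw [(h.mul_right p).neg_one_zpow, one_smul]
  · rw [hx, zpow_mul, (Int.not_even_iff_odd.1 h).neg_one_zpow]

lemma twist_comp_inv (r : ℤ) (x : Lam m) : twist r (inv x) = twist (r + 1) x := by
  rw [show inv x = twist 1 x by rw [twist_apply]; simp, twist_twist]

/-! The pullback by a linear map. -/

lemma pullLam_ι (J : Eu m →L[ℝ] Eu m) (v : Fin m → ℂ) :
    pullLam J (ExteriorAlgebra.ι ℂ v) =
      ExteriorAlgebra.ι ℂ (fun j => ∑ i, ((J (vec j) i : ℝ) : ℂ) * v i) := by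
  rw [pullLam, ExteriorAlgebra.map_apply_ι]
  congr 1

lemma pullLam_dx (J : Eu m →L[ℝ] Eu m) (i : Fin m) :
    pullLam J (dx i) = ∑ j, ((J (vec j) i : ℝ) : ℂ) • dx j := by
  rw [dx, pullLam_ι]
  simp only [dx, ← map_smul, ← map_sum]
  congr 1
  ext j
  simp [Pi.single_apply]

lemma pullLam_inv (J : Eu m →L[ℝ] Eu m) (x : Lam m) : pullLam J (inv x) = inv (pullLam J x) := by
  induction x using Lam.induction with
  | h1 r => simp
  | hadd x y hx hy => simp only [map_add, hx, hy]
  | hmul v x hx => rw [map_mul, map_mul, inv_ι, map_neg, hx, map_mul, map_mul, pullLam_ι, inv_ι]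

lemma pullLam_twist (J : Eu m →L[ℝ] Eu m) (r : ℤ) (x : Lam m) :
    pullLam J (twist r x) = twist r (pullLam J x) := by
  simp only [twist_apply]; split_ifs <;> simp [pullLam_inv]

lemma contr_pullLam (J : Eu m →L[ℝ] Eu m) (a : Fin m) (x : Lam m) :
    contr a (pullLam J x) = ∑ i, ((J (vec a) i : ℝ) : ℂ) • pullLam J (contr i x) := by
  induction x using Lam.induction with
  | h1 r => simp [contr_algebraMap]
  | hadd x y hx hy => simp only [map_add, hx, hy, smul_add, Finset.sum_add_distrib]
  | hmul v x hx =>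
    rw [map_mul, pullLam_ι, contr_ι_mul, hx]
    simp only [contr_ι_mul, map_sub, map_smul, smul_sub, map_mul, pullLam_ι,
      Finset.sum_sub_distrib, Finset.mul_sum, mul_smul_comm, Finset.sum_smul, smul_smul]

lemma pullLam_id (x : Lam m) : pullLam (ContinuousLinearMap.id ℝ (Eu m)) x = x := by
  induction x using Lam.induction with
  | h1 r => simp
  | hadd x y hx hy => simp only [map_add, hx, hy]
  | hmul v x hx =>
    rw [map_mul, hx, pullLam_ι]
    congr 2
    ext j
    rw [Finset.sum_eq_single j]
    · simp
    · intro b _ hb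
      simp [hb]
    · simp

lemma pullLam_comp (J K : Eu m →L[ℝ] Eu m) (x : Lam m) :
    pullLam (J.comp K) x = pullLam K (pullLam J x) := by
  have hK : ∀ (w : Eu m) (i : Fin m), J w i = ∑ k, w k * J (vec k) i := by
    intro w i
    conv_lhs => rw [← (EuclideanSpace.basisFun (Fin m) ℝ).sum_repr w]
    simp
  induction x using Lam.induction with
  | h1 r => simp
  | hadd x y hx hy => simp only [map_add, hx, hy]
  | hmul v x hx =>
    rw [map_mul, map_mul, map_mul, hx, pullLam_ι, pullLam_ι, pullLam_ι]
    congr 2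
    ext j
    simp only [ContinuousLinearMap.comp_apply, hK (K (vec j)), Complex.ofReal_sum,
      Complex.ofReal_mul, Finset.sum_mul, Finset.mul_sum]
    rw [Finset.sum_comm]
    simp only [mul_assoc]

/-! Degrees of exterior forms. -/

/-- The form `a` only involves monomials whose degree satisfies `R`. -/
def SuppIn (R : ℕ → Prop) (a : Lam m) : Prop := ∀ S : Finset (Fin m), ¬ R S.card → coef S a = 0

lemma lamBasis_mem (S : Finset (Fin m)) :
    lamBasis m S ∈ (⋀[ℂ]^S.card (Fin m → ℂ) : Submodule ℂ (Lam m)) := by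
  rw [lamBasis, ExteriorAlgebra.basis_eq_coe_basis (Pi.basisFun ℂ (Fin m))
    (⟨S, rfl⟩ : Set.powersetCard (Fin m) S.card)]
  exact Subtype.coe_prop _

lemma suppIn_of_mem {q : ℕ} {a : Lam m} (ha : a ∈ (⋀[ℂ]^q (Fin m → ℂ) : Submodule ℂ (Lam m)))
    {R : ℕ → Prop} (hq : R q) : SuppIn R a := by
  intro S hS
  have h := (((Pi.basisFun ℂ (Fin m)).exteriorPower q).sum_repr ⟨a, ha⟩)
  have h' := congrArg (Subtype.val) h
  rw [Submodule.coe_sum] at h'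
  dsimp only at h'
  rw [← h', map_sum]
  refine Finset.sum_eq_zero fun s _ => ?_
  rw [Submodule.coe_smul, map_smul, ← ExteriorAlgebra.basis_eq_coe_basis, coef,
    Module.Basis.coord_apply, lamBasis, Module.Basis.repr_self, Finsupp.single_apply, if_neg,
    smul_zero]
  rintro rfl
  exact hS (by rw [show s.val.card = q from s.2]; exact hq)

lemma suppIn_zero {R : ℕ → Prop} : SuppIn R (0 : Lam m) := fun _ _ => map_zero _

lemma SuppIn.smul {R : ℕ → Prop} {a : Lam m} (c : ℂ) (ha : SuppIn R a) :
    SuppIn R (c • a) := fun S hS => by rw [map_smul, ha S hS, smul_zero]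

lemma SuppIn.sum {R : ℕ → Prop} {ι : Type*} {s : Finset ι} {f : ι → Lam m}
    (h : ∀ i ∈ s, SuppIn R (f i)) : SuppIn R (∑ i ∈ s, f i) := fun S hS => by
  rw [map_sum]; exact Finset.sum_eq_zero fun i hi => h i hi S hS

lemma sum_coef (a : Lam m) : ∑ S, coef S a • lamBasis m S = a := (lamBasis m).sum_repr a

lemma SuppIn.map {R R' : ℕ → Prop} {f : Lam m →ₗ[ℂ] Lam m} {a : Lam m} (ha : SuppIn R a)
    (h : ∀ q, R q → ∀ b ∈ (⋀[ℂ]^q (Fin m → ℂ) : Submodule ℂ (Lam m)), SuppIn R' (f b)) :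
    SuppIn R' (f a) := by
  rw [← sum_coef a, map_sum]
  refine SuppIn.sum fun S _ => ?_
  rw [map_smul]
  by_cases hS : R S.card
  · exact (h _ hS _ (lamBasis_mem S)).smul _
  · rw [ha S hS, zero_smul]; exact suppIn_zero

lemma SuppIn.mul {R R' R'' : ℕ → Prop} {a b : Lam m} (ha : SuppIn R a) (hb : SuppIn R' b)
    (h : ∀ p q, R p → R' q → R'' (p + q)) : SuppIn R'' (a * b) := by
  refine ha.map (f := LinearMap.mulRight ℂ b) fun p hp x hx => ?_
  refine hb.map (f := LinearMap.mulLeft ℂ x) fun q hq y hy => ?_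
  refine suppIn_of_mem (q := p + q) ?_ (h p q hp hq)
  rw [ExteriorAlgebra.exteriorPower, pow_add]
  exact Submodule.mul_mem_mul hx hy

lemma SuppIn.dx_mul {R R' : ℕ → Prop} {a : Lam m} (i : Fin m) (ha : SuppIn R a)
    (h : ∀ q, R q → R' (q + 1)) : SuppIn R' (dx i * a) := by
  refine (suppIn_of_mem (q := 1) (R := fun q => q = 1) ?_ rfl).mul ha fun p q hp hq => ?_
  · rw [ExteriorAlgebra.exteriorPower, pow_one]; exact ⟨_, rfl⟩
  · rw [hp, add_comm]; exact h q hq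

lemma contr_mem {i : Fin m} {q : ℕ} {a : Lam m}
    (ha : a ∈ (⋀[ℂ]^(q + 1) (Fin m → ℂ) : Submodule ℂ (Lam m))) :
    contr i a ∈ (⋀[ℂ]^q (Fin m → ℂ) : Submodule ℂ (Lam m)) := by
  induction q generalizing a with
  | zero =>
    rw [zero_add, ExteriorAlgebra.exteriorPower, pow_one] at ha
    obtain ⟨v, rfl⟩ := ha
    have := contr_ι_mul i v 1
    rw [mul_one] at this
    rw [this, ExteriorAlgebra.exteriorPower, pow_zero, show contr i (1 : Lam m) = 0 by
      simpa using contr_algebraMap i (1 : ℂ)]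
    exact ⟨v i, by simp⟩
  | succ q ih =>
    rw [ExteriorAlgebra.exteriorPower, pow_succ'] at ha
    refine Submodule.mul_induction_on ha ?_ ?_
    · rintro _ ⟨v, rfl⟩ y hy
      rw [contr_ι_mul]
      refine Submodule.sub_mem _ (Submodule.smul_mem _ _ hy) ?_
      rw [ExteriorAlgebra.exteriorPower, pow_succ']
      exact Submodule.mul_mem_mul ⟨v, rfl⟩ (ih hy)
    · intro x y hx hy
      rw [map_add]
      exact Submodule.add_mem _ hx hy

lemma SuppIn.contr {R R' : ℕ → Prop} {a : Lam m} (i : Fin m) (ha : SuppIn R a)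
    (h : ∀ q, R (q + 1) → R' q) : SuppIn R' (contr i a) := by
  refine ha.map fun q hq b hb => ?_
  cases q with
  | zero =>
    rw [ExteriorAlgebra.exteriorPower, pow_zero] at hb
    obtain ⟨r, rfl⟩ := hb
    have h0 : ShT.contr i (r • (1 : Lam m)) = 0 := by
      rw [← Algebra.algebraMap_eq_smul_one]; exact contr_algebraMap i r
    rw [LinearMap.toSpanSingleton_apply, h0]
    exact suppIn_zero
  | succ q => exact suppIn_of_mem (contr_mem hb) (h q hq)

lemma inv_of_mem {q : ℕ} {a : Lam m} (ha : a ∈ (⋀[ℂ]^q (Fin m → ℂ) : Submodule ℂ (Lam m))) :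
    inv a = ((-1 : ℂ) ^ q) • a := by
  induction q generalizing a with
  | zero =>
    rw [ExteriorAlgebra.exteriorPower, pow_zero] at ha
    obtain ⟨r, rfl⟩ := ha
    simp
  | succ q ih =>
    rw [ExteriorAlgebra.exteriorPower, pow_succ'] at ha
    refine Submodule.mul_induction_on ha ?_ ?_
    · rintro _ ⟨v, rfl⟩ y hy
      rw [map_mul, inv_ι, ih hy, pow_succ]
      simp
    · intro x y hx hy
      rw [map_add, hx, hy, smul_add]

lemma SuppIn.inv {R : ℕ → Prop} {a : Lam m} (ha : SuppIn R a) : SuppIn R (inv a) := by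
  refine ha.map (f := ShT.inv.toLinearMap) fun q hq b hb => ?_
  rw [AlgHom.toLinearMap_apply, inv_of_mem hb]
  exact (suppIn_of_mem hb hq).smul _

lemma SuppIn.twist {R : ℕ → Prop} {a : Lam m} (r : ℤ) (ha : SuppIn R a) :
    SuppIn R (twist r a) := by
  rw [twist_apply]; split_ifs
  exacts [ha, ha.inv]

lemma SuppIn.inv_eq {R : ℕ → Prop} {a : Lam m} (ha : SuppIn R a) {p : ℤ}
    (h : ∀ q : ℕ, R q → Even ((q : ℤ) - p)) : ShT.inv a = ((-1 : ℂ) ^ p) • a := by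
  conv_lhs => rw [← sum_coef a]
  conv_rhs => rw [← sum_coef a]
  rw [map_sum, Finset.smul_sum]
  refine Finset.sum_congr rfl fun S _ => ?_
  rw [map_smul]
  by_cases hS : R S.card
  · obtain ⟨k, hk⟩ := h _ hS
    rw [inv_of_mem (lamBasis_mem S), smul_comm, ← zpow_natCast,
      neg_one_zpow_congr (a := (S.card : ℤ)) (b := p) k (by linarith)]
  · rw [ha S hS, zero_smul, zero_smul, smul_zero]

lemma pullLam_mem {J : Eu m →L[ℝ] Eu m} {q : ℕ} {a : Lam m}
    (ha : a ∈ (⋀[ℂ]^q (Fin m → ℂ) : Submodule ℂ (Lam m))) :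
    pullLam J a ∈ (⋀[ℂ]^q (Fin m → ℂ) : Submodule ℂ (Lam m)) := by
  induction q generalizing a with
  | zero =>
    rw [ExteriorAlgebra.exteriorPower, pow_zero] at ha ⊢
    obtain ⟨r, rfl⟩ := ha
    exact ⟨r, by simp⟩
  | succ q ih =>
    rw [ExteriorAlgebra.exteriorPower, pow_succ'] at ha
    refine Submodule.mul_induction_on ha ?_ ?_
    · rintro _ ⟨v, rfl⟩ y hy
      rw [map_mul, pullLam_ι, ExteriorAlgebra.exteriorPower, pow_succ']
      exact Submodule.mul_mem_mul ⟨_, rfl⟩ (ih hy)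
    · intro x y hx hy
      rw [map_add]
      exact Submodule.add_mem _ hx hy

lemma SuppIn.pullLam {R : ℕ → Prop} {a : Lam m} (J : Eu m →L[ℝ] Eu m) (ha : SuppIn R a) :
    SuppIn R (pullLam J a) :=
  ha.map (f := (ShT.pullLam J).toLinearMap) fun _ hq _ hb => suppIn_of_mem (pullLam_mem hb) hq

lemma real_smul_eq (r : ℝ) (x : Lam m) : r • x = (r : ℂ) • x := by
  exact (Complex.coe_smul r x).symm

end Lam

/-! ### The graded commutative ring of formal series -/

section SeriesRing

variable {g m : ℕ}

@[simp] lemma Mon.add_e (p q : Mon g) : (p + q).e = p.e + q.e := rfl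
@[simp] lemma Mon.add_k (p q : Mon g) : (p + q).k = p.k + q.k := rfl
@[simp] lemma Mon.add_n (p q : Mon g) : (p + q).n = p.n + q.n := rfl
@[simp] lemma Mon.add_s (p q : Mon g) : (p + q).s = p.s + q.s := rfl

lemma Mon.add_comm' (p q : Mon g) : p + q = q + p := by
  ext <;> simp [add_comm]

lemma Mon.add_assoc' (p q r : Mon g) : p + q + r = p + (q + r) := by
  ext <;> simp [add_assoc]

lemma Mon.deg_add (d : Fin g → ℤ) (p q : Mon g) : (p + q).deg d = p.deg d + q.deg d := by
  simp only [Mon.deg, Mon.add_k, Mon.add_s, Pi.add_apply, Nat.cast_add, mul_add,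
    Finset.sum_add_distrib]
  ring

lemma Mon.sign_add_left (d : Fin g → ℤ) (p q r : Mon g) :
    Mon.sign d (p + q) r = Mon.sign d p r * Mon.sign d q r := by
  unfold Mon.sign
  rw [← zpow_add₀ (by simp)]
  congr 1
  simp only [Mon.add_k, Mon.add_s, Pi.add_apply, Nat.cast_add, mul_add, add_mul,
    Finset.sum_add_distrib]
  ring

lemma Mon.sign_add_right (d : Fin g → ℤ) (p q r : Mon g) :
    Mon.sign d p (q + r) = Mon.sign d p q * Mon.sign d p r := by
  unfold Mon.sign
  rw [← zpow_add₀ (by simp)]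
  congr 1
  simp only [Mon.add_k, Pi.add_apply, Nat.cast_add, mul_add, Finset.sum_add_distrib]
  ring

lemma Mon.Adm.left {d : Fin g → ℤ} {p q : Mon g} (h : (p + q).Adm d) : p.Adm d :=
  ⟨fun i hi => le_trans (Nat.le_add_right _ _) (h.1 i hi), le_trans (Nat.le_add_right _ _) h.2⟩

lemma Mon.Adm.right {d : Fin g → ℤ} {p q : Mon g} (h : (p + q).Adm d) : q.Adm d :=
  ⟨fun i hi => le_trans (Nat.le_add_left _ _) (h.1 i hi), le_trans (Nat.le_add_left _ _) h.2⟩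

lemma sum_filter_lt_add_swap (x y : Fin g → ℤ) :
    (∑ i, ∑ j ∈ Finset.univ.filter (· < i), x i * y j) +
      (∑ i, ∑ j ∈ Finset.univ.filter (· < i), y i * x j) =
      (∑ i, x i) * (∑ j, y j) - ∑ i, x i * y i := by
  have h1 : (∑ i, ∑ j ∈ Finset.univ.filter (· < i), y i * x j) =
      ∑ i, ∑ j ∈ Finset.univ.filter (i < ·), x i * y j := by
    simp only [Finset.sum_filter]
    rw [Finset.sum_comm]
    simp only [mul_comm]
  rw [h1, Finset.sum_mul_sum, ← Finset.sum_add_distrib, ← Finset.sum_sub_distrib]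
  refine Finset.sum_congr rfl fun i _ => ?_
  simp only [Finset.sum_filter]
  have h0 : x i * y i = ∑ j, if j = i then x i * y j else 0 := by simp
  rw [← Finset.sum_add_distrib, eq_sub_iff_add_eq, h0, ← Finset.sum_add_distrib]
  refine Finset.sum_congr rfl fun j _ => ?_
  rcases lt_trichotomy i j with h | h | h
  · simp [h, h.not_gt, h.ne']
  · simp [h]
  · simp [h, h.not_gt, h.ne]

/-- The exchange of two monomials produces the Koszul sign `(-1)^{|p||q|}`; for admissible
products, the squares of odd parameters do not contribute. -/
lemma Mon.sign_swap {d : Fin g → ℤ} {p q : Mon g} (h : (p + q).Adm d) :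
    Mon.sign d p q = (-1 : ℂ) ^ (p.deg d * q.deg d) * Mon.sign d q p := by
  have hs : (p.s : ℤ) * q.s = 0 := by
    have := h.2
    rw [Mon.add_s] at this
    have h' : p.s = 0 ∨ q.s = 0 := by omega
    rcases h' with h' | h' <;> simp [h']
  have hk : Even (∑ i, (d i * p.k i) * (d i * q.k i)) := by
    refine Finset.even_sum _ fun i _ => ?_
    rcases Int.even_or_odd (d i) with hi | hi
    · exact (hi.mul_right _).mul_right _
    · have := h.1 i hi
      rw [Mon.add_k, Pi.add_apply] at this
      have h' : p.k i = 0 ∨ q.k i = 0 := by omega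
      rcases h' with h' | h' <;> simp [h']
  obtain ⟨c, hc⟩ := hk
  have hsw := sum_filter_lt_add_swap (fun i => d i * p.k i) (fun i => d i * q.k i)
  unfold Mon.sign
  rw [← zpow_add₀ (by simp)]
  set P := ∑ i, ∑ j ∈ Finset.univ.filter (· < i), (d i * p.k i) * (d j * q.k j)
  set Q := ∑ i, ∑ j ∈ Finset.univ.filter (· < i), (d i * q.k i) * (d j * p.k j)
  refine neg_one_zpow_congr (-Q - c - q.s * ∑ j, d j * p.k j) ?_
  simp only [Mon.deg]
  linear_combination hsw - hc - hs

/-- The factorizations `κ = p q` for which `ε` has an exponent at least `N` in `p` and at least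
`N'` in `q`. -/
def factPairs (N N' : ℤ) (κ : Mon g) : Set (Mon g × Mon g) :=
  {z | z.1 + z.2 = κ ∧ N ≤ z.1.e ∧ N' ≤ z.2.e}

lemma factPairs_finite (N N' : ℤ) (κ : Mon g) : (factPairs N N' κ).Finite := by
  let f : (ℤ × ℤ) × ((Fin g → ℕ) × (Fin g → ℕ)) × (ℕ × ℕ) × (ℕ × ℕ) → Mon g × Mon g := fun z =>
    (⟨z.1.1, z.2.1.1, z.2.2.1.1, z.2.2.2.1⟩, ⟨z.1.2, z.2.1.2, z.2.2.1.2, z.2.2.2.2⟩)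
  have hfin : ((Set.Icc N (κ.e - N') ×ˢ Set.Icc N' (κ.e - N)) ×ˢ
      (Set.Iic κ.k ×ˢ Set.Iic κ.k) ×ˢ (Set.Iic κ.n ×ˢ Set.Iic κ.n) ×ˢ
        (Set.Iic κ.s ×ˢ Set.Iic κ.s)).Finite :=
    ((Set.finite_Icc _ _).prod (Set.finite_Icc _ _)).prod
      (((Set.finite_Iic _).prod (Set.finite_Iic _)).prod
        (((Set.finite_Iic _).prod (Set.finite_Iic _)).prod
          ((Set.finite_Iic _).prod (Set.finite_Iic _))))
  refine (hfin.image f).subset ?_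
  rintro ⟨p, q⟩ ⟨rfl, h1, h2⟩
  dsimp only at h1 h2
  refine ⟨((p.e, q.e), (p.k, q.k), (p.n, q.n), (p.s, q.s)), ?_, rfl⟩
  simp only [Set.mem_prod, Set.mem_Icc, Set.mem_Iic, Mon.add_e, Mon.add_k, Mon.add_n, Mon.add_s]
  exact ⟨⟨⟨h1, by linarith⟩, h2, by linarith⟩, ⟨le_self_add, le_add_self⟩,
    ⟨le_self_add, le_add_self⟩, le_self_add, le_add_self⟩

/-- The finite set of factorizations underlying `factPairs`. -/
def fact (N N' : ℤ) (κ : Mon g) : Finset (Mon g × Mon g) := (factPairs_finite N N' κ).toFinset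

lemma mem_fact {N N' : ℤ} {κ : Mon g} {z : Mon g × Mon g} :
    z ∈ fact N N' κ ↔ z.1 + z.2 = κ ∧ N ≤ z.1.e ∧ N' ≤ z.2.e := by
  rw [fact, Set.Finite.mem_toFinset]; rfl

/-- The exponents of `ε` in `a` are at least `N`. -/
def BddE (N : ℤ) (a : PtSer g m) : Prop := ∀ κ : Mon g, κ.e < N → a κ = 0

lemma serMul_apply {d : Fin g → ℤ} {N N' : ℤ} {a b : PtSer g m} (ha : BddE N a) (hb : BddE N' b)
    (κ : Mon g) [Decidable (κ.Adm d)] : serMul d a b κ =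
      if κ.Adm d then ∑ z ∈ fact N N' κ,
        Mon.sign d z.1 z.2 • (a z.1 * twist (z.1.deg d) (b z.2)) else 0 := by
  unfold serMul
  by_cases h : κ.Adm d
  · rw [if_pos h, if_pos h]
    refine (finsum_set_coe_eq_finsum_mem (s := {z : Mon g × Mon g | z.1 + z.2 = κ})
      (f := fun z : Mon g × Mon g =>
        Mon.sign d z.1 z.2 • (a z.1 * twist (z.1.deg d) (b z.2)))).trans ?_
    apply finsum_mem_eq_sum_of_inter_support_eq
    ext z
    simp only [Set.mem_inter_iff, Set.mem_ofPred_eq, Function.mem_support, Finset.mem_coe, mem_fact]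
    constructor
    · rintro ⟨h1, h2⟩
      refine ⟨⟨h1, ?_, ?_⟩, h2⟩
      · by_contra h3
        exact h2 (by rw [ha _ (not_le.1 h3), zero_mul, smul_zero])
      · by_contra h3
        exact h2 (by rw [hb _ (not_le.1 h3), map_zero, mul_zero, smul_zero])
    · rintro ⟨h1, h2⟩
      exact ⟨h1.1, h2⟩
  · rw [if_neg h, if_neg h]

lemma BddE.serMul {d : Fin g → ℤ} {N N' : ℤ} {a b : PtSer g m} (ha : BddE N a) (hb : BddE N' b) :
    BddE (N + N') (serMul d a b) := by
  classical
  intro κ hκ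
  rw [serMul_apply ha hb]
  split_ifs
  · refine Finset.sum_eq_zero fun z hz => ?_
    obtain ⟨rfl, h1, h2⟩ := mem_fact.1 hz
    rw [Mon.add_e] at hκ
    omega
  · rfl

variable (g m) in
/-- The series in which the exponents of `ε` are bounded below. -/
def bddSub : Submodule ℂ (PtSer g m) where
  carrier := {a | ∃ N, BddE N a}
  zero_mem' := ⟨0, fun _ _ => rfl⟩
  add_mem' := by
    rintro a b ⟨N, h⟩ ⟨N', h'⟩
    refine ⟨min N N', fun κ hκ => ?_⟩
    rw [Pi.add_apply, h κ (lt_of_lt_of_le hκ (min_le_left _ _)),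
      h' κ (lt_of_lt_of_le hκ (min_le_right _ _)), add_zero]
  smul_mem' := by
    rintro c a ⟨N, h⟩
    exact ⟨N, fun κ hκ => by rw [Pi.smul_apply, h κ hκ, smul_zero]⟩

lemma serMul_assoc {d : Fin g → ℤ} {a b c : PtSer g m} (ha : a ∈ bddSub g m) (hb : b ∈ bddSub g m)
    (hc : c ∈ bddSub g m) : serMul d (serMul d a b) c = serMul d a (serMul d b c) := by
  classical
  obtain ⟨A, ha⟩ := ha
  obtain ⟨B, hb⟩ := hb
  obtain ⟨C, hc⟩ := hc
  funext κ
  rw [serMul_apply (ha.serMul hb) hc, serMul_apply ha (hb.serMul hc)]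
  by_cases h : κ.Adm d
  swap
  · rw [if_neg h, if_neg h]
  rw [if_pos h, if_pos h]
  have e1 : ∀ z ∈ fact (A + B) C κ, Mon.sign d z.1 z.2 • (serMul d a b z.1 *
      twist (z.1.deg d) (c z.2)) = ∑ w ∈ fact A B z.1, Mon.sign d z.1 z.2 •
        ((Mon.sign d w.1 w.2 • (a w.1 * twist (w.1.deg d) (b w.2))) *
          twist (z.1.deg d) (c z.2)) := by
    intro z hz
    obtain ⟨rfl, -, -⟩ := mem_fact.1 hz
    rw [serMul_apply ha hb, if_pos h.left, Finset.sum_mul, Finset.smul_sum]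
  have e2 : ∀ z ∈ fact A (B + C) κ, Mon.sign d z.1 z.2 • (a z.1 *
      twist (z.1.deg d) (serMul d b c z.2)) = ∑ w ∈ fact B C z.2, Mon.sign d z.1 z.2 •
        (a z.1 * twist (z.1.deg d) (Mon.sign d w.1 w.2 • (b w.1 * twist (w.1.deg d) (c w.2)))) := by
    intro z hz
    obtain ⟨rfl, -, -⟩ := mem_fact.1 hz
    rw [serMul_apply hb hc, if_pos h.right, map_sum, Finset.mul_sum, Finset.smul_sum]
  rw [Finset.sum_congr rfl e1, Finset.sum_congr rfl e2, Finset.sum_sigma', Finset.sum_sigma']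
  refine Finset.sum_bij' (fun x _ => ⟨(x.2.1, x.2.2 + x.1.2), (x.2.2, x.1.2)⟩)
    (fun x _ => ⟨(x.1.1 + x.2.1, x.2.2), (x.1.1, x.2.1)⟩) ?_ ?_ ?_ ?_ ?_
  · rintro ⟨⟨p, r⟩, ⟨q, t⟩⟩ hx
    simp only [Finset.mem_sigma, mem_fact] at hx ⊢
    obtain ⟨⟨rfl, h1, h2⟩, rfl, h3, h4⟩ := hx
    exact ⟨⟨(Mon.add_assoc' _ _ _).symm, h3, by rw [Mon.add_e]; omega⟩, trivial, h4, h2⟩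
  · rintro ⟨⟨p, r⟩, ⟨q, t⟩⟩ hx
    simp only [Finset.mem_sigma, mem_fact] at hx ⊢
    obtain ⟨⟨rfl, h1, h2⟩, rfl, h3, h4⟩ := hx
    exact ⟨⟨Mon.add_assoc' _ _ _, by rw [Mon.add_e]; omega, h4⟩, trivial, h1, h3⟩
  · rintro ⟨⟨p, r⟩, ⟨q, t⟩⟩ hx
    simp only [Finset.mem_sigma, mem_fact] at hx
    obtain ⟨⟨rfl, h1, h2⟩, rfl, h3, h4⟩ := hx
    rfl
  · rintro ⟨⟨p, r⟩, ⟨q, t⟩⟩ hx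
    simp only [Finset.mem_sigma, mem_fact] at hx
    obtain ⟨⟨rfl, h1, h2⟩, rfl, h3, h4⟩ := hx
    rfl
  · rintro ⟨⟨p, r⟩, ⟨q, t⟩⟩ hx
    simp only [Finset.mem_sigma, mem_fact] at hx
    obtain ⟨⟨rfl, h1, h2⟩, rfl, h3, h4⟩ := hx
    simp only [Mon.sign_add_left, Mon.sign_add_right, map_smul, twist_mul, twist_twist,
      Mon.deg_add, smul_mul_assoc, mul_smul_comm, smul_smul, mul_assoc]
    congr 1
    ring

lemma serMul_add {d : Fin g → ℤ} {a b c : PtSer g m} (ha : a ∈ bddSub g m) (hb : b ∈ bddSub g m)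
    (hc : c ∈ bddSub g m) : serMul d a (b + c) = serMul d a b + serMul d a c := by
  classical
  obtain ⟨A, ha⟩ := ha
  obtain ⟨B, hbc⟩ := Submodule.add_mem _ hb hc
  obtain ⟨B', hb⟩ := hb
  obtain ⟨C, hc⟩ := hc
  have hb' : BddE (min B' C) b := fun κ hκ => hb κ (lt_of_lt_of_le hκ (min_le_left _ _))
  have hc' : BddE (min B' C) c := fun κ hκ => hc κ (lt_of_lt_of_le hκ (min_le_right _ _))
  have hbc' : BddE (min B' C) (b + c) := fun κ hκ => by
    rw [Pi.add_apply, hb' κ hκ, hc' κ hκ, add_zero]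
  funext κ
  rw [Pi.add_apply, serMul_apply ha hb', serMul_apply ha hc', serMul_apply ha hbc']
  split_ifs
  · simp only [Pi.add_apply, map_add, mul_add, smul_add, Finset.sum_add_distrib]
  · rw [add_zero]

lemma add_serMul {d : Fin g → ℤ} {a b c : PtSer g m} (ha : a ∈ bddSub g m) (hb : b ∈ bddSub g m)
    (hc : c ∈ bddSub g m) : serMul d (a + b) c = serMul d a c + serMul d b c := by
  classical
  obtain ⟨A, ha⟩ := ha
  obtain ⟨B, hb⟩ := hb
  obtain ⟨C, hc⟩ := hc
  have ha' : BddE (min A B) a := fun κ hκ => ha κ (lt_of_lt_of_le hκ (min_le_left _ _))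
  have hb' : BddE (min A B) b := fun κ hκ => hb κ (lt_of_lt_of_le hκ (min_le_right _ _))
  have hab' : BddE (min A B) (a + b) := fun κ hκ => by
    rw [Pi.add_apply, ha' κ hκ, hb' κ hκ, add_zero]
  funext κ
  rw [Pi.add_apply, serMul_apply ha' hc, serMul_apply hb' hc, serMul_apply hab' hc]
  split_ifs
  · simp only [Pi.add_apply, add_mul, smul_add, Finset.sum_add_distrib]
  · rw [add_zero]

lemma serMul_smul {d : Fin g → ℤ} (r : ℂ) {a b : PtSer g m} (ha : a ∈ bddSub g m)
    (hb : b ∈ bddSub g m) : serMul d a (r • b) = r • serMul d a b := by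
  classical
  obtain ⟨A, ha⟩ := ha
  obtain ⟨B, hb⟩ := hb
  have hb' : BddE B (r • b) := fun κ hκ => by rw [Pi.smul_apply, hb κ hκ, smul_zero]
  funext κ
  rw [Pi.smul_apply, serMul_apply ha hb, serMul_apply ha hb', smul_ite, smul_zero]
  simp only [Pi.smul_apply, map_smul, mul_smul_comm, Finset.smul_sum, smul_comm r]

lemma smul_serMul {d : Fin g → ℤ} (r : ℂ) {a b : PtSer g m} (ha : a ∈ bddSub g m)
    (hb : b ∈ bddSub g m) : serMul d (r • a) b = r • serMul d a b := by
  classical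
  obtain ⟨A, ha⟩ := ha
  obtain ⟨B, hb⟩ := hb
  have ha' : BddE A (r • a) := fun κ hκ => by rw [Pi.smul_apply, ha κ hκ, smul_zero]
  funext κ
  rw [Pi.smul_apply, serMul_apply ha hb, serMul_apply ha' hb, smul_ite, smul_zero]
  simp only [Pi.smul_apply, smul_mul_assoc, Finset.smul_sum, smul_comm r]

/-- The graded commutative ring of the series in which the exponents of `ε` are bounded below. -/
def SerRing (m : ℕ) (_d : Fin g → ℤ) : Type := ↥(bddSub g m)

variable {d : Fin g → ℤ}

instance : AddCommGroup (SerRing m d) := inferInstanceAs (AddCommGroup ↥(bddSub g m))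

instance : Module ℂ (SerRing m d) := inferInstanceAs (Module ℂ ↥(bddSub g m))

/-- The series underlying an element of `SerRing`. -/
def SerRing.val : SerRing m d →ₗ[ℂ] PtSer g m := (bddSub g m).subtype

lemma SerRing.val_injective : Function.Injective (SerRing.val : SerRing m d → PtSer g m) :=
  Subtype.val_injective

lemma SerRing.val_mem (a : SerRing m d) : a.val ∈ bddSub g m := Subtype.prop a

variable (d) in
/-- A series with bounded exponents of `ε`, as an element of `SerRing`. -/
def SerRing.mk (a : PtSer g m) (ha : a ∈ bddSub g m) : SerRing m d := ⟨a, ha⟩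

@[simp] lemma SerRing.val_mk (a : PtSer g m) (ha : a ∈ bddSub g m) : (SerRing.mk d a ha).val = a :=
  rfl

instance : Mul (SerRing m d) :=
  ⟨fun a b => SerRing.mk d (serMul d a.val b.val) (by
    obtain ⟨A, ha⟩ := a.val_mem
    obtain ⟨B, hb⟩ := b.val_mem
    exact ⟨A + B, ha.serMul hb⟩)⟩

@[simp] lemma SerRing.val_mul (a b : SerRing m d) : (a * b).val = serMul d a.val b.val := rfl

instance : NonUnitalRing (SerRing m d) where
  left_distrib a b c := SerRing.val_injective (by
    simp only [SerRing.val_mul, map_add]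
    exact serMul_add a.val_mem b.val_mem c.val_mem)
  right_distrib a b c := SerRing.val_injective (by
    simp only [SerRing.val_mul, map_add]
    exact add_serMul a.val_mem b.val_mem c.val_mem)
  zero_mul a := SerRing.val_injective (by
    have := smul_serMul (d := d) 0 a.val_mem a.val_mem
    simpa only [SerRing.val_mul, map_zero, zero_smul] using this)
  mul_zero a := SerRing.val_injective (by
    have := serMul_smul (d := d) 0 a.val_mem a.val_mem
    simpa only [SerRing.val_mul, map_zero, zero_smul] using this)
  mul_assoc a b c := SerRing.val_injective (by
    simp only [SerRing.val_mul]
    exact serMul_assoc a.val_mem b.val_mem c.val_mem)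

instance : IsScalarTower ℂ (SerRing m d) (SerRing m d) :=
  ⟨fun r a b => SerRing.val_injective (by
    simp only [smul_eq_mul, SerRing.val_mul, map_smul]
    exact smul_serMul r a.val_mem b.val_mem)⟩

instance : SMulCommClass ℂ (SerRing m d) (SerRing m d) :=
  ⟨fun r a b => SerRing.val_injective (by
    simp only [smul_eq_mul, SerRing.val_mul, map_smul]
    exact (serMul_smul r a.val_mem b.val_mem).symm)⟩

namespace SerRing

/-- The operator `∂ / ∂dxⁱ`. -/
def contr (i : Fin m) : SerRing m d →ₗ[ℂ] SerRing m d where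
  toFun a := mk d (serContr i a.val) (by
    obtain ⟨A, ha⟩ := a.val_mem
    exact ⟨A, fun κ hκ => by rw [serContr, ha κ hκ, map_zero]⟩)
  map_add' a b := val_injective (by ext1 κ; simp [serContr])
  map_smul' r a := val_injective (by ext1 κ; simp [serContr])

/-- Left multiplication by `dxⁱ`. -/
def dx (i : Fin m) : SerRing m d →ₗ[ℂ] SerRing m d where
  toFun a := mk d (serDx i a.val) (by
    obtain ⟨A, ha⟩ := a.val_mem
    exact ⟨A, fun κ hκ => by rw [serDx, ha κ hκ, mul_zero]⟩)
  map_add' a b := val_injective (by ext1 κ; simp [serDx, mul_add])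
  map_smul' r a := val_injective (by ext1 κ; simp [serDx])

/-- The sign operator `a ↦ (-1)^{|a|} a`. -/
def sgn : SerRing m d →ₗ[ℂ] SerRing m d where
  toFun a := mk d (serSgn d a.val) (by
    obtain ⟨A, ha⟩ := a.val_mem
    exact ⟨A, fun κ hκ => by rw [serSgn, ha κ hκ, map_zero, smul_zero]⟩)
  map_add' a b := val_injective (by ext1 κ; simp [serSgn])
  map_smul' r a := val_injective (by ext1 κ; simp [serSgn, smul_comm r])

/-- Multiplication by `ε`. -/
def eps : SerRing m d →ₗ[ℂ] SerRing m d where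
  toFun a := mk d (epsMul a.val) (by
    obtain ⟨A, ha⟩ := a.val_mem
    exact ⟨A + 1, fun κ hκ => by rw [epsMul]; exact ha _ (by dsimp only; linarith)⟩)
  map_add' a b := val_injective (by ext1 κ; simp [epsMul])
  map_smul' r a := val_injective (by ext1 κ; simp [epsMul])

@[simp] lemma val_contr (i : Fin m) (a : SerRing m d) : (contr i a).val = serContr i a.val := rfl
@[simp] lemma val_dx (i : Fin m) (a : SerRing m d) : (dx i a).val = serDx i a.val := rfl
@[simp] lemma val_sgn (a : SerRing m d) : (sgn a).val = serSgn d a.val := rfl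
@[simp] lemma val_eps (a : SerRing m d) : (eps a).val = epsMul a.val := rfl

lemma contr_contr (i j : Fin m) (a : SerRing m d) : contr i (contr j a) = -contr j (contr i a) :=
  val_injective (by
    ext1 κ
    simp only [val_contr, map_neg, Pi.neg_apply, serContr]
    exact ShT.contr_contr _ _ _)

lemma contr_dx (i j : Fin m) (a : SerRing m d) :
    contr i (dx j a) = (if i = j then a else 0) - dx j (contr i a) :=
  val_injective (by
    ext1 κ
    simp only [val_contr, val_dx, map_sub, Pi.sub_apply, serContr, serDx, contr_dx_mul]
    split_ifs <;> simp)

lemma contr_sgn (i : Fin m) (a : SerRing m d) : contr i (sgn a) = -sgn (contr i a) :=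
  val_injective (by
    ext1 κ
    simp only [val_contr, val_sgn, map_neg, Pi.neg_apply, serContr, serSgn, map_smul]
    rw [show ShT.contr i (CliffordAlgebra.involute (a.val κ)) = -inv (ShT.contr i (a.val κ)) from
      contr_inv _ _, smul_neg])

lemma sgn_dx (i : Fin m) (a : SerRing m d) : sgn (dx i a) = -dx i (sgn a) :=
  val_injective (by
    ext1 κ
    simp only [val_dx, val_sgn, map_neg, Pi.neg_apply, serDx, serSgn, map_mul, mul_smul_comm]
    rw [show CliffordAlgebra.involute (ShT.dx i : Lam m) = -ShT.dx i from inv_comp_dx i, neg_mul,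
      smul_neg])

lemma contr_eps (i : Fin m) (a : SerRing m d) : contr i (eps a) = eps (contr i a) := rfl
lemma dx_eps (i : Fin m) (a : SerRing m d) : dx i (eps a) = eps (dx i a) := rfl
lemma sgn_eps (a : SerRing m d) : sgn (eps a) = eps (sgn a) := rfl

lemma dx_mul (i : Fin m) (a b : SerRing m d) : dx i (a * b) = dx i a * b :=
  val_injective (by
    classical
    obtain ⟨A, ha⟩ := a.val_mem
    obtain ⟨B, hb⟩ := b.val_mem
    have ha' : BddE A (serDx i a.val) := fun κ hκ => by rw [serDx, ha κ hκ, mul_zero]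
    ext1 κ
    simp only [val_dx, val_mul]
    rw [serMul_apply ha' hb, serDx, serMul_apply ha hb]
    split_ifs
    · simp only [Finset.mul_sum, mul_smul_comm, serDx, mul_assoc]
    · rw [mul_zero])

lemma contr_mul (i : Fin m) (a b : SerRing m d) :
    contr i (a * b) = contr i a * b + sgn a * contr i b :=
  val_injective (by
    classical
    obtain ⟨A, ha⟩ := a.val_mem
    obtain ⟨B, hb⟩ := b.val_mem
    have ha' : BddE A (serContr i a.val) := fun κ hκ => by rw [serContr, ha κ hκ, map_zero]
    have hb' : BddE B (serContr i b.val) := fun κ hκ => by rw [serContr, hb κ hκ, map_zero]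
    have ha'' : BddE A (serSgn d a.val) := fun κ hκ => by
      rw [serSgn, ha κ hκ, map_zero, smul_zero]
    ext1 κ
    simp only [val_contr, val_mul, val_sgn, map_add, Pi.add_apply]
    rw [serMul_apply ha' hb, serMul_apply ha'' hb', serContr, serMul_apply ha hb]
    split_ifs
    · rw [← Finset.sum_add_distrib, map_sum]
      refine Finset.sum_congr rfl fun z _ => ?_
      rw [map_smul, ShT.contr_mul, contr_twist, serContr, serSgn, serContr, smul_add]
      simp only [smul_mul_assoc, mul_smul_comm]
    · rw [map_zero, add_zero])

lemma sgn_mul (a b : SerRing m d) : sgn (a * b) = sgn a * sgn b :=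
  val_injective (by
    classical
    obtain ⟨A, ha⟩ := a.val_mem
    obtain ⟨B, hb⟩ := b.val_mem
    have ha' : BddE A (serSgn d a.val) := fun κ hκ => by
      rw [serSgn, ha κ hκ, map_zero, smul_zero]
    have hb' : BddE B (serSgn d b.val) := fun κ hκ => by
      rw [serSgn, hb κ hκ, map_zero, smul_zero]
    ext1 κ
    simp only [val_mul, val_sgn]
    rw [serMul_apply ha' hb', serSgn, serMul_apply ha hb]
    split_ifs
    · rw [map_sum, Finset.smul_sum]
      refine Finset.sum_congr rfl fun z hz => ?_
      obtain ⟨rfl, -, -⟩ := mem_fact.1 hz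
      simp only [serSgn, map_smul, map_mul, Mon.deg_add, smul_mul_assoc, mul_smul_comm, smul_smul]
      rw [show CliffordAlgebra.involute (twist (z.1.deg d) (b.val z.2)) =
        twist (z.1.deg d) (CliffordAlgebra.involute (b.val z.2)) from (twist_inv _ _).symm,
        zpow_add₀ (by simp)]
      congr 1
      ring
    · rw [map_zero, smul_zero])

lemma sgn_sgn (a : SerRing m d) : sgn (sgn a) = a :=
  val_injective (by
    ext1 κ
    simp only [val_sgn, serSgn, map_smul, smul_smul]
    rw [CliffordAlgebra.involute_involute, ← mul_zpow]
    simp)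

lemma eps_mul_left (a b : SerRing m d) : eps a * b = eps (a * b) :=
  val_injective (by
    classical
    obtain ⟨A, ha⟩ := a.val_mem
    obtain ⟨B, hb⟩ := b.val_mem
    have ha' : BddE (A + 1) (epsMul a.val) := fun κ hκ => by
      rw [epsMul]; exact ha _ (by dsimp only; linarith)
    ext1 κ
    simp only [val_mul, val_eps]
    rw [serMul_apply ha' hb, epsMul, serMul_apply ha hb]
    refine if_congr Iff.rfl ?_ rfl
    refine Finset.sum_bij' (fun z _ => ({ z.1 with e := z.1.e - 1 }, z.2))
      (fun z _ => ({ z.1 with e := z.1.e + 1 }, z.2)) ?_ ?_ ?_ ?_ ?_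
    · intro z hz
      obtain ⟨rfl, h1, h2⟩ := mem_fact.1 hz
      refine mem_fact.2 ⟨?_, by dsimp only; omega, h2⟩
      ext <;> simp [sub_add_eq_add_sub]
    · intro z hz
      obtain ⟨h, h1, h2⟩ := mem_fact.1 hz
      have he := congrArg Mon.e h
      have hk := congrArg Mon.k h
      have hn := congrArg Mon.n h
      have hs := congrArg Mon.s h
      simp only [Mon.add_e, Mon.add_k, Mon.add_n, Mon.add_s] at he hk hn hs
      refine mem_fact.2 ⟨?_, by dsimp only; omega, h2⟩
      ext1
      · simp only [Mon.add_e]; omega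
      · exact hk
      · exact hn
      · exact hs
    · intro z _; simp
    · intro z _; simp
    · intro z _; rfl)

/-- Graded commutativity, for elements of parity `p` and `q`. -/
lemma mul_comm_of_sgn {a b : SerRing m d} {p q : ℤ} (ha : sgn a = ((-1 : ℂ) ^ p) • a)
    (hb : sgn b = ((-1 : ℂ) ^ q) • b) : a * b = ((-1 : ℂ) ^ (p * q)) • (b * a) :=
  val_injective (by
    classical
    have hinv : ∀ {c : SerRing m d} {r : ℤ}, sgn c = ((-1 : ℂ) ^ r) • c → ∀ κ : Mon g,
        inv (c.val κ) = ((-1 : ℂ) ^ (r - κ.deg d)) • c.val κ := by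
      intro c r hc κ
      have h := congrFun (congrArg val hc) κ
      rw [val_sgn, map_smul, Pi.smul_apply, serSgn] at h
      have h' := congrArg (fun v => ((-1 : ℂ) ^ (-κ.deg d)) • v) h
      simp only [smul_smul] at h'
      rw [← zpow_add₀ (by simp), neg_add_cancel, zpow_zero, one_smul, ← zpow_add₀ (by simp)] at h'
      rw [sub_eq_neg_add]
      exact h'
    obtain ⟨A, hA⟩ := a.val_mem
    obtain ⟨B, hB⟩ := b.val_mem
    ext1 κ
    rw [map_smul, val_mul, val_mul, Pi.smul_apply, serMul_apply hA hB, serMul_apply hB hA]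
    split_ifs with h
    · rw [Finset.smul_sum]
      refine Finset.sum_bij' (fun z _ => (z.2, z.1)) (fun z _ => (z.2, z.1)) ?_ ?_ ?_ ?_ ?_
      · intro z hz
        obtain ⟨h0, h1, h2⟩ := mem_fact.1 hz
        exact mem_fact.2 ⟨by rw [← h0]; exact Mon.add_comm' _ _, h2, h1⟩
      · intro z hz
        obtain ⟨h0, h1, h2⟩ := mem_fact.1 hz
        exact mem_fact.2 ⟨by rw [← h0]; exact Mon.add_comm' _ _, h2, h1⟩
      · intro z _; rfl
      · intro z _; rfl
      · intro z hz
        obtain ⟨rfl, -, -⟩ := mem_fact.1 hz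
        have h1 := hinv ha z.1
        have h2 := hinv hb z.2
        dsimp only
        rw [twist_of_inv_eq h2, twist_of_inv_eq h1, mul_smul_comm, mul_smul_comm,
          mul_comm_of_inv_eq h1 h2, Mon.sign_swap h]
        simp only [smul_smul]
        congr 1
        have hexp : (-1 : ℂ) ^ (z.1.deg d * z.2.deg d) * ((-1) ^ (z.1.deg d * (q - z.2.deg d)) *
            (-1) ^ ((p - z.1.deg d) * (q - z.2.deg d))) =
            (-1) ^ (p * q) * (-1) ^ (z.2.deg d * (p - z.1.deg d)) := by
          rw [← zpow_add₀ (by simp), ← zpow_add₀ (by simp), ← zpow_add₀ (by simp)]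
          exact neg_one_zpow_congr (z.1.deg d * z.2.deg d - p * z.2.deg d) (by ring)
        linear_combination (Mon.sign d z.2 z.1) * hexp
    · rw [smul_zero])

end SerRing

end SeriesRing

/-! ### The Poisson contraction and the bracket at a point -/

section PointIdentities

variable {g m : ℕ} {d : Fin g → ℤ}

namespace SerRing

lemma sgn_contr_of {a : SerRing m d} {A : ℤ} (ha : sgn a = ((-1 : ℂ) ^ A) • a) (i : Fin m) :
    sgn (contr i a) = ((-1 : ℂ) ^ (A + 1)) • contr i a := by
  have := contr_sgn i a
  rw [ha, map_smul] at this
  rw [zpow_add₀ (by simp), zpow_one, mul_neg_one, neg_smul, this, neg_neg]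

lemma sgn_contr_contr_of {a : SerRing m d} {A : ℤ} (ha : sgn a = ((-1 : ℂ) ^ A) • a)
    (i j : Fin m) : sgn (contr i (contr j a)) = ((-1 : ℂ) ^ A) • contr i (contr j a) := by
  rw [sgn_contr_of (sgn_contr_of ha j), neg_one_zpow_congr (a := A + 1 + 1) (b := A) 1 (by ring)]

lemma sgn_mul_of {a b : SerRing m d} {A B : ℤ} (ha : sgn a = ((-1 : ℂ) ^ A) • a)
    (hb : sgn b = ((-1 : ℂ) ^ B) • b) : sgn (a * b) = ((-1 : ℂ) ^ (A + B)) • (a * b) := by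
  rw [sgn_mul, ha, hb, smul_mul_assoc, mul_smul_comm, smul_smul, zpow_add₀ (by simp)]

/-- The exchange of two factors of a product of three. -/
lemma mul_right_comm_of_sgn {b c : SerRing m d} {B C : ℤ} (hb : sgn b = ((-1 : ℂ) ^ B) • b)
    (hc : sgn c = ((-1 : ℂ) ^ C) • c) (a : SerRing m d) :
    a * c * b = ((-1 : ℂ) ^ (C * B)) • (a * b * c) := by
  rw [mul_assoc, mul_comm_of_sgn hc hb, mul_smul_comm, mul_assoc]

/-- The rotation of a product of three factors. -/
lemma mul_rotate_of_sgn {a b c : SerRing m d} {A B C : ℤ} (ha : sgn a = ((-1 : ℂ) ^ A) • a)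
    (hb : sgn b = ((-1 : ℂ) ^ B) • b) (hc : sgn c = ((-1 : ℂ) ^ C) • c) :
    b * c * a = ((-1 : ℂ) ^ ((B + C) * A)) • (a * b * c) := by
  rw [mul_comm_of_sgn (sgn_mul_of hb hc) ha, mul_assoc]

variable (α : Fin m → Fin m → ℂ) (dα : Fin m → Fin m → Fin m → ℂ)

/-- The operator `dα^{ij} = ∑ ∂_{x^k} α^{ij} dx^k`. -/
def dxPoisson (i j : Fin m) : SerRing m d →ₗ[ℂ] SerRing m d := ∑ k, dα k i j • dx k

lemma dxPoisson_apply (i j : Fin m) (a : SerRing m d) :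
    dxPoisson dα i j a = ∑ k, dα k i j • dx k a := by
  simp [dxPoisson, LinearMap.sum_apply]

lemma dxPoisson_mul (i j : Fin m) (a b : SerRing m d) :
    dxPoisson dα i j (a * b) = dxPoisson dα i j a * b := by
  simp only [dxPoisson_apply, dx_mul, Finset.sum_mul, smul_mul_assoc]

lemma dxPoisson_eps (i j : Fin m) (a : SerRing m d) :
    dxPoisson dα i j (eps a) = eps (dxPoisson dα i j a) := by
  simp only [dxPoisson_apply, dx_eps, map_sum, map_smul]

lemma contr_dxPoisson (p i j : Fin m) (a : SerRing m d) :
    contr p (dxPoisson dα i j a) = dα p i j • a - dxPoisson dα i j (contr p a) := by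
  simp only [dxPoisson_apply, map_sum, map_smul, contr_dx, smul_sub, Finset.sum_sub_distrib]
  simp

/-- The operation `ε α^{ij} ∂(±a)/∂dxⁱ ∂b/∂dx^j` at a point. -/
def pbr (a b : SerRing m d) : SerRing m d :=
  eps (∑ i, ∑ j, α i j • (contr i (sgn a) * contr j b))

/-- The partial derivatives of `pbr a b`, from those of `α`, `a` and `b`. -/
def pbrDeriv (a : SerRing m d) (a' : Fin m → SerRing m d) (b : SerRing m d)
    (b' : Fin m → SerRing m d) (k : Fin m) : SerRing m d :=
  eps (∑ i, ∑ j, (dα k i j • (contr i (sgn a) * contr j b) +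
    α i j • (contr i (sgn (a' k)) * contr j b + contr i (sgn a) * contr j (b' k))))

/-- The bracket at a point, in terms of the values of `a` and `b` and of their partial
derivatives. -/
def fbr (a : SerRing m d) (a' : Fin m → SerRing m d) (b : SerRing m d)
    (b' : Fin m → SerRing m d) : SerRing m d :=
  eps (∑ i, ∑ j, (dxPoisson dα i j (contr i a * contr j b) -
    α i j • (contr i (sgn a) * b' j) + α i j • (a' i * contr j b)))

/-- The terms of the cubic identity in which the first factor is contracted twice, or contracted
and differentiated. -/
def cubicFst (sa sb : ℂ) (a : SerRing m d) (a' : Fin m → SerRing m d) (b : SerRing m d)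
    (b' : Fin m → SerRing m d) (c : SerRing m d) (c' : Fin m → SerRing m d) (p q i j : Fin m) :
    SerRing m d :=
  (sb * α i j) • dxPoisson dα p q (contr p (contr i a) * contr j b * contr q c) -
    (sb * α p q) • dxPoisson dα i j (contr p (contr i a) * contr j b * contr q c) +
    (sb * α p q * α i j) • ((contr i (a' p) + contr p (a' i)) * contr j b * contr q c) -
    (sa * α p q * α i j) • (contr p (contr i a) * contr j b * c' q) -
    (sa * sb * α p q * α i j) • (contr p (contr i a) * b' j * contr q c)

/-- The terms of the cubic identity in which the second factor is contracted twice, or contracted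
and differentiated. -/
def cubicSnd (sa sb : ℂ) (a : SerRing m d) (a' : Fin m → SerRing m d) (b : SerRing m d)
    (b' : Fin m → SerRing m d) (c : SerRing m d) (c' : Fin m → SerRing m d) (p q i j : Fin m) :
    SerRing m d :=
  -((sa * sb * α i j) • dxPoisson dα p q (contr i a * contr p (contr j b) * contr q c)) +
    (sa * sb * α p q) • dxPoisson dα i j (contr i a * contr p (contr j b) * contr q c) +
    (sb * α p q * α i j) • (contr i a * (contr j (b' p) + contr p (b' j)) * contr q c) +
    (α p q * α i j) • (contr i a * contr p (contr j b) * c' q) +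
    (sa * sb * α p q * α i j) • (a' i * contr p (contr j b) * contr q c)

/-- The terms of the cubic identity with a derivative of `α` and no form `dx^k`. -/
def cubicJac (sb : ℂ) (a b c : SerRing m d) (p q i j : Fin m) : SerRing m d :=
  (2 * sb * α p q * dα p i j) • (contr i a * contr j b * contr q c)

/-- The expression of `Q(B(a,b),c) - B(Q(a,b),c)` in normal form, where `B` is `pbr` and
`Q(a,b) = (-1)^{|a|} [a,b]`. -/
lemma fbr_pbr_sub_pbr_fbr {A B : ℤ} {a b c : SerRing m d} {a' b' c' : Fin m → SerRing m d}
    (ha : sgn a = ((-1 : ℂ) ^ A) • a) (ha' : ∀ i, sgn (a' i) = ((-1 : ℂ) ^ A) • a' i)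
    (hb : sgn b = ((-1 : ℂ) ^ B) • b) (hb' : ∀ i, sgn (b' i) = ((-1 : ℂ) ^ B) • b' i) :
    ((-1 : ℂ) ^ (A + B)) • fbr α dα (pbr α a b) (pbrDeriv α dα a a' b b') c c' -
      pbr α (((-1 : ℂ) ^ A) • fbr α dα a a' b b') c =
    eps (eps (∑ p, ∑ q, ∑ i, ∑ j,
      (cubicFst α dα ((-1) ^ A) ((-1) ^ B) a a' b b' c c' p q i j +
        cubicSnd α dα ((-1) ^ A) ((-1) ^ B) a a' b b' c c' p q i j +
        cubicJac α dα ((-1) ^ B) a b c p q i j))) := by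
  rw [zpow_add₀ (by simp)]
  have hca : ∀ i, sgn (contr i a) = -(((-1 : ℂ) ^ A) • contr i a) := fun i => by
    rw [sgn_contr_of ha, zpow_add₀ (by simp)]; simp
  have hcb : ∀ i, sgn (contr i b) = -(((-1 : ℂ) ^ B) • contr i b) := fun i => by
    rw [sgn_contr_of hb, zpow_add₀ (by simp)]; simp
  have hsa : (-1 : ℂ) ^ A * (-1 : ℂ) ^ A = 1 := by rw [← mul_zpow]; simp
  have hsb : (-1 : ℂ) ^ B * (-1 : ℂ) ^ B = 1 := by rw [← mul_zpow]; simp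
  generalize ((-1 : ℂ) ^ A) = sa at *
  generalize ((-1 : ℂ) ^ B) = sb at *
  have hpb : sgn (pbr α a b) = (sa * sb) • pbr α a b := by
    simp only [pbr, sgn_eps, map_sum, map_smul, sgn_mul, ha, hca, hcb, Finset.smul_sum]
    refine Finset.sum_congr rfl fun i _ => Finset.sum_congr rfl fun j _ => ?_
    simp only [smul_mul_assoc, mul_smul_comm, neg_mul_neg, smul_smul, map_smul]
    congr 1; ring
  have hca' : ∀ i k, sgn (contr i (a' k)) = -(sa • contr i (a' k)) := fun i k => by
    rw [← neg_eq_iff_eq_neg, ← contr_sgn, ha', map_smul]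
  have hfb : sgn (sa • fbr α dα a a' b b') = (-(sa * sb)) • (sa • fbr α dα a a' b b') := by
    have hdp : ∀ i j (x : SerRing m d), sgn (dxPoisson dα i j x) = -dxPoisson dα i j (sgn x) :=
      fun i j x => by
        simp only [dxPoisson_apply, map_sum, map_smul, sgn_dx, smul_neg, Finset.sum_neg_distrib]
    simp only [fbr, sgn_eps, map_sum, map_smul, sgn_mul, ha, hca, hcb, Finset.smul_sum, map_add,
      map_sub, hdp, ha', hb', smul_add, smul_sub]
    refine Finset.sum_congr rfl fun i _ => Finset.sum_congr rfl fun j _ => ?_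
    simp only [smul_mul_assoc, mul_smul_comm, smul_smul, map_smul, map_neg, neg_mul,
      mul_neg]
    module
  have key1 : ∀ p q, dxPoisson dα p q (contr p (pbr α a b) * contr q c) -
      α p q • (contr p (sgn (pbr α a b)) * c' q) +
      α p q • (pbrDeriv α dα a a' b b' p * contr q c) = eps (∑ i, ∑ j,
        ((sa * α i j) • dxPoisson dα p q (contr p (contr i a * contr j b) * contr q c) -
          (sa * (sa * sb) * α p q * α i j) • (contr p (contr i a * contr j b) * c' q) +
          (sa * α p q) • ((dα p i j • (contr i a * contr j b) +
            α i j • (contr i (a' p) * contr j b + contr i a * contr j (b' p))) *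
              contr q c))) := by
    intro p q
    rw [hpb]
    simp only [pbr, pbrDeriv, ha, ha', contr_eps, eps_mul_left, dxPoisson_eps, map_sum, map_smul,
      Finset.sum_mul, smul_mul_assoc, Finset.smul_sum, smul_smul, map_add, map_sub,
      ← Finset.sum_add_distrib, ← Finset.sum_sub_distrib]
    refine Finset.sum_congr rfl fun i _ => Finset.sum_congr rfl fun j _ => ?_
    simp only [add_mul, smul_mul_assoc, map_add, map_smul, eps_mul_left]
    module
  have key2 : ∀ p q, α p q • (contr p (sgn (sa • fbr α dα a a' b b')) * contr q c) =
      eps (∑ i, ∑ j, (-(sa * sb) * α p q) •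
        (contr p (sa • dxPoisson dα i j (contr i a * contr j b) -
          (sa * sa * α i j) • (contr i a * b' j) + (sa * α i j) • (a' i * contr j b)) *
            contr q c)) := by
    intro p q
    rw [hfb]
    simp only [fbr, ha, contr_eps, map_sum, map_smul,
      Finset.sum_mul, smul_mul_assoc, Finset.smul_sum, smul_smul, map_add, map_sub]
    refine Finset.sum_congr rfl fun i _ => Finset.sum_congr rfl fun j _ => ?_
    simp only [add_mul, sub_mul, smul_mul_assoc, map_add, map_sub, map_smul, eps_mul_left]
    module
  have hsa' : sa = 1 ∨ sa = -1 := mul_self_eq_one_iff.1 hsa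
  have hsb' : sb = 1 ∨ sb = -1 := mul_self_eq_one_iff.1 hsb
  have key3 : pbr α (sa • fbr α dα a a' b b') c = eps (∑ p, ∑ q,
      α p q • (contr p (sgn (sa • fbr α dα a a' b b')) * contr q c)) := rfl
  rw [key3, fbr]
  simp only [key1, key2]
  simp only [map_sum, Finset.smul_sum, ← Finset.sum_sub_distrib]
  refine Finset.sum_congr rfl fun p _ => Finset.sum_congr rfl fun q _ =>
    Finset.sum_congr rfl fun i _ => Finset.sum_congr rfl fun j _ => ?_
  simp only [cubicFst, cubicSnd, cubicJac, map_add, map_sub, map_smul, contr_mul, hca, ha',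
    contr_dxPoisson, add_mul, sub_mul, mul_add, smul_mul_assoc, neg_mul, map_neg,
    ← dxPoisson_mul]
  rcases hsa' with rfl | rfl <;> rcases hsb' with rfl | rfl <;> module

lemma neg_one_zpow_add_one (A : ℤ) : (-1 : ℂ) ^ (A + 1) = -(-1 : ℂ) ^ A := by
  rw [zpow_add₀ (by simp), zpow_one, mul_neg_one]

lemma neg_one_zpow_add (A B : ℤ) : (-1 : ℂ) ^ (A + B) = (-1 : ℂ) ^ A * (-1 : ℂ) ^ B :=
  zpow_add₀ (by simp) _ _

lemma neg_one_zpow_eq (A : ℤ) : (-1 : ℂ) ^ A = 1 ∨ (-1 : ℂ) ^ A = -1 :=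
  mul_self_eq_one_iff.1 (by rw [← mul_zpow]; simp)

section Cyclic

variable {A B C : ℤ} {a b c : SerRing m d} {a' b' c' : Fin m → SerRing m d}
  (ha : sgn a = ((-1 : ℂ) ^ A) • a) (ha' : ∀ i, sgn (a' i) = ((-1 : ℂ) ^ A) • a' i)
  (hb : sgn b = ((-1 : ℂ) ^ B) • b) (hb' : ∀ i, sgn (b' i) = ((-1 : ℂ) ^ B) • b' i)
  (hc : sgn c = ((-1 : ℂ) ^ C) • c) (hc' : ∀ i, sgn (c' i) = ((-1 : ℂ) ^ C) • c' i)
  (hα : ∀ i j, α j i = -α i j) (hdα : ∀ k i j, dα k j i = -dα k i j)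

include hdα in
lemma dxPoisson_swap (i j : Fin m) (x : SerRing m d) :
    dxPoisson dα j i x = -dxPoisson dα i j x := by
  simp only [dxPoisson_apply, ← Finset.sum_neg_distrib]
  exact Finset.sum_congr rfl fun k _ => by rw [hdα, neg_smul]

include hb hb' hc hc' in
lemma cubicFst_cubicFst (p q i j : Fin m) :
    cubicFst α dα ((-1) ^ A) ((-1) ^ B) a a' b b' c c' p q i j + ((-1 : ℂ) ^ (B * C)) •
      cubicFst α dα ((-1) ^ A) ((-1) ^ C) a a' c c' b b' i j p q = 0 := by
  have e1 : ∀ x : SerRing m d, x * contr q c * contr j b =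
      (-1 : ℂ) ^ ((C + 1) * (B + 1)) • (x * contr j b * contr q c) :=
    mul_right_comm_of_sgn (sgn_contr_of hb j) (sgn_contr_of hc q)
  have e2 : ∀ x : SerRing m d, x * contr q c * b' j =
      (-1 : ℂ) ^ ((C + 1) * B) • (x * b' j * contr q c) :=
    mul_right_comm_of_sgn (hb' j) (sgn_contr_of hc q)
  have e3 : ∀ x : SerRing m d, x * c' q * contr j b =
      (-1 : ℂ) ^ (C * (B + 1)) • (x * contr j b * c' q) :=
    mul_right_comm_of_sgn (sgn_contr_of hb j) (hc' q)
  have e4 := contr_contr i p a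
  simp only [cubicFst, e1, e2, e3, e4, map_smul, neg_mul, map_neg, neg_one_zpow_add, mul_add,
      add_mul, mul_one, one_mul, mul_comm C B]
  rcases neg_one_zpow_eq (B * C) with h1 | h1 <;> rcases neg_one_zpow_eq B with h2 | h2 <;>
    rcases neg_one_zpow_eq C with h3 | h3 <;> simp only [h1, h2, h3, zpow_one] <;> module

include ha ha' hb hb' hc hc' hα hdα in
lemma cubicSnd_cubicFst (p q i j : Fin m) :
    cubicSnd α dα ((-1) ^ A) ((-1) ^ B) a a' b b' c c' p q i j + ((-1 : ℂ) ^ ((B + C) * A)) •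
      cubicFst α dα ((-1) ^ B) ((-1) ^ C) b b' c c' a a' j i p q = 0 := by
  set P := (-1 : ℂ) ^ ((B + C) * A) with hP
  set sa := (-1 : ℂ) ^ A with hsa
  set sb := (-1 : ℂ) ^ B with hsb
  set sc := (-1 : ℂ) ^ C with hsc
  have e1 : ∀ k l r, contr k (contr l b) * contr r c * contr i a =
      (-(P * sa * sb * sc)) • (contr i a * contr k (contr l b) * contr r c) := by
    intro k l r
    rw [mul_rotate_of_sgn (sgn_contr_of ha i) (sgn_contr_contr_of hb k l) (sgn_contr_of hc r),
      show (B + (C + 1)) * (A + 1) = (B + C) * A + A + B + C + 1 by ring]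
    simp only [neg_one_zpow_add, zpow_one, mul_neg_one, hP, hsa, hsb, hsc]
  have e2 : ∀ k l r, contr k (b' l) * contr r c * contr i a =
      (P * sb * sc) • (contr i a * contr k (b' l) * contr r c) := by
    intro k l r
    rw [mul_rotate_of_sgn (sgn_contr_of ha i) (sgn_contr_of (hb' l) k) (sgn_contr_of hc r),
      neg_one_zpow_congr (a := (B + 1 + (C + 1)) * (A + 1)) (b := (B + C) * A + B + C) (A + 1)
        (by ring)]
    simp only [neg_one_zpow_add, hP, hsb, hsc]
  have e3 : ∀ k l r, contr k (contr l b) * contr r c * a' i =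
      (P * sa) • (a' i * contr k (contr l b) * contr r c) := by
    intro k l r
    rw [mul_rotate_of_sgn (ha' i) (sgn_contr_contr_of hb k l) (sgn_contr_of hc r),
      show (B + (C + 1)) * A = (B + C) * A + A by ring]
    simp only [neg_one_zpow_add, hP, hsa]
  have e4 : ∀ k l r, contr k (contr l b) * c' r * contr i a =
      (P * sb * sc) • (contr i a * contr k (contr l b) * c' r) := by
    intro k l r
    rw [mul_rotate_of_sgn (sgn_contr_of ha i) (sgn_contr_contr_of hb k l) (hc' r),
      show (B + C) * (A + 1) = (B + C) * A + B + C by ring]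
    simp only [neg_one_zpow_add, hP, hsb, hsc]
  have e5 := contr_contr j p b
  have hP' : P = 1 ∨ P = -1 := neg_one_zpow_eq _
  have hsa' : sa = 1 ∨ sa = -1 := neg_one_zpow_eq _
  have hsb' : sb = 1 ∨ sb = -1 := neg_one_zpow_eq _
  have hsc' : sc = 1 ∨ sc = -1 := neg_one_zpow_eq _
  clear_value P sa sb sc
  simp only [cubicFst, cubicSnd, add_mul, mul_add, e1, e2, e3, e4, e5, hα i j,
    dxPoisson_swap dα hdα i j, map_smul, neg_mul, mul_neg, map_neg]
  rcases hP' with rfl | rfl <;> rcases hsa' with rfl | rfl <;> rcases hsb' with rfl | rfl <;>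
    rcases hsc' with rfl | rfl <;> module

include ha ha' hb hb' hc hc' hα hdα in
lemma cubicSnd_cubicSnd (p q i j : Fin m) :
    ((-1 : ℂ) ^ (B * C)) • cubicSnd α dα ((-1) ^ A) ((-1) ^ C) a a' c c' b b' p q i j +
      ((-1 : ℂ) ^ ((B + C) * A)) •
        cubicSnd α dα ((-1) ^ B) ((-1) ^ C) b b' c c' a a' j i q p = 0 := by
  set P := (-1 : ℂ) ^ ((B + C) * A) with hP
  set R := (-1 : ℂ) ^ (B * C) with hR
  set sa := (-1 : ℂ) ^ A with hsa
  set sb := (-1 : ℂ) ^ B with hsb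
  set sc := (-1 : ℂ) ^ C with hsc
  have e1 : ∀ k l r, contr r b * contr k (contr l c) * contr i a =
      (-(P * sa * sb * sc)) • (contr i a * contr r b * contr k (contr l c)) := by
    intro k l r
    rw [mul_rotate_of_sgn (sgn_contr_of ha i) (sgn_contr_of hb r) (sgn_contr_contr_of hc k l),
      show (B + 1 + C) * (A + 1) = (B + C) * A + A + B + C + 1 by ring]
    simp only [neg_one_zpow_add, zpow_one, mul_neg_one, hP, hsa, hsb, hsc]
  have e2 : ∀ k l r, contr r b * contr k (c' l) * contr i a =
      (P * sb * sc) • (contr i a * contr r b * contr k (c' l)) := by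
    intro k l r
    rw [mul_rotate_of_sgn (sgn_contr_of ha i) (sgn_contr_of hb r) (sgn_contr_of (hc' l) k),
      neg_one_zpow_congr (a := (B + 1 + (C + 1)) * (A + 1)) (b := (B + C) * A + B + C) (A + 1)
        (by ring)]
    simp only [neg_one_zpow_add, hP, hsb, hsc]
  have e3 : ∀ k l r, contr r b * contr k (contr l c) * a' i =
      (P * sa) • (a' i * contr r b * contr k (contr l c)) := by
    intro k l r
    rw [mul_rotate_of_sgn (ha' i) (sgn_contr_of hb r) (sgn_contr_contr_of hc k l),
      show (B + 1 + C) * A = (B + C) * A + A by ring]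
    simp only [neg_one_zpow_add, hP, hsa]
  have e4 : ∀ k l r, b' r * contr k (contr l c) * contr i a =
      (P * sb * sc) • (contr i a * b' r * contr k (contr l c)) := by
    intro k l r
    rw [mul_rotate_of_sgn (sgn_contr_of ha i) (hb' r) (sgn_contr_contr_of hc k l),
      show (B + C) * (A + 1) = (B + C) * A + B + C by ring]
    simp only [neg_one_zpow_add, hP, hsb, hsc]
  have f1 : ∀ (x : SerRing m d) k l r, x * contr k (contr l c) * contr r b =
      (R * sc) • (x * contr r b * contr k (contr l c)) := by
    intro x k l r
    rw [mul_right_comm_of_sgn (sgn_contr_of hb r) (sgn_contr_contr_of hc k l),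
      show C * (B + 1) = B * C + C by ring]
    simp only [neg_one_zpow_add, hR, hsc]
  have f2 : ∀ (x : SerRing m d) k l r, x * contr k (c' l) * contr r b =
      (-(R * sb * sc)) • (x * contr r b * contr k (c' l)) := by
    intro x k l r
    rw [mul_right_comm_of_sgn (sgn_contr_of hb r) (sgn_contr_of (hc' l) k),
      show (C + 1) * (B + 1) = B * C + B + C + 1 by ring]
    simp only [neg_one_zpow_add, hR, hsc, hsb, zpow_one, mul_neg_one]
  have f3 : ∀ (x : SerRing m d) k l r, x * contr k (contr l c) * b' r =
      R • (x * b' r * contr k (contr l c)) := by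
    intro x k l r
    rw [mul_right_comm_of_sgn (hb' r) (sgn_contr_contr_of hc k l), mul_comm C B, hR]
  have e5 := contr_contr j p c
  have hP' : P = 1 ∨ P = -1 := neg_one_zpow_eq _
  have hR' : R = 1 ∨ R = -1 := neg_one_zpow_eq _
  have hsa' : sa = 1 ∨ sa = -1 := neg_one_zpow_eq _
  have hsb' : sb = 1 ∨ sb = -1 := neg_one_zpow_eq _
  have hsc' : sc = 1 ∨ sc = -1 := neg_one_zpow_eq _
  clear_value P R sa sb sc
  simp only [cubicSnd, add_mul, mul_add, e1, e2, e3, e4, e5, f1, f2, f3, hα i j, hα p q,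
    dxPoisson_swap dα hdα i j, dxPoisson_swap dα hdα p q, map_smul, neg_mul, mul_neg, map_neg]
  rcases hP' with rfl | rfl <;> rcases hR' with rfl | rfl <;> rcases hsa' with rfl | rfl <;>
    rcases hsb' with rfl | rfl <;> rcases hsc' with rfl | rfl <;> module

include ha hb hc in
/-- The Jacobi identity of `α` makes the terms without a form `dx^k` cancel. -/
lemma sum_cubicJac (hJ : ∀ i j k, ∑ l, (α l i * dα l j k + α l j * dα l k i + α l k * dα l i j) = 0)
    (hdα : ∀ k i j, dα k j i = -dα k i j) :
    (∑ p, ∑ q, ∑ i, ∑ j, cubicJac α dα ((-1) ^ B) a b c p q i j) +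
      ((-1 : ℂ) ^ (B * C)) • (∑ p, ∑ q, ∑ i, ∑ j, cubicJac α dα ((-1) ^ C) a c b p q i j) +
      ((-1 : ℂ) ^ ((B + C) * A)) • (∑ p, ∑ q, ∑ i, ∑ j, cubicJac α dα ((-1) ^ C) b c a p q i j) =
      0 := by
  set P := (-1 : ℂ) ^ ((B + C) * A) with hP
  set R := (-1 : ℂ) ^ (B * C) with hR
  set sb := (-1 : ℂ) ^ B with hsb
  set sc := (-1 : ℂ) ^ C with hsc
  have e1 : ∀ k l r, contr k b * contr l c * contr r a =
      (P * sb * sc) • (contr r a * contr k b * contr l c) := by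
    intro k l r
    rw [mul_rotate_of_sgn (sgn_contr_of ha r) (sgn_contr_of hb k) (sgn_contr_of hc l),
      neg_one_zpow_congr (a := (B + 1 + (C + 1)) * (A + 1)) (b := (B + C) * A + B + C) (A + 1)
        (by ring)]
    simp only [neg_one_zpow_add, hP, hsb, hsc]
  have f1 : ∀ (x : SerRing m d) k l, x * contr k c * contr l b =
      (-(R * sb * sc)) • (x * contr l b * contr k c) := by
    intro x k l
    rw [mul_right_comm_of_sgn (sgn_contr_of hb l) (sgn_contr_of hc k),
      show (C + 1) * (B + 1) = B * C + B + C + 1 by ring]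
    simp only [neg_one_zpow_add, hR, hsc, hsb, zpow_one, mul_neg_one]
  have hP' : P = 1 ∨ P = -1 := neg_one_zpow_eq _
  have hR' : R = 1 ∨ R = -1 := neg_one_zpow_eq _
  have hsb' : sb = 1 ∨ sb = -1 := neg_one_zpow_eq _
  have hsc' : sc = 1 ∨ sc = -1 := neg_one_zpow_eq _
  clear_value P R sb sc
  have s1 : (∑ p, ∑ q, ∑ i, ∑ j, cubicJac α dα sb a b c p q i j) = ∑ i, ∑ j, ∑ q, ∑ p,
      cubicJac α dα sb a b c p q i j := by
    calc _ = ∑ p, ∑ i, ∑ j, ∑ q, cubicJac α dα sb a b c p q i j := by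
          refine Finset.sum_congr rfl fun p _ => ?_
          rw [Finset.sum_comm]
          exact Finset.sum_congr rfl fun i _ => Finset.sum_comm
      _ = _ := by
          rw [Finset.sum_comm]
          refine Finset.sum_congr rfl fun i _ => ?_
          rw [Finset.sum_comm]
          exact Finset.sum_congr rfl fun j _ => Finset.sum_comm
  have s2 : (∑ p, ∑ q, ∑ i, ∑ j, cubicJac α dα sc a c b p q i j) = ∑ i, ∑ j, ∑ q, ∑ p,
      cubicJac α dα sc a c b p j i q := by
    rw [Finset.sum_congr rfl fun p _ => Finset.sum_comm, Finset.sum_comm]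
    refine Finset.sum_congr rfl fun i _ => ?_
    rw [Finset.sum_comm]
    exact Finset.sum_congr rfl fun j _ => Finset.sum_comm
  have s3 : (∑ p, ∑ q, ∑ i, ∑ j, cubicJac α dα sc b c a p q i j) = ∑ i, ∑ j, ∑ q, ∑ p,
      cubicJac α dα sc b c a p i j q := by
    rw [Finset.sum_comm]
    refine Finset.sum_congr rfl fun i _ => ?_
    rw [Finset.sum_comm]
    refine Finset.sum_congr rfl fun j _ => ?_
    rw [Finset.sum_comm]
  rw [s1, s2, s3]
  simp only [Finset.smul_sum, ← Finset.sum_add_distrib]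
  refine Finset.sum_eq_zero fun i _ => Finset.sum_eq_zero fun j _ =>
    Finset.sum_eq_zero fun q _ => ?_
  have h := hJ q i j
  have key : ∀ p, cubicJac α dα sb a b c p q i j + R • cubicJac α dα sc a c b p j i q +
      P • cubicJac α dα sc b c a p i j q = (2 * sb) •
        ((α p q * dα p i j + α p i * dα p j q + α p j * dα p q i) •
          (contr i a * contr j b * contr q c)) := by
    intro p
    simp only [cubicJac, e1, f1, hdα p q i]
    rcases hP' with rfl | rfl <;> rcases hR' with rfl | rfl <;> rcases hsb' with rfl | rfl <;>
      rcases hsc' with rfl | rfl <;> module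
  simp only [key, ← Finset.smul_sum, ← Finset.sum_smul, h, zero_smul, smul_zero]

/-- The sum of three terms of the form `Q(B(a,b),c) - B(Q(a,b),c)` vanishes. -/
lemma cubic_sum {A B C : ℤ} {a b c : SerRing m d} {a' b' c' : Fin m → SerRing m d}
    (ha : sgn a = ((-1 : ℂ) ^ A) • a) (ha' : ∀ i, sgn (a' i) = ((-1 : ℂ) ^ A) • a' i)
    (hb : sgn b = ((-1 : ℂ) ^ B) • b) (hb' : ∀ i, sgn (b' i) = ((-1 : ℂ) ^ B) • b' i)
    (hc : sgn c = ((-1 : ℂ) ^ C) • c) (hc' : ∀ i, sgn (c' i) = ((-1 : ℂ) ^ C) • c' i)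
    (hα : ∀ i j, α j i = -α i j) (hdα : ∀ k i j, dα k j i = -dα k i j)
    (hJ : ∀ i j k, ∑ l, (α l i * dα l j k + α l j * dα l k i + α l k * dα l i j) = 0) :
    (((-1 : ℂ) ^ (A + B)) • fbr α dα (pbr α a b) (pbrDeriv α dα a a' b b') c c' -
      pbr α (((-1 : ℂ) ^ A) • fbr α dα a a' b b') c) +
    ((-1 : ℂ) ^ (B * C)) •
      (((-1 : ℂ) ^ (A + C)) • fbr α dα (pbr α a c) (pbrDeriv α dα a a' c c') b b' -
        pbr α (((-1 : ℂ) ^ A) • fbr α dα a a' c c') b) +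
    ((-1 : ℂ) ^ ((B + C) * A)) •
      (((-1 : ℂ) ^ (B + C)) • fbr α dα (pbr α b c) (pbrDeriv α dα b b' c c') a a' -
        pbr α (((-1 : ℂ) ^ B) • fbr α dα b b' c c') a) = 0 := by
  rw [fbr_pbr_sub_pbr_fbr α dα ha ha' hb hb', fbr_pbr_sub_pbr_fbr α dα ha ha' hc hc',
    fbr_pbr_sub_pbr_fbr α dα hb hb' hc hc']
  have r1 : ∀ f : Fin m → Fin m → Fin m → Fin m → SerRing m d,
      (∑ p, ∑ q, ∑ i, ∑ j, f p q i j) = ∑ p, ∑ q, ∑ i, ∑ j, f i j p q := by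
    intro f
    calc _ = ∑ p, ∑ i, ∑ q, ∑ j, f p q i j :=
          Finset.sum_congr rfl fun p _ => Finset.sum_comm
      _ = ∑ i, ∑ p, ∑ j, ∑ q, f p q i j := by
          rw [Finset.sum_comm]
          exact Finset.sum_congr rfl fun i _ => Finset.sum_congr rfl fun p _ => Finset.sum_comm
      _ = _ := Finset.sum_congr rfl fun i _ => Finset.sum_comm
  have r2 : ∀ f : Fin m → Fin m → Fin m → Fin m → SerRing m d,
      (∑ p, ∑ q, ∑ i, ∑ j, f p q i j) = ∑ p, ∑ q, ∑ i, ∑ j, f j i p q := by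
    intro f
    rw [r1 f]
    exact Finset.sum_congr rfl fun p _ => Finset.sum_congr rfl fun q _ => Finset.sum_comm
  have r3 : ∀ f : Fin m → Fin m → Fin m → Fin m → SerRing m d,
      (∑ p, ∑ q, ∑ i, ∑ j, f p q i j) = ∑ p, ∑ q, ∑ i, ∑ j, f j i q p := by
    intro f
    rw [r2 f]
    exact Finset.sum_comm
  have h1 := fun p q i j => cubicFst_cubicFst (A := A) α dα (a := a)
      (a' := a') hb hb' hc hc' p q i j
  have h2 := fun p q i j => cubicSnd_cubicFst α dα ha ha' hb hb' hc hc' hα hdα p q i j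
  have h3 := fun p q i j => cubicSnd_cubicSnd α dα ha ha' hb hb' hc hc' hα hdα p q i j
  have h4 := sum_cubicJac α dα ha hb hc hJ hdα
  have h1' := Finset.sum_congr rfl fun p (_ : p ∈ Finset.univ) => Finset.sum_congr rfl fun q
    (_ : q ∈ Finset.univ) => Finset.sum_congr rfl fun i (_ : i ∈ Finset.univ) =>
      Finset.sum_congr rfl fun j (_ : j ∈ Finset.univ) => h1 p q i j
  have h2' := Finset.sum_congr rfl fun p (_ : p ∈ Finset.univ) => Finset.sum_congr rfl fun q
    (_ : q ∈ Finset.univ) => Finset.sum_congr rfl fun i (_ : i ∈ Finset.univ) =>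
      Finset.sum_congr rfl fun j (_ : j ∈ Finset.univ) => h2 p q i j
  have h3' := Finset.sum_congr rfl fun p (_ : p ∈ Finset.univ) => Finset.sum_congr rfl fun q
    (_ : q ∈ Finset.univ) => Finset.sum_congr rfl fun i (_ : i ∈ Finset.univ) =>
      Finset.sum_congr rfl fun j (_ : j ∈ Finset.univ) => h3 p q i j
  simp only [Finset.sum_add_distrib, ← Finset.smul_sum, Finset.sum_const_zero] at h1' h2' h3'
  rw [← r1 (fun p q i j => cubicFst α dα ((-1) ^ A) ((-1) ^ C) a a' c c' b b' p q i j)] at h1'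
  rw [← r2 (fun p q i j => cubicFst α dα ((-1) ^ B) ((-1) ^ C) b b' c c' a a' p q i j)] at h2'
  rw [← r3 (fun p q i j => cubicSnd α dα ((-1) ^ B) ((-1) ^ C) b b' c c' a a' p q i j)] at h3'
  simp only [Finset.sum_add_distrib, ← map_smul, ← map_add, smul_add]
  rw [← map_zero eps, ← map_zero eps]
  congr 2
  have e := congrArg₂ (· + ·) (congrArg₂ (· + ·) (congrArg₂ (· + ·) h1' h2') h3') h4
  simp only [add_zero] at e
  rw [← e]
  module

end Cyclic

end SerRing

end PointIdentities

/-! ### The differential at a point -/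

section PointDifferential

variable {g m : ℕ} {d : Fin g → ℤ}

namespace SerRing

/-- The derivative with respect to the coordinate `t` of the simplex. -/
def dt : SerRing m d →ₗ[ℂ] SerRing m d where
  toFun a := mk d (fun κ => ((κ.n : ℂ) + 1) • a.val { κ with n := κ.n + 1 }) (by
    obtain ⟨A, ha⟩ := a.val_mem
    refine ⟨A, fun κ hκ => ?_⟩
    have h0 : a.val { κ with n := κ.n + 1 } = 0 := ha _ hκ
    simp only [h0, smul_zero])
  map_add' a b := val_injective (by ext1 κ; simp)
  map_smul' r a := val_injective (by
    ext1 κ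
    simp only [val_mk, map_smul, Pi.smul_apply, RingHom.id_apply]
    rw [smul_comm])

/-- Right multiplication by the form `dt` of the simplex. -/
def mulDt : SerRing m d →ₗ[ℂ] SerRing m d where
  toFun a := mk d (fun κ => if κ.s = 1 then a.val { κ with s := 0 } else 0) (by
    obtain ⟨A, ha⟩ := a.val_mem
    refine ⟨A, fun κ hκ => ?_⟩
    have h0 : a.val { κ with s := 0 } = 0 := ha _ hκ
    simp only [h0, ite_self])
  map_add' a b := val_injective (by
    ext1 κ
    simp only [val_mk, map_add, Pi.add_apply]
    split_ifs <;> simp)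
  map_smul' r a := val_injective (by
    ext1 κ
    simp only [val_mk, map_smul, Pi.smul_apply, RingHom.id_apply]
    split_ifs <;> simp)

/-- The de Rham differential of the simplex at a point: `a ↦ -(∂_t (-1)^{|a|} a) dt`. -/
def simp₁ : SerRing m d →ₗ[ℂ] SerRing m d := -(mulDt ∘ₗ dt ∘ₗ sgn)

lemma val_dt (a : SerRing m d) (κ : Mon g) :
    (dt a).val κ = ((κ.n : ℂ) + 1) • a.val { κ with n := κ.n + 1 } := rfl

lemma val_mulDt (a : SerRing m d) (κ : Mon g) :
    (mulDt a).val κ = if κ.s = 1 then a.val { κ with s := 0 } else 0 := rfl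

lemma val_simp₁ (a : SerRing m d) (κ : Mon g) : (simp₁ a).val κ =
    if κ.s = 1 then -(((κ.n : ℂ) + 1) • serSgn d a.val { κ with n := κ.n + 1, s := 0 }) else 0 := by
  rw [simp₁, LinearMap.neg_apply, map_neg, Pi.neg_apply, LinearMap.comp_apply, val_mulDt]
  split_ifs
  · rfl
  · rw [neg_zero]

lemma dt_mul (a b : SerRing m d) : dt (a * b) = dt a * b + a * dt b :=
  val_injective (by
    classical
    obtain ⟨A, ha⟩ := a.val_mem
    obtain ⟨B, hb⟩ := b.val_mem
    have ha' : BddE A (dt a).val := fun κ hκ => by rw [val_dt, ha _ (by exact hκ), smul_zero]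
    have hb' : BddE B (dt b).val := fun κ hκ => by rw [val_dt, hb _ (by exact hκ), smul_zero]
    ext1 κ
    rw [val_dt, map_add, Pi.add_apply, val_mul, val_mul, val_mul, serMul_apply ha' hb,
      serMul_apply ha hb', serMul_apply ha hb]
    by_cases h : κ.Adm d
    swap
    · rw [if_neg h, if_neg h, if_neg (by exact h), smul_zero, add_zero]
    rw [if_pos h, if_pos h, if_pos (by exact h)]
    set f : Mon g × Mon g → Lam m := fun z =>
      Mon.sign d z.1 z.2 • (a.val z.1 * twist (z.1.deg d) (b.val z.2)) with hf
    have h1 : ∑ z ∈ fact A B κ, Mon.sign d z.1 z.2 • ((dt a).val z.1 *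
        twist (z.1.deg d) (b.val z.2)) =
        ∑ z ∈ fact A B { κ with n := κ.n + 1 }, (z.1.n : ℂ) • f z := by
      refine Finset.sum_of_injOn (fun z => ({ z.1 with n := z.1.n + 1 }, z.2)) ?_ ?_ ?_ ?_
      · rintro ⟨⟨e, k, n, s⟩, q⟩ - ⟨⟨e', k', n', s'⟩, q'⟩ - h
        simp only [Prod.mk.injEq, Mon.mk.injEq, add_left_inj] at h ⊢
        exact h
      · intro z hz
        obtain ⟨rfl, h1, h2⟩ := mem_fact.1 hz
        refine mem_fact.2 ⟨?_, h1, h2⟩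
        ext <;> simp [add_right_comm]
      · rintro ⟨⟨e, k, n, s⟩, q⟩ hz hz'
        cases n with
        | zero => simp
        | succ n =>
          refine absurd ⟨(⟨e, k, n, s⟩, q), ?_, rfl⟩ hz'
          obtain ⟨h0, h1, h2⟩ := mem_fact.1 hz
          refine mem_fact.2 ⟨?_, h1, h2⟩
          have hn := congrArg Mon.n h0
          simp only [Mon.add_n] at hn
          ext1
          · exact (congrArg Mon.e h0 :)
          · exact (congrArg Mon.k h0 :)
          · simp only [Mon.add_n]; omega
          · exact (congrArg Mon.s h0 :)
      · intro z _
        rw [val_dt, hf]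
        dsimp only
        rw [smul_mul_assoc, smul_comm]
        push_cast
        rfl
    have h2 : ∑ z ∈ fact A B κ, Mon.sign d z.1 z.2 • (a.val z.1 *
        twist (z.1.deg d) ((dt b).val z.2)) =
        ∑ z ∈ fact A B { κ with n := κ.n + 1 }, (z.2.n : ℂ) • f z := by
      refine Finset.sum_of_injOn (fun z => (z.1, { z.2 with n := z.2.n + 1 })) ?_ ?_ ?_ ?_
      · rintro ⟨q, ⟨e, k, n, s⟩⟩ - ⟨q', ⟨e', k', n', s'⟩⟩ - h
        simp only [Prod.mk.injEq, Mon.mk.injEq, add_left_inj] at h ⊢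
        exact h
      · intro z hz
        obtain ⟨rfl, h1, h2⟩ := mem_fact.1 hz
        refine mem_fact.2 ⟨?_, h1, h2⟩
        ext <;> simp [add_assoc]
      · rintro ⟨q, ⟨e, k, n, s⟩⟩ hz hz'
        cases n with
        | zero => simp
        | succ n =>
          refine absurd ⟨(q, ⟨e, k, n, s⟩), ?_, rfl⟩ hz'
          obtain ⟨h0, h1, h2⟩ := mem_fact.1 hz
          refine mem_fact.2 ⟨?_, h1, h2⟩
          have hn := congrArg Mon.n h0
          simp only [Mon.add_n] at hn
          ext1
          · exact (congrArg Mon.e h0 :)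
          · exact (congrArg Mon.k h0 :)
          · simp only [Mon.add_n]; omega
          · exact (congrArg Mon.s h0 :)
      · intro z _
        rw [val_dt, hf]
        dsimp only
        rw [map_smul, mul_smul_comm, smul_comm]
        push_cast
        rfl
    rw [h1, h2, ← Finset.sum_add_distrib, Finset.smul_sum]
    refine Finset.sum_congr rfl fun z hz => ?_
    have hn := congrArg Mon.n (mem_fact.1 hz).1
    simp only [Mon.add_n] at hn
    rw [← add_smul, ← Nat.cast_add, hn]
    push_cast
    rfl)

lemma mulDt_mul_right (a b : SerRing m d) : mulDt (a * b) = a * mulDt b :=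
  val_injective (by
    classical
    obtain ⟨A, ha⟩ := a.val_mem
    obtain ⟨B, hb⟩ := b.val_mem
    have hb' : BddE B (mulDt b).val := fun κ hκ => by
      rw [val_mulDt, hb _ (by exact hκ), ite_self]
    ext1 κ
    rw [val_mulDt, val_mul, val_mul, serMul_apply ha hb']
    by_cases h : κ.Adm d
    swap
    · rw [if_neg h]
      split_ifs with hs
      · rw [serMul_apply ha hb, if_neg]
        exact fun h' => h ⟨h'.1, hs.le⟩
      · rfl
    rw [if_pos h]
    split_ifs with hs
    · rw [serMul_apply ha hb, if_pos (by exact ⟨h.1, zero_le_one⟩)]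
      refine Finset.sum_of_injOn (fun z => (z.1, { z.2 with s := 1 })) ?_ ?_ ?_ ?_
      · rintro ⟨q, ⟨e, k, n, s⟩⟩ hz ⟨q', ⟨e', k', n', s'⟩⟩ hz' h
        have h1 := congrArg Mon.s (mem_fact.1 hz).1
        have h2 := congrArg Mon.s (mem_fact.1 hz').1
        simp only [Mon.add_s, Nat.add_eq_zero_iff] at h1 h2
        simp only [Prod.mk.injEq, Mon.mk.injEq, and_true] at h ⊢
        exact ⟨h.1, h.2.1, h.2.2.1, h.2.2.2, by rw [h1.2, h2.2]⟩
      · intro z hz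
        obtain ⟨h0, h1, h2⟩ := mem_fact.1 hz
        refine mem_fact.2 ⟨?_, h1, h2⟩
        have hs' := congrArg Mon.s h0
        simp only [Mon.add_s, Nat.add_eq_zero_iff] at hs'
        ext1
        · exact (congrArg Mon.e h0 :)
        · exact (congrArg Mon.k h0 :)
        · exact (congrArg Mon.n h0 :)
        · simp only [Mon.add_s, hs'.1, hs, zero_add]
      · rintro ⟨q, ⟨e, k, n, s⟩⟩ hz hz'
        by_cases hs1 : s = 1
        · subst hs1
          refine absurd ⟨(q, ⟨e, k, n, 0⟩), ?_, rfl⟩ hz'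
          obtain ⟨h0, h1, h2⟩ := mem_fact.1 hz
          refine mem_fact.2 ⟨?_, h1, h2⟩
          have hs' := congrArg Mon.s h0
          simp only [Mon.add_s, hs] at hs'
          ext1
          · exact (congrArg Mon.e h0 :)
          · exact (congrArg Mon.k h0 :)
          · exact (congrArg Mon.n h0 :)
          · simp only [Mon.add_s]; omega
        · rw [val_mulDt, if_neg hs1, map_zero, mul_zero, smul_zero]
      · rintro ⟨q, ⟨e, k, n, s⟩⟩ hz
        have hs' := congrArg Mon.s (mem_fact.1 hz).1
        simp only [Mon.add_s, Nat.add_eq_zero_iff] at hs'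
        rw [val_mulDt, if_pos rfl]
        simp only [Mon.sign, hs'.2]
    · refine (Finset.sum_eq_zero fun z hz => ?_).symm
      rw [val_mulDt, if_neg, map_zero, mul_zero, smul_zero]
      have hs' := congrArg Mon.s (mem_fact.1 hz).1
      have := h.2
      simp only [Mon.add_s] at hs'
      omega)

lemma mulDt_mul_left (a b : SerRing m d) : mulDt a * b = mulDt (a * sgn b) :=
  val_injective (by
    classical
    obtain ⟨A, ha⟩ := a.val_mem
    obtain ⟨B, hb⟩ := b.val_mem
    have ha' : BddE A (mulDt a).val := fun κ hκ => by
      rw [val_mulDt, ha _ (by exact hκ), ite_self]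
    have hb' : BddE B (sgn b).val := fun κ hκ => by
      rw [val_sgn, serSgn, hb _ hκ, map_zero, smul_zero]
    ext1 κ
    rw [val_mulDt, val_mul, val_mul, serMul_apply ha' hb]
    by_cases h : κ.Adm d
    swap
    · rw [if_neg h]
      split_ifs with hs
      · rw [serMul_apply ha hb', if_neg]
        exact fun h' => h ⟨h'.1, hs.le⟩
      · rfl
    rw [if_pos h]
    split_ifs with hs
    · rw [serMul_apply ha hb', if_pos (by exact ⟨h.1, zero_le_one⟩)]
      refine (Finset.sum_of_injOn (fun z => ({ z.1 with s := 1 }, z.2)) ?_ ?_ ?_ ?_).symm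
      · rintro ⟨⟨e, k, n, s⟩, q⟩ hz ⟨⟨e', k', n', s'⟩, q'⟩ hz' h
        have h1 := congrArg Mon.s (mem_fact.1 hz).1
        have h2 := congrArg Mon.s (mem_fact.1 hz').1
        simp only [Mon.add_s, Nat.add_eq_zero_iff] at h1 h2
        simp only [Prod.mk.injEq, Mon.mk.injEq, and_true] at h ⊢
        exact ⟨⟨h.1.1, h.1.2.1, h.1.2.2, by rw [h1.1, h2.1]⟩, h.2⟩
      · intro z hz
        obtain ⟨h0, h1, h2⟩ := mem_fact.1 hz
        refine mem_fact.2 ⟨?_, h1, h2⟩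
        have hs' := congrArg Mon.s h0
        simp only [Mon.add_s, Nat.add_eq_zero_iff] at hs'
        ext1
        · exact (congrArg Mon.e h0 :)
        · exact (congrArg Mon.k h0 :)
        · exact (congrArg Mon.n h0 :)
        · simp only [Mon.add_s, hs'.2, hs, add_zero]
      · rintro ⟨⟨e, k, n, s⟩, q⟩ hz hz'
        by_cases hs1 : s = 1
        · subst hs1
          refine absurd ⟨(⟨e, k, n, 0⟩, q), ?_, rfl⟩ hz'
          obtain ⟨h0, h1, h2⟩ := mem_fact.1 hz
          refine mem_fact.2 ⟨?_, h1, h2⟩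
          have hs' := congrArg Mon.s h0
          simp only [Mon.add_s, hs] at hs'
          ext1
          · exact (congrArg Mon.e h0 :)
          · exact (congrArg Mon.k h0 :)
          · exact (congrArg Mon.n h0 :)
          · simp only [Mon.add_s]; omega
        · rw [val_mulDt, if_neg hs1, zero_mul, smul_zero]
      · rintro ⟨⟨e, k, n, s⟩, q⟩ hz
        have hs' := congrArg Mon.s (mem_fact.1 hz).1
        simp only [Mon.add_s, Nat.add_eq_zero_iff] at hs'
        obtain ⟨rfl, hq⟩ := hs'
        have hdeg : Mon.deg d q = ∑ j, d j * q.k j := by simp [Mon.deg, hq]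
        have hdeg1 : Mon.deg d ⟨e, k, n, 1⟩ = Mon.deg d ⟨e, k, n, 0⟩ + 1 := by simp [Mon.deg]
        have hsign : Mon.sign d ⟨e, k, n, 1⟩ q =
            Mon.sign d ⟨e, k, n, 0⟩ q * (-1) ^ Mon.deg d q := by
          rw [Mon.sign, Mon.sign, ← zpow_add₀ (by simp), hdeg]
          simp
        dsimp only
        rw [val_mulDt, if_pos rfl, val_sgn, serSgn, hsign, hdeg1, ← twist_comp_inv, map_smul,
          mul_smul_comm, smul_smul]
    · refine Finset.sum_eq_zero fun z hz => ?_
      rw [val_mulDt, if_neg, zero_mul, smul_zero]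
      have hs' := congrArg Mon.s (mem_fact.1 hz).1
      have := h.2
      simp only [Mon.add_s] at hs'
      omega)

lemma contr_simp₁ (i : Fin m) (a : SerRing m d) : contr i (simp₁ a) = -simp₁ (contr i a) :=
  val_injective (by
    ext1 κ
    have h := fun μ => congrFun (congrArg val (contr_sgn i a)) μ
    simp only [val_contr, val_sgn, map_neg, Pi.neg_apply, serContr] at h
    rw [val_contr, serContr, val_simp₁, map_neg, Pi.neg_apply, val_simp₁, val_contr]
    split_ifs
    · rw [map_neg, map_smul, h, smul_neg]
    · simp)

lemma dx_simp₁ (i : Fin m) (a : SerRing m d) : dx i (simp₁ a) = -simp₁ (dx i a) :=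
  val_injective (by
    ext1 κ
    have h := fun μ => congrFun (congrArg val (sgn_dx i a)) μ
    simp only [val_dx, val_sgn, map_neg, Pi.neg_apply] at h
    rw [val_dx, serDx, val_simp₁, map_neg, Pi.neg_apply, val_simp₁, val_dx]
    split_ifs
    · rw [h, mul_neg, mul_smul_comm, smul_neg, serDx, neg_neg]
    · simp)

lemma simp₁_eps (a : SerRing m d) : simp₁ (eps a) = eps (simp₁ a) :=
  val_injective (by
    ext1 κ
    rw [val_eps, epsMul, val_simp₁, val_simp₁]
    rfl)

lemma sgn_simp₁ (a : SerRing m d) : sgn (simp₁ a) = -simp₁ (sgn a) :=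
  val_injective (by
    ext1 κ
    rw [val_sgn, serSgn, val_simp₁, map_neg, Pi.neg_apply, val_simp₁, val_sgn]
    split_ifs with h
    · have : Mon.deg d κ = Mon.deg d { κ with n := κ.n + 1, s := 0 } + 1 := by
        simp [Mon.deg, h]
      rw [map_neg, map_smul, serSgn, serSgn, serSgn, map_smul, this,
        neg_one_zpow_add_one]
      simp only [smul_neg, neg_smul, neg_neg, smul_comm ((κ.n : ℂ) + 1)]
    · simp)

lemma simp₁_mul (a b : SerRing m d) : simp₁ (a * b) = simp₁ a * b + sgn a * simp₁ b := by
  simp only [simp₁, LinearMap.neg_apply, LinearMap.comp_apply, sgn_mul, dt_mul, map_add, neg_mul,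
    mul_neg, mulDt_mul_left, ← mulDt_mul_right, neg_add]

lemma mul_dx (i : Fin m) (a b : SerRing m d) : a * dx i b = dx i (sgn a * b) :=
  val_injective (by
    classical
    obtain ⟨A, ha⟩ := a.val_mem
    obtain ⟨B, hb⟩ := b.val_mem
    have ha' : BddE A (serSgn d a.val) := fun κ hκ => by
      rw [serSgn, ha κ hκ, map_zero, smul_zero]
    have hb' : BddE B (serDx i b.val) := fun κ hκ => by rw [serDx, hb κ hκ, mul_zero]
    ext1 κ
    simp only [val_dx, val_mul, val_sgn]
    rw [serMul_apply ha hb', serDx, serMul_apply ha' hb]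
    split_ifs
    · rw [Finset.mul_sum]
      refine Finset.sum_congr rfl fun z _ => ?_
      rw [serDx, twist_mul, twist_dx, serSgn]
      simp only [mul_smul_comm, smul_mul_assoc]
      rw [← mul_assoc, dx_mul_comm, mul_assoc]
    · rw [mul_zero])

variable (α : Fin m → Fin m → ℂ) (dα : Fin m → Fin m → Fin m → ℂ)

lemma pbr_comm {A B : ℤ} {a b : SerRing m d} (hα : ∀ i j, α j i = -α i j)
    (ha : sgn a = ((-1 : ℂ) ^ A) • a) (hb : sgn b = ((-1 : ℂ) ^ B) • b) :
    pbr α a b = ((-1 : ℂ) ^ (A * B)) • pbr α b a := by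
  have e : ∀ i j, contr i b * contr j a =
      (-1 : ℂ) ^ ((B + 1) * (A + 1)) • (contr j a * contr i b) := fun i j =>
    mul_comm_of_sgn (sgn_contr_of hb i) (sgn_contr_of ha j)
  rw [show (B + 1) * (A + 1) = A * B + A + B + 1 by ring] at e
  simp only [neg_one_zpow_add, zpow_one] at e
  rw [pbr, pbr, ← map_smul]
  congr 1
  rw [Finset.sum_comm, Finset.smul_sum]
  refine Finset.sum_congr rfl fun i _ => ?_
  rw [Finset.smul_sum]
  refine Finset.sum_congr rfl fun j _ => ?_
  rw [hα i j, ha, hb, map_smul, map_smul, smul_mul_assoc, smul_mul_assoc, e]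
  rcases neg_one_zpow_eq A with h1 | h1 <;> rcases neg_one_zpow_eq B with h2 | h2 <;>
    rcases neg_one_zpow_eq (A * B) with h3 | h3 <;> rw [h1, h2, h3] <;> module

/-- The simplex differential is a derivation of `pbr`. -/
lemma simp₁_pbr {A : ℤ} {a b : SerRing m d} (ha : sgn a = ((-1 : ℂ) ^ A) • a) :
    simp₁ (pbr α a b) = pbr α (simp₁ a) b + ((-1 : ℂ) ^ A) • pbr α a (simp₁ b) := by
  rw [pbr, pbr, pbr, ← map_smul, simp₁_eps, ← map_add, map_sum, Finset.smul_sum,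
    ← Finset.sum_add_distrib]
  congr 1
  refine Finset.sum_congr rfl fun i _ => ?_
  rw [map_sum, Finset.smul_sum, ← Finset.sum_add_distrib]
  refine Finset.sum_congr rfl fun j _ => ?_
  have h1 : sgn (contr i (sgn a)) = -contr i a := by
    rw [← neg_eq_iff_eq_neg, ← contr_sgn, sgn_sgn]
  have h2 : simp₁ (contr i (sgn a)) = contr i (sgn (simp₁ a)) := by
    rw [sgn_simp₁, map_neg, contr_simp₁, neg_neg]
  rw [map_smul, simp₁_mul, h1, h2, contr_simp₁, ha, map_smul]
  rcases neg_one_zpow_eq A with h1 | h1 <;> rw [h1] <;>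
    simp only [neg_mul, mul_neg, smul_mul_assoc] <;> module

/-- The defect of the de Rham differential to be a derivation of `pbr` is the bracket. -/
lemma dx_pbrDeriv {A : ℤ} {a b : SerRing m d} {a' b' : Fin m → SerRing m d}
    (ha : sgn a = ((-1 : ℂ) ^ A) • a) (ha' : ∀ i, sgn (a' i) = ((-1 : ℂ) ^ A) • a' i) :
    (∑ k, dx k (pbrDeriv α dα a a' b b' k)) - pbr α (∑ k, dx k (a' k)) b -
      ((-1 : ℂ) ^ A) • pbr α a (∑ k, dx k (b' k)) = ((-1 : ℂ) ^ A) • fbr α dα a a' b b' := by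
  have hca : ∀ i, sgn (contr i a) = -(((-1 : ℂ) ^ A) • contr i a) := fun i => by
    rw [sgn_contr_of ha, neg_one_zpow_add_one, neg_smul]
  have hsa := neg_one_zpow_eq A
  generalize ((-1 : ℂ) ^ A) = sa at *
  have hdd : sgn (∑ k, dx k (a' k)) = -(sa • ∑ k, dx k (a' k)) := by
    simp only [map_sum, sgn_dx, ha', map_smul, Finset.smul_sum, Finset.sum_neg_distrib]
  have hcd : ∀ i (x : Fin m → SerRing m d),
      contr i (∑ k, dx k (x k)) = x i - ∑ k, dx k (contr i (x k)) := by
    intro i x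
    simp only [map_sum, contr_dx, Finset.sum_sub_distrib]
    simp
  have h1 : (∑ k, dx k (pbrDeriv α dα a a' b b' k)) = eps (∑ i, ∑ j,
      (sa • dxPoisson dα i j (contr i a * contr j b) +
        (sa * α i j) • (∑ k, dx k (contr i (a' k) * contr j b) +
          ∑ k, dx k (contr i a * contr j (b' k))))) := by
    simp only [pbrDeriv, dx_eps, ← map_sum]
    congr 1
    simp only [map_sum]
    rw [Finset.sum_comm]
    refine Finset.sum_congr rfl fun i _ => ?_
    rw [Finset.sum_comm]
    refine Finset.sum_congr rfl fun j _ => ?_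
    rw [← Finset.sum_add_distrib, dxPoisson_apply, Finset.smul_sum, Finset.smul_sum,
      ← Finset.sum_add_distrib]
    refine Finset.sum_congr rfl fun k _ => ?_
    simp only [ha, ha', map_smul, map_add, smul_mul_assoc]
    module
  have h2 : pbr α (∑ k, dx k (a' k)) b = eps (∑ i, ∑ j, (-(sa * α i j)) •
      (a' i * contr j b - ∑ k, dx k (contr i (a' k) * contr j b))) := by
    rw [pbr]
    congr 1
    refine Finset.sum_congr rfl fun i _ => Finset.sum_congr rfl fun j _ => ?_
    rw [hdd, map_neg, map_smul, hcd]
    simp only [dx_mul, ← Finset.sum_mul, neg_mul, smul_mul_assoc, sub_mul]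
    module
  have h3 : pbr α a (∑ k, dx k (b' k)) = eps (∑ i, ∑ j, (sa * α i j) •
      (contr i a * b' j + sa • ∑ k, dx k (contr i a * contr j (b' k)))) := by
    rw [pbr]
    congr 1
    refine Finset.sum_congr rfl fun i _ => Finset.sum_congr rfl fun j _ => ?_
    rw [hcd, ha, map_smul, mul_sub, Finset.mul_sum]
    simp only [mul_dx, map_smul, hca, neg_mul, smul_mul_assoc, map_neg, Finset.sum_neg_distrib,
      ← Finset.smul_sum]
    module
  rw [h1, h2, h3, fbr, ← map_smul, ← map_sub, ← map_sub, ← map_smul]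
  congr 1
  simp only [Finset.smul_sum, ← Finset.sum_sub_distrib]
  refine Finset.sum_congr rfl fun i _ => Finset.sum_congr rfl fun j _ => ?_
  rw [ha, map_smul]
  rcases hsa with rfl | rfl <;> simp only [smul_mul_assoc, ← Finset.smul_sum] <;> module

end SerRing

end PointDifferential

/-! ### Calculus of exterior forms on `ℝ^m` -/

section Flat

open scoped ContDiff

variable {m : ℕ}

/-- The norm on `ℂ[dx¹, …, dx^m]` given by the coefficients; any norm would do, since it only
serves to differentiate forms. -/
@[reducible]
def lamNormedAddCommGroup (m : ℕ) : NormedAddCommGroup (Lam m) :=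
  NormedAddCommGroup.induced (Lam m) (Finset (Fin m) → ℂ) (lamBasis m).equivFun
    (lamBasis m).equivFun.injective

attribute [local instance] lamNormedAddCommGroup

/-- The normed space structure that belongs to `lamNormedAddCommGroup`. -/
@[reducible]
def lamNormedSpace (m : ℕ) : NormedSpace ℂ (Lam m) :=
  NormedSpace.induced ℂ (Lam m) (Finset (Fin m) → ℂ) (lamBasis m).equivFun

attribute [local instance] lamNormedSpace

lemma lam_finiteDimensional (m : ℕ) : FiniteDimensional ℂ (Lam m) :=
  (lamBasis m).finiteDimensional_of_finite

attribute [local instance] lam_finiteDimensional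

/-- A complex linear map on forms, as a continuous real linear map. -/
def lamCLM {V : Type*} [NormedAddCommGroup V] [NormedSpace ℂ V] (f : Lam m →ₗ[ℂ] V) :
    Lam m →L[ℝ] V :=
  haveI : FiniteDimensional ℝ (Lam m) := FiniteDimensional.complexToReal _
  LinearMap.toContinuousLinearMap (f.restrictScalars ℝ)

/-- The product of forms, as a continuous bilinear map. -/
def lamMul (m : ℕ) : Lam m →L[ℝ] Lam m →L[ℝ] Lam m :=
  haveI : FiniteDimensional ℝ (Lam m) := FiniteDimensional.complexToReal _
  LinearMap.toContinuousBilinearMap (LinearMap.mk₂ ℝ (fun a b : Lam m => a * b)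
    (fun a b c => add_mul a b c)
    (fun r a b => smul_mul_assoc (r : ℂ) a b)
    (fun a b c => mul_add a b c)
    (fun r a b => mul_smul_comm (r : ℂ) a b))

lemma contDiffAt_iff_coef {f : Eu m → Lam m} {y : Eu m} {n : WithTop ℕ∞} :
    ContDiffAt ℝ n f y ↔ ∀ S, ContDiffAt ℝ n (fun z => coef S (f z)) y := by
  refine ⟨fun h S => (lamCLM (coef S)).contDiff.contDiffAt.comp y h, fun h => ?_⟩
  have : f = fun z => ∑ S, coef S (f z) • lamBasis m S := by
    funext z; exact (sum_coef (f z)).symm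
  rw [this]
  exact ContDiffAt.sum fun S _ => (h S).smul contDiffAt_const

lemma pd_eq_fderiv {f : Eu m → Lam m} {y : Eu m} (hf : DifferentiableAt ℝ f y) (i : Fin m) :
    pd i f y = fderiv ℝ f y (vec i) := by
  rw [pd, ← sum_coef (fderiv ℝ f y (vec i))]
  refine Finset.sum_congr rfl fun S _ => ?_
  have := ((lamCLM (coef S)).hasFDerivAt.comp y hf.hasFDerivAt).fderiv
  rw [show (fun z => coef S (f z)) = lamCLM (coef S) ∘ f from rfl, this]
  rfl

lemma pd_congr {f h : Eu m → Lam m} {y : Eu m} (hfh : f =ᶠ[nhds y] h) (i : Fin m) :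
    pd i f y = pd i h y := by
  unfold pd
  refine Finset.sum_congr rfl fun S _ => ?_
  rw [show fderiv ℝ (fun z => coef S (f z)) y = fderiv ℝ (fun z => coef S (h z)) y from
    Filter.EventuallyEq.fderiv_eq (hfh.fun_comp (coef S))]

/-- The exterior derivative of a form on `ℝ^m`. -/
def dFlat (f : Eu m → Lam m) (y : Eu m) : Lam m := ∑ i, dx i * pd i f y

lemma dFlat_congr {f h : Eu m → Lam m} {y : Eu m} (hfh : f =ᶠ[nhds y] h) :
    dFlat f y = dFlat h y := by
  unfold dFlat
  exact Finset.sum_congr rfl fun i _ => by rw [pd_congr hfh]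

lemma dx_mul_dx (i j : Fin m) : (dx i * dx j : Lam m) = -(dx j * dx i) :=
  eq_neg_of_add_eq_zero_left (ExteriorAlgebra.ι_add_mul_swap _ _)

lemma sum_dx_dx_symm (X : Fin m → Fin m → Lam m) (hX : ∀ i j, X i j = X j i) :
    ∑ i, ∑ j, dx i * (dx j * X i j) = 0 := by
  have h : ∑ i, ∑ j, dx i * (dx j * X i j) = -∑ i, ∑ j, dx i * (dx j * X i j) := by
    conv_lhs => rw [Finset.sum_comm]
    rw [← Finset.sum_neg_distrib]
    refine Finset.sum_congr rfl fun i _ => ?_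
    rw [← Finset.sum_neg_distrib]
    refine Finset.sum_congr rfl fun j _ => ?_
    rw [hX j i, ← mul_assoc, dx_mul_dx, neg_mul, mul_assoc]
  have h2 : (2 : ℂ) • ∑ i, ∑ j, dx i * (dx j * X i j) = 0 := by
    rw [two_smul]; nth_rewrite 1 [h]; exact neg_add_cancel _
  exact (smul_eq_zero.1 h2).resolve_left two_ne_zero

lemma _root_.ContDiffAt.eventually_differentiableAt {V : Type*} [NormedAddCommGroup V]
    [NormedSpace ℝ V]
    {f : Eu m → V} {y : Eu m} (hf : ContDiffAt ℝ ∞ f y) :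
    ∀ᶠ z in nhds y, DifferentiableAt ℝ f z := by
  have h1 : ContDiffAt ℝ 1 f y := hf.of_le (by exact_mod_cast le_top)
  exact (h1.eventually (by simp)).mono fun z hz => hz.differentiableAt (by simp)

lemma _root_.ContDiffAt.fderiv_apply' {V : Type*} [NormedAddCommGroup V] [NormedSpace ℝ V]
    {f : Eu m → V} {y : Eu m} (hf : ContDiffAt ℝ ∞ f y) (v : Eu m) :
    ContDiffAt ℝ ∞ (fun z => fderiv ℝ f z v) y :=
  (hf.fderiv_right (m := ∞) (by simp)).clm_apply contDiffAt_const

lemma _root_.ContDiffAt.pd {f : Eu m → Lam m} {y : Eu m} (hf : ContDiffAt ℝ ∞ f y) (i : Fin m) :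
    ContDiffAt ℝ ∞ (ShT.pd i f) y :=
  (hf.fderiv_apply' (vec i)).congr_of_eventuallyEq
    (hf.eventually_differentiableAt.mono fun _ hz => pd_eq_fderiv hz i)

lemma _root_.ContDiffAt.lamMul {f h : Eu m → Lam m} {y : Eu m} {n : WithTop ℕ∞}
    (hf : ContDiffAt ℝ n f y)
    (hh : ContDiffAt ℝ n h y) : ContDiffAt ℝ n (fun z => f z * h z) y :=
  (ShT.lamMul m).isBoundedBilinearMap.contDiff.contDiffAt.comp y (hf.prodMk hh)

lemma _root_.ContDiffAt.lamMap {f : Eu m → Lam m} {y : Eu m} {n : WithTop ℕ∞}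
    (L : Lam m →ₗ[ℂ] Lam m)
    (hf : ContDiffAt ℝ n f y) : ContDiffAt ℝ n (fun z => L (f z)) y :=
  (lamCLM L).contDiff.contDiffAt.comp y hf

lemma _root_.ContDiffAt.dFlat {f : Eu m → Lam m} {y : Eu m} (hf : ContDiffAt ℝ ∞ f y) :
    ContDiffAt ℝ ∞ (ShT.dFlat f) y :=
  ContDiffAt.sum fun i _ => contDiffAt_const.lamMul (hf.pd i)

lemma pd_lamMul {f h : Eu m → Lam m} {y : Eu m} (hf : DifferentiableAt ℝ f y)
    (hh : DifferentiableAt ℝ h y) (i : Fin m) :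
    pd i (fun z => f z * h z) y = pd i f y * h y + f y * pd i h y := by
  have H := (ShT.lamMul m).hasFDerivAt_of_bilinear hf.hasFDerivAt hh.hasFDerivAt
  have H' : HasFDerivAt (fun z => f z * h z) _ y := H
  rw [pd_eq_fderiv H'.differentiableAt, H'.fderiv, pd_eq_fderiv hf, pd_eq_fderiv hh, add_comm]
  rfl

lemma pd_lamMap {f : Eu m → Lam m} {y : Eu m} (L : Lam m →ₗ[ℂ] Lam m)
    (hf : DifferentiableAt ℝ f y) (i : Fin m) : pd i (fun z => L (f z)) y = L (pd i f y) := by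
  have H : HasFDerivAt (fun z => L (f z)) _ y := (lamCLM L).hasFDerivAt.comp y hf.hasFDerivAt
  rw [pd_eq_fderiv H.differentiableAt, H.fderiv, pd_eq_fderiv hf]
  rfl

lemma pd_smul {u : Eu m → ℂ} {f : Eu m → Lam m} {y : Eu m} (hu : DifferentiableAt ℝ u y)
    (hf : DifferentiableAt ℝ f y) (i : Fin m) :
    pd i (fun z => u z • f z) y = fderiv ℝ u y (vec i) • f y + u y • pd i f y := by
  have H : HasFDerivAt (fun z => u z • f z) _ y := hu.hasFDerivAt.smul hf.hasFDerivAt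
  rw [pd_eq_fderiv H.differentiableAt, H.fderiv, pd_eq_fderiv hf, add_comm]
  rfl

lemma pd_sum {ι : Type*} {s : Finset ι} {f : ι → Eu m → Lam m} {y : Eu m}
    (hf : ∀ k ∈ s, DifferentiableAt ℝ (f k) y) (i : Fin m) :
    pd i (fun z => ∑ k ∈ s, f k z) y = ∑ k ∈ s, pd i (f k) y := by
  have H : HasFDerivAt (fun z => ∑ k ∈ s, f k z) _ y :=
    HasFDerivAt.fun_sum fun k hk => (hf k hk).hasFDerivAt
  rw [pd_eq_fderiv H.differentiableAt, H.fderiv, sum_apply]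
  exact Finset.sum_congr rfl fun k hk => (pd_eq_fderiv (hf k hk) i).symm

lemma pd_const (c : Lam m) (y : Eu m) (i : Fin m) : pd i (fun _ => c) y = 0 := by
  simp [pd]

lemma _root_.ContDiffAt.differentiableAt' {V : Type*} [NormedAddCommGroup V] [NormedSpace ℝ V]
    {f : Eu m → V} {y : Eu m} (hf : ContDiffAt ℝ ∞ f y) : DifferentiableAt ℝ f y :=
  hf.differentiableAt (by simp)

lemma dFlat_sum {ι : Type*} {s : Finset ι} {f : ι → Eu m → Lam m} {y : Eu m}
    (hf : ∀ k ∈ s, DifferentiableAt ℝ (f k) y) :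
    dFlat (fun z => ∑ k ∈ s, f k z) y = ∑ k ∈ s, dFlat (f k) y := by
  simp only [dFlat, pd_sum hf, Finset.mul_sum]
  exact Finset.sum_comm

lemma snd_fderiv_symm {V : Type*} [NormedAddCommGroup V] [NormedSpace ℝ V]
    {f : Eu m → V} {y : Eu m} (hf : ContDiffAt ℝ ∞ f y) (v w : Eu m) :
    fderiv ℝ (fun z => fderiv ℝ f z v) y w = fderiv ℝ (fun z => fderiv ℝ f z w) y v := by
  have h1 : DifferentiableAt ℝ (fderiv ℝ f) y :=
    (hf.fderiv_right (m := ∞) (by simp)).differentiableAt'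
  have h2 : IsSymmSndFDerivAt ℝ f y := hf.isSymmSndFDerivAt (by
    simp only [minSmoothness_of_isRCLikeNormedField]
    exact WithTop.coe_le_coe.2 (show (2 : ℕ∞) ≤ ⊤ from le_top))
  rw [fderiv_clm_apply h1 (differentiableAt_const _), fderiv_clm_apply h1
      (differentiableAt_const _)]
  simpa using h2.eq w v

lemma pd_pd_symm {f : Eu m → Lam m} {y : Eu m} (hf : ContDiffAt ℝ ∞ f y) (i j : Fin m) :
    pd i (pd j f) y = pd j (pd i f) y := by
  have h : ∀ k, pd k f =ᶠ[nhds y] fun z => fderiv ℝ f z (vec k) := fun k =>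
    hf.eventually_differentiableAt.mono fun _ hz => pd_eq_fderiv hz k
  rw [pd_eq_fderiv (hf.pd j).differentiableAt', pd_eq_fderiv (hf.pd i).differentiableAt',
    (h i).fderiv_eq, (h j).fderiv_eq, snd_fderiv_symm hf]

lemma pd_dFlat {f : Eu m → Lam m} {y : Eu m} (hf : ContDiffAt ℝ ∞ f y) (i : Fin m) :
    pd i (dFlat f) y = ∑ j, dx j * pd i (pd j f) y := by
  have h1 : ∀ j ∈ Finset.univ, DifferentiableAt ℝ (fun z => dx j * pd j f z) y := fun j _ =>
    (contDiffAt_const.lamMul (hf.pd j)).differentiableAt'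
  rw [show dFlat f = fun z => ∑ j, dx j * pd j f z from rfl, pd_sum h1]
  refine Finset.sum_congr rfl fun j _ => ?_
  rw [pd_lamMul (differentiableAt_const _) (hf.pd j).differentiableAt', pd_const, zero_mul,
      zero_add]

lemma dFlat_dFlat {f : Eu m → Lam m} {y : Eu m} (hf : ContDiffAt ℝ ∞ f y) :
    dFlat (dFlat f) y = 0 := by
  rw [dFlat]
  simp only [pd_dFlat hf, Finset.mul_sum]
  exact sum_dx_dx_symm _ fun i j => pd_pd_symm hf i j

/-- The pullback of a constant form is smooth and closed. -/
lemma pullLam_fderiv_const {φ : Eu m → Eu m} {y : Eu m} (hφ : ContDiffAt ℝ ∞ φ y) (c : Lam m) :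
    ContDiffAt ℝ ∞ (fun z => pullLam (fderiv ℝ φ z) c) y ∧
      dFlat (fun z => pullLam (fderiv ℝ φ z) c) y = 0 := by
  induction c using Lam.induction with
  | h1 r =>
    simp only [AlgHom.commutes]
    exact ⟨contDiffAt_const, by simp [dFlat, pd_const]⟩
  | hadd a b ha hb =>
    simp only [map_add]
    refine ⟨ha.1.add hb.1, ?_⟩
    have h := dFlat_sum (s := Finset.univ)
      (f := fun k : Bool => fun z => pullLam (fderiv ℝ φ z) (if k then a else b)) (y := y)
      (fun k _ => by cases k; exacts [hb.1.differentiableAt', ha.1.differentiableAt'])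
    simp only [Fintype.univ_bool, Finset.mem_singleton, Bool.true_eq_false, not_false_eq_true,
      Finset.sum_insert, if_true, Finset.sum_singleton, Bool.false_eq_true, if_false, ha.2,
      hb.2, add_zero] at h
    exact h
  | hmul v c hc =>
    -- the pullback of the constant one-form `v`
    set β : Eu m → Lam m := fun z => ∑ j,
      (∑ i, ((fderiv ℝ φ z (vec j) i : ℝ) : ℂ) * v i) • dx j with hβ
    have hpull : ∀ z, pullLam (fderiv ℝ φ z) (ExteriorAlgebra.ι ℂ v) = β z := by
      intro z
      rw [pullLam_ι, hβ]
      simp only [dx, ← map_smul, ← map_sum]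
      congr 1
      ext j
      simp [Pi.single_apply]
    have hb : ∀ j i, ContDiffAt ℝ ∞ (fun z => ((fderiv ℝ φ z (vec j) i : ℝ) : ℂ) * v i) y := by
      intro j i
      have h1 := hφ.fderiv_apply' (vec j)
      have h2 : ContDiffAt ℝ ∞ (fun z => fderiv ℝ φ z (vec j) i) y :=
        (EuclideanSpace.proj (𝕜 := ℝ) i).contDiff.contDiffAt.comp y h1
      exact (Complex.ofRealCLM.contDiff.contDiffAt.comp y h2).mul contDiffAt_const
    have hbs : ∀ j, ContDiffAt ℝ ∞
        (fun z => ∑ i, ((fderiv ℝ φ z (vec j) i : ℝ) : ℂ) * v i) y := fun j =>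
      ContDiffAt.sum fun i _ => hb j i
    have hβs : ContDiffAt ℝ ∞ β y := ContDiffAt.sum fun j _ =>
      (hbs j).smul (contDiffAt_const (c := (dx j : Lam m)))
    have hβd : dFlat β y = 0 := by
      have h1 : ∀ k, pd k β y = ∑ j, dx j * algebraMap ℂ (Lam m)
          (fderiv ℝ (fun z => ∑ i, ((fderiv ℝ φ z (vec j) i : ℝ) : ℂ) * v i) y (vec k)) := by
        intro k
        rw [hβ, pd_sum (f := fun j z => (∑ i, ((fderiv ℝ φ z (vec j) i : ℝ) : ℂ) * v i) •
          (dx j : Lam m)) fun j _ => ((hbs j).smul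
            (contDiffAt_const (c := (dx j : Lam m)))).differentiableAt']
        refine Finset.sum_congr rfl fun j _ => ?_
        rw [pd_smul (hbs j).differentiableAt' (differentiableAt_const _), pd_const, smul_zero,
          add_zero, Algebra.smul_def, Algebra.commutes]
      rw [dFlat]
      simp only [h1, Finset.mul_sum]
      refine sum_dx_dx_symm _ fun k j => ?_
      congr 1
      have h2 : ∀ a b : Fin m,
          fderiv ℝ (fun z => ∑ i, ((fderiv ℝ φ z (vec a) i : ℝ) : ℂ) * v i) y (vec b) =
          ∑ i, ((fderiv ℝ (fun z => fderiv ℝ φ z (vec a)) y (vec b) i : ℝ) : ℂ) * v i := by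
        intro a b
        rw [fderiv_fun_sum fun i _ => (hb a i).differentiableAt', sum_apply]
        refine Finset.sum_congr rfl fun i _ => ?_
        have h3 : HasFDerivAt (fun z => ((fderiv ℝ φ z (vec a) i : ℝ) : ℂ)) _ y :=
          Complex.ofRealCLM.hasFDerivAt.comp y
            ((EuclideanSpace.proj (𝕜 := ℝ) i).hasFDerivAt.comp y
              (hφ.fderiv_apply' (vec a)).differentiableAt'.hasFDerivAt)
        rw [(h3.mul_const (v i)).fderiv]
        simp [mul_comm]
      rw [h2, h2]
      refine Finset.sum_congr rfl fun i _ => ?_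
      rw [snd_fderiv_symm hφ]
    simp only [map_mul, hpull]
    refine ⟨hβs.lamMul hc.1, ?_⟩
    have hinv : ∀ x, β y * (dx x) = -(dx x * β y) := by
      intro x
      rw [dx_mul_comm, ← hpull, ← pullLam_inv, inv_ι, map_neg, mul_neg]
    have h0 := hc.2
    rw [dFlat] at hβd h0 ⊢
    simp only [pd_lamMul hβs.differentiableAt' hc.1.differentiableAt', mul_add, ← mul_assoc,
      Finset.sum_add_distrib, ← Finset.sum_mul, hβd, zero_mul, zero_add]
    have h1 : ∀ x, dx x * β y = -(β y * dx x) := fun x => by rw [hinv, neg_neg]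
    simp only [h1, neg_mul, mul_assoc, Finset.sum_neg_distrib, ← Finset.mul_sum, h0, mul_zero,
      neg_zero]

/-- The exterior derivative commutes with the pullback by a smooth map. -/
lemma dFlat_pullLam {φ : Eu m → Eu m} {θ : Eu m → Lam m} {y : Eu m} (hφ : ContDiffAt ℝ ∞ φ y)
    (hθ : ContDiffAt ℝ ∞ θ (φ y)) :
    ContDiffAt ℝ ∞ (fun z => pullLam (fderiv ℝ φ z) (θ (φ z))) y ∧
    dFlat (fun z => pullLam (fderiv ℝ φ z) (θ (φ z))) y =
      pullLam (fderiv ℝ φ y) (dFlat θ (φ y)) := by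
  have hS : ∀ S, ContDiffAt ℝ ∞ (fun z => coef S (θ (φ z))) y := fun S =>
    ((contDiffAt_iff_coef.1 hθ S).comp y hφ)
  have hH := fun S : Finset (Fin m) => pullLam_fderiv_const hφ (lamBasis m S)
  have hexp : (fun z => pullLam (fderiv ℝ φ z) (θ (φ z))) = fun z => ∑ S,
      coef S (θ (φ z)) • pullLam (fderiv ℝ φ z) (lamBasis m S) := by
    funext z
    conv_lhs => rw [← sum_coef (θ (φ z))]
    simp only [map_sum, map_smul]
  have hsm : ∀ S, ContDiffAt ℝ ∞
      (fun z => coef S (θ (φ z)) • pullLam (fderiv ℝ φ z) (lamBasis m S)) y := fun S =>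
    (hS S).smul (hH S).1
  rw [hexp]
  refine ⟨ContDiffAt.sum fun S _ => hsm S, ?_⟩
  rw [dFlat_sum fun S _ => (hsm S).differentiableAt']
  have hterm : ∀ S, dFlat (fun z => coef S (θ (φ z)) • pullLam (fderiv ℝ φ z) (lamBasis m S)) y =
      ∑ i, pullLam (fderiv ℝ φ y) (dx i) *
        (fderiv ℝ (fun z => coef S (θ z)) (φ y) (vec i) •
          pullLam (fderiv ℝ φ y) (lamBasis m S)) := by
    intro S
    have h0 := (hH S).2
    rw [dFlat] at h0 ⊢
    simp only [pd_smul (hS S).differentiableAt' (hH S).1.differentiableAt', mul_add, mul_smul_comm,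
      Finset.sum_add_distrib, ← Finset.smul_sum, h0, smul_zero, add_zero, pullLam_dx,
      Finset.sum_mul, smul_mul_assoc]
    simp only [Finset.smul_sum]
    rw [Finset.sum_comm]
    refine Finset.sum_congr rfl fun j _ => ?_
    have hcomp : fderiv ℝ (fun z => coef S (θ (φ z))) y = (fderiv ℝ (fun z => coef S (θ z))
        (φ y)).comp (fderiv ℝ φ y) :=
      fderiv_comp y (contDiffAt_iff_coef.1 hθ S).differentiableAt' hφ.differentiableAt'
    have hvec : fderiv ℝ φ y (vec j) = ∑ i, (fderiv ℝ φ y (vec j) i) • vec i := by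
      conv_lhs => rw [← (EuclideanSpace.basisFun (Fin m) ℝ).sum_repr (fderiv ℝ φ y (vec j))]
      simp
    rw [hcomp, ContinuousLinearMap.comp_apply]
    nth_rewrite 1 [hvec]
    rw [map_sum, Finset.sum_smul]
    refine Finset.sum_congr rfl fun i _ => ?_
    rw [map_smul, smul_smul, Complex.real_smul, mul_comm]
  simp only [hterm]
  rw [dFlat, map_sum, Finset.sum_comm]
  refine Finset.sum_congr rfl fun i _ => ?_
  rw [map_mul, pd, map_sum, Finset.mul_sum]
  simp only [map_smul]

end Flat

/-! ### Forms in local coordinates -/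

section Local

open scoped ContDiff

attribute [local instance] lamNormedAddCommGroup lamNormedSpace lam_finiteDimensional

variable {m : ℕ} {M : Type*} [TopologicalSpace M] [ChartedSpace (EuclideanSpace ℝ (Fin m)) M]

section Charts

variable [IsManifold (𝓡 m) ∞ M]

lemma contDiffAt_transition (x₀ p : M) {y : Eu m} (hy : y ∈ (chartAt (Eu m) x₀).target)
    (hp : (chartAt (Eu m) x₀).symm y ∈ (chartAt (Eu m) p).source) :
    ContDiffAt ℝ ∞ (chartAt (Eu m) p ∘ (chartAt (Eu m) x₀).symm) y := by
  have h := (𝓡 m).contDiffWithinAt_extendCoordChange (n := ∞)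
    (IsManifold.chart_mem_maximalAtlas x₀) (IsManifold.chart_mem_maximalAtlas p) (x := y) (by
      rw [ModelWithCorners.extendCoordChange_source]
      exact ⟨y, ⟨hy, hp⟩, rfl⟩)
  rw [ModelWithCorners.range_eq_univ, contDiffWithinAt_univ] at h
  exact h

lemma jac_eq_comp (x₀ p : M) {y : Eu m} (hy : y ∈ (chartAt (Eu m) x₀).target)
    (hp : (chartAt (Eu m) x₀).symm y ∈ (chartAt (Eu m) p).source) :
    jac x₀ y = (jac p ((chartAt (Eu m) p ∘ (chartAt (Eu m) x₀).symm) y)).comp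
      (fderiv ℝ (chartAt (Eu m) p ∘ (chartAt (Eu m) x₀).symm) y) := by
  have hq : (chartAt (Eu m) p).symm ((chartAt (Eu m) p ∘ (chartAt (Eu m) x₀).symm) y) =
      (chartAt (Eu m) x₀).symm y := (chartAt (Eu m) p).left_inv hp
  set q := (chartAt (Eu m) x₀).symm y with hqdef
  have h1 := contDiffAt_transition x₀ p hy hp
  have h2 : ContDiffAt ℝ ∞ (chartAt (Eu m) q ∘ (chartAt (Eu m) p).symm)
      ((chartAt (Eu m) p ∘ (chartAt (Eu m) x₀).symm) y) := by
    refine contDiffAt_transition p q ((chartAt (Eu m) p).map_source hp) ?_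
    rw [hq]; exact mem_chart_source _ q
  rw [jac, jac, hq, ← fderiv_comp y h2.differentiableAt' h1.differentiableAt']
  refine Filter.EventuallyEq.fderiv_eq ?_
  have hev : ∀ᶠ z in nhds y, (chartAt (Eu m) x₀).symm z ∈ (chartAt (Eu m) p).source :=
    ((chartAt (Eu m) x₀).continuousAt_symm hy).eventually
      ((chartAt (Eu m) p).open_source.mem_nhds hp)
  filter_upwards [hev] with z hz
  simp only [Function.comp_apply, (chartAt (Eu m) p).left_inv hz]
  rfl

lemma loc_eq_pullLam (x₀ p : M) (f : M → Lam m) {y : Eu m} (hy : y ∈ (chartAt (Eu m) x₀).target)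
    (hp : (chartAt (Eu m) x₀).symm y ∈ (chartAt (Eu m) p).source) :
    loc x₀ f y = pullLam (fderiv ℝ (chartAt (Eu m) p ∘ (chartAt (Eu m) x₀).symm) y)
      (loc p f ((chartAt (Eu m) p ∘ (chartAt (Eu m) x₀).symm) y)) := by
  rw [loc, jac_eq_comp x₀ p hy hp, pullLam_comp, loc]
  simp only [Function.comp_apply, (chartAt (Eu m) p).left_inv hp]

end Charts

lemma jac_self (x : M) : jac x (chartAt (Eu m) x x) = ContinuousLinearMap.id ℝ (Eu m) := by
  have hx : (chartAt (Eu m) x).symm (chartAt (Eu m) x x) = x :=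
    (chartAt (Eu m) x).left_inv (mem_chart_source _ x)
  rw [jac, hx, ← fderiv_id]
  refine Filter.EventuallyEq.fderiv_eq ?_
  filter_upwards [(chartAt (Eu m) x).open_target.mem_nhds (mem_chart_target _ x)] with z hz
  exact (chartAt (Eu m) x).right_inv hz

lemma loc_self (x : M) (f : M → Lam m) : loc x f (chartAt (Eu m) x x) = f x := by
  rw [loc, jac_self, pullLam_id, (chartAt (Eu m) x).left_inv (mem_chart_source _ x)]

lemma isSmoothForm_iff {f : M → Lam m} : IsSmoothForm f ↔
    ∀ x₀ : M, ∀ y ∈ (chartAt (Eu m) x₀).target, ContDiffAt ℝ ∞ (loc x₀ f) y := by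
  refine ⟨fun h x₀ y hy => contDiffAt_iff_coef.2 fun S =>
    (h x₀ S).contDiffAt ((chartAt (Eu m) x₀).open_target.mem_nhds hy), fun h x₀ S y hy => ?_⟩
  exact (contDiffAt_iff_coef.1 (h x₀ y hy) S).contDiffWithinAt

lemma IsSmoothForm.contDiffAt {f : M → Lam m} (hf : IsSmoothForm f) (x : M) :
    ContDiffAt ℝ ∞ (loc x f) (chartAt (Eu m) x x) :=
  isSmoothForm_iff.1 hf x _ (mem_chart_target _ x)

lemma isSmoothForm_zero : IsSmoothForm (0 : M → Lam m) := by
  intro x₀ S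
  simp [loc, contDiffOn_const]

lemma IsSmoothForm.add {f h : M → Lam m} (hf : IsSmoothForm f) (hh : IsSmoothForm h) :
    IsSmoothForm (f + h) := fun x₀ S => by
  simpa only [loc_add, map_add] using (hf x₀ S).add (hh x₀ S)

lemma IsSmoothForm.smul {f : M → Lam m} (c : ℂ) (hf : IsSmoothForm f) : IsSmoothForm (c • f) :=
  fun x₀ S => by simpa only [loc_smul, map_smul] using (hf x₀ S).const_smul c

lemma IsSmoothForm.sum {ι : Type*} {s : Finset ι} {f : ι → M → Lam m}
    (hf : ∀ k ∈ s, IsSmoothForm (f k)) : IsSmoothForm (∑ k ∈ s, f k) := by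
  classical
  induction s using Finset.induction_on with
  | empty => simpa using isSmoothForm_zero
  | insert k s hk ih =>
    rw [Finset.sum_insert hk]
    exact (hf k (Finset.mem_insert_self _ _)).add
      (ih fun j hj => hf j (Finset.mem_insert_of_mem hj))

/-- The linear operator `T` on exterior forms commutes with pullbacks. -/
def PullCommutes (T : Lam m →ₗ[ℂ] Lam m) : Prop :=
  ∀ (J : Eu m →L[ℝ] Eu m) x, pullLam J (T x) = T (pullLam J x)

lemma pullCommutes_inv : PullCommutes (inv (m := m)).toLinearMap := fun J x => pullLam_inv J x

lemma pullCommutes_twist (r : ℤ) : PullCommutes (twist (m := m) r) := fun J x => pullLam_twist J r x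

lemma PullCommutes.loc {T : Lam m →ₗ[ℂ] Lam m} (hT : PullCommutes T) (x₀ : M) (f : M → Lam m) :
    loc x₀ (fun x => T (f x)) = fun y => T (loc x₀ f y) := by
  funext y; exact hT _ _

lemma IsSmoothForm.pullCommutes {T : Lam m →ₗ[ℂ] Lam m} {f : M → Lam m} (hf : IsSmoothForm f)
    (hT : PullCommutes T) : IsSmoothForm fun x => T (f x) :=
  isSmoothForm_iff.2 fun x₀ y hy => by
    rw [hT.loc]; exact (isSmoothForm_iff.1 hf x₀ y hy).lamMap T

lemma PullCommutes.pdAt {T : Lam m →ₗ[ℂ] Lam m} (hT : PullCommutes T) {f : M → Lam m}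
    (hf : IsSmoothForm f) (x : M) (i : Fin m) :
    pdAt x i (fun x => T (f x)) = T (pdAt x i f) := by
  rw [ShT.pdAt, hT.loc, pd_lamMap T (hf.contDiffAt x).differentiableAt', ShT.pdAt]

lemma pdAt_zero (x : M) (i : Fin m) : pdAt x i (0 : M → Lam m) = 0 := by
  rw [pdAt, show loc x (0 : M → Lam m) = fun _ => 0 by funext y; simp [loc], pd_const]

lemma pdAt_add {f h : M → Lam m} (hf : IsSmoothForm f) (hh : IsSmoothForm h) (x : M) (i : Fin m) :
    pdAt x i (f + h) = pdAt x i f + pdAt x i h := by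
  have H : HasFDerivAt (fun z => loc x f z + loc x h z) _ _ :=
    (hf.contDiffAt x).differentiableAt'.hasFDerivAt.add
      (hh.contDiffAt x).differentiableAt'.hasFDerivAt
  rw [pdAt, show loc x (f + h) = fun z => loc x f z + loc x h z from
      funext fun _ => loc_add _ _ _ _,
    pd_eq_fderiv H.differentiableAt, H.fderiv, pdAt, pdAt,
    pd_eq_fderiv (hf.contDiffAt x).differentiableAt',
    pd_eq_fderiv (hh.contDiffAt x).differentiableAt']
  rfl

lemma pdAt_smul (c : ℂ) {f : M → Lam m} (hf : IsSmoothForm f) (x : M) (i : Fin m) :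
    pdAt x i (c • f) = c • pdAt x i f := by
  rw [pdAt, show loc x (c • f) = fun z => (fun _ => c) z • loc x f z from
    funext fun _ => loc_smul _ _ _ _,
    pd_smul (differentiableAt_const _) (hf.contDiffAt x).differentiableAt']
  simp [pdAt]

lemma pdAt_sum {ι : Type*} {s : Finset ι} {f : ι → M → Lam m}
    (hf : ∀ k ∈ s, IsSmoothForm (f k)) (x : M) (i : Fin m) :
    pdAt x i (∑ k ∈ s, f k) = ∑ k ∈ s, pdAt x i (f k) := by
  classical
  induction s using Finset.induction_on with
  | empty => simpa using pdAt_zero x i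
  | insert k s hk ih =>
    have h := fun j hj => hf j (Finset.mem_insert_of_mem hj)
    rw [Finset.sum_insert hk, Finset.sum_insert hk, ← ih h,
      pdAt_add (hf k (Finset.mem_insert_self _ _)) (IsSmoothForm.sum h)]

lemma SuppIn.pdAt {R : ℕ → Prop} {f : M → Lam m} (hf : ∀ x, SuppIn R (f x)) (x : M) (i : Fin m) :
    SuppIn R (pdAt x i f) := by
  intro S hS
  have h0 : (fun z => coef S (loc x f z)) = fun _ => 0 := funext fun z => (hf _).pullLam _ S hS
  have h1 : ∀ T, coef S (lamBasis m T) = if T = S then 1 else 0 := fun T => by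
    simp [coef, Module.Basis.coord_apply, Finsupp.single_apply]
  rw [ShT.pdAt, pd, map_sum]
  refine Finset.sum_eq_zero fun T _ => ?_
  rw [map_smul, h1]
  split_ifs with hT
  · subst hT; rw [h0]; simp
  · simp

/-- The de Rham differential of a field of exterior forms. -/
def dForm (f : M → Lam m) (x : M) : Lam m := ∑ i, dx i * pdAt x i f

lemma dForm_eq (f : M → Lam m) (x : M) : dForm f x = dFlat (loc x f) (chartAt (Eu m) x x) := rfl

lemma SuppIn.dForm {R R' : ℕ → Prop} {f : M → Lam m} (hf : ∀ x, SuppIn R (f x)) (x : M)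
    (h : ∀ q, R q → R' (q + 1)) : SuppIn R' (dForm f x) :=
  SuppIn.sum fun i _ => (SuppIn.pdAt hf x i).dx_mul i h

lemma dForm_add {f h : M → Lam m} (hf : IsSmoothForm f) (hh : IsSmoothForm h) :
    dForm (f + h) = dForm f + dForm h := by
  funext x
  simp only [dForm, pdAt_add hf hh, mul_add, Finset.sum_add_distrib, Pi.add_apply]

lemma dForm_smul (c : ℂ) {f : M → Lam m} (hf : IsSmoothForm f) :
    dForm (c • f) = c • dForm f := by
  funext x
  simp only [dForm, pdAt_smul c hf, mul_smul_comm, Finset.smul_sum, Pi.smul_apply]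

lemma dForm_zero : dForm (0 : M → Lam m) = 0 := by
  funext x; simp [dForm, pdAt_zero]

variable [IsManifold (𝓡 m) ∞ M]

/-- The differential has the same expression in all coordinates. -/
lemma loc_dForm {f : M → Lam m} (hf : IsSmoothForm f) (x₀ : M) {y : Eu m}
    (hy : y ∈ (chartAt (Eu m) x₀).target) : loc x₀ (dForm f) y = dFlat (loc x₀ f) y := by
  set q := (chartAt (Eu m) x₀).symm y with hq
  set φ := chartAt (Eu m) q ∘ (chartAt (Eu m) x₀).symm with hφ
  have hsrc : (chartAt (Eu m) x₀).symm y ∈ (chartAt (Eu m) q).source := mem_chart_source _ q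
  have h1 : ContDiffAt ℝ ∞ φ y := contDiffAt_transition x₀ q hy hsrc
  have h2 := (dFlat_pullLam h1 (hf.contDiffAt q)).2
  have hev : ∀ᶠ z in nhds y, (chartAt (Eu m) x₀).symm z ∈ (chartAt (Eu m) q).source :=
    ((chartAt (Eu m) x₀).continuousAt_symm hy).eventually
      ((chartAt (Eu m) q).open_source.mem_nhds hsrc)
  have hcongr : loc x₀ f =ᶠ[nhds y] fun z => pullLam (fderiv ℝ φ z) (loc q f (φ z)) := by
    filter_upwards [hev, (chartAt (Eu m) x₀).open_target.mem_nhds hy] with z hz hz'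
    exact loc_eq_pullLam x₀ q f hz' hz
  rw [dFlat_congr hcongr]
  exact h2.symm

lemma IsSmoothForm.dForm {f : M → Lam m} (hf : IsSmoothForm f) : IsSmoothForm (dForm f) :=
  isSmoothForm_iff.2 fun x₀ y hy =>
      (isSmoothForm_iff.1 hf x₀ y hy).dFlat.congr_of_eventuallyEq <| by
    filter_upwards [(chartAt (Eu m) x₀).open_target.mem_nhds hy] with z hz
    exact loc_dForm hf x₀ hz

lemma dForm_dForm {f : M → Lam m} (hf : IsSmoothForm f) : dForm (dForm f) = 0 := by
  funext x
  rw [dForm_eq, Pi.zero_apply, ← dFlat_dFlat (hf.contDiffAt x)]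
  refine dFlat_congr ?_
  filter_upwards [(chartAt (Eu m) x).open_target.mem_nhds (mem_chart_target _ x)] with z hz
  exact loc_dForm hf x hz

end Local

/-! ### The Poisson structure of a symplectic form -/

section Poisson

open scoped ContDiff

attribute [local instance] lamNormedAddCommGroup lamNormedSpace lam_finiteDimensional

variable {m : ℕ} {M : Type*} [TopologicalSpace M] [ChartedSpace (EuclideanSpace ℝ (Fin m)) M]

lemma eu_sum_vec (u : Eu m) : ∑ i, u i • vec i = u := by
  conv_rhs => rw [← (EuclideanSpace.basisFun (Fin m) ℝ).sum_repr u]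
  simp

lemma alt₂_swap (θ : Eu m [⋀^Fin 2]→L[ℝ] ℝ) (u w : Eu m) : θ ![w, u] = -θ ![u, w] := by
  have h := θ.toAlternatingMap.map_swap (![u, w]) (i := 0) (j := 1) (by decide)
  have h' : (![u, w] ∘ Equiv.swap (0 : Fin 2) 1) = ![w, u] := by
    funext i; fin_cases i <;> simp
  rw [h'] at h
  exact h

lemma alt₂_expand (θ : Eu m [⋀^Fin 2]→L[ℝ] ℝ) (u w : Eu m) :
    θ ![u, w] = ∑ a, ∑ b, u a * w b * θ ![vec a, vec b] := by
  have hl : ∀ u w : Eu m, θ ![u, w] = ∑ a, u a * θ ![vec a, w] := by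
    intro u w
    let F : Eu m →ₗ[ℝ] ℝ :=
      { toFun := fun u => θ ![u, w]
        map_add' := fun x y => θ.vecCons_add ![w] x y
        map_smul' := fun c x => θ.vecCons_smul ![w] c x }
    change F u = ∑ a, u a * F (vec a)
    conv_lhs => rw [← eu_sum_vec u]
    simp
  rw [hl]
  refine Finset.sum_congr rfl fun a _ => ?_
  rw [alt₂_swap, hl, ← Finset.sum_neg_distrib, Finset.mul_sum]
  refine Finset.sum_congr rfl fun b _ => ?_
  rw [alt₂_swap θ (vec a)]
  ring

/-- The matrix of the symplectic form in the coordinates of the chart at `x₀`. -/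
def SymplecticForm.mat (σ : SymplecticForm m M) (x₀ : M) (y : Eu m) : Matrix (Fin m) (Fin m) ℝ :=
  Matrix.of fun i j => loc₂ x₀ σ.form y ![vec i, vec j]

/-- The Jacobian matrix `jac x₀ y`. -/
def jacMat (x₀ : M) (y : Eu m) : Matrix (Fin m) (Fin m) ℝ := Matrix.of fun a i => jac x₀ y (vec i) a

namespace SymplecticForm

variable (σ : SymplecticForm m M)

lemma poisson_eq (x₀ : M) (y : Eu m) : σ.poisson x₀ y = (σ.mat x₀ y)⁻¹ := rfl

lemma mat_apply (x₀ : M) (y : Eu m) (i j : Fin m) :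
    σ.mat x₀ y i j = loc₂ x₀ σ.form y ![vec i, vec j] := rfl

lemma mat_transpose (x₀ : M) (y : Eu m) : (σ.mat x₀ y).transpose = -σ.mat x₀ y := by
  ext i j
  exact alt₂_swap (loc₂ x₀ σ.form y) (vec i) (vec j)

lemma loc₂_self (x : M) : loc₂ x σ.form (chartAt (Eu m) x x) = σ.form x := by
  rw [loc₂, jac_self, (chartAt (Eu m) x).left_inv (mem_chart_source _ x)]
  ext v
  rfl

lemma det_mat_self (x : M) : (σ.mat x (chartAt (Eu m) x x)).det ≠ 0 := by
  intro h
  obtain ⟨v, hv, hv0⟩ := Matrix.exists_vecMul_eq_zero_iff.2 h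
  refine hv ?_
  have h0 := σ.nondegenerate x (WithLp.toLp 2 v) fun w => by
    rw [alt₂_expand, Finset.sum_comm]
    refine Finset.sum_eq_zero fun b _ => ?_
    have := congrFun hv0 b
    simp only [Matrix.vecMul, dotProduct, mat_apply, loc₂_self, Pi.zero_apply] at this
    calc _ = w b * ∑ a, v a * σ.form x ![vec a, vec b] := by
          rw [Finset.mul_sum]
          exact Finset.sum_congr rfl fun a _ => by ring
      _ = 0 := by rw [this, mul_zero]
  funext i
  exact congrFun (congrArg WithLp.ofLp h0) i

lemma mat_eq (x₀ : M) (y : Eu m) :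
    σ.mat x₀ y = (jacMat x₀ y).transpose *
      σ.mat ((chartAt (Eu m) x₀).symm y)
          (chartAt (Eu m) ((chartAt (Eu m) x₀).symm y) ((chartAt (Eu m) x₀).symm y)) *
        jacMat x₀ y := by
  ext i j
  rw [mat_apply, loc₂]
  have h : ((σ.form ((chartAt (Eu m) x₀).symm y)).compContinuousLinearMap (jac x₀ y))
      ![vec i, vec j] = σ.form
          ((chartAt (Eu m) x₀).symm y) ![jac x₀ y (vec i), jac x₀ y (vec j)] := by
    rw [ContinuousAlternatingMap.compContinuousLinearMap_apply]
    congr 1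
    funext k; fin_cases k <;> rfl
  rw [h, alt₂_expand, Matrix.mul_apply, Finset.sum_comm]
  refine Finset.sum_congr rfl fun b _ => ?_
  rw [Matrix.mul_apply, Finset.sum_mul]
  refine Finset.sum_congr rfl fun a _ => ?_
  rw [mat_apply, loc₂_self, Matrix.transpose_apply, jacMat, Matrix.of_apply, Matrix.of_apply]
  ring

lemma contDiffAt_mat {x₀ : M} {y : Eu m} (hy : y ∈ (chartAt (Eu m) x₀).target) (i j : Fin m) :
    ContDiffAt ℝ ∞ (fun z => σ.mat x₀ z i j) y := by
  have h := (σ.smooth x₀).contDiffAt ((chartAt (Eu m) x₀).open_target.mem_nhds hy)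
  let E : (Eu m [⋀^Fin 2]→L[ℝ] ℝ) →L[ℝ] ℝ := ContinuousAlternatingMap.apply ℝ
      (Eu m) ℝ ![vec i, vec j]
  exact E.contDiff.contDiffAt.comp y h

lemma contDiffAt_det {B : Eu m → Matrix (Fin m) (Fin m) ℝ} {y : Eu m}
    (hB : ∀ i j, ContDiffAt ℝ ∞ (fun z => B z i j) y) : ContDiffAt ℝ ∞ (fun z => (B z).det) y := by
  simp only [Matrix.det_apply']
  exact ContDiffAt.sum fun τ _ => contDiffAt_const.mul (contDiffAt_prod fun i _ => hB _ _)

section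

variable [IsManifold (𝓡 m) ∞ M]

lemma det_jacMat {x₀ : M} {y : Eu m} (hy : y ∈ (chartAt (Eu m) x₀).target) :
    IsUnit (jacMat x₀ y).det := by
  set q := (chartAt (Eu m) x₀).symm y with hq
  have hq1 : (chartAt (Eu m) q).symm (chartAt (Eu m) q q) = q :=
    (chartAt (Eu m) q).left_inv (mem_chart_source _ q)
  have hqs : q ∈ (chartAt (Eu m) x₀).source := (chartAt (Eu m) x₀).map_target hy
  have h := jac_eq_comp q x₀ (mem_chart_target _ q) (by rw [hq1]; exact hqs)
  rw [jac_self] at h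
  simp only [Function.comp_apply, hq1] at h
  rw [show chartAt (Eu m) x₀ q = y from (chartAt (Eu m) x₀).right_inv hy] at h
  set K := fderiv ℝ (chartAt (Eu m) x₀ ∘ (chartAt (Eu m) q).symm) (chartAt (Eu m) q q) with hK
  have hmul : jacMat x₀ y * Matrix.of (fun a i => K (vec i) a) = 1 := by
    ext a i
    have h1 := congrArg (fun v : Eu m => v a) (DFunLike.congr_fun h (vec i))
    simp only [ContinuousLinearMap.id_apply, ContinuousLinearMap.comp_apply] at h1
    rw [← eu_sum_vec (K (vec i)), map_sum] at h1
    simp only [map_smul] at h1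
    rw [Matrix.mul_apply]
    simp only [jacMat, Matrix.of_apply]
    have h2 : (∑ b, K (vec i) b • jac x₀ y (vec b)) a = ∑ b, jac x₀ y (vec b) a * K (vec i) b := by
      rw [WithLp.ofLp_sum, Finset.sum_apply]
      exact Finset.sum_congr rfl fun b _ => by simp [mul_comm]
    rw [← h2, ← h1]
    simp [Matrix.one_apply]
  exact Matrix.isUnit_det_of_right_inverse hmul

lemma det_mat {x₀ : M} {y : Eu m} (hy : y ∈ (chartAt (Eu m) x₀).target) :
    (σ.mat x₀ y).det ≠ 0 := by
  rw [mat_eq, Matrix.det_mul, Matrix.det_mul, Matrix.det_transpose]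
  exact mul_ne_zero (mul_ne_zero (det_jacMat hy).ne_zero (σ.det_mat_self _)) (det_jacMat hy).ne_zero

/-- The transformation of the Poisson structure under a change of coordinates. -/
lemma poissonAt_symm {x₀ : M} {y : Eu m} (hy : y ∈ (chartAt (Eu m) x₀).target) (a b : Fin m) :
    σ.poissonAt ((chartAt (Eu m) x₀).symm y) a b =
      ∑ i, ∑ j, jac x₀ y (vec i) a * jac x₀ y (vec j) b * σ.poisson x₀ y i j := by
  have hN := det_jacMat hy
  have h : σ.poisson ((chartAt (Eu m) x₀).symm y)
      (chartAt (Eu m) ((chartAt (Eu m) x₀).symm y) ((chartAt (Eu m) x₀).symm y)) =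
      jacMat x₀ y * σ.poisson x₀ y * (jacMat x₀ y).transpose := by
    rw [poisson_eq, poisson_eq, mat_eq σ x₀ y, Matrix.mul_inv_rev, Matrix.mul_inv_rev,
      Matrix.mul_nonsing_inv_cancel_left _ _ hN, Matrix.nonsing_inv_mul_cancel_right]
    rwa [Matrix.det_transpose]
  rw [poissonAt, h, Matrix.mul_apply, Finset.sum_comm]
  refine Finset.sum_congr rfl fun j _ => ?_
  rw [Matrix.mul_apply, Finset.sum_mul]
  refine Finset.sum_congr rfl fun i _ => ?_
  rw [Matrix.transpose_apply, jacMat, Matrix.of_apply, Matrix.of_apply]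
  ring

lemma contDiffAt_poisson {x₀ : M} {y : Eu m} (hy : y ∈ (chartAt (Eu m) x₀).target) (i j : Fin m) :
    ContDiffAt ℝ ∞ (fun z => σ.poisson x₀ z i j) y := by
  have h : ∀ z, σ.poisson x₀ z i j =
      (σ.mat x₀ z).det⁻¹ * ((σ.mat x₀ z).updateRow j (Pi.single i 1)).det := fun z => by
    rw [poisson_eq, Matrix.inv_def, Ring.inverse_eq_inv', Matrix.smul_apply, Matrix.adjugate_apply,
      smul_eq_mul]
  simp only [h]
  refine ((contDiffAt_det (σ.contDiffAt_mat hy)).inv (σ.det_mat hy)).mul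
      (contDiffAt_det fun a b => ?_)
  by_cases hj : a = j
  · subst hj; simpa using contDiffAt_const
  · simpa [Matrix.updateRow_ne hj] using σ.contDiffAt_mat hy a b

end

lemma poisson_antisymm (x₀ : M) (y : Eu m) (i j : Fin m) :
    σ.poisson x₀ y j i = -σ.poisson x₀ y i j := by
  have h : (σ.poisson x₀ y).transpose = -σ.poisson x₀ y := by
    rw [poisson_eq, Matrix.transpose_nonsing_inv, mat_transpose]
    by_cases hu : IsUnit (σ.mat x₀ y).det
    · exact Matrix.inv_eq_right_inv (by rw [neg_mul_neg, Matrix.mul_nonsing_inv _ hu])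
    · rw [Matrix.nonsing_inv_apply_not_isUnit _ hu, Matrix.nonsing_inv_apply_not_isUnit, neg_zero]
      rw [Matrix.det_neg, IsUnit.mul_iff]
      exact fun h => hu h.2
  exact congrFun (congrFun h i) j

lemma poissonAt_antisymm (x : M) (i j : Fin m) : σ.poissonAt x j i = -σ.poissonAt x i j :=
  σ.poisson_antisymm _ _ _ _

lemma dpoissonAt_antisymm (x : M) (k i j : Fin m) :
    σ.dpoissonAt x k j i = -σ.dpoissonAt x k i j := by
  rw [dpoissonAt, show (fun y => σ.poisson x y j i) = fun y => -σ.poisson x y i j from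
    funext fun y => σ.poisson_antisymm _ _ _ _, fderiv_fun_neg]
  rfl

/-- The closedness of the symplectic form in local coordinates. -/
lemma mat_cyclic (x : M) (i j k : Fin m) :
    fderiv ℝ (fun y => σ.mat x y j k) (chartAt (Eu m) x x) (vec i) +
      fderiv ℝ (fun y => σ.mat x y k i) (chartAt (Eu m) x x) (vec j) +
        fderiv ℝ (fun y => σ.mat x y i j) (chartAt (Eu m) x x) (vec k) = 0 := by
  have hd : DifferentiableAt ℝ (loc₂ x σ.form) (chartAt (Eu m) x x) :=
    ((σ.smooth x).contDiffAt ((chartAt (Eu m) x).open_target.mem_nhds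
      (mem_chart_target _ x))).differentiableAt'
  have h := extDeriv_apply hd ![vec i, vec j, vec k]
  rw [σ.closed x, Fin.sum_univ_three] at h
  have h0 : Fin.removeNth 0 ![vec i, vec j, vec k] = ![vec j, vec k] := by
    funext l; fin_cases l <;> rfl
  have h1 : Fin.removeNth 1 ![vec i, vec j, vec k] = ![vec i, vec k] := by
    funext l; fin_cases l <;> rfl
  have h2 : Fin.removeNth 2 ![vec i, vec j, vec k] = ![vec i, vec j] := by
    funext l; fin_cases l <;> rfl
  rw [h0, h1, h2] at h
  have h3 : (fun y => σ.mat x y k i) = fun y => -loc₂ x σ.form y ![vec i, vec k] :=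
    funext fun y => alt₂_swap (loc₂ x σ.form y) _ _
  rw [h3, fderiv_fun_neg]
  simp only [mat_apply]
  simp at h
  simp
  linarith

section

variable [IsManifold (𝓡 m) ∞ M]

/-- The derivative of the inverse matrix. -/
lemma dpoissonAt_eq (x : M) (k i j : Fin m) :
    σ.dpoissonAt x k i j = ∑ p, ∑ q, σ.poissonAt x p i * σ.poissonAt x q j *
      fderiv ℝ (fun y => σ.mat x y p q) (chartAt (Eu m) x x) (vec k) := by
  have hx := mem_chart_target (Eu m) x
  set y₀ := chartAt (Eu m) x x with hy₀
  set W : Matrix (Fin m) (Fin m) ℝ :=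
    Matrix.of fun p q => fderiv ℝ (fun y => σ.mat x y p q) y₀ (vec k) with hW
  have hu : IsUnit (σ.mat x y₀).det := (σ.det_mat hx).isUnit
  have h1 : Matrix.of (fun i j => σ.dpoissonAt x k i j) * σ.mat x y₀ = -(σ.poisson x y₀ * W) := by
    ext a b
    have hev : (fun z => ∑ p, σ.poisson x z a p * σ.mat x z p b) =ᶠ[nhds y₀]
        fun _ => (1 : Matrix (Fin m) (Fin m) ℝ) a b := by
      filter_upwards [(chartAt (Eu m) x).open_target.mem_nhds hx] with z hz
      rw [← Matrix.mul_apply, poisson_eq, Matrix.nonsing_inv_mul _ (σ.det_mat hz).isUnit]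
    have hder := congrArg (fun L : Eu m →L[ℝ] ℝ => L (vec k)) hev.fderiv_eq
    have H : HasFDerivAt (fun z => ∑ p, σ.poisson x z a p * σ.mat x z p b) _ y₀ :=
      HasFDerivAt.fun_sum fun p _ =>
        (σ.contDiffAt_poisson hx a p).differentiableAt'.hasFDerivAt.mul
          (σ.contDiffAt_mat hx p b).differentiableAt'.hasFDerivAt
    simp only [H.fderiv, fderiv_fun_const] at hder
    rw [eq_comm, Matrix.neg_apply, neg_eq_iff_add_eq_zero, Matrix.mul_apply, Matrix.mul_apply,
      ← Finset.sum_add_distrib]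
    rw [_root_.sum_apply] at hder
    refine Eq.trans (Finset.sum_congr rfl fun p _ => ?_) hder
    simp [hW, dpoissonAt, ← hy₀]
    ring
  have h2 : Matrix.of (fun i j => σ.dpoissonAt x k i j) =
      -(σ.poisson x y₀ * W * σ.poisson x y₀) := by
    rw [← neg_mul, ← h1, poisson_eq, Matrix.mul_nonsing_inv_cancel_right _ _ hu]
  have h3 := congrFun (congrFun h2 i) j
  rw [Matrix.of_apply] at h3
  rw [h3, Matrix.neg_apply, Matrix.mul_apply, Finset.sum_comm, ← Finset.sum_neg_distrib]
  refine Finset.sum_congr rfl fun q _ => ?_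
  rw [Matrix.mul_apply, Finset.sum_mul, ← Finset.sum_neg_distrib]
  refine Finset.sum_congr rfl fun p _ => ?_
  rw [σ.poissonAt_antisymm x i p, hW, Matrix.of_apply, poissonAt, poissonAt, ← hy₀]
  ring

lemma sum_rotate (f : Fin m → Fin m → Fin m → ℝ) :
    ∑ l, ∑ p, ∑ q, f l p q = ∑ l, ∑ p, ∑ q, f p q l := by
  conv_rhs => rw [Finset.sum_comm]
  exact Finset.sum_congr rfl fun p _ => Finset.sum_comm

/-- The Jacobi identity of the Poisson structure. -/
lemma poisson_jacobi (x : M) (i j k : Fin m) :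
    ∑ l, (σ.poissonAt x l i * σ.dpoissonAt x l j k + σ.poissonAt x l j * σ.dpoissonAt x l k i +
      σ.poissonAt x l k * σ.dpoissonAt x l i j) = 0 := by
  simp only [dpoissonAt_eq, Finset.mul_sum, Finset.sum_add_distrib]
  rw [sum_rotate (fun l p q => σ.poissonAt x l j * _), ← sum_rotate (fun p q l =>
    σ.poissonAt x l k * (σ.poissonAt x p i * σ.poissonAt x q j *
      fderiv ℝ (fun y => σ.mat x y p q) (chartAt (Eu m) x x) (vec l)))]
  simp only [← Finset.sum_add_distrib]
  refine Finset.sum_eq_zero fun l _ => Finset.sum_eq_zero fun p _ =>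
    Finset.sum_eq_zero fun q _ => ?_
  linear_combination σ.poissonAt x l i * σ.poissonAt x p j * σ.poissonAt x q k *
    σ.mat_cyclic x l p q

end

/-- The contraction `α^{ij} ∂f/∂dxⁱ ∂h/∂dx^j` of two fields of exterior forms. -/
def poissonForm (f h : M → Lam m) (x : M) : Lam m :=
  ∑ i, ∑ j, (σ.poissonAt x i j : ℂ) • (contr i (f x) * contr j (h x))

lemma sum_comm₄ (f : Fin m → Fin m → Fin m → Fin m → Lam m) :
    ∑ i, ∑ j, ∑ a, ∑ b, f i j a b = ∑ a, ∑ b, ∑ i, ∑ j, f i j a b := by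
  calc _ = ∑ i, ∑ a, ∑ j, ∑ b, f i j a b := Finset.sum_congr rfl fun _ _ => Finset.sum_comm
    _ = ∑ a, ∑ i, ∑ j, ∑ b, f i j a b := Finset.sum_comm
    _ = ∑ a, ∑ i, ∑ b, ∑ j, f i j a b := Finset.sum_congr rfl fun _ _ =>
        Finset.sum_congr rfl fun _ _ => Finset.sum_comm
    _ = _ := Finset.sum_congr rfl fun _ _ => Finset.sum_comm

lemma poissonForm_suppIn {R R' R'' : ℕ → Prop} {f h : M → Lam m} {x : M} (hf : SuppIn R (f x))
    (hh : SuppIn R' (h x)) (hR : ∀ p q, R (p + 1) → R' (q + 1) → R'' (p + q)) :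
    SuppIn R'' (σ.poissonForm f h x) :=
  SuppIn.sum fun i _ => SuppIn.sum fun j _ => SuppIn.smul _ <|
    SuppIn.mul (R := fun p => R (p + 1)) (R' := fun q => R' (q + 1)) (hf.contr i fun _ h => h)
      (hh.contr j fun _ h => h) hR

variable [IsManifold (𝓡 m) ∞ M]

/-- The contraction has the same expression in all coordinates. -/
lemma loc_poissonForm (f h : M → Lam m) (x₀ : M) {y : Eu m} (hy : y ∈ (chartAt (Eu m) x₀).target) :
    loc x₀ (σ.poissonForm f h) y =
      ∑ i, ∑ j, (σ.poisson x₀ y i j : ℂ) • (contr i (loc x₀ f y) * contr j (loc x₀ h y)) := by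
  simp only [loc, poissonForm, map_sum, map_smul, map_mul, contr_pullLam, σ.poissonAt_symm hy,
    Finset.sum_mul, Finset.mul_sum, Complex.ofReal_sum, Finset.sum_smul, Finset.smul_sum]
  rw [sum_comm₄]
  refine Finset.sum_congr rfl fun i _ => Finset.sum_congr rfl fun j _ => ?_
  rw [Finset.sum_comm]
  refine Finset.sum_congr rfl fun a _ => Finset.sum_congr rfl fun b _ => ?_
  rw [smul_mul_smul_comm, smul_smul]
  congr 1
  push_cast
  ring

lemma contDiffAt_poissonC {x₀ : M} {y : Eu m} (hy : y ∈ (chartAt (Eu m) x₀).target) (i j : Fin m) :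
    ContDiffAt ℝ ∞ (fun z => (σ.poisson x₀ z i j : ℂ)) y :=
  Complex.ofRealCLM.contDiff.contDiffAt.comp y (σ.contDiffAt_poisson hy i j)

lemma isSmoothForm_poissonForm {f h : M → Lam m} (hf : IsSmoothForm f) (hh : IsSmoothForm h) :
    IsSmoothForm (σ.poissonForm f h) :=
  isSmoothForm_iff.2 fun x₀ y hy => ContDiffAt.congr_of_eventuallyEq
    (f := fun y => ∑ i, ∑ j, (σ.poisson x₀ y i j : ℂ) •
      (contr i (loc x₀ f y) * contr j (loc x₀ h y)))
    (ContDiffAt.sum fun i _ => ContDiffAt.sum fun j _ => (σ.contDiffAt_poissonC hy i j).smul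
      (((isSmoothForm_iff.1 hf x₀ y hy).lamMap _).lamMul
          ((isSmoothForm_iff.1 hh x₀ y hy).lamMap _)))
    (by
      filter_upwards [(chartAt (Eu m) x₀).open_target.mem_nhds hy] with z hz
      exact σ.loc_poissonForm f h x₀ hz)

lemma pdAt_poissonForm {f h : M → Lam m} (hf : IsSmoothForm f) (hh : IsSmoothForm h) (x : M)
    (k : Fin m) : pdAt x k (σ.poissonForm f h) =
      ∑ i, ∑ j, ((σ.dpoissonAt x k i j : ℂ) • (contr i (f x) * contr j (h x)) +
        (σ.poissonAt x i j : ℂ) • (contr i (pdAt x k f) * contr j (h x) +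
          contr i (f x) * contr j (pdAt x k h))) := by
  have hx := mem_chart_target (Eu m) x
  have hev : loc x (σ.poissonForm f h) =ᶠ[nhds (chartAt (Eu m) x x)]
      fun y => ∑ i, ∑ j, (σ.poisson x y i j : ℂ) • (contr i (loc x f y) * contr j (loc x h y)) := by
    filter_upwards [(chartAt (Eu m) x).open_target.mem_nhds hx] with z hz
    exact σ.loc_poissonForm f h x hz
  have hf' := (hf.contDiffAt x)
  have hh' := (hh.contDiffAt x)
  have hm : ∀ i j, ContDiffAt ℝ ∞ (fun y => contr i (loc x f y) * contr j (loc x h y))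
      (chartAt (Eu m) x x) := fun i j => (hf'.lamMap _).lamMul (hh'.lamMap _)
  have hs : ∀ i j, ContDiffAt ℝ ∞ (fun y => (σ.poisson x y i j : ℂ) •
      (contr i (loc x f y) * contr j (loc x h y))) (chartAt (Eu m) x x) := fun i j =>
    (σ.contDiffAt_poissonC hx i j).smul (hm i j)
  rw [pdAt, pd_congr hev, pd_sum fun i _ =>
    (ContDiffAt.sum fun j _ => hs i j).differentiableAt']
  refine Finset.sum_congr rfl fun i _ => ?_
  rw [pd_sum fun j _ => (hs i j).differentiableAt']
  refine Finset.sum_congr rfl fun j _ => ?_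
  have hα : fderiv ℝ (fun z => (σ.poisson x z i j : ℂ)) (chartAt (Eu m) x x) (vec k) =
      (σ.dpoissonAt x k i j : ℂ) := by
    have H := Complex.ofRealCLM.hasFDerivAt.comp (chartAt (Eu m) x x)
      (σ.contDiffAt_poisson hx i j).differentiableAt'.hasFDerivAt
    rw [show (fun z => (σ.poisson x z i j : ℂ)) = Complex.ofRealCLM ∘ fun z => σ.poisson x z i j
      from rfl, H.fderiv]
    rfl
  rw [pd_smul (σ.contDiffAt_poissonC hx i j).differentiableAt' (hm i j).differentiableAt', hα,
    pd_lamMul (hf'.lamMap _).differentiableAt' (hh'.lamMap _).differentiableAt',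
    pd_lamMap _ hf'.differentiableAt', pd_lamMap _ hh'.differentiableAt', loc_self, loc_self]
  rfl

end SymplecticForm

end Poisson

/-! ### Operations on series of forms -/

section FieldSeries

open scoped ContDiff

variable {g m : ℕ} {M : Type*} [TopologicalSpace M] [ChartedSpace (EuclideanSpace ℝ (Fin m)) M]

variable (g m M) in
/-- The series of smooth forms in which the exponents of `ε` are bounded below. -/
def fieldSub : Submodule ℂ (Ser g m M) where
  carrier := {η | (∀ κ, IsSmoothForm (η κ)) ∧ ∃ N : ℤ, ∀ κ : Mon g, κ.e < N → η κ = 0}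
  zero_mem' := ⟨fun _ => isSmoothForm_zero, 0, fun _ _ => rfl⟩
  add_mem' := by
    rintro η ξ ⟨h1, N, h2⟩ ⟨h1', N', h2'⟩
    refine ⟨fun κ => (h1 κ).add (h1' κ), min N N', fun κ hκ => ?_⟩
    rw [Pi.add_apply, h2 κ (lt_of_lt_of_le hκ (min_le_left _ _)),
      h2' κ (lt_of_lt_of_le hκ (min_le_right _ _)), add_zero]
  smul_mem' := by
    rintro c η ⟨h1, N, h2⟩
    exact ⟨fun κ => (h1 κ).smul c, N, fun κ hκ => by rw [Pi.smul_apply, h2 κ hκ, smul_zero]⟩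

lemma fieldSub_smooth (η : fieldSub g m M) (κ : Mon g) : IsSmoothForm (η.1 κ) := η.2.1 κ

/-- The value of a series at a point. -/
def valAt (d : Fin g → ℤ) (x : M) : fieldSub g m M →ₗ[ℂ] SerRing m d where
  toFun η := SerRing.mk d (Ser.value η.1 x) (by
    obtain ⟨N, hN⟩ := η.2.2
    exact ⟨N, fun κ hκ => by rw [Ser.value, hN κ hκ]; rfl⟩)
  map_add' _ _ := SerRing.val_injective rfl
  map_smul' _ _ := SerRing.val_injective rfl

/-- The value at a point of a partial derivative of a series. -/
def pdVal (d : Fin g → ℤ) (x : M) (k : Fin m) : fieldSub g m M →ₗ[ℂ] SerRing m d where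
  toFun η := SerRing.mk d (Ser.pdAt k η.1 x) (by
    obtain ⟨N, hN⟩ := η.2.2
    exact ⟨N, fun κ hκ => by rw [Ser.pdAt, hN κ hκ, pdAt_zero]⟩)
  map_add' η ξ := SerRing.val_injective (by
    funext κ; exact pdAt_add (fieldSub_smooth η κ) (fieldSub_smooth ξ κ) x k)
  map_smul' c η := SerRing.val_injective (by
    funext κ; exact pdAt_smul c (fieldSub_smooth η κ) x k)

variable {d : Fin g → ℤ}

@[simp] lemma val_valAt (x : M) (η : fieldSub g m M) : (valAt d x η).val = Ser.value η.1 x := rfl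

@[simp] lemma val_pdVal (x : M) (k : Fin m) (η : fieldSub g m M) :
    (pdVal d x k η).val = Ser.pdAt k η.1 x := rfl

variable (d) in
lemma fieldSub_ext {η ξ : fieldSub g m M} (h : ∀ x, valAt d x η = valAt d x ξ) : η = ξ := by
  ext κ x
  exact congrFun (congrArg SerRing.val (h x)) κ

section Exterior

variable [IsManifold (𝓡 m) ∞ M]

/-- The de Rham differential of series. -/
def dField : fieldSub g m M →ₗ[ℂ] fieldSub g m M where
  toFun η := ⟨fun κ => dForm (η.1 κ), fun κ => (fieldSub_smooth η κ).dForm, by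
    obtain ⟨N, hN⟩ := η.2.2
    exact ⟨N, fun κ hκ => by dsimp only; rw [hN κ hκ, dForm_zero]⟩⟩
  map_add' η ξ := Subtype.ext <| funext fun κ => dForm_add (fieldSub_smooth η κ)
      (fieldSub_smooth ξ κ)
  map_smul' c η := Subtype.ext <| funext fun κ => dForm_smul c (fieldSub_smooth η κ)

lemma coe_dField (η : fieldSub g m M) : (dField η).1 = deRham η.1 := by
  funext κ x
  simp [dField, deRham, dForm, serDx, Ser.pdAt, Finset.sum_apply]

lemma valAt_dField (x : M) (η : fieldSub g m M) :
    valAt d x (dField η) = ∑ k, SerRing.dx k (pdVal d x k η) :=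
  SerRing.val_injective (by
    rw [val_valAt, coe_dField, map_sum]
    rfl)

lemma dField_dField (η : fieldSub g m M) : dField (dField η) = 0 :=
  Subtype.ext <| funext fun κ => dForm_dForm (fieldSub_smooth η κ)

end Exterior

/-- The monomial `κ` with `dt` replaced by `t`. -/
abbrev Mon.dtToT (κ : Mon g) : Mon g := { κ with n := κ.n + 1, s := 0 }

omit [TopologicalSpace M] [ChartedSpace (EuclideanSpace ℝ (Fin m)) M] in
lemma simplexD_apply (η : Ser g m M) (κ : Mon g) : simplexD d η κ = if κ.s = 1 then
    (-(((κ.n : ℂ) + 1) * (-1) ^ (κ.dtToT.deg d))) • fun x => inv (η κ.dtToT x) else 0 := by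
  funext x
  by_cases h : κ.s = 1
  · rw [simplexD, if_pos h, if_pos h, Pi.smul_apply, neg_smul, mul_smul]
    rfl
  · rw [simplexD, if_neg h, if_neg h]
    rfl

lemma IsSmoothForm.inv {f : M → Lam m} (hf : IsSmoothForm f) :
    IsSmoothForm fun x => ShT.inv (f x) := by
  have h := hf.pullCommutes pullCommutes_inv
  simp only [AlgHom.toLinearMap_apply] at h
  exact h

lemma pdAt_inv {f : M → Lam m} (hf : IsSmoothForm f) (x : M) (k : Fin m) :
    pdAt x k (fun x => inv (f x)) = inv (pdAt x k f) := by
  have h := pullCommutes_inv.pdAt hf x k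
  simp only [AlgHom.toLinearMap_apply] at h
  exact h

variable (d) in
/-- The differential of the simplex, on series of forms. -/
def sField : fieldSub g m M →ₗ[ℂ] fieldSub g m M where
  toFun η := ⟨simplexD d η.1, fun κ => by
    rw [simplexD_apply]
    split_ifs
    · exact (fieldSub_smooth η _).inv.smul _
    · exact isSmoothForm_zero, by
    obtain ⟨N, hN⟩ := η.2.2
    refine ⟨N, fun κ hκ => ?_⟩
    rw [simplexD_apply, hN κ.dtToT hκ]
    split_ifs
    · funext x; simp
    · rfl⟩
  map_add' η ξ := Subtype.ext <| funext fun κ => by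
    simp only [Submodule.coe_add, Pi.add_apply, simplexD_apply]
    split_ifs
    · funext x; simp only [Pi.smul_apply, Pi.add_apply, map_add, smul_add]
    · simp
  map_smul' c η := Subtype.ext <| funext fun κ => by
    simp only [Submodule.coe_smul, Pi.smul_apply, simplexD_apply, RingHom.id_apply]
    split_ifs
    · funext x; simp only [Pi.smul_apply, map_smul, smul_comm c]
    · simp

lemma coe_sField (η : fieldSub g m M) : (sField d η).1 = simplexD d η.1 := rfl

lemma valAt_sField (x : M) (η : fieldSub g m M) :
    valAt d x (sField d η) = SerRing.simp₁ (valAt d x η) :=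
  SerRing.val_injective (by
    funext κ
    rw [SerRing.val_simp₁]
    rfl)

lemma pdVal_sField (x : M) (k : Fin m) (η : fieldSub g m M) :
    pdVal d x k (sField d η) = SerRing.simp₁ (pdVal d x k η) :=
  SerRing.val_injective (by
    funext κ
    rw [SerRing.val_simp₁, val_pdVal, Ser.pdAt, coe_sField, simplexD_apply]
    split_ifs
    · rw [pdAt_smul _ (fieldSub_smooth η _).inv, pdAt_inv (fieldSub_smooth η _), neg_smul, mul_smul]
      rfl
    · exact pdAt_zero x k)

lemma sField_sField (η : fieldSub g m M) : sField d (sField d η) = 0 :=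
  Subtype.ext <| funext fun κ => funext fun x => by
    rw [coe_sField, coe_sField]
    simp [simplexD, serSgn, Ser.value]

lemma dField_sField [IsManifold (𝓡 m) ∞ M] (η : fieldSub g m M) :
    dField (sField d η) = -sField d (dField η) :=
  fieldSub_ext d fun x => by
    rw [valAt_dField, map_neg, valAt_sField, valAt_dField, map_sum, ← Finset.sum_neg_distrib]
    exact Finset.sum_congr rfl fun k _ => by rw [pdVal_sField, SerRing.dx_simp₁]

section Contraction

variable (σ : SymplecticForm m M)

/-- The components of the Poisson structure at a point, as complex numbers. -/
abbrev SymplecticForm.alpha (x : M) (i j : Fin m) : ℂ := σ.poissonAt x i j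

/-- The partial derivatives of the Poisson structure at a point, as complex numbers. -/
abbrev SymplecticForm.dalpha (x : M) (k i j : Fin m) : ℂ := σ.dpoissonAt x k i j

lemma serMul_contr_contr {N N' : ℤ} {a b : PtSer g m} (ha : BddE N a) (hb : BddE N' b)
    (i j : Fin m) (κ : Mon g) [Decidable (κ.Adm d)] :
    serMul d (serContr i (serSgn d a)) (serContr j b) κ =
      if κ.Adm d then ∑ z ∈ fact N N' κ, Mon.sign d z.1 z.2 •
        (contr i (inv (a z.1)) * contr j (twist (z.1.deg d) (b z.2))) else 0 := by
  have ha' : BddE N (serContr i (serSgn d a)) := fun κ hκ => by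
    simp [serContr, serSgn, ha κ hκ]
  have hb' : BddE N' (serContr j b) := fun κ hκ => by simp [serContr, hb κ hκ]
  rw [serMul_apply ha' hb']
  split_ifs
  · refine Finset.sum_congr rfl fun z _ => ?_
    rw [serContr, serSgn, serContr, map_smul, contr_twist, smul_mul_assoc, mul_smul_comm]
  · rfl

/-- The monomial divided by `ε`. -/
abbrev Mon.divEps (κ : Mon g) : Mon g := { κ with e := κ.e - 1 }

omit [TopologicalSpace M] [ChartedSpace (EuclideanSpace ℝ (Fin m)) M] in
lemma bddE_value {η : Ser g m M} {N : ℤ} (hη : ∀ κ : Mon g, κ.e < N → η κ = 0) (x : M) :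
    BddE N (η.value x) := fun κ hκ => by rw [Ser.value, hη κ hκ]; rfl

lemma bddE_pdAt {η : Ser g m M} {N : ℤ} (hη : ∀ κ : Mon g, κ.e < N → η κ = 0) (x : M)
    (k : Fin m) : BddE N (Ser.pdAt k η x) := fun κ hκ => by rw [Ser.pdAt, hη κ hκ, pdAt_zero]

/-- The coefficients of `poissonContr` as finite sums of contractions of forms. -/
lemma poissonContr_apply {η ξ : Ser g m M} {N N' : ℤ} (hη : ∀ κ : Mon g, κ.e < N → η κ = 0)
    (hξ : ∀ κ : Mon g, κ.e < N' → ξ κ = 0) (κ : Mon g) [Decidable (κ.divEps.Adm d)] :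
    poissonContr σ d η ξ κ = if κ.divEps.Adm d then
      ∑ z ∈ fact N N' κ.divEps, Mon.sign d z.1 z.2 •
        σ.poissonForm (fun x => inv (η z.1 x)) (fun x => twist (z.1.deg d) (ξ z.2 x)) else 0 := by
  funext x
  have h : poissonContr σ d η ξ κ x = ∑ i, ∑ j, (σ.alpha x i j) •
      serMul d (serContr i (serSgn d (η.value x))) (serContr j (ξ.value x)) κ.divEps := by
    simp only [poissonContr, epsMul, Finset.sum_apply, Pi.smul_apply, real_smul_eq]
  rw [h]
  simp only [serMul_contr_contr (bddE_value hη x) (bddE_value hξ x)]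
  split_ifs
  · simp only [Finset.sum_apply, Pi.smul_apply, SymplecticForm.poissonForm, Finset.smul_sum]
    rw [Finset.sum_comm' (s := fact N N' κ.divEps) (t := fun _ => Finset.univ)
      (t' := Finset.univ) (s' := fun _ => fact N N' κ.divEps) (by simp)]
    refine Finset.sum_congr rfl fun i _ => ?_
    rw [Finset.sum_comm]
    exact Finset.sum_congr rfl fun z _ => Finset.sum_congr rfl fun j _ => smul_comm _ _ _
  · simp only [smul_zero, Finset.sum_const_zero, Pi.zero_apply]

lemma poissonContr_mem [IsManifold (𝓡 m) ∞ M] (η ξ : fieldSub g m M) :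
    poissonContr σ d η.1 ξ.1 ∈ fieldSub g m M := by
  classical
  obtain ⟨N, hN⟩ := η.2.2
  obtain ⟨N', hN'⟩ := ξ.2.2
  refine ⟨fun κ => ?_, N + N' + 1, fun κ hκ => ?_⟩
  · rw [poissonContr_apply σ hN hN']
    split_ifs
    · exact IsSmoothForm.sum fun z _ => (σ.isSmoothForm_poissonForm (fieldSub_smooth η _).inv
        ((fieldSub_smooth ξ _).pullCommutes (pullCommutes_twist _))).smul _
    · exact isSmoothForm_zero
  · rw [poissonContr_apply σ hN hN']
    split_ifs
    · refine Finset.sum_eq_zero fun z hz => ?_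
      obtain ⟨h1, h2, h3⟩ := mem_fact.1 hz
      have h4 : z.1.e + z.2.e = κ.e - 1 := congrArg Mon.e h1
      omega
    · rfl

lemma value_poissonContr (x : M) (η ξ : fieldSub g m M) :
    Ser.value (poissonContr σ d η.1 ξ.1) x =
      (SerRing.pbr (σ.alpha x) (valAt d x η) (valAt d x ξ)).val := by
  funext κ
  simp only [Ser.value, poissonContr, SerRing.pbr, SerRing.val_eps, epsMul, map_sum, map_smul,
    Finset.sum_apply, Pi.smul_apply, real_smul_eq, SerRing.val_mul, SerRing.val_contr,
    SerRing.val_sgn, val_valAt]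

end Contraction

section Pbr

variable (α : Fin m → Fin m → ℂ)

namespace SerRing

lemma pbr_add_left (a b c : SerRing m d) : pbr α (a + b) c = pbr α a c + pbr α b c := by
  simp only [pbr, map_add, add_mul, smul_add, Finset.sum_add_distrib]

lemma pbr_add_right (a b c : SerRing m d) : pbr α a (b + c) = pbr α a b + pbr α a c := by
  simp only [pbr, map_add, mul_add, smul_add, Finset.sum_add_distrib]

lemma pbr_smul_left (r : ℂ) (a b : SerRing m d) : pbr α (r • a) b = r • pbr α a b := by
  simp only [pbr, map_smul, smul_mul_assoc, Finset.smul_sum, map_sum, smul_comm r]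

lemma pbr_smul_right (r : ℂ) (a b : SerRing m d) : pbr α a (r • b) = r • pbr α a b := by
  simp only [pbr, map_smul, mul_smul_comm, Finset.smul_sum, map_sum, smul_comm r]

end SerRing

end Pbr

section Bilinear

variable [IsManifold (𝓡 m) ∞ M] (σ : SymplecticForm m M)

variable (d) in
/-- The operation `poissonContr` on series of forms. -/
def pField : fieldSub g m M →ₗ[ℂ] fieldSub g m M →ₗ[ℂ] fieldSub g m M :=
  LinearMap.mk₂ ℂ (fun η ξ => ⟨poissonContr σ d η.1 ξ.1, poissonContr_mem σ η ξ⟩)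
    (fun η η' ξ => fieldSub_ext d fun x => SerRing.val_injective (by
      simp only [map_add, val_valAt, value_poissonContr, SerRing.pbr_add_left]))
    (fun c η ξ => fieldSub_ext d fun x => SerRing.val_injective (by
      simp only [map_smul, val_valAt, value_poissonContr, SerRing.pbr_smul_left]))
    (fun η ξ ξ' => fieldSub_ext d fun x => SerRing.val_injective (by
      simp only [map_add, val_valAt, value_poissonContr, SerRing.pbr_add_right]))
    (fun c η ξ => fieldSub_ext d fun x => SerRing.val_injective (by
      simp only [map_smul, val_valAt, value_poissonContr, SerRing.pbr_smul_right]))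

lemma coe_pField (η ξ : fieldSub g m M) : (pField d σ η ξ).1 = poissonContr σ d η.1 ξ.1 := rfl

lemma valAt_pField (x : M) (η ξ : fieldSub g m M) :
    valAt d x (pField d σ η ξ) = SerRing.pbr (σ.alpha x) (valAt d x η) (valAt d x ξ) :=
  SerRing.val_injective (value_poissonContr σ x η ξ)

lemma pdVal_pField (x : M) (k : Fin m) (η ξ : fieldSub g m M) :
    pdVal d x k (pField d σ η ξ) = SerRing.pbrDeriv (σ.alpha x) (σ.dalpha x) (valAt d x η)
      (fun k => pdVal d x k η) (valAt d x ξ) (fun k => pdVal d x k ξ) k :=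
  SerRing.val_injective (by
    classical
    obtain ⟨N, hN⟩ := η.2.2
    obtain ⟨N', hN'⟩ := ξ.2.2
    funext κ
    have hη := bddE_value hN x
    have hξ := bddE_value hN' x
    simp only [SerRing.pbrDeriv, SerRing.val_eps, epsMul, map_sum, map_smul, map_add,
      Finset.sum_apply, Pi.smul_apply, Pi.add_apply, SerRing.val_mul, SerRing.val_contr,
      SerRing.val_sgn, val_valAt, val_pdVal]
    rw [Ser.pdAt, coe_pField, poissonContr_apply σ hN hN']
    simp only [serMul_contr_contr hη hξ, serMul_contr_contr (bddE_pdAt hN x k) hξ,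
      serMul_contr_contr hη (bddE_pdAt hN' x k)]
    split_ifs
    · have hs : ∀ z : Mon g × Mon g, IsSmoothForm (σ.poissonForm (fun x => inv (η.1 z.1 x))
          (fun x => twist (z.1.deg d) (ξ.1 z.2 x))) := fun z =>
        σ.isSmoothForm_poissonForm (fieldSub_smooth η _).inv
          ((fieldSub_smooth ξ _).pullCommutes (pullCommutes_twist _))
      rw [pdAt_sum fun z _ => (hs z).smul _]
      have hz : ∀ z : Mon g × Mon g, pdAt x k (Mon.sign d z.1 z.2 • σ.poissonForm
          (fun x => inv (η.1 z.1 x)) (fun x => twist (z.1.deg d) (ξ.1 z.2 x))) =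
          ∑ i, ∑ j, Mon.sign d z.1 z.2 • (σ.dalpha x k i j •
              (contr i (inv (η.1 z.1 x)) * contr j (twist (z.1.deg d) (ξ.1 z.2 x))) +
            σ.alpha x i j • (contr i (inv (pdAt x k (η.1 z.1))) *
                contr j (twist (z.1.deg d) (ξ.1 z.2 x)) +
              contr i (inv (η.1 z.1 x)) * contr j (twist (z.1.deg d) (pdAt x k (ξ.1 z.2))))) := by
        intro z
        rw [pdAt_smul _ (hs z), σ.pdAt_poissonForm (fieldSub_smooth η _).inv
          ((fieldSub_smooth ξ _).pullCommutes (pullCommutes_twist _)), pdAt_inv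
              (fieldSub_smooth η _),
          (pullCommutes_twist _).pdAt (fieldSub_smooth ξ _)]
        simp only [Finset.smul_sum]
      simp only [hz]
      rw [Finset.sum_comm' (s := fact N N' κ.divEps) (t := fun _ => Finset.univ)
        (t' := Finset.univ) (s' := fun _ => fact N N' κ.divEps) (by simp)]
      refine Finset.sum_congr rfl fun i _ => ?_
      rw [Finset.sum_comm]
      refine Finset.sum_congr rfl fun j _ => ?_
      simp only [Finset.smul_sum, ← Finset.sum_add_distrib]
      refine Finset.sum_congr rfl fun z _ => ?_
      simp only [smul_add, smul_comm (Mon.sign d z.1 z.2)]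
      rfl
    · simp only [smul_zero, add_zero, Finset.sum_const_zero]
      exact pdAt_zero x k)

omit [IsManifold (𝓡 m) ∞ M] in
lemma value_formBracket (x : M) (η ξ : fieldSub g m M) :
    Ser.value (formBracket σ d η.1 ξ.1) x =
      (SerRing.fbr (σ.alpha x) (σ.dalpha x) (valAt d x η) (fun k => pdVal d x k η) (valAt d x ξ)
        (fun k => pdVal d x k ξ)).val := by
  funext κ
  simp only [Ser.value, formBracket, SerRing.fbr, SerRing.val_eps, epsMul, map_sum, map_smul,
    map_add, map_sub, SerRing.dxPoisson_apply, SerRing.val_dx,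
    Finset.sum_apply, Pi.smul_apply, Pi.add_apply, Pi.sub_apply, real_smul_eq, SerRing.val_mul,
    SerRing.val_contr, SerRing.val_sgn, val_valAt, val_pdVal]

end Bilinear

end FieldSeries

/-! ### Graded spaces of series of forms -/

section Rules

open scoped ContDiff

variable {g m : ℕ} {M : Type*} [TopologicalSpace M] [ChartedSpace (EuclideanSpace ℝ (Fin m)) M]

/-- The conditions on the products of a monomial and a `q`-form allowed in a graded filtered space
of series (`R k n` for filtration `k` and degree `n`) under which the differentials and the
contraction with the Poisson structure act on it. -/
structure IsRule (d : Fin g → ℤ) (R : ℕ → ℤ → Mon g → ℕ → Prop) : Prop where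
  degree : ∀ {k n κ q}, R k n κ q → q + κ.deg d - 1 = n
  bounded : ∀ {k n κ q}, R k n κ q → 0 ≤ κ.e + q
  mono : ∀ {k k' n κ q}, k ≤ k' → R k' n κ q → R k n κ q
  exterior : ∀ {k n κ q}, R k n κ q → R k (n + 1) κ (q + 1)
  simplex : ∀ {k n κ q}, κ.s = 1 → R k n κ.dtToT q → R k (n + 1) κ q
  contraction : ∀ {k k' n n' κ κ' μ p q}, κ + κ' = μ.divEps → μ.divEps.Adm d →
    R k n κ (p + 1) → R k' n' κ' (q + 1) → R (k + k') (n + n' - 1) μ (p + q)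

lemma Mon.deg_of_add {d : Fin g → ℤ} {κ κ' μ : Mon g} (h : κ + κ' = μ.divEps) :
    μ.deg d = κ.deg d + κ'.deg d := by
  rw [← Mon.deg_add, h]; rfl

lemma isRule_tilde (d : Fin g → ℤ) : IsRule d (TildeRule d) where
  degree h := h.2.2.2.2.2
  bounded h := by have := h.2.2.2.1; omega
  mono hk h := ⟨h.1, h.2.1, h.2.2.1, h.2.2.2.1,
    le_trans (by exact_mod_cast hk) h.2.2.2.2.1, h.2.2.2.2.2⟩
  exterior := by
    rintro k n κ q ⟨h1, h2, h3, h4, h5, h6⟩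
    refine ⟨h1, h2, h3, ?_, ?_, ?_⟩ <;> push_cast <;> linarith
  simplex _ h := absurd h.1 (Nat.succ_ne_zero _)
  contraction := by
    rintro k k' n n' κ κ' μ p q hμ hadm ⟨h1, h2, h3, h4, h5, h6⟩ ⟨h1', h2', h3', h4', h5', h6'⟩
    have e1 : κ.e + κ'.e = μ.e - 1 := congrArg Mon.e hμ
    have e2 : κ.k + κ'.k = μ.k := congrArg Mon.k hμ
    have e3 : κ.n + κ'.n = μ.n := congrArg Mon.n hμ
    have e4 : κ.s + κ'.s = μ.s := congrArg Mon.s hμ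
    have e5 : ∑ i, (μ.k i : ℤ) = ∑ i, (κ.k i : ℤ) + ∑ i, (κ'.k i : ℤ) := by
      rw [← e2, ← Finset.sum_add_distrib]; simp
    have e6 := Mon.deg_of_add (d := d) hμ
    push_cast at h4 h5 h6 h4' h5' h6'
    refine ⟨by omega, by omega, hadm, ?_, ?_, ?_⟩ <;> push_cast <;> linarith

lemma isRule_simplex (d : Fin g → ℤ) : IsRule d (SimplexRule d) where
  degree h := h.2.2.2
  bounded := by
    rintro k n κ q ⟨h1, h2, h3, -⟩
    have := h1.2
    rcases (by omega : κ.s = 0 ∨ κ.s = 1) with h | h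
    · have := (h2 h).1; omega
    · exact (h3 h).1
  mono hk h := ⟨h.1, fun hs => ⟨(h.2.1 hs).1, le_trans (by exact_mod_cast hk) (h.2.1 hs).2⟩,
    fun hs => ⟨(h.2.2.1 hs).1, le_trans (by exact_mod_cast hk) (h.2.2.1 hs).2⟩, h.2.2.2⟩
  exterior := by
    rintro k n κ q ⟨h1, h2, h3, h4⟩
    refine ⟨h1, fun hs => ?_, fun hs => ?_, by push_cast; linarith⟩
    · obtain ⟨h, h'⟩ := h2 hs
      constructor <;> push_cast <;> linarith
    · obtain ⟨h, h'⟩ := h3 hs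
      constructor <;> push_cast <;> linarith
  simplex := by
    rintro k n κ q hs ⟨h1, h2, h3, h4⟩
    obtain ⟨h, h'⟩ := h2 rfl
    refine ⟨⟨h1.1, hs.le⟩, fun h0 => by omega, fun _ => ?_, ?_⟩
    · dsimp only at h h'
      constructor <;> linarith
    · simp only [Mon.deg, hs] at h4 ⊢
      push_cast at h4 ⊢
      linarith
  contraction := by
    rintro k k' n n' κ κ' μ p q hμ hadm ⟨h1, h2, h3, h4⟩ ⟨h1', h2', h3', h4'⟩
    have e1 : κ.e + κ'.e = μ.e - 1 := congrArg Mon.e hμ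
    have e2 : κ.k + κ'.k = μ.k := congrArg Mon.k hμ
    have e4 : κ.s + κ'.s = μ.s := congrArg Mon.s hμ
    have e5 : ∑ i, (μ.k i : ℤ) = ∑ i, (κ.k i : ℤ) + ∑ i, (κ'.k i : ℤ) := by
      rw [← e2, ← Finset.sum_add_distrib]; simp
    have e6 := Mon.deg_of_add (d := d) hμ
    push_cast at h2 h3 h4 h2' h3' h4'
    refine ⟨hadm, fun hs => ?_, fun hs => ?_, by push_cast; linarith⟩
    · obtain ⟨a1, a2⟩ := h2 (by omega)
      obtain ⟨b1, b2⟩ := h2' (by omega)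
      constructor <;> push_cast <;> linarith
    · rcases (by omega : (κ.s = 0 ∧ κ'.s = 1) ∨ (κ.s = 1 ∧ κ'.s = 0)) with ⟨u, v⟩ | ⟨u, v⟩
      · obtain ⟨a1, a2⟩ := h2 u
        obtain ⟨b1, b2⟩ := h3' v
        constructor <;> push_cast <;> linarith
      · obtain ⟨a1, a2⟩ := h3 u
        obtain ⟨b1, b2⟩ := h2' v
        constructor <;> push_cast <;> linarith

lemma eq_zero_of_suppIn_false {R : ℕ → Prop} {a : Lam m} (ha : SuppIn R a)
    (h : ∀ q ≤ m, ¬ R q) : a = 0 := by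
  rw [← sum_coef a]
  refine Finset.sum_eq_zero fun S _ => ?_
  rw [ha S (h _ (by simpa using Finset.card_le_univ S)), zero_smul]

variable {d : Fin g → ℤ} {R : ℕ → ℤ → Mon g → ℕ → Prop}

lemma IsRule.vanish (hR : IsRule d R) {k : ℕ} {n : ℤ} {η : Ser g m M}
    (hη : η ∈ seriesSub M (R k n)) (κ : Mon g) (hκ : κ.e < -m) : η κ = 0 := by
  funext x
  exact eq_zero_of_suppIn_false (hη.2.1 κ x) fun q hq h => by
    have := hR.bounded h
    omega

lemma IsRule.le_fieldSub (hR : IsRule d R) (k : ℕ) (n : ℤ) :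
    seriesSub M (R k n) ≤ fieldSub g m M :=
  fun _ hη => ⟨hη.1, -m, hR.vanish hη⟩

lemma IsRule.simplexD_mem (hR : IsRule d R) {k : ℕ} {n : ℤ} {η : Ser g m M}
    (hη : η ∈ seriesSub M (R k n)) : simplexD d η ∈ seriesSub M (R k (n + 1)) := by
  refine ⟨(sField d ⟨η, hR.le_fieldSub k n hη⟩).2.1, fun κ x => ?_, fun κ => ?_⟩
  · change SuppIn (R k (n + 1) κ) (simplexD d η κ x)
    rw [simplexD_apply]
    split_ifs with hs
    · refine SuppIn.smul _ fun S hS => SuppIn.inv (hη.2.1 κ.dtToT x) S fun h => hS ?_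
      exact hR.simplex hs h
    · exact suppIn_zero
  · obtain ⟨N, hN⟩ := hη.2.2 { κ with s := 0 }
    refine ⟨N, fun n hn => ?_⟩
    rw [simplexD_apply]
    have h0 : η (Mon.dtToT { κ with n := n }) = 0 := hN (n + 1) (by omega)
    split_ifs
    · rw [h0]; funext x; simp
    · rfl

lemma IsRule.poissonContr_mem [IsManifold (𝓡 m) ∞ M] (hR : IsRule d R) (σ : SymplecticForm m M)
    {k k' : ℕ} {n n' : ℤ} {η ξ : Ser g m M} (hη : η ∈ seriesSub M (R k n))
    (hξ : ξ ∈ seriesSub M (R k' n')) :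
    poissonContr σ d η ξ ∈ seriesSub M (R (k + k') (n + n' - 1)) := by
  classical
  have hv := hR.vanish hη
  have hv' := hR.vanish hξ
  refine ⟨(ShT.poissonContr_mem σ ⟨η, hR.le_fieldSub k n hη⟩ ⟨ξ, hR.le_fieldSub k' n' hξ⟩).1,
    fun κ x => ?_, fun κ => ?_⟩
  · change SuppIn (R (k + k') (n + n' - 1) κ) (poissonContr σ d η ξ κ x)
    rw [poissonContr_apply σ hv hv']
    split_ifs with hadm
    · rw [Finset.sum_apply]
      refine SuppIn.sum fun z hz => SuppIn.smul _ ?_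
      exact σ.poissonForm_suppIn (SuppIn.inv (hη.2.1 z.1 x)) (SuppIn.twist _ (hξ.2.1 z.2 x))
        fun p q hp hq => hR.contraction (mem_fact.1 hz).1 hadm hp hq
    · exact suppIn_zero
  · -- the exponents other than that of `t` in the factors take finitely many values
    choose N hN using hη.2.2
    choose N' hN' using hξ.2.2
    let r : Mon g → Mon g := fun κ => { κ with n := 0 }
    refine ⟨∑ z ∈ fact (-m) (-m) (r κ.divEps), (N z.1 + N' z.2), fun n hn => ?_⟩
    rw [poissonContr_apply σ hv hv']
    split_ifs
    · refine Finset.sum_eq_zero fun z hz => ?_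
      obtain ⟨h1, h2, h3⟩ := mem_fact.1 hz
      have hz0 : (r z.1, r z.2) ∈ fact (-m) (-m) (r κ.divEps) := mem_fact.2
        ⟨by rw [show r z.1 + r z.2 = r (z.1 + z.2) from rfl, h1], h2, h3⟩
      have hle : N (r z.1) + N' (r z.2) ≤ n := le_trans
        (Finset.single_le_sum (f := fun z : Mon g × Mon g => N z.1 + N' z.2)
          (fun _ _ => Nat.zero_le _) hz0) hn
      have hn' : z.1.n + z.2.n = n := congrArg Mon.n h1
      rcases (by omega : N (r z.1) ≤ z.1.n ∨ N' (r z.2) ≤ z.2.n) with h | h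
      · have h0 : η z.1 = 0 := hN (r z.1) z.1.n h
        funext x
        simp [h0, SymplecticForm.poissonForm]
      · have h0 : ξ z.2 = 0 := hN' (r z.2) z.2.n h
        funext x
        simp [h0, SymplecticForm.poissonForm]
    · rfl

lemma IsRule.deRham_mem [IsManifold (𝓡 m) ∞ M] (hR : IsRule d R) {k : ℕ} {n : ℤ} {η : Ser g m M}
    (hη : η ∈ seriesSub M (R k n)) : deRham η ∈ seriesSub M (R k (n + 1)) := by
  have h := coe_dField ⟨η, hR.le_fieldSub k n hη⟩
  rw [← h]
  refine ⟨(dField ⟨η, hR.le_fieldSub k n hη⟩).2.1, fun κ x => ?_, fun κ => ?_⟩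
  · exact SuppIn.dForm (R' := R k (n + 1) κ) (hη.2.1 κ) x fun q hq => hR.exterior hq
  · obtain ⟨N, hN⟩ := hη.2.2 κ
    exact ⟨N, fun n hn => by
      change dForm (η { κ with n := n }) = 0
      rw [hN n hn, dForm_zero]⟩

/-- The vectors of degree `n` have parity `n + 1` before the desuspension. -/
lemma IsRule.sgn_valAt (hR : IsRule d R) {k : ℕ} {n : ℤ} {η : fieldSub g m M}
    (hη : η.1 ∈ seriesSub M (R k n)) (x : M) :
    SerRing.sgn (valAt d x η) = ((-1 : ℂ) ^ (n - 1)) • valAt d x η :=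
  SerRing.val_injective (by
    funext κ
    have h := SuppIn.inv_eq (p := n + 1 - κ.deg d) (hη.2.1 κ x) fun q hq => by
      have := hR.degree hq
      exact ⟨0, by linarith⟩
    rw [SerRing.val_sgn, serSgn, map_smul, Pi.smul_apply, val_valAt, Ser.value]
    refine (congrArg _ h).trans ?_
    rw [smul_smul, ← zpow_add₀ (by simp), neg_one_zpow_congr (b := n - 1) 1 (by ring)])

lemma IsRule.sgn_pdVal (hR : IsRule d R) {k : ℕ} {n : ℤ} {η : fieldSub g m M}
    (hη : η.1 ∈ seriesSub M (R k n)) (x : M) (i : Fin m) :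
    SerRing.sgn (pdVal d x i η) = ((-1 : ℂ) ^ (n - 1)) • pdVal d x i η :=
  SerRing.val_injective (by
    funext κ
    have h := SuppIn.inv_eq (p := n + 1 - κ.deg d) (SuppIn.pdAt (hη.2.1 κ) x i) fun q hq => by
      have := hR.degree hq
      exact ⟨0, by linarith⟩
    rw [SerRing.val_sgn, serSgn, map_smul, Pi.smul_apply, val_pdVal, Ser.pdAt]
    refine (congrArg _ h).trans ?_
    rw [smul_smul, ← zpow_add₀ (by simp), neg_one_zpow_congr (b := n - 1) 1 (by ring)])

end Rules

/-! ### The differential graded Lie algebra of series of forms -/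

section Total

open scoped ContDiff

variable {g m : ℕ} {M : Type*} [TopologicalSpace M] [ChartedSpace (EuclideanSpace ℝ (Fin m)) M]
  [IsManifold (𝓡 m) ∞ M] {d : Fin g → ℤ} {R : ℕ → ℤ → Mon g → ℕ → Prop}

namespace SerRing

variable (α : Fin m → Fin m → ℂ) (dα : Fin m → Fin m → Fin m → ℂ)

lemma fbr_add_left (a₁ a₂ : SerRing m d) (a₁' a₂' : Fin m → SerRing m d) (b : SerRing m d)
    (b' : Fin m → SerRing m d) : fbr α dα (a₁ + a₂) (fun k => a₁' k + a₂' k) b b' =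
      fbr α dα a₁ a₁' b b' + fbr α dα a₂ a₂' b b' := by
  simp only [fbr, ← map_add, ← Finset.sum_add_distrib]
  congr 1
  refine Finset.sum_congr rfl fun i _ => Finset.sum_congr rfl fun j _ => ?_
  simp only [map_add, add_mul, smul_add]
  abel

lemma fbr_zero_left (b : SerRing m d) (b' : Fin m → SerRing m d) :
    fbr α dα 0 (fun _ => 0) b b' = 0 := by
  simp [fbr]

end SerRing

omit [IsManifold (𝓡 m) ∞ M] in
lemma SymplecticForm.alpha_antisymm (σ : SymplecticForm m M) (x : M) (i j : Fin m) :
    σ.alpha x j i = -σ.alpha x i j := by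
  rw [SymplecticForm.alpha, σ.poissonAt_antisymm, Complex.ofReal_neg]

/-- The vectors of degree `n` of the graded space that belongs to the rule `R`. -/
abbrev ruleSub (M : Type*) [TopologicalSpace M] [ChartedSpace (EuclideanSpace ℝ (Fin m)) M]
    (R : ℕ → ℤ → Mon g → ℕ → Prop) (n : ℤ) : Submodule ℂ (Ser g m M) :=
  seriesSub M (R 1 n)

namespace IsRule

omit [IsManifold (𝓡 m) ∞ M] in
lemma coef_toSer (hR : IsRule d R) (x : Tot fun n => ruleSub (m := m) M R n) (κ : Mon g) (p : M)
    (S : Finset (Fin m)) :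
    coef S (toSer (ruleSub M R) x κ p) = coef S ((x (S.card + κ.deg d - 1)).1 κ p) := by
  induction x using DirectSum.induction_on with
  | zero => simp
  | add x y hx hy =>
    rw [map_add, Pi.add_apply, Pi.add_apply, map_add, hx, hy, DirectSum.add_apply,
      Submodule.coe_add, Pi.add_apply, Pi.add_apply, map_add]
  | of i a =>
    rw [toSer, DirectSum.coeLinearMap_of]
    by_cases h : i = S.card + κ.deg d - 1
    · subst h; rw [DirectSum.of_eq_same]
    · rw [DirectSum.of_eq_of_ne _ _ _ (Ne.symm h)]
      rw [a.2.2.1 κ p S fun hS => h (hR.degree hS).symm]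
      simp

/-- A vector of the graded space, as a series with bounded exponents. -/
def toField (hR : IsRule d R) : (Tot fun n => ruleSub (m := m) M R n) →ₗ[ℂ] fieldSub g m M :=
  DirectSum.toModule ℂ ℤ _ fun n => Submodule.inclusion (hR.le_fieldSub 1 n)

omit [IsManifold (𝓡 m) ∞ M] in
lemma toField_hom (hR : IsRule d R) (n : ℤ) (a : ruleSub (m := m) M R n) :
    hR.toField (hom (fun n => ruleSub M R n) n a) = Submodule.inclusion (hR.le_fieldSub 1 n) a :=
  DirectSum.toModule_lof _ _ _

omit [IsManifold (𝓡 m) ∞ M] in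
lemma coe_toField (hR : IsRule d R) (x : Tot fun n => ruleSub (m := m) M R n) :
    (hR.toField x).1 = toSer (ruleSub M R) x := by
  induction x using DirectSum.induction_on with
  | zero => simp
  | add x y hx hy => rw [map_add, map_add, Submodule.coe_add, hx, hy]
  | of i a =>
    have h := congrArg Subtype.val (hR.toField_hom i a)
    have h2 : toSer (ruleSub M R) (DirectSum.of (fun n => ruleSub M R n) i a) = a.1 :=
      DirectSum.coeLinearMap_of _ i a
    rw [h2]
    exact h

omit [IsManifold (𝓡 m) ∞ M] in
lemma toSer_injective (hR : IsRule d R) :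
    Function.Injective (toSer (ruleSub (m := m) (g := g) M R)) := by
  rw [injective_iff_map_eq_zero]
  intro x hx
  ext n κ p
  refine (lamBasis m).ext_elem fun S => ?_
  have h := hR.coef_toSer x κ p S
  rw [hx] at h
  change coef S ((x n).1 κ p) = coef S 0
  by_cases hn : n = S.card + κ.deg d - 1
  · subst hn; rw [← h]; simp
  · rw [(x n).2.2.1 κ p S fun hS => hn (hR.degree hS).symm, map_zero]

omit [IsManifold (𝓡 m) ∞ M] in
lemma toField_injective (hR : IsRule d R) :
    Function.Injective (hR.toField (m := m) (M := M)) := fun x y h =>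
  hR.toSer_injective (by rw [← hR.coe_toField, ← hR.coe_toField, h])

/-- The differential `-d + d_t` on the vectors of degree `n`. -/
def diffHom (hR : IsRule d R) (n : ℤ) :
    ruleSub (m := m) M R n →ₗ[ℂ] ruleSub (m := m) M R (n + 1) :=
  LinearMap.codRestrict _ ((fieldSub g m M).subtype ∘ₗ (sField d - dField) ∘ₗ
    Submodule.inclusion (hR.le_fieldSub 1 n)) fun a => by
      refine Submodule.sub_mem _ (hR.simplexD_mem a.2) ?_
      have h := hR.deRham_mem a.2
      rw [← coe_dField ⟨a.1, hR.le_fieldSub 1 n a.2⟩] at h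
      exact h

variable (M) in
/-- The differential `-d + d_t`. -/
def diff (hR : IsRule d R) :
    (Tot fun n => ruleSub (m := m) M R n) →ₗ[ℂ] (Tot fun n => ruleSub (m := m) M R n) :=
  DirectSum.toModule ℂ ℤ _ fun n => hom (fun n => ruleSub M R n) (n + 1) ∘ₗ hR.diffHom n

lemma diff_hom (hR : IsRule d R) (n : ℤ) (a : ruleSub (m := m) M R n) :
    hR.diff M (hom (fun n => ruleSub M R n) n a) =
      hom (fun n => ruleSub M R n) (n + 1) (hR.diffHom n a) :=
  DirectSum.toModule_lof _ _ _

lemma toField_diff (hR : IsRule d R) (x : Tot fun n => ruleSub (m := m) M R n) :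
    hR.toField (hR.diff M x) = sField d (hR.toField x) - dField (hR.toField x) := by
  induction x using DirectSum.induction_on with
  | zero => simp
  | add x y hx hy => simp only [map_add, hx, hy]; abel
  | of i a =>
    have h := congrArg hR.toField (hR.diff_hom i a)
    rw [toField_hom] at h
    refine h.trans ?_
    have h2 := hR.toField_hom i a
    simp only [hom, DirectSum.lof_eq_of] at h2
    rw [h2]
    rfl

/-- The contraction with the Poisson structure on the vectors of degrees `i` and `j`. -/
def contrHom (hR : IsRule d R) (σ : SymplecticForm m M) (i j : ℤ) :
    ruleSub (m := m) M R i →ₗ[ℂ] ruleSub (m := m) M R j →ₗ[ℂ] ruleSub (m := m) M R (i + j - 1) :=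
  LinearMap.mk₂ ℂ
    (fun a b => ⟨(pField d σ (Submodule.inclusion (hR.le_fieldSub 1 i) a)
      (Submodule.inclusion (hR.le_fieldSub 1 j) b)).1,
      seriesSub_mono (fun _ _ h => hR.mono one_le_two h) (hR.poissonContr_mem σ a.2 b.2)⟩)
    (fun a a' b => Subtype.ext (by simp))
    (fun c a b => Subtype.ext (by simp))
    (fun a b b' => Subtype.ext (by simp))
    (fun c a b => Subtype.ext (by simp))

/-- The operation `(-1)^{|η|} ε α^{ij} ∂η/∂dxⁱ ∂ξ/∂dx^j`. -/
def contraction₂ (hR : IsRule d R) (σ : SymplecticForm m M) :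
    (Tot fun n => ruleSub (m := m) M R n) →ₗ[ℂ] (Tot fun n => ruleSub (m := m) M R n) →ₗ[ℂ]
      (Tot fun n => ruleSub (m := m) M R n) :=
  DirectSum.toModule ℂ ℤ _ fun i => LinearMap.flip <| DirectSum.toModule ℂ ℤ _ fun j =>
    LinearMap.flip <| (hR.contrHom σ i j).compr₂ (hom (fun n => ruleSub M R n) (i + j - 1))

lemma contraction₂_hom (hR : IsRule d R) (σ : SymplecticForm m M) (i j : ℤ)
    (a : ruleSub (m := m) M R i) (b : ruleSub (m := m) M R j) :
    hR.contraction₂ σ (hom (fun n => ruleSub M R n) i a) (hom (fun n => ruleSub M R n) j b) =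
      hom (fun n => ruleSub M R n) (i + j - 1) (hR.contrHom σ i j a b) := by
  simp [contraction₂, DirectSum.toModule_lof, LinearMap.flip_apply]

lemma toField_contraction₂ (hR : IsRule d R) (σ : SymplecticForm m M)
    (x y : Tot fun n => ruleSub (m := m) M R n) :
    hR.toField (hR.contraction₂ σ x y) = pField d σ (hR.toField x) (hR.toField y) := by
  induction x using DirectSum.induction_on with
  | zero => simp
  | add x x' hx hx' => simp only [map_add, LinearMap.add_apply, hx, hx']
  | of i a =>
    induction y using DirectSum.induction_on with
    | zero => simp
    | add y y' hy hy' => simp only [map_add, hy, hy']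
    | of j b =>
      have h := congrArg hR.toField (hR.contraction₂_hom σ i j a b)
      rw [toField_hom] at h
      refine h.trans ?_
      have h1 := hR.toField_hom i a
      have h2 := hR.toField_hom j b
      simp only [hom, DirectSum.lof_eq_of] at h1 h2
      rw [h1, h2]
      rfl

omit [IsManifold (𝓡 m) ∞ M] in
lemma sgn_valAt_toField (hR : IsRule d R) {i : ℤ} {v : Tot fun n => ruleSub (m := m) M R n}
    (hv : v ∈ LinearMap.range (hom (fun n => ruleSub M R n) i)) (x : M) :
    SerRing.sgn (valAt d x (hR.toField v)) = ((-1 : ℂ) ^ (i - 1)) • valAt d x (hR.toField v) := by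
  obtain ⟨a, rfl⟩ := hv
  rw [toField_hom]
  exact hR.sgn_valAt (η := Submodule.inclusion (hR.le_fieldSub 1 i) a) (k := 1) (n := i) a.2 x

omit [IsManifold (𝓡 m) ∞ M] in
lemma sgn_pdVal_toField (hR : IsRule d R) {i : ℤ} {v : Tot fun n => ruleSub (m := m) M R n}
    (hv : v ∈ LinearMap.range (hom (fun n => ruleSub M R n) i)) (x : M) (k : Fin m) :
    SerRing.sgn (pdVal d x k (hR.toField v)) =
      ((-1 : ℂ) ^ (i - 1)) • pdVal d x k (hR.toField v) := by
  obtain ⟨a, rfl⟩ := hv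
  rw [toField_hom]
  exact hR.sgn_pdVal (η := Submodule.inclusion (hR.le_fieldSub 1 i) a) (k := 1) (n := i) a.2 x k

omit [IsManifold (𝓡 m) ∞ M] in
lemma ext_valAt (hR : IsRule d R) {v w : Tot fun n => ruleSub (m := m) M R n}
    (h : ∀ x, valAt d x (hR.toField v) = valAt d x (hR.toField w)) : v = w :=
  hR.toField_injective (fieldSub_ext d h)

lemma homDegree_diff (hR : IsRule d R) : HomDegree 1 (hR.diff (m := m) M) := fun i a =>
  ⟨_, (hR.diff_hom i a).symm⟩

lemma diff_diff (hR : IsRule d R) (x : Tot fun n => ruleSub (m := m) M R n) :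
    hR.diff M (hR.diff M x) = 0 :=
  hR.toField_injective (by
    simp only [toField_diff, map_sub, sField_sField, dField_dField, dField_sField, map_zero]
    abel)

lemma isSymmBilin_contraction₂ (hR : IsRule d R) (σ : SymplecticForm m M) :
    IsSymmBilin 0 (hR.contraction₂ σ) where
  degree i j a b := mem_range_hom_of_eq (add_zero _).symm ⟨_, (hR.contraction₂_hom σ i j a b).symm⟩
  symm i j a b := hR.ext_valAt fun x => by
    have ha := hR.sgn_valAt_toField (hom_mem_range i a) x
    have hb := hR.sgn_valAt_toField (hom_mem_range j b) x
    rw [map_smul, map_smul, toField_contraction₂, toField_contraction₂, valAt_pField, valAt_pField]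
    exact SerRing.pbr_comm _ (σ.alpha_antisymm x) ha hb

/-- The failure of the differential to be a derivation of the contraction is the bracket. -/
lemma valAt_defect (hR : IsRule d R) (σ : SymplecticForm m M) {i : ℤ}
    {v : Tot fun n => ruleSub (m := m) M R n}
    (hv : v ∈ LinearMap.range (hom (fun n => ruleSub M R n) i))
    (w : Tot fun n => ruleSub (m := m) M R n) (x : M) :
    valAt d x (hR.toField (defect (hR.diff M) (hR.contraction₂ σ) v w)) =
      ((-1 : ℂ) ^ (i - 1)) • SerRing.fbr (σ.alpha x) (σ.dalpha x) (valAt d x (hR.toField v))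
        (fun k => pdVal d x k (hR.toField v)) (valAt d x (hR.toField w))
        (fun k => pdVal d x k (hR.toField w)) := by
  have h1 := hR.sgn_valAt_toField hv x
  have h2 := hR.sgn_pdVal_toField hv x
  have hs := SerRing.simp₁_pbr (σ.alpha x) (b := valAt d x (hR.toField w)) h1
  have hd := SerRing.dx_pbrDeriv (σ.alpha x) (σ.dalpha x) (b := valAt d x (hR.toField w))
    (b' := fun k => pdVal d x k (hR.toField w)) h1 h2
  obtain ⟨a, rfl⟩ := hv
  rw [defect_hom, ← hd]
  simp only [map_sub, map_add, map_smul, toField_contraction₂, toField_diff, valAt_pField,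
    LinearMap.sub_apply, valAt_sField, valAt_dField, pdVal_pField, hs]
  simp only [smul_sub]
  abel

end IsRule

end Total

/-! ### Uniqueness of coderivations -/

section Uniqueness

universe u v

variable {L : ℤ → Type u} [∀ n, AddCommGroup (L n)] [∀ n, Module ℂ (L n)]

lemma IsCoderivation.add_const_smul {r : ℤ} {D D' : SBar L →ₗ[ℂ] SBar L} (hD : IsCoderivation r D)
    (c : ℂ) (hD' : IsCoderivation r D') : IsCoderivation r (D + c • D') where
  degree n x hx :=
    Submodule.add_mem _ (hD.degree n x hx) (Submodule.smul_mem _ c (hD'.degree n x hx))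
  coleibniz := by
    rw [LinearMap.comp_add, LinearMap.comp_smul, hD.coleibniz, hD'.coleibniz,
      TensorProduct.map_add_left, TensorProduct.map_add_right, TensorProduct.map_smul_left,
      TensorProduct.map_smul_right, ← LinearMap.smul_comp, ← LinearMap.add_comp, smul_add]
    congr 1
    abel

lemma linearMap_eq_zero_of_mono {V : Type v} [AddCommGroup V] [Module ℂ V] {f : SBar L →ₗ[ℂ] V}
    (h : ∀ l : List (Tot L), f (mono l) = 0) : f = 0 := by
  have htop : Submodule.span ℂ (Set.range fun l : List (Tot L) => (l.map (gen L)).prod) = ⊤ := by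
    refine GSym.submodule_eq_top (Submodule.subset_span ⟨[], rfl⟩) fun i a x hx => ?_
    induction hx using Submodule.span_induction with
    | mem y hy =>
      obtain ⟨l, rfl⟩ := hy
      exact Submodule.subset_span ⟨hom L i a :: l, by simp⟩
    | zero => simp
    | add y z _ _ hy hz => rw [mul_add]; exact Submodule.add_mem _ hy hz
    | smul c y _ hy => rw [mul_smul_comm]; exact Submodule.smul_mem _ c hy
  have hker : LinearMap.ker (f ∘ₗ toBar L) = ⊤ := by
    rw [eq_top_iff, ← htop, Submodule.span_le]
    rintro _ ⟨l, rfl⟩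
    exact h l
  ext1 x
  have hx := LinearMap.congr_fun (LinearMap.ker_eq_top.1 hker) x.1
  rw [LinearMap.comp_apply, toBar_coe] at hx
  exact hx

/-- A coderivation is determined by its corestriction on monomials. -/
lemma IsCoderivation.ext_mono {r : ℤ} {D D' : SBar L →ₗ[ℂ] SBar L} (hD : IsCoderivation r D)
    (hD' : IsCoderivation r D')
    (h : ∀ l : List (Tot L), corestr L (D (mono l)) = corestr L (D' (mono l))) : D = D' := by
  have h0 : corestr L ∘ₗ (D + (-1 : ℂ) • D') = 0 := linearMap_eq_zero_of_mono fun l => by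
    rw [LinearMap.comp_apply, LinearMap.add_apply, LinearMap.smul_apply, map_add, map_smul, h,
      neg_one_smul, add_neg_cancel]
  have h1 := (hD.add_const_smul (-1) hD').eq_zero fun x => LinearMap.congr_fun h0 x
  calc D = (D + (-1 : ℂ) • D') + (1 : ℂ) • D' := by
        rw [add_assoc, ← add_smul, neg_add_cancel, zero_smul, add_zero]
    _ = D' := by rw [h1, zero_add, one_smul]

end Uniqueness

section Cyclic

universe u

variable {L : ℤ → Type u} [∀ n, AddCommGroup (L n)] [∀ n, Module ℂ (L n)]
  {D : Tot L →ₗ[ℂ] Tot L} {B : Tot L →ₗ[ℂ] Tot L →ₗ[ℂ] Tot L}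

/-- By symmetry, the cubic condition is the vanishing of a cyclic sum. -/
lemma TwistData.of_cyclic (hD : HomDegree 1 D) (hDD : ∀ x, D (D x) = 0) (hB : IsSymmBilin 0 B)
    (h : ∀ (i j l : ℤ) (a b c : Tot L), a ∈ LinearMap.range (hom L i) →
      b ∈ LinearMap.range (hom L j) → c ∈ LinearMap.range (hom L l) →
      (defect D B (B a b) c - B (defect D B a b) c) +
      ((-1 : ℂ) ^ ((j - 1) * (l - 1))) • (defect D B (B a c) b - B (defect D B a c) b) +
      ((-1 : ℂ) ^ (((j - 1) + (l - 1)) * (i - 1))) •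
        (defect D B (B b c) a - B (defect D B b c) a) = 0) : TwistData D B where
  diff_degree := hD
  diff_diff := hDD
  symm := hB
  cubic i j l a b c := by
    have hQ := hB.defect hD
    have ha := hom_mem_range i a
    have hb := hom_mem_range j b
    have hc := hom_mem_range l c
    generalize hom L i a = a at *
    generalize hom L j b = b at *
    generalize hom L l c = c at *
    have key := h i j l a b c ha hb hc
    rw [hQ.symm_of_mem ha (hB.mem_range hb hc rfl), hQ.symm_of_mem hb (hB.mem_range ha hc rfl),
      hB.symm_of_mem ha (hQ.mem_range hb hc rfl), hB.symm_of_mem hb (hQ.mem_range ha hc rfl),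
      smul_smul, smul_smul, smul_smul, ← zpow_add₀ (by simp), ← zpow_add₀ (by simp),
      ← zpow_add₀ (by simp),
      neg_one_zpow_congr (a := (i - 1) * (j + l - 1 + 0 - 1))
        (b := ((j - 1) + (l - 1)) * (i - 1)) 0 (by ring),
      neg_one_zpow_congr (a := (i - 1) * (j - 1) + (j - 1) * (i + l - 1 + 0 - 1))
        (b := (j - 1) * (l - 1)) ((i - 1) * (j - 1)) (by ring),
      neg_one_zpow_congr (a := i - 1 + (i - 1) * (j + l - 1 + 1 - 1))
        (b := ((j - 1) + (l - 1)) * (i - 1)) (i - 1) (by ring),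
      neg_one_zpow_congr (a := i * (j - 1) + (j - 1) * (i + l - 1 + 1 - 1))
        (b := (j - 1) * (l - 1)) (i * (j - 1)) (by ring)]
    rw [← sub_eq_zero, ← key]
    module

end Cyclic

/-! ### Trivialization of the bracket of forms -/

section Trivialization

open scoped ContDiff

variable {g m : ℕ} {M : Type*} [TopologicalSpace M] [ChartedSpace (EuclideanSpace ℝ (Fin m)) M]
  [IsManifold (𝓡 m) ∞ M] {d : Fin g → ℤ} {R : ℕ → ℤ → Mon g → ℕ → Prop}

namespace IsRule

/-- The cubic identity holds because it holds at every point, where it follows from the antisymmetry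
and the Jacobi identity of the Poisson structure. -/
lemma cubic (hR : IsRule d R) (σ : SymplecticForm m M) {i j l : ℤ}
    {a b c : Tot fun n => ruleSub (m := m) M R n}
    (ha : a ∈ LinearMap.range (hom (fun n => ruleSub M R n) i))
    (hb : b ∈ LinearMap.range (hom (fun n => ruleSub M R n) j))
    (hc : c ∈ LinearMap.range (hom (fun n => ruleSub M R n) l)) :
    (defect (hR.diff M) (hR.contraction₂ σ) (hR.contraction₂ σ a b) c -
      hR.contraction₂ σ (defect (hR.diff M) (hR.contraction₂ σ) a b) c) +
    ((-1 : ℂ) ^ ((j - 1) * (l - 1))) •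
      (defect (hR.diff M) (hR.contraction₂ σ) (hR.contraction₂ σ a c) b -
        hR.contraction₂ σ (defect (hR.diff M) (hR.contraction₂ σ) a c) b) +
    ((-1 : ℂ) ^ (((j - 1) + (l - 1)) * (i - 1))) •
      (defect (hR.diff M) (hR.contraction₂ σ) (hR.contraction₂ σ b c) a -
        hR.contraction₂ σ (defect (hR.diff M) (hR.contraction₂ σ) b c) a) = 0 := by
  refine hR.ext_valAt fun x => ?_
  have hB := hR.isSymmBilin_contraction₂ (d := d) σ
  have hab := hR.valAt_defect σ (hB.mem_range ha hb (n := i - 1 + (j - 1) + 1) (by ring)) c x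
  have hac := hR.valAt_defect σ (hB.mem_range ha hc (n := i - 1 + (l - 1) + 1) (by ring)) b x
  have hbc := hR.valAt_defect σ (hB.mem_range hb hc (n := j - 1 + (l - 1) + 1) (by ring)) a x
  rw [add_sub_cancel_right] at hab hac hbc
  have key := SerRing.cubic_sum (σ.alpha x) (σ.dalpha x)
    (hR.sgn_valAt_toField ha x) (hR.sgn_pdVal_toField ha x)
    (hR.sgn_valAt_toField hb x) (hR.sgn_pdVal_toField hb x)
    (hR.sgn_valAt_toField hc x) (hR.sgn_pdVal_toField hc x)
    (σ.alpha_antisymm x)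
    (fun k i j => by
      rw [SymplecticForm.dalpha, σ.dpoissonAt_antisymm, Complex.ofReal_neg])
    (fun i j k => by exact_mod_cast congrArg (fun r : ℝ => (r : ℂ)) (σ.poisson_jacobi x i j k))
  simp only [map_add, map_sub, map_smul, map_zero, hab, hac, hbc, toField_contraction₂,
    valAt_pField, pdVal_pField, hR.valAt_defect σ ha, hR.valAt_defect σ hb]
  exact key

lemma twistData (hR : IsRule d R) (σ : SymplecticForm m M) :
    TwistData (hR.diff M) (hR.contraction₂ σ) :=
  .of_cyclic hR.homDegree_diff hR.diff_diff (hR.isSymmBilin_contraction₂ σ)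
    fun _ _ _ _ _ _ ha hb hc => hR.cubic σ ha hb hc

/-- The differential graded Lie algebra of the series of forms that satisfy the rule `R`. -/
def dgLie (hR : IsRule d R) (σ : SymplecticForm m M) : DGLie fun n => ruleSub (m := m) M R n :=
  (hR.twistData σ).dgLie

lemma toSer_diff (hR : IsRule d R) (σ : SymplecticForm m M)
    (x : Tot fun n => ruleSub (m := m) M R n) : toSer (ruleSub M R) ((hR.dgLie σ).diff x) =
      -deRham (toSer (ruleSub M R) x) + simplexD d (toSer (ruleSub M R) x) := by
  rw [← hR.coe_toField, ← hR.coe_toField, ← coe_dField, ← coe_sField, neg_add_eq_sub]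
  exact congrArg Subtype.val (hR.toField_diff x)

lemma valAt_bracket (hR : IsRule d R) (σ : SymplecticForm m M)
    (x y : Tot fun n => ruleSub (m := m) M R n) (p : M) :
    valAt d p (hR.toField ((hR.dgLie σ).bracket x y)) =
      SerRing.fbr (σ.alpha p) (σ.dalpha p) (valAt d p (hR.toField x))
        (fun k => pdVal d p k (hR.toField x)) (valAt d p (hR.toField y))
        (fun k => pdVal d p k (hR.toField y)) := by
  induction x using DirectSum.induction_on with
  | zero => simp only [map_zero, LinearMap.zero_apply, SerRing.fbr_zero_left]
  | add x x' hx hx' =>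
    simp only [map_add, LinearMap.add_apply, hx, hx', SerRing.fbr_add_left]
  | of i a =>
    have hv := hom_mem_range (L := fun n => ruleSub (m := m) M R n) i a
    have h := twistBracket_of_mem (D := hR.diff M) (B := hR.contraction₂ σ) hv y
    have h2 := congrArg (fun v => valAt d p (hR.toField v)) h
    simp only [map_smul, hR.valAt_defect σ hv y p, smul_smul, ← mul_zpow, neg_one_mul, neg_neg,
      one_zpow, one_smul] at h2
    exact h2

lemma toSer_bracket (hR : IsRule d R) (σ : SymplecticForm m M)
    (x y : Tot fun n => ruleSub (m := m) M R n) :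
    toSer (ruleSub M R) ((hR.dgLie σ).bracket x y) =
      formBracket σ d (toSer (ruleSub M R) x) (toSer (ruleSub M R) y) := by
  rw [← hR.coe_toField, ← hR.coe_toField, ← hR.coe_toField]
  funext κ p
  have h := congrArg SerRing.val (hR.valAt_bracket σ x y p)
  rw [← value_formBracket] at h
  exact congrFun h κ

variable {O : GSym (fun n => ruleSub (m := m) M R n) →ₗ[ℂ] GSym fun n => ruleSub (m := m) M R n}

lemma isPi (hR : IsRule d R) (σ : SymplecticForm m M)
    (hO : IsSecondOrder 0 (hR.contraction₂ σ) O) : IsPi σ d (ruleSub M R) (barOp O) := by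
  have hf := hO.isFullCoder (hR.isSymmBilin_contraction₂ σ)
  refine ⟨hf.isCoderivation, fun x y => ?_, fun l hl => ?_⟩
  · rw [corestr_barOp_pair hf.counit, hO.apply_gen_gen, cor_gen, ← hR.coe_toField,
      ← hR.coe_toField, ← hR.coe_toField, hR.toField_contraction₂, coe_pField]
  · exact corestr_barOp_mono_of_length_ne hf.counit (k := 1) hO.len (by
      intro h; exact hl (by omega))

omit [IsManifold (𝓡 m) ∞ M] in
lemma isPi_unique (hR : IsRule d R) (σ : SymplecticForm m M)
    {P P' : SBar (fun n => ruleSub (m := m) M R n) →ₗ[ℂ] SBar fun n => ruleSub (m := m) M R n}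
    (hP : IsPi σ d (ruleSub M R) P) (hP' : IsPi σ d (ruleSub M R) P') : P = P' :=
  hP.coder.ext_mono hP'.coder fun l => by
    by_cases hl : l.length = 2
    · obtain ⟨x, y, rfl⟩ := List.length_eq_two.1 hl
      exact hR.toSer_injective (by rw [hP.quadratic, hP'.quadratic])
    · rw [hP.other l hl, hP'.other l hl]

/-- The filtration by the powers of the maximal ideal. -/
def filt (M : Type*) [TopologicalSpace M] [ChartedSpace (EuclideanSpace ℝ (Fin m)) M]
    (R : ℕ → ℤ → Mon g → ℕ → Prop) (k : ℕ) (n : ℤ) : Submodule ℂ (ruleSub (m := m) M R n) :=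
  (seriesSub M (R k n)).comap (Submodule.subtype _)

lemma contraction₂_mem_filt (hR : IsRule d R) (σ : SymplecticForm m M) (k l : ℕ) (i j : ℤ)
    (a : ruleSub (m := m) M R i) (b : ruleSub (m := m) M R j) (ha : a ∈ filt M R k i)
    (hb : b ∈ filt M R l j) (n : ℤ) :
    hR.contraction₂ σ (hom (fun n => ruleSub M R n) i a) (hom (fun n => ruleSub M R n) j b) n ∈
      filt M R (k + l) n := by
  rw [contraction₂_hom]
  by_cases hn : n = i + j - 1
  · subst hn
    rw [hom, DirectSum.lof_apply]
    exact hR.poissonContr_mem σ ha hb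
  · rw [hom, DirectSum.lof_eq_of, DirectSum.of_eq_of_ne _ _ _ hn]
    exact Submodule.zero_mem _

lemma isStrictlyInvertible (hR : IsRule d R) (σ : SymplecticForm m M)
    (hO : IsSecondOrder 0 (hR.contraction₂ σ) O) :
    IsStrictlyInvertible (filt M R) (filt M R) (hR.dgLie σ).abelian (hR.dgLie σ)
      (barOp (lexp O)) :=
  (hR.twistData σ).isStrictlyInvertible hO (hR.contraction₂_mem_filt σ)

end IsRule

end Trivialization

/-! ### The extension to the simplex -/

section Coalgebra

universe u v

variable {L : ℤ → Type u} [∀ n, AddCommGroup (L n)] [∀ n, Module ℂ (L n)]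
variable {L' : ℤ → Type v} [∀ n, AddCommGroup (L' n)] [∀ n, Module ℂ (L' n)]

/-- Exponentials of coderivations that are related by a map of graded vector spaces have related
components. -/
lemma corestr_barOp_lexp_symMap (φ : ∀ n, L n →ₗ[ℂ] L' n) {O : GSym L →ₗ[ℂ] GSym L}
    {O' : GSym L' →ₗ[ℂ] GSym L'} (hO : IsFullCoder 0 O) (hn : LocNilp O) (hO' : IsFullCoder 0 O')
    (hn' : LocNilp O') (h : ∀ x, O' (symMap φ x) = symMap φ (O x)) {l : List (Tot L)}
    (hl : l ≠ []) : corestr L' (barOp (lexp O') (mono (l.map (DirectSum.lmap φ)))) =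
      DirectSum.lmap φ (corestr L (barOp (lexp O) (mono l))) := by
  obtain ⟨v, l, rfl⟩ := List.exists_cons_of_ne_nil hl
  have hmono : (mono ((v :: l).map (DirectSum.lmap φ))).1 = symMap φ (mono (v :: l)).1 := by
    rw [List.map_cons, mono_val_cons, mono_val_cons, map_mul, symMap_gen, map_list_prod,
      List.map_map, List.map_map]
    congr 3
    funext w
    exact (symMap_gen φ w).symm
  rw [corestr_eq_cor, corestr_eq_cor, barOp_lexp_val hO' hn', barOp_lexp_val hO hn, hmono,
    ← cor_symMap]
  exact congrArg _ (lexp_intertwine hn hn' (symMap φ).toLinearMap (fun x => (h x).symm) _).symm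

end Coalgebra

section Extension

open scoped ContDiff

variable {g m : ℕ} {M : Type*} [TopologicalSpace M] [ChartedSpace (EuclideanSpace ℝ (Fin m)) M]
  {d : Fin g → ℤ}

/-- No vector of `TildeForms` involves `t`. -/
lemma simplexD_toSer_tilde (x : Tot (TildeForms m M d)) :
    simplexD d (toSer (tildeSub m M d) x) = 0 := by
  funext κ p
  have h : toSer (tildeSub m M d) x κ.dtToT p = 0 := (lamBasis m).ext_elem fun S => by
    change coef S _ = coef S 0
    rw [(isRule_tilde d).coef_toSer x κ.dtToT p S, map_zero]
    exact (x _).2.2.1 _ p S fun h => Nat.succ_ne_zero _ h.1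
  rw [simplexD_apply]
  split_ifs
  · rw [Pi.smul_apply, h, map_zero, smul_zero]; rfl
  · rfl

lemma toSer_inclSimplex (x : Tot (TildeForms m M d)) :
    toSer (simplexSub m M d) (inclSimplex m M d x) = toSer (tildeSub m M d) x := by
  induction x using DirectSum.induction_on with
  | zero => simp
  | add x y hx hy => rw [map_add, map_add, map_add, hx, hy]
  | of i a =>
    have h1 : inclSimplex m M d (DirectSum.of (TildeForms m M d) i a) =
        DirectSum.of (SimplexForms m M d) i (Submodule.inclusion (tilde_le_simplex m M d i) a) :=
      DirectSum.lmap_lof _ _ _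
    rw [h1]
    exact (DirectSum.coeLinearMap_of _ i _).trans (DirectSum.coeLinearMap_of _ i a).symm

variable [IsManifold (𝓡 m) ∞ M]

lemma toSer_contraction₂ {R : ℕ → ℤ → Mon g → ℕ → Prop} (hR : IsRule d R) (σ : SymplecticForm m M)
    (x y : Tot fun n => ruleSub (m := m) M R n) : toSer (ruleSub M R) (hR.contraction₂ σ x y) =
      poissonContr σ d (toSer (ruleSub M R) x) (toSer (ruleSub M R) y) := by
  rw [← hR.coe_toField, ← hR.coe_toField, ← hR.coe_toField, hR.toField_contraction₂, coe_pField]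

lemma toSer_diff_tilde (σ : SymplecticForm m M) (x : Tot (TildeForms m M d)) :
    toSer (tildeSub m M d) (((isRule_tilde d).dgLie σ).diff x) =
      -deRham (toSer (tildeSub m M d) x) := by
  have h := simplexD_toSer_tilde x
  refine ((isRule_tilde d).toSer_diff σ x).trans ?_
  refine (congrArg (fun η => -deRham (toSer (tildeSub m M d) x) + η) h).trans ?_
  exact add_zero _

lemma contraction₂_inclSimplex (σ : SymplecticForm m M) (x y : Tot (TildeForms m M d)) :
    (isRule_simplex d).contraction₂ σ (inclSimplex m M d x) (inclSimplex m M d y) =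
      inclSimplex m M d ((isRule_tilde d).contraction₂ σ x y) :=
  (isRule_simplex d).toSer_injective (by
    have h1 := toSer_contraction₂ (isRule_simplex d) σ (inclSimplex m M d x) (inclSimplex m M d y)
    have h2 := toSer_contraction₂ (isRule_tilde d) σ x y
    rw [toSer_inclSimplex, toSer_inclSimplex] at h1
    exact h1.trans (h2.symm.trans (toSer_inclSimplex _).symm))

lemma corestr_barOp_lexp_inclSimplex (σ : SymplecticForm m M)
    {O : GSym (TildeForms m M d) →ₗ[ℂ] GSym (TildeForms m M d)}
    {O' : GSym (SimplexForms m M d) →ₗ[ℂ] GSym (SimplexForms m M d)}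
    (hO : IsSecondOrder 0 ((isRule_tilde d).contraction₂ σ) O)
    (hO' : IsSecondOrder 0 ((isRule_simplex d).contraction₂ σ) O')
    (l : List (Tot (TildeForms m M d))) (hl : l ≠ []) :
    corestr _ (barOp (lexp O') (mono (l.map (inclSimplex m M d)))) =
      inclSimplex m M d (corestr _ (barOp (lexp O) (mono l))) :=
  corestr_barOp_lexp_symMap _ (hO.isFullCoder ((isRule_tilde d).isSymmBilin_contraction₂ σ))
    hO.locNilp (hO'.isFullCoder ((isRule_simplex d).isSymmBilin_contraction₂ σ)) hO'.locNilp
    (hO.symMap _ hO' (contraction₂_inclSimplex σ)) hl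

lemma isStrictlyInvertible_tilde (σ : SymplecticForm m M)
    {O : GSym (TildeForms m M d) →ₗ[ℂ] GSym (TildeForms m M d)}
    (hO : IsSecondOrder 0 ((isRule_tilde d).contraction₂ σ) O) :
    IsStrictlyInvertible (tildeFilt m M d) (tildeFilt m M d) ((isRule_tilde d).dgLie σ).abelian
      ((isRule_tilde d).dgLie σ) (barOp (lexp O)) :=
  (isRule_tilde d).isStrictlyInvertible σ hO

omit [IsManifold (𝓡 m) ∞ M] in
lemma isPi_unique_tilde (σ : SymplecticForm m M)
    {P P' : SBar (TildeForms m M d) →ₗ[ℂ] SBar (TildeForms m M d)}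
        (hP : IsPi σ d (tildeSub m M d) P)
    (hP' : IsPi σ d (tildeSub m M d) P') : P = P' :=
  (isRule_tilde d).isPi_unique σ hP hP'

lemma isStrictlyInvertible_simplex (σ : SymplecticForm m M)
    {O : GSym (SimplexForms m M d) →ₗ[ℂ] GSym (SimplexForms m M d)}
    (hO : IsSecondOrder 0 ((isRule_simplex d).contraction₂ σ) O) :
    IsStrictlyInvertible (simplexFilt m M d) (simplexFilt m M d)
        ((isRule_simplex d).dgLie σ).abelian
      ((isRule_simplex d).dgLie σ) (barOp (lexp O)) :=
  (isRule_simplex d).isStrictlyInvertible σ hO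

omit [IsManifold (𝓡 m) ∞ M] in
lemma isPi_unique_simplex (σ : SymplecticForm m M)
    {P P' : SBar (SimplexForms m M d) →ₗ[ℂ] SBar (SimplexForms m M d)}
        (hP : IsPi σ d (simplexSub m M d) P)
    (hP' : IsPi σ d (simplexSub m M d) P') : P = P' :=
  (isRule_simplex d).isPi_unique σ hP hP'

lemma exists_isPi_tilde (σ : SymplecticForm m M) :
    ∃ O, IsSecondOrder 0 ((isRule_tilde d).contraction₂ σ) O ∧
      IsPi σ d (tildeSub m M d) (barOp O) ∧ IsExp (barOp O) (barOp (lexp O)) := by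
  have h := (isRule_tilde d).isSymmBilin_contraction₂ σ
  obtain ⟨O, hO⟩ := exists_secondOrder h
  exact ⟨O, hO, (isRule_tilde d).isPi σ hO, isExp_barOp (hO.isFullCoder h) hO.locNilp⟩

lemma exists_isPi_simplex (σ : SymplecticForm m M) :
    ∃ O, IsSecondOrder 0 ((isRule_simplex d).contraction₂ σ) O ∧
      IsPi σ d (simplexSub m M d) (barOp O) ∧ IsExp (barOp O) (barOp (lexp O)) := by
  have h := (isRule_simplex d).isSymmBilin_contraction₂ σ
  obtain ⟨O, hO⟩ := exists_secondOrder h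
  exact ⟨O, hO, (isRule_simplex d).isPi σ hO, isExp_barOp (hO.isFullCoder h) hO.locNilp⟩

lemma toSer_bracket_tilde (σ : SymplecticForm m M) (x y : Tot (TildeForms m M d)) :
    toSer (tildeSub m M d) (((isRule_tilde d).dgLie σ).bracket x y) =
      formBracket σ d (toSer (tildeSub m M d) x) (toSer (tildeSub m M d) y) :=
  (isRule_tilde d).toSer_bracket σ x y

lemma toSer_diff_simplex (σ : SymplecticForm m M) (x : Tot (SimplexForms m M d)) :
    toSer (simplexSub m M d) (((isRule_simplex d).dgLie σ).diff x) =
      -deRham (toSer (simplexSub m M d) x) + simplexD d (toSer (simplexSub m M d) x) :=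
  (isRule_simplex d).toSer_diff σ x

lemma toSer_bracket_simplex (σ : SymplecticForm m M) (x y : Tot (SimplexForms m M d)) :
    toSer (simplexSub m M d) (((isRule_simplex d).dgLie σ).bracket x y) =
      formBracket σ d (toSer (simplexSub m M d) x) (toSer (simplexSub m M d) y) :=
  (isRule_simplex d).toSer_bracket σ x y

end Extension

end
end ShT

set_option maxHeartbeats 1600000 in
theorem corollary4p4 {m g : ℕ} {M : Type*} [TopologicalSpace M]
    [ChartedSpace (EuclideanSpace ℝ (Fin m)) M]
    [IsManifold (𝓡 m) ((⊤ : ℕ∞) : WithTop ℕ∞) M]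
    (ω : SymplecticForm m M) (d : Fin g → ℤ) (hd : ∀ i, d i ≤ 0) :
    -- the differential graded Lie algebra of rescaled forms, `Π` and `exp(Π)`
    ∃ (A : DGLie (TildeForms m M d))
      (P F : SBar (TildeForms m M d) →ₗ[ℂ] SBar (TildeForms m M d))
    -- the same after tensoring with the forms on the `1`-simplex
      (A₁ : DGLie (SimplexForms m M d))
      (P₁ F₁ : SBar (SimplexForms m M d) →ₗ[ℂ] SBar (SimplexForms m M d)),
      (∀ x, toSer (tildeSub m M d) (A.diff x) = -deRham (toSer (tildeSub m M d) x)) ∧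
      (∀ x y, toSer (tildeSub m M d) (A.bracket x y) =
        formBracket ω d (toSer (tildeSub m M d) x) (toSer (tildeSub m M d) y)) ∧
      IsPi ω d (tildeSub m M d) P ∧
      (∀ P', IsPi ω d (tildeSub m M d) P' → P' = P) ∧
      IsExp P F ∧
      IsStrictlyInvertible (tildeFilt m M d) (tildeFilt m M d) A.abelian A F ∧
      (∀ x, toSer (simplexSub m M d) (A₁.diff x) =
        -deRham (toSer (simplexSub m M d) x) + simplexD d (toSer (simplexSub m M d) x)) ∧
      (∀ x y, toSer (simplexSub m M d) (A₁.bracket x y) =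
        formBracket ω d (toSer (simplexSub m M d) x) (toSer (simplexSub m M d) y)) ∧
      IsPi ω d (simplexSub m M d) P₁ ∧
      (∀ P', IsPi ω d (simplexSub m M d) P' → P' = P₁) ∧
      IsExp P₁ F₁ ∧
      IsStrictlyInvertible (simplexFilt m M d) (simplexFilt m M d) A₁.abelian A₁ F₁ ∧
      -- the second morphism extends the first one
      (∀ l : List (Tot (TildeForms m M d)), l ≠ [] →
        corestr _ (F₁ (mono (l.map (inclSimplex m M d)))) =
          inclSimplex m M d (corestr _ (F (mono l)))) := by
  obtain ⟨O, hO, hP, hE⟩ := exists_isPi_tilde (d := d) ω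
  obtain ⟨O₁, hO₁, hP₁, hE₁⟩ := exists_isPi_simplex (d := d) ω
  exact ⟨(isRule_tilde d).dgLie ω, barOp O, barOp (lexp O), (isRule_simplex d).dgLie ω, barOp O₁,
    barOp (lexp O₁), toSer_diff_tilde ω, toSer_bracket_tilde ω, hP,
    fun P' hP' => isPi_unique_tilde ω hP' hP, hE, isStrictlyInvertible_tilde ω hO,
    toSer_diff_simplex ω, toSer_bracket_simplex ω, hP₁,
    fun P' hP' => isPi_unique_simplex ω hP' hP₁, hE₁, isStrictlyInvertible_simplex ω hO₁,
    corestr_barOp_lexp_inclSimplex ω hO hO₁⟩
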